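/- **Setting.** Let $d\ge1$, let $\mathbb Z^d$ carry the $\ell^\infty$ distance, and let $\Omega=\mathbb R^{\mathbb Z^d}$ with the product $\sigma$-algebra. For every finite $X\subset\mathbb Z^d$ let $J_X:\mathbb R^X\to\mathbb R$ be continuously differentiable, with $J_X=0$ whenever $\operatorname{diam}X>R$, for some fixed $R\in\mathbb N$. For finite $\Lambda\subset\mathbb Z^d$ put $$U_\Lambda(x)=\sum_{X\cap\Lambda\ne\varnothing}J_X(x_X),\qquad \mathcal L_\Lambda g=\Delta_\Lambda g-\nabla_\Lambda U_\Lambda\cdot\nabla_\Lambda g,$$ where $\nabla_\Lambda=(\partial/\partial x_j)_{j\in\Lambda}$ and $\Delta_\Lambda=\sum_{j\in\Lambda}\partial^2/\partial x_j^2$. Let $U_\Lambda^\omega$ be $U_\Lambda$ as a function of $x_\Lambda\in\mathbb R^\Lambda$ with the coordinates outside $\Lambda$ fixed to be those of $\omega\in\Omega$. Assume $0<\int_{\mathbb R^\Lambda}e^{-U_\Lambda^\omega}dx_\Lambda<\infty$ for all finite $\Lambda$ and all $\omega$, and let $\mathbb E_\Lambda^\omega$ be the probability measure with density proportional to $e^{-U_\Lambda^\omega}$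 on $\mathbb R^\Lambda$ (coordinates outside $\Lambda$ fixed to be those of $\omega$). Let $\mu$ be a Gibbs measure, that is, a probability measure on $\Omega$ with $\mu\,\mathbb E_\Lambda=\mu$ for every finite $\Lambda$. Write $\mu g=\int g\,d\mu$ and $\|g\|_\mu^2=\mu|g|^2$. Test functions are the functions $g:\Omega\to\mathbb C$ that are smooth and compactly supported functions of finitely many coordinates $x_\Delta$, where $\Delta$ contains all sites within distance $R$ of the sites under consideration. A function $v\in L^2(\mu)$ is the weak derivative $\nabla_jf$ of $f\in L^2(\mu)$ if $\mu(vg)=-\mu\big(f\,(\partial_jg-g\,\partial_jU_{\{j\}})\big)$ for all test functions $g$ (note that $\partial_jU_{\{j\}}=\partial_jU_\Lambda$ for $j\in\Lambda$). The space $H^1(\mu)$ consists of the $f\in L^2(\mu)$ that have weak derivatives $\nabla_jf\in L^2(\mu)$ for all $j\in\mathbb Z^d$ with $\sum_j\|\nabla_jf\|_\mu^2<\infty$; and $\|\nabla_\Lambda f\|_\mu^2=\sum_{j\in\Lambda}\|\nabla_jf\|_\mu^2$. For $F\ge0$ in $L^1(\mu)$ let $\operatorname{Ent}_\mu F=\mu\big(F\log\frac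 F{\mu F}\big)\in[0,\infty]$. Fix a finite $\Lambda\subset\mathbb Z^d$, $\lambda\in\mathbb R$ and $f\in H^1(\mu)$. A solution of $$i\partial_t\phi=-\mathcal L_\Lambda\phi+\lambda\phi\log\frac{|\phi|^2}{\mu|\phi|^2},\qquad\phi|_{t=0}=f, \tag{LSE$_\Lambda$}$$ is a function $\phi\in C([0,\infty);L^2(\mu))$ with $\phi(\cdot,0)=f$ whose weak derivatives $\nabla_j\phi(\cdot,t)\in L^2(\mu)$, $j\in\Lambda$, exist for all $t\ge0$, such that $\|\nabla_\Lambda\phi(\cdot,t)\|_\mu$ is bounded on bounded time intervals and, for every test function $g$ and every $t\ge0$, the function $t\mapsto\mu(g\phi(\cdot,t))$ is differentiable (from the right at $t=0$) with $$i\,\frac{d}{dt}\mu(g\phi)=\mu\Big(-(\mathcal L_\Lambda g)\phi+g\,\lambda\phi\log\frac{|\phi|^2}{\mu|\phi|^2}\Big).$$ **Theorem.** Let $\phi$ be a solution of (LSE$_\Lambda$) with initial data $f\in H^1(\mu)$. Then for all $t\ge0$ $$\|\phi(\cdot,t)\|_\mu^2=\|f\|_\mu^2 .$$ If moreover $U_\Lambda^\omega$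 is twice differentiable on $\mathbb R^\Lambda$ for every $\omega$, then for all $t\ge0$ $$\|\nabla_\Lambda\phi(\cdot,t)\|_\mu^2+\lambda\operatorname{Ent}_\mu|\phi(\cdot,t)|^2=\|\nabla_\Lambda f\|_\mu^2+\lambda\operatorname{Ent}_\mu|f|^2 ,$$ an equality in $[-\infty,\infty]$ with the convention $0\cdot\infty=0$. -/

import Mathlib

open MeasureTheory Filter Topology
open scoped ENNReal

noncomputable section

namespace LatticeLSE

/-- The lattice `ℤ^d`; its distance is the `ℓ^∞` distance. -/
abbrev Site (d : ℕ) : Type := Fin d → ℤ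

/-- The configuration space `Ω = ℝ^{ℤ^d}`, with the `σ`-algebra generated by the projections. -/
abbrev Config (d : ℕ) : Type := Site d → ℝ

/-- A family of `C¹` local potentials `J_X` (`X` a finite set of sites, `J_X` a function of the
coordinates in `X`) of finite range: `J_X = 0` as soon as the diameter of `X` exceeds `range`. -/
structure Interaction (d : ℕ) where
  J : (X : Finset (Site d)) → (X → ℝ) → ℝ
  range : ℕ
  contDiff_J : ∀ X, ContDiff ℝ 1 (J X)
  eq_zero_of_range_lt : ∀ X : Finset (Site d),
    (range : ℝ) < Metric.diam (X : Set (Site d)) → J X = 0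

/-- The sites at `ℓ^∞` distance at most `R` from `Λ`. -/
def nbhd {d : ℕ} (R : ℕ) (Λ : Finset (Site d)) : Finset (Site d) :=
  Λ.biUnion fun i => Finset.Icc (i - fun _ => (R : ℤ)) (i + fun _ => (R : ℤ))

/-- The potential energy `U_Λ(x) = ∑_{X ∩ Λ ≠ ∅} J_X(x)`; because of the finite range only
finitely many terms are nonzero. -/
def Interaction.U {d : ℕ} (I : Interaction d) (Λ : Finset (Site d)) (x : Config d) : ℝ :=
  ∑ᶠ (X : Finset (Site d)) (_ : (X ∩ Λ).Nonempty), I.J X (X.restrict x)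

/-- The configuration equal to `x` in `Λ` and to the boundary condition `ω` outside `Λ`. -/
def glue {d : ℕ} (Λ : Finset (Site d)) (ω : Config d) (x : Λ → ℝ) : Config d :=
  fun i => if h : i ∈ Λ then x ⟨i, h⟩ else ω i

/-- The energy `U_Λ^ω` on `ℝ^Λ` with boundary condition `ω`. -/
def Interaction.Ubd {d : ℕ} (I : Interaction d) (Λ : Finset (Site d)) (ω : Config d)
    (x : Λ → ℝ) : ℝ :=
  I.U Λ (glue Λ ω x)

/-- The partition function `∫ exp (-U_Λ^ω) dx_Λ`. -/
def Interaction.Z {d : ℕ} (I : Interaction d) (Λ : Finset (Site d)) (ω : Config d) : ℝ≥0∞ :=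
  ∫⁻ x : Λ → ℝ, ENNReal.ofReal (Real.exp (-I.Ubd Λ ω x))

/-- All partition functions are positive and finite. -/
def Interaction.Normalizable {d : ℕ} (I : Interaction d) : Prop :=
  ∀ (Λ : Finset (Site d)) (ω : Config d), 0 < I.Z Λ ω ∧ I.Z Λ ω < ∞

/-- The local Gibbs measure `𝔼_Λ^ω`, with density `exp (-U_Λ^ω) / Z` on `ℝ^Λ`, seen as a measure
on `Ω` carried by the configurations that equal `ω` outside `Λ`. -/
def Interaction.localGibbs {d : ℕ} (I : Interaction d) (Λ : Finset (Site d)) (ω : Config d) :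
    Measure (Config d) :=
  Measure.map (glue Λ ω)
    ((I.Z Λ ω)⁻¹ •
      (volume : Measure (Λ → ℝ)).withDensity fun x => ENNReal.ofReal (Real.exp (-I.Ubd Λ ω x)))

/-- `μ` is a global Gibbs measure: a probability measure on `Ω` that solves the
Dobrushin-Lanford-Ruelle equations `μ 𝔼_Λ = μ` for every finite `Λ`. -/
structure Interaction.IsGibbs {d : ℕ} (I : Interaction d) (μ : Measure (Config d)) : Prop where
  isProbabilityMeasure : IsProbabilityMeasure μ
  dlr : ∀ (Λ : Finset (Site d)) (A : Set (Config d)), MeasurableSet A →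
    ∫⁻ ω, I.localGibbs Λ ω A ∂μ = μ A

/-- The partial derivative `∇_j F` of a function on `Ω`. -/
def pderiv {d : ℕ} {E : Type*} [NormedAddCommGroup E] [NormedSpace ℝ E] (j : Site d)
    (F : Config d → E) (x : Config d) : E :=
  deriv (fun s : ℝ => F (Function.update x j s)) (x j)

/-- The operator `L_Λ g = Δ_Λ g - ∇_Λ U_Λ · ∇_Λ g`. -/
def Interaction.L {d : ℕ} (I : Interaction d) (Λ : Finset (Site d)) (g : Config d → ℂ)
    (x : Config d) : ℂ :=
  ∑ j ∈ Λ, (pderiv j (pderiv j g) x - ((pderiv j (I.U Λ) x : ℝ) : ℂ) * pderiv j g x)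

/-- Test functions: `g` is smooth and compactly supported as a function of the coordinates in a
finite set `Δ` that contains `S`, and depends on these coordinates only. (Taking for `S` the set of
all sites that `∇_Λ U_Λ` depends on makes `g ∇_Λ U_Λ` bounded.) -/
def IsTest {d : ℕ} (S : Finset (Site d)) (g : Config d → ℂ) : Prop :=
  ∃ (Δ : Finset (Site d)) (h : (Δ → ℝ) → ℂ), S ⊆ Δ ∧ ContDiff ℝ ((⊤ : ℕ∞) : WithTop ℕ∞) h ∧
    HasCompactSupport h ∧ ∀ x, g x = h (Δ.restrict x)

/-- `v ∈ L²(μ)` is the weak derivative `∇_j f` of `f ∈ L²(μ)`: integration by parts against test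
functions, where `∇_j U_{j}` is the logarithmic derivative of `μ` in the direction `j`, up to
sign. -/
structure Interaction.HasWeakDeriv {d : ℕ} (I : Interaction d) (μ : Measure (Config d))
    (j : Site d) (f v : Config d → ℂ) : Prop where
  memLp : MemLp f 2 μ
  memLp_deriv : MemLp v 2 μ
  integral_eq : ∀ g : Config d → ℂ, IsTest (nbhd I.range {j}) g →
    ∫ x, v x * g x ∂μ = -∫ x, f x * (pderiv j g x - ((pderiv j (I.U {j}) x : ℝ) : ℂ) * g x) ∂μ

open Classical in
/-- The weak derivative `∇_j f` (zero if there is none). -/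
def Interaction.weakDeriv {d : ℕ} (I : Interaction d) (μ : Measure (Config d)) (j : Site d)
    (f : Config d → ℂ) : Config d → ℂ :=
  if h : ∃ v, I.HasWeakDeriv μ j f v then h.choose else 0

/-- `f` and its weak derivatives `∇_j f` for all `j ∈ S` are in `L²(μ)`, and
`∑_{j ∈ S} ‖∇_j f‖² < ∞`. -/
structure Interaction.MemH1On {d : ℕ} (I : Interaction d) (μ : Measure (Config d))
    (S : Set (Site d)) (f : Config d → ℂ) : Prop where
  memLp : MemLp f 2 μ
  exists_deriv : ∀ j ∈ S, ∃ v, I.HasWeakDeriv μ j f v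
  summable : Summable fun j : S => ∫ x, ‖I.weakDeriv μ j f x‖ ^ 2 ∂μ

/-- The Sobolev space `H¹(μ)`. -/
def Interaction.MemH1 {d : ℕ} (I : Interaction d) (μ : Measure (Config d))
    (f : Config d → ℂ) : Prop :=
  I.MemH1On μ Set.univ f

/-- `‖f‖_μ² = μ|f|²`. -/
def mass {d : ℕ} (μ : Measure (Config d)) (f : Config d → ℂ) : ℝ :=
  ∫ x, ‖f x‖ ^ 2 ∂μ

/-- `‖∇_Λ f‖_μ² = ∑_{j ∈ Λ} μ|∇_j f|²`. -/
def Interaction.gradSq {d : ℕ} (I : Interaction d) (μ : Measure (Config d))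
    (Λ : Finset (Site d)) (f : Config d → ℂ) : ℝ :=
  ∑ j ∈ Λ, ∫ x, ‖I.weakDeriv μ j f x‖ ^ 2 ∂μ

open Classical in
/-- The entropy `Ent_μ F = μ(F log (F / μF))` of a nonnegative integrable `F`. The negative part
of the integrand is bounded when `μ` is finite, so that the integral is either finite or `+∞`. -/
def entropy {d : ℕ} (μ : Measure (Config d)) (F : Config d → ℝ) : EReal :=
  if Integrable (fun x => F x * Real.log (F x / ∫ y, F y ∂μ)) μ then
    ((∫ x, F x * Real.log (F x / ∫ y, F y ∂μ) ∂μ : ℝ) : EReal)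
  else ⊤

/-- The energy `‖∇_Λ f‖_μ² + λ Ent_μ |f|²`, with values in `[-∞, ∞]`. -/
def Interaction.energy {d : ℕ} (I : Interaction d) (μ : Measure (Config d))
    (Λ : Finset (Site d)) (lam : ℝ) (f : Config d → ℂ) : EReal :=
  ((I.gradSq μ Λ f : ℝ) : EReal) + (lam : EReal) * entropy μ fun x => ‖f x‖ ^ 2

/-- `φ` is a (weak) solution on `[0, ∞)` of
`i ∂_t φ = - L_Λ φ + λ φ log (|φ|² / μ|φ|²)`, `φ(0) = f`: it is continuous in time with values in
`L²(μ)`, its weak gradient `∇_Λ φ` is in `L²(μ)`, locally boundedly in time, and the equation holds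
when integrated against every test function. -/
structure Interaction.IsSolution {d : ℕ} (I : Interaction d) (μ : Measure (Config d))
    (Λ : Finset (Site d)) (lam : ℝ) (f : Config d → ℂ) (φ : ℝ → Config d → ℂ) : Prop where
  memH1On : ∀ t, 0 ≤ t → I.MemH1On μ Λ (φ t)
  continuous : ∀ t, 0 ≤ t →
    Tendsto (fun s => eLpNorm (φ s - φ t) 2 μ) (𝓝[Set.Ici 0] t) (𝓝 0)
  gradSq_bounded : ∀ T, 0 ≤ T → ∃ C : ℝ, ∀ t, 0 ≤ t → t ≤ T → I.gradSq μ Λ (φ t) ≤ C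
  initial : φ 0 =ᵐ[μ] f
  equation : ∀ g : Config d → ℂ, IsTest (nbhd I.range Λ) g → ∀ t, 0 ≤ t →
    ∃ D : ℂ, HasDerivWithinAt (fun s => ∫ x, g x * φ s x ∂μ) D (Set.Ici 0) t ∧
      Complex.I * D =
        ∫ x, (-(I.L Λ g x * φ t x) +
          g x * ((lam : ℂ) * φ t x * ((Real.log (‖φ t x‖ ^ 2 / mass μ (φ t)) : ℝ) : ℂ))) ∂μ

end LatticeLSE

end

open MeasureTheory Filter Topology
open scoped ENNReal

noncomputable section

set_option linter.unusedSectionVars false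
set_option linter.unusedVariables false

namespace LatticeLSE

/-! ### Superposition operators of linear and quadratic growth on `L²`. -/

section Superposition

variable {Ω : Type*} [MeasurableSpace Ω] {μ : Measure Ω} [IsProbabilityMeasure μ]
  {κ : Type*} [Fintype κ]

/-! Formally, mass is conserved by testing the equation with `φ̄`, and energy by testing with
`∂ₜφ̄`. A weak solution allows neither: `φ log |φ|²` is only integrable, so test functions must be
bounded, and in time `φ` is merely continuous with values in `L²`. The proof regularizes with the
resolvents `J_ε = (1 + εA)⁻¹` of the Dirichlet form, `A` being minus the operator `L_Λ`. They
contract `L²` and the Dirichlet energy, preserve bounds on `|u|` (maximum principle), and act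
boundedly on `L² log L`.

The analysis takes place in a closed space `V` of jets `(u, ∂_j u)`, of which only three properties
are used (`IsSobolev`): derivatives are unique, the functions are dense in `L²`, and the maps `z ↦
h(|z|²) z` act on `V` with the chain rule.

Mass and entropy follow from a local conservation law, `IsSol.integral_balance`: if `z b'(|z|²)`,
`b'(s)` and `s b''(s)` are bounded, then `d/dt ∫ b(|φ|²) = 4 ∑_j ∫ b''(|φ|²) Re(φ̄ ∂_j φ) Im(φ̄ ∂_j
φ)`. The nonlinearity drops out, being a real multiple of `φ`. For `b(s) = s / (1 + s/n)` the right
side disappears as `n → ∞`, and the mass is constant (`IsSol.norm_eq`). Approximations of `s log s`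
show that finiteness of the entropy propagates in both directions of time
(`IsSol.tame_of_tame_zero`) and that its derivative is the current with density `1/s`
(`IsSol.logMoment_sub`).

For the energy, `ε⁻¹ (‖φ‖² - ⟨J_ε φ, φ⟩)` tends to the Dirichlet energy, and its time derivative is
`-2 ε⁻¹` times the imaginary part of the nonlinearity paired with `J_ε φ`. The Cazenave-Haraux
inequality compares this with `-4 λ` times the entropy current of `J_ε φ`, up to `O(ε⁻¹ ‖φ - J_ε
φ‖²)`, which tends to zero because `φ` has derivatives in `L²` (`IsSol.gsq_sub`). The sum with `λ`
times the entropy is constant. If `λ ≠ 0` and the entropy is infinite at time zero, it is infinite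
always, and both energies are the same infinity.

For Gibbs measures, the DLR equations make `e^{U_Λ} μ` invariant under translations of the
coordinates in `Λ`. Averaging translations shows that jets of test functions are dense among weakly
differentiable functions (`Interaction.IsGibbs.mem_closure_jetOf`). Density yields the chain rule,
hence `Interaction.IsGibbs.isSobolev`, and it extends the weak equation from test functions to
bounded elements of `V` (`Interaction.IsSolution.isSol`). -/

theorem integrable_norm_sq (u : Lp ℂ 2 μ) : Integrable (fun ω => ‖u ω‖ ^ 2) μ :=
  (memLp_two_iff_integrable_sq_norm (Lp.aestronglyMeasurable u)).1 (Lp.memLp u)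

theorem integral_norm_sq (u : Lp ℂ 2 μ) : ∫ ω, ‖u ω‖ ^ 2 ∂μ = ‖u‖ ^ 2 := by
  have h1 : inner ℂ u u = ((‖u‖ ^ 2 : ℝ) : ℂ) := by
    rw [inner_self_eq_norm_sq_to_K]; norm_cast
  rw [L2.inner_def] at h1
  have h2 : ∀ ω, inner ℂ (u ω) (u ω) = ((‖u ω‖ ^ 2 : ℝ) : ℂ) := fun ω => by
    rw [inner_self_eq_norm_sq_to_K]; norm_cast
  simp_rw [h2] at h1
  rw [integral_complex_ofReal] at h1
  exact_mod_cast h1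

/-- Superposition operators of quadratic growth: the basic limit theorem. -/
theorem tendsto_integral_of_quadratic (u : ℕ → κ → Lp ℂ 2 μ) (v : κ → Lp ℂ 2 μ)
    (hu : Tendsto u atTop (𝓝 v)) (Φ : (κ → ℂ) → (κ → ℂ) → ℝ)
    (hΦ : Continuous fun p : (κ → ℂ) × (κ → ℂ) => Φ p.1 p.2)
    (h0 : ∀ z, Φ z z = 0) (hnn : ∀ z w, 0 ≤ Φ z w) (C : ℝ)
    (hC : ∀ z w, Φ z w ≤ C * (1 + ∑ i, ‖z i‖ ^ 2 + ∑ i, ‖w i‖ ^ 2)) :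
    Tendsto (fun n => ∫ ω, Φ (fun i => u n i ω) (fun i => v i ω) ∂μ) atTop (𝓝 0) := by
  have hC0 : 0 ≤ C := by
    have := (hnn 0 0).trans (hC 0 0)
    simpa using this
  let d : ℕ → Ω → ℝ := fun n ω => ∑ i, ‖(u n i - v i : Lp ℂ 2 μ) ω‖ ^ 2
  have hdi : ∀ n, Integrable (d n) μ := fun n =>
    integrable_finsetSum _ fun i _ => integrable_norm_sq _
  have hd0 : ∀ n ω, 0 ≤ d n ω := fun n ω => Finset.sum_nonneg fun i _ => by positivity
  have hdint : Tendsto (fun n => ∫ ω, d n ω ∂μ) atTop (𝓝 0) := by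
    have : ∀ n, ∫ ω, d n ω ∂μ = ∑ i, ‖u n i - v i‖ ^ 2 := fun n => by
      rw [integral_finsetSum _ fun i _ => integrable_norm_sq _]
      exact Finset.sum_congr rfl fun i _ => integral_norm_sq _
    simp_rw [this]
    have h : Tendsto (fun n => ∑ i, ‖u n i - v i‖ ^ 2) atTop (𝓝 (∑ i : κ, ‖v i - v i‖ ^ 2)) :=
      tendsto_finsetSum _ fun i _ => (((tendsto_pi_nhds.1 hu i).sub_const _).norm).pow 2
    simpa using h
  -- `L²` convergence gives convergence almost everywhere only along subsequences, which suffice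
  -- here.
  refine tendsto_of_subseq_tendsto fun ns hns => ?_
  have hm : TendstoInMeasure μ (fun n => d (ns n)) atTop (fun _ => 0) := by
    refine tendstoInMeasure_of_tendsto_eLpNorm (p := 1) one_ne_zero
      (fun n => (hdi _).aestronglyMeasurable) aestronglyMeasurable_const ?_
    have : ∀ n, eLpNorm (d (ns n) - fun _ => (0 : ℝ)) 1 μ = ENNReal.ofReal (∫ ω, d (ns n) ω ∂μ) := by
      intro n
      have e : (d (ns n) - fun _ => (0 : ℝ)) = d (ns n) := by ext; simp
      rw [e, eLpNorm_one_eq_lintegral_enorm, ← ofReal_integral_norm_eq_lintegral_enorm (hdi _)]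
      congr 1
      exact integral_congr_ae (ae_of_all _ fun ω => Real.norm_of_nonneg (hd0 _ _))
    simp_rw [this]
    have := (ENNReal.continuous_ofReal.tendsto 0).comp (hdint.comp hns)
    rw [ENNReal.ofReal_zero] at this
    exact this
  obtain ⟨ms, hms, hae⟩ := hm.exists_seq_tendsto_ae
  refine ⟨ms, ?_⟩
  set f : ℕ → Ω → ℝ := fun n ω => Φ (fun i => u (ns (ms n)) i ω) (fun i => v i ω) with hf
  set e : ℕ → Ω → ℝ := fun n => d (ns (ms n)) with he
  have hsub : ∀ᵐ ω ∂μ, ∀ n i, (u n i - v i : Lp ℂ 2 μ) ω = u n i ω - v i ω := by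
    rw [ae_all_iff]; intro n; rw [ae_all_iff]; intro i
    exact Lp.coeFn_sub _ _
  have hfm : ∀ n, AEStronglyMeasurable (f n) μ := by
    intro n
    have h1 : AEStronglyMeasurable (fun ω => ((fun i => u (ns (ms n)) i ω : κ → ℂ),
        (fun i => v i ω : κ → ℂ))) μ := by
      refine AEMeasurable.aestronglyMeasurable ?_
      exact (aemeasurable_pi_lambda _ fun i => (Lp.aestronglyMeasurable _).aemeasurable).prodMk
        (aemeasurable_pi_lambda _ fun i => (Lp.aestronglyMeasurable _).aemeasurable)
    exact hΦ.comp_aestronglyMeasurable h1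
  let D : Ω → ℝ := fun ω => C * (1 + 3 * ∑ i, ‖v i ω‖ ^ 2)
  have hD : Integrable D μ := by
    refine ((integrable_const _).add (Integrable.const_mul ?_ _)).const_mul _
    exact integrable_finsetSum _ fun i _ => integrable_norm_sq _
  have hfb : ∀ᵐ ω ∂μ, ∀ n, f n ω ≤ D ω + 2 * C * e n ω := by
    filter_upwards [hsub] with ω hω n
    refine (hC _ _).trans ?_
    have : ∑ i, ‖u (ns (ms n)) i ω‖ ^ 2 ≤ 2 * e n ω + 2 * ∑ i, ‖v i ω‖ ^ 2 := by
      rw [he]; simp only [d]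
      rw [Finset.mul_sum, Finset.mul_sum, ← Finset.sum_add_distrib]
      refine Finset.sum_le_sum fun i _ => ?_
      rw [hω]
      have h1 := norm_add_le (u (ns (ms n)) i ω - v i ω) (v i ω)
      rw [sub_add_cancel] at h1
      have h2 := norm_nonneg (u (ns (ms n)) i ω)
      nlinarith [sq_nonneg (‖u (ns (ms n)) i ω - v i ω‖ - ‖v i ω‖)]
    simp only [D]
    nlinarith
  have hfi : ∀ n, Integrable (f n) μ := by
    intro n
    refine Integrable.mono' (hD.add ((hdi (ns (ms n))).const_mul (2 * C))) (hfm n) ?_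
    filter_upwards [hfb] with ω hω
    rw [Real.norm_of_nonneg (hnn _ _)]
    exact hω n
  -- No fixed function dominates `f n`. After subtraction of `2 * C * e n`, whose integral tends to
  -- zero, the positive part is dominated by `D`.
  have hmax : Tendsto (fun n => ∫ ω, max (f n ω - 2 * C * e n ω) 0 ∂μ) atTop (𝓝 (∫ _, (0 : ℝ) ∂μ)) := by
    refine tendsto_integral_of_dominated_convergence D (fun n => ?_) hD (fun n => ?_) ?_
    · exact (((hfi n).sub ((hdi _).const_mul _)).sup (integrable_const 0)).aestronglyMeasurable
    · filter_upwards [hfb] with ω hω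
      rw [Real.norm_of_nonneg (le_max_right _ _)]
      refine max_le (by linarith [hω n]) ?_
      simp only [D]; have : 0 ≤ ∑ i, ‖v i ω‖ ^ 2 := Finset.sum_nonneg fun i _ => by positivity
      positivity
    · filter_upwards [hsub, hae] with ω hω hae
      have hu' : ∀ i, Tendsto (fun n => u (ns (ms n)) i ω) atTop (𝓝 (v i ω)) := by
        intro i
        rw [tendsto_iff_norm_sub_tendsto_zero]
        have h1 : Tendsto (fun n => ‖u (ns (ms n)) i ω - v i ω‖ ^ 2) atTop (𝓝 0) := by
          refine squeeze_zero (fun n => by positivity) (fun n => ?_) hae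
          simp only [d]
          rw [← hω]
          exact Finset.single_le_sum (f := fun i => ‖(u (ns (ms n)) i - v i : Lp ℂ 2 μ) ω‖ ^ 2)
            (fun i _ => by positivity) (Finset.mem_univ i)
        have h2 := h1.sqrt
        simpa using h2
      have h1 : Tendsto (fun n => f n ω) atTop (𝓝 0) := by
        have h2 : Tendsto (fun n => ((fun i => u (ns (ms n)) i ω : κ → ℂ), (fun i => v i ω : κ → ℂ)))
            atTop (𝓝 ((fun i => v i ω), (fun i => v i ω))) :=
          (tendsto_pi_nhds.2 hu').prodMk_nhds tendsto_const_nhds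
        have h3 := (hΦ.tendsto _).comp h2
        simp only [h0] at h3
        exact h3
      have h4 : Tendsto (fun n => max (f n ω - 2 * C * e n ω) 0) atTop
          (𝓝 (max (0 - 2 * C * 0) 0)) := (h1.sub (hae.const_mul _)).max tendsto_const_nhds
      simpa using h4
  rw [integral_zero] at hmax
  have he0 : Tendsto (fun n => 2 * C * ∫ ω, e n ω ∂μ) atTop (𝓝 (2 * C * 0)) :=
    (hdint.comp (hns.comp hms.tendsto_atTop)).const_mul _
  have hsum := hmax.add he0
  rw [mul_zero, add_zero] at hsum
  refine squeeze_zero (fun n => integral_nonneg fun ω => hnn _ _) (fun n => ?_) hsum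
  have hm1 : Integrable (fun ω => max (f n ω - 2 * C * e n ω) 0) μ :=
    ((hfi n).sub ((hdi _).const_mul _)).sup (integrable_const 0)
  have he1 : Integrable (fun ω => 2 * C * e n ω) μ := (hdi _).const_mul _
  rw [← integral_const_mul, ← integral_add hm1 he1]
  refine integral_mono (hfi n) (hm1.add he1) fun ω => ?_
  have := le_max_left (f n ω - 2 * C * e n ω) 0
  simp only
  linarith

theorem aestronglyMeasurable_superposition {G : Type*} [TopologicalSpace G]
    [TopologicalSpace.PseudoMetrizableSpace G] {F : (κ → ℂ) → G}
    (hF : Continuous F) (u : κ → Lp ℂ 2 μ) :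
    AEStronglyMeasurable (fun ω => F fun i => u i ω) μ :=
  hF.comp_aestronglyMeasurable (AEMeasurable.aestronglyMeasurable
    (aemeasurable_pi_lambda _ fun i => (Lp.aestronglyMeasurable _).aemeasurable))

theorem integrable_superposition {G : Type*} [NormedAddCommGroup G] {F : (κ → ℂ) → G}
    (hF : Continuous F) {C : ℝ} (hC : ∀ z, ‖F z‖ ≤ C * (1 + ∑ i, ‖z i‖ ^ 2)) (u : κ → Lp ℂ 2 μ) :
    Integrable (fun ω => F fun i => u i ω) μ := by
  refine Integrable.mono' (g := fun ω => C * (1 + ∑ i, ‖u i ω‖ ^ 2)) ?_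
    (aestronglyMeasurable_superposition hF u) (ae_of_all _ fun ω => hC _)
  exact ((integrable_const _).add
    (integrable_finsetSum _ fun i _ => integrable_norm_sq _)).const_mul _

/-- A superposition operator of quadratic growth is continuous from `L²` to `L¹`. -/
theorem continuous_integral_superposition {G : Type*} [NormedAddCommGroup G] [NormedSpace ℝ G]
    {F : (κ → ℂ) → G}
    (hF : Continuous F) {C : ℝ} (hC : ∀ z, ‖F z‖ ≤ C * (1 + ∑ i, ‖z i‖ ^ 2)) :
    Continuous fun u : κ → Lp ℂ 2 μ => ∫ ω, F (fun i => u i ω) ∂μ := by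
  rw [continuous_iff_seqContinuous]
  intro u v hu
  have h := tendsto_integral_of_quadratic u v hu (fun z w => ‖F z - F w‖) (by fun_prop) (by simp)
    (fun _ _ => norm_nonneg _) (2 * |C|) (fun z w => by
      have h1 : ∀ z, ‖F z‖ ≤ |C| * (1 + ∑ i, ‖z i‖ ^ 2) := fun z => (hC z).trans
        (mul_le_mul_of_nonneg_right (le_abs_self C) (by positivity))
      have hz : 0 ≤ ∑ i, ‖z i‖ ^ 2 := by positivity
      have hw : 0 ≤ ∑ i, ‖w i‖ ^ 2 := by positivity
      have := norm_sub_le (F z) (F w)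
      nlinarith [h1 z, h1 w, abs_nonneg C, mul_nonneg (abs_nonneg C) hz,
        mul_nonneg (abs_nonneg C) hw])
  rw [tendsto_iff_norm_sub_tendsto_zero]
  refine squeeze_zero (fun _ => norm_nonneg _) (fun n => ?_) h
  simp only [Function.comp_apply]
  rw [← integral_sub (integrable_superposition hF hC _) (integrable_superposition hF hC _)]
  exact norm_integral_le_integral_norm _

theorem memLp_superposition {F : (κ → ℂ) → ℂ} (hF : Continuous F) {C : ℝ}
    (hC : ∀ z, ‖F z‖ ≤ C * (1 + ∑ i, ‖z i‖)) (u : κ → Lp ℂ 2 μ) :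
    MemLp (fun ω => F fun i => u i ω) 2 μ := by
  refine MemLp.of_le (g := fun ω => C * (1 + ∑ i, ‖u i ω‖)) ?_
    (aestronglyMeasurable_superposition hF u)
    (ae_of_all _ fun ω => (hC _).trans (le_abs_self _))
  have h1 : MemLp (fun ω => ∑ i, ‖u i ω‖) 2 μ := memLp_finsetSum _ fun i _ => (Lp.memLp (u i)).norm
  have h2 : MemLp (fun _ : Ω => (1 : ℝ)) 2 μ := memLp_const 1
  exact (h2.add h1).const_mul C

theorem sq_norm_le_of_linear_growth {F : (κ → ℂ) → ℂ} {C : ℝ}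
    (hC : ∀ z, ‖F z‖ ≤ C * (1 + ∑ i, ‖z i‖)) (z : κ → ℂ) :
    ‖F z‖ ^ 2 ≤ C ^ 2 * (Fintype.card κ + 1) * (1 + ∑ i, ‖z i‖ ^ 2) := by
  have h1 : ‖F z‖ ^ 2 ≤ (C * (1 + ∑ i, ‖z i‖)) ^ 2 :=
    pow_le_pow_left₀ (norm_nonneg _) (hC z) 2
  have h3 : (1 + ∑ i, ‖z i‖) ^ 2 ≤ (1 + Fintype.card κ) * (1 + ∑ i, ‖z i‖ ^ 2) := by
    -- Cauchy-Schwarz for the numbers `1` and `‖z i‖`, indexed by `Option κ`: hence the factor `card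
    -- κ + 1`.
    have h5 := Finset.sum_mul_sq_le_sq_mul_sq (Finset.univ : Finset (Option κ)) (fun _ => (1 : ℝ))
      (fun o => o.elim 1 fun i => ‖z i‖)
    simp only [Fintype.sum_option, Option.elim_none, Option.elim_some, one_mul, one_pow, Finset.sum_const, Finset.card_univ, nsmul_eq_mul, mul_one, Fintype.card_option] at h5
    push_cast at h5
    rwa [add_comm (Fintype.card κ : ℝ) 1] at h5
  calc ‖F z‖ ^ 2 ≤ _ := h1
    _ = C ^ 2 * (1 + ∑ i, ‖z i‖) ^ 2 := by ring
    _ ≤ C ^ 2 * ((1 + Fintype.card κ) * (1 + ∑ i, ‖z i‖ ^ 2)) :=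
        mul_le_mul_of_nonneg_left h3 (sq_nonneg _)
    _ = _ := by ring

theorem sq_norm_sub_le_of_linear_growth {F : (κ → ℂ) → ℂ} {C : ℝ}
    (hC : ∀ z, ‖F z‖ ≤ C * (1 + ∑ i, ‖z i‖)) (z w : κ → ℂ) :
    ‖F z - F w‖ ^ 2 ≤ 4 * (C ^ 2 * (Fintype.card κ + 1)) *
      (1 + ∑ i, ‖z i‖ ^ 2 + ∑ i, ‖w i‖ ^ 2) := by
  have h1 := sq_norm_le_of_linear_growth hC z
  have h2 := sq_norm_le_of_linear_growth hC w
  have h3 := norm_sub_le (F z) (F w)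
  have h4 : ‖F z - F w‖ ^ 2 ≤ 2 * ‖F z‖ ^ 2 + 2 * ‖F w‖ ^ 2 := by
    have h5 : ‖F z - F w‖ ^ 2 ≤ (‖F z‖ + ‖F w‖) ^ 2 := pow_le_pow_left₀ (norm_nonneg _) h3 2
    linarith [sq_nonneg (‖F z‖ - ‖F w‖), add_sq ‖F z‖ ‖F w‖, sub_sq ‖F z‖ ‖F w‖]
  have hz : 0 ≤ ∑ i, ‖z i‖ ^ 2 := by positivity
  have hw : 0 ≤ ∑ i, ‖w i‖ ^ 2 := by positivity
  have hK : 0 ≤ C ^ 2 * (Fintype.card κ + 1 : ℝ) := by positivity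
  generalize C ^ 2 * (Fintype.card κ + 1 : ℝ) = K at *
  nlinarith [mul_nonneg hK hz, mul_nonneg hK hw]

/-- The superposition operator of a continuous function of linear growth, on `L²`. -/
def superposition (F : (κ → ℂ) → ℂ) (u : κ → Lp ℂ 2 μ) : Lp ℂ 2 μ :=
  open Classical in
  if h : MemLp (fun ω => F fun i => u i ω) 2 μ then h.toLp else 0

theorem coeFn_superposition {F : (κ → ℂ) → ℂ} (hF : Continuous F) {C : ℝ}
    (hC : ∀ z, ‖F z‖ ≤ C * (1 + ∑ i, ‖z i‖)) (u : κ → Lp ℂ 2 μ) :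
    superposition F u =ᵐ[μ] fun ω => F fun i => u i ω := by
  rw [superposition, dif_pos (memLp_superposition hF hC u)]
  exact MemLp.coeFn_toLp _

theorem continuous_superposition {F : (κ → ℂ) → ℂ} (hF : Continuous F) {C : ℝ}
    (hC : ∀ z, ‖F z‖ ≤ C * (1 + ∑ i, ‖z i‖)) :
    Continuous (superposition F : (κ → Lp ℂ 2 μ) → Lp ℂ 2 μ) := by
  rw [continuous_iff_seqContinuous]
  intro u v hu
  have h := tendsto_integral_of_quadratic u v hu (fun z w => ‖F z - F w‖ ^ 2)
    ((hF.fst'.sub hF.snd').norm.pow 2) (by simp) (fun _ _ => by positivity)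
    (4 * (C ^ 2 * (Fintype.card κ + 1))) (fun z w => sq_norm_sub_le_of_linear_growth hC z w)
  rw [tendsto_iff_norm_sub_tendsto_zero]
  have h' := h.sqrt
  rw [Real.sqrt_zero] at h'
  refine h'.congr fun n => ?_
  rw [← Real.sqrt_sq (norm_nonneg _), ← integral_norm_sq]
  congr 1
  refine integral_congr_ae ?_
  filter_upwards [coeFn_superposition hF hC (u n), coeFn_superposition hF hC v,
    Lp.coeFn_sub (superposition F (u n)) (superposition F v)] with ω h1 h2 h3
  simp only [Function.comp_apply]
  rw [h3, Pi.sub_apply, h1, h2]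

end Superposition

/-! ### Jets and the resolvents of the Dirichlet form. -/

section Resolvent

variable {H : Type*} [NormedAddCommGroup H] [InnerProductSpace ℂ H]
  {ι : Type*} [Fintype ι]

/-- First-order jets: the component `none` is the function, `some j` its `j`-th derivative. -/
abbrev Jet (H : Type*) [NormedAddCommGroup H] [InnerProductSpace ℂ H] (ι : Type*) [Fintype ι] :
    Type _ :=
  PiLp 2 fun _ : Option ι => H

/-- The Dirichlet form of two jets. -/
def form (x y : Jet H ι) : ℂ := ∑ j, inner ℂ (x (some j)) (y (some j))

/-- The Dirichlet energy of a jet. -/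
def gsq (x : Jet H ι) : ℝ := ∑ j, ‖x (some j)‖ ^ 2

theorem inner_self_ofReal {E : Type*} [NormedAddCommGroup E] [InnerProductSpace ℂ E] (u : E) :
    inner ℂ u u = ((‖u‖ ^ 2 : ℝ) : ℂ) := by
  rw [inner_self_eq_norm_sq_to_K]; norm_cast

theorem inner_jet (x y : Jet H ι) : inner ℂ x y = inner ℂ (x none) (y none) + form x y := by
  rw [PiLp.inner_apply, Fintype.sum_option, form]

theorem form_self (x : Jet H ι) : form x x = gsq x := by
  simp only [form, gsq, inner_self_eq_norm_sq_to_K]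
  push_cast
  rfl

theorem norm_sq_jet (x : Jet H ι) : ‖x‖ ^ 2 = ‖x none‖ ^ 2 + gsq x := by
  rw [PiLp.norm_sq_eq_of_L2, Fintype.sum_option, gsq]

theorem gsq_nonneg (x : Jet H ι) : 0 ≤ gsq x := Finset.sum_nonneg fun _ _ => by positivity

theorem form_conj (x y : Jet H ι) : starRingEnd ℂ (form x y) = form y x := by
  simp only [form, map_sum, inner_conj_symm]

theorem form_sub_right (x y z : Jet H ι) : form x (y - z) = form x y - form x z := by
  simp only [form, PiLp.sub_apply, inner_sub_right, Finset.sum_sub_distrib]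

theorem form_sub_left (x y z : Jet H ι) : form (x - y) z = form x z - form y z := by
  simp only [form, PiLp.sub_apply, inner_sub_left, Finset.sum_sub_distrib]

theorem norm_none_le (x : Jet H ι) : ‖x none‖ ≤ ‖x‖ := PiLp.norm_apply_le x none

theorem gsq_le (x : Jet H ι) : gsq x ≤ ‖x‖ ^ 2 := by
  rw [norm_sq_jet]; nlinarith [sq_nonneg ‖x none‖]

theorem continuous_apply_jet (o : Option ι) : Continuous fun x : Jet H ι => x o :=
  PiLp.continuous_apply 2 _ o

theorem norm_form_le (x y : Jet H ι) : ‖form x y‖ ≤ ‖x‖ * ‖y‖ := by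
  unfold form
  refine (norm_sum_le _ _).trans ?_
  refine (Finset.sum_le_sum fun j _ => norm_inner_le_norm _ _).trans ?_
  have h := Real.sum_mul_le_sqrt_mul_sqrt Finset.univ (fun j => ‖x (some j)‖) fun j => ‖y (some j)‖
  refine h.trans ?_
  refine mul_le_mul ?_ ?_ (Real.sqrt_nonneg _) (norm_nonneg _)
  · exact Real.sqrt_le_iff.2 ⟨norm_nonneg _, gsq_le x⟩
  · exact Real.sqrt_le_iff.2 ⟨norm_nonneg _, gsq_le y⟩

/-- Expand `0 ≤ gsq (x - y)`. -/
theorem gsq_sub_le {x y : Jet H ι} (h : gsq y ≤ (form x y).re) : gsq y ≤ gsq x := by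
  have h1 := gsq_nonneg (x - y)
  have h2 : ((gsq (x - y) : ℝ) : ℂ) = gsq x - form x y - form y x + gsq y := by
    rw [← form_self, form_sub_left, form_sub_right, form_sub_right, form_self, form_self]; ring
  have h3 := congrArg Complex.re h2
  have h4 : (form y x).re = (form x y).re := by rw [← form_conj, Complex.conj_re]
  simp [h4] at h3
  linarith

/-- Multiplication of the derivatives of a jet by `c`. -/
def scaleJet (c : ℝ) : Jet H ι →L[ℂ] Jet H ι :=
  (PiLp.continuousLinearEquiv 2 ℂ (fun _ : Option ι => H)).symm.toContinuousLinearMap.comp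
    (ContinuousLinearMap.pi fun o : Option ι =>
      (o.elim (1 : ℂ) fun _ => (c : ℂ)) • PiLp.proj (𝕜 := ℂ) 2 (fun _ : Option ι => H) o)

@[simp]
theorem scaleJet_none (c : ℝ) (x : Jet H ι) : scaleJet c x none = x none := by
  simp [scaleJet]

@[simp]
theorem scaleJet_some (c : ℝ) (x : Jet H ι) (j : ι) :
    scaleJet c x (some j) = (c : ℂ) • x (some j) := by
  simp [scaleJet]

/-- The jet with value `u` and zero derivatives. -/
def valueJet : H →L[ℂ] Jet H ι :=
  (PiLp.continuousLinearEquiv 2 ℂ (fun _ : Option ι => H)).symm.toContinuousLinearMap.comp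
    (ContinuousLinearMap.pi fun o : Option ι =>
      (o.elim (1 : ℂ) fun _ => 0) • ContinuousLinearMap.id ℂ H)

@[simp]
theorem valueJet_none (u : H) : (valueJet u : Jet H ι) none = u := by
  simp [valueJet]

@[simp]
theorem valueJet_some (u : H) (j : ι) : (valueJet u : Jet H ι) (some j) = 0 := by
  simp [valueJet]


variable [CompleteSpace H] (V : ClosedSubmodule ℂ (Jet H ι))

/-- The resolvent `(1 + ε A)⁻¹ u` of the Dirichlet form on `V`, with its derivatives. -/
def res (ε : ℝ) : H →L[ℂ] Jet H ι :=
  (scaleJet (√ε)⁻¹).comp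
    (((V.comap (scaleJet (√ε)⁻¹)).toSubmodule.starProjection).comp valueJet)

theorem res_mem (ε : ℝ) (u : H) : res V ε u ∈ V := by
  have := (V.comap (scaleJet (√ε)⁻¹)).toSubmodule.starProjection_apply_mem (valueJet u)
  exact this

variable {V}

/-- The Euler equation of the resolvent. Projecting the jet `(u, 0)` onto the jets `(v, √ε ∂v)` with
`v ∈ V` minimizes `‖u - v‖² + ε ‖∂v‖²`, and the residual is orthogonal to all these jets. The
properties of the resolvents below come from this equation, with various choices of `v`. -/
theorem res_inner {ε : ℝ} (hε : 0 < ε) (u : H) {v : Jet H ι} (hv : v ∈ V) :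
    inner ℂ (v none) (u - res V ε u none) = ε * form v (res V ε u) := by
  set W := (V.comap (scaleJet (√ε)⁻¹)).toSubmodule with hW
  have hs : √ε ≠ 0 := (Real.sqrt_pos.2 hε).ne'
  have hs' : ((√ε : ℝ) : ℂ) ≠ 0 := by exact_mod_cast hs
  set p := W.starProjection (valueJet u) with hp
  have hvW : scaleJet (√ε) v ∈ W := by
    have : scaleJet (√ε)⁻¹ (scaleJet (√ε) v) = v := by
      ext o
      cases o
      · simp
      · simp only [scaleJet_some, smul_smul]
        rw [← Complex.ofReal_mul, inv_mul_cancel₀ hs]; simp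
    change scaleJet (√ε)⁻¹ (scaleJet (√ε) v) ∈ V
    rwa [this]
  have h0 := W.starProjection_inner_eq_zero (valueJet u) _ hvW
  rw [← inner_conj_symm, map_eq_zero, inner_jet] at h0
  have e1 : form (scaleJet (√ε) v) (valueJet u - p) = -(ε * form v (res V ε u)) := by
    simp only [form, Finset.mul_sum, ← Finset.sum_neg_distrib]
    refine Finset.sum_congr rfl fun j _ => ?_
    have : (res V ε u) (some j) = ((√ε)⁻¹ : ℝ) • p (some j) := by
      simp only [res, ContinuousLinearMap.comp_apply]
      rw [scaleJet_some]
      simp [hp, hW]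
      rw [← Complex.coe_smul]; simp
    rw [this]
    simp only [scaleJet_some, PiLp.sub_apply, valueJet_some, zero_sub, inner_neg_right,
      inner_smul_left, Complex.conj_ofReal]
    rw [← Complex.coe_smul, inner_smul_right]
    have h2 : (ε : ℂ) = (√ε : ℝ) * (√ε : ℝ) := by
      rw [← Complex.ofReal_mul, Real.mul_self_sqrt hε.le]
    rw [h2]; push_cast
    field_simp
  rw [e1] at h0
  simp only [scaleJet_none, PiLp.sub_apply, valueJet_none] at h0
  have e2 : (res V ε u) none = p none := by
    simp [res, hp, hW]
  rw [e2]
  linear_combination h0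

theorem res_sub_inner {ε : ℝ} (hε : 0 < ε) (u w : H) :
    inner ℂ (res V ε w none) (u - res V ε u none) = ε * form (res V ε w) (res V ε u) :=
  res_inner hε u (res_mem V ε w)

/-- The Euler equation tested with the resolvent itself. -/
theorem norm_res_none_sq_add {ε : ℝ} (hε : 0 < ε) (u : H) :
    ‖res V ε u none‖ ^ 2 + ε * gsq (res V ε u) = (inner ℂ (res V ε u none) u).re := by
  have h := res_sub_inner hε u u (V := V)
  rw [inner_sub_right, form_self, inner_self_ofReal] at h
  have h1 := congrArg Complex.re h
  simp only [Complex.sub_re, Complex.ofReal_re, Complex.re_ofReal_mul] at h1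
  linarith

theorem norm_res_none_le {ε : ℝ} (hε : 0 < ε) (u : H) : ‖res V ε u none‖ ≤ ‖u‖ := by
  have h := norm_res_none_sq_add hε u (V := V)
  have h1 : (inner ℂ (res V ε u none) u).re ≤ ‖res V ε u none‖ * ‖u‖ := re_inner_le_norm (𝕜 := ℂ) _ _
  have h2 := mul_nonneg hε.le (gsq_nonneg (res V ε u))
  by_contra! h3
  nlinarith [norm_nonneg u, norm_nonneg (res V ε u none)]

theorem res_selfadjoint {ε : ℝ} (hε : 0 < ε) (u w : H) :
    inner ℂ (res V ε u none) w = inner ℂ u (res V ε w none) := by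
  have h1 := res_sub_inner hε w u (V := V)
  have h2 := congrArg (starRingEnd ℂ) (res_sub_inner hε u w (V := V))
  rw [inner_conj_symm, map_mul, form_conj, Complex.conj_ofReal] at h2
  rw [← h1, inner_sub_left, inner_sub_right] at h2
  linear_combination -h2

/-- Testing with `x - J x` gives `ε form (x - J x) (J x) = ‖x - J x‖² ≥ 0`, which is the hypothesis
of `gsq_sub_le`. -/
theorem gsq_res_le {ε : ℝ} (hε : 0 < ε) {x : Jet H ι} (hx : x ∈ V) :
    gsq (res V ε (x none)) ≤ gsq x := by
  apply gsq_sub_le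
  have h := res_inner hε (x none) (V.sub_mem hx (res_mem V ε (x none)))
  rw [PiLp.sub_apply, inner_self_ofReal, form_sub_left, form_self] at h
  have h1 := congrArg Complex.re h
  simp only [Complex.sub_re, Complex.ofReal_re, Complex.re_ofReal_mul] at h1
  have h2 : 0 ≤ ε * ((form x (res V ε (x none))).re - gsq (res V ε (x none))) := by
    rw [← h1]; positivity
  have := nonneg_of_mul_nonneg_right h2 hε
  linarith

theorem norm_res_le {ε : ℝ} (hε : 0 < ε) {x : Jet H ι} (hx : x ∈ V) :
    ‖res V ε (x none)‖ ≤ ‖x‖ := by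
  have h := gsq_res_le hε hx
  have h1 := norm_res_none_le hε (x none) (V := V)
  have h2 := norm_sq_jet x
  have h3 := norm_sq_jet (res V ε (x none))
  have h4 : ‖res V ε (x none)‖ ^ 2 ≤ ‖x‖ ^ 2 := by
    rw [h2, h3]; gcongr
  exact (pow_le_pow_iff_left₀ (norm_nonneg _) (norm_nonneg _) two_ne_zero).1 h4

/-- On the range of `J₁` the convergence has a rate. For `x = J₁ u` the vector `a = u - x` is the
generator applied to `x`. The Euler equations of `J₁` and `J_ε`, tested with `z = x - J_ε x`,
combine to `‖z‖² + ε gsq z = ε Re ⟨z, a⟩` with `‖z‖` the norm of the value. This yields `‖z‖ ≤ ε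
‖a‖`, and then `gsq z ≤ ε ‖a‖²`. -/
theorem norm_sub_res_res_le {ε : ℝ} (hε : 0 < ε) (u : H) :
    ‖res V 1 u - res V ε (res V 1 u none)‖ ^ 2 ≤
      (ε ^ 2 + ε) * ‖u - res V 1 u none‖ ^ 2 := by
  set x := res V 1 u with hx
  set z := x - res V ε (x none) with hz
  set a := u - x none with ha
  have hzV : z ∈ V := V.sub_mem (res_mem _ _ _) (res_mem _ _ _)
  have h1 := res_inner hε (x none) hzV
  have h2 := res_inner one_pos u hzV
  have e1 : res V ε (x none) = x - z := by rw [hz]; abel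
  rw [e1, form_sub_right, form_self, ← PiLp.sub_apply, sub_sub_cancel,
    inner_self_ofReal] at h1
  rw [← hx, ← ha, Complex.ofReal_one, one_mul] at h2
  rw [← h2] at h1
  have h3 := congrArg Complex.re h1
  simp only [Complex.sub_re, Complex.ofReal_re, Complex.re_ofReal_mul] at h3
  have h4 : (inner ℂ (z none) a).re ≤ ‖z none‖ * ‖a‖ := re_inner_le_norm (𝕜 := ℂ) _ _
  have hg := gsq_nonneg z
  have h5 : ‖z none‖ ≤ ε * ‖a‖ := by
    by_contra! h6
    have : 0 ≤ ‖a‖ := norm_nonneg a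
    have h7 : 0 < ‖z none‖ := lt_of_le_of_lt (by positivity) h6
    nlinarith [mul_nonneg hε.le hg]
  have h8 : gsq z ≤ ε * ‖a‖ ^ 2 := by
    have h9 : ε * gsq z ≤ ε * (‖z none‖ * ‖a‖) := by nlinarith [sq_nonneg ‖z none‖]
    have h10 := le_of_mul_le_mul_left h9 hε
    nlinarith [norm_nonneg a]
  rw [norm_sq_jet]
  have h11 : ‖z none‖ ^ 2 ≤ (ε * ‖a‖) ^ 2 := pow_le_pow_left₀ (norm_nonneg _) h5 2
  nlinarith

/-- Uniqueness of the derivatives of the elements of `V`. -/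
def HasUniqueDerivs (V : ClosedSubmodule ℂ (Jet H ι)) : Prop :=
  ∀ x ∈ V, x none = 0 → x = 0

/-- Density of the domain of the derivatives. -/
def HasDenseDomain (V : ClosedSubmodule ℂ (Jet H ι)) : Prop :=
  ∀ u : H, (∀ x ∈ V, inner ℂ (x none) u = 0) → u = 0

/-- The difference of `v` and its projection onto the closure of `R` lies in `W` and is orthogonal
to `R`. -/
theorem mem_closure_of_orthogonal {E : Type*} [NormedAddCommGroup E] [InnerProductSpace ℂ E]
    [CompleteSpace E] (R W : Submodule ℂ E) (hW : IsClosed (W : Set E)) (hRW : R ≤ W)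
    (h : ∀ y ∈ W, (∀ x ∈ R, inner ℂ x y = 0) → y = 0) {v : E} (hv : v ∈ W) :
    v ∈ R.topologicalClosure := by
  have hc : R.topologicalClosure ≤ W := R.topologicalClosure_minimal hRW hW
  have : CompleteSpace R.topologicalClosure := R.isClosed_topologicalClosure.completeSpace_coe
  have h1 := R.topologicalClosure.starProjection_apply_mem v
  have h2 := h (v - R.topologicalClosure.starProjection v) (W.sub_mem hv (hc h1)) fun x hx => by
    rw [← inner_conj_symm,
      R.topologicalClosure.starProjection_inner_eq_zero v x (R.le_topologicalClosure hx), map_zero]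
  rw [sub_eq_zero.1 h2]
  exact h1

/-- If `y ∈ V` is orthogonal to `J₁ y` in the space of jets, the Euler equation tested with `y`
itself says that the value of `y` is zero. -/
theorem mem_closure_range_res (hV : HasUniqueDerivs V) {x : Jet H ι} (hx : x ∈ V) :
    x ∈ closure (Set.range (res V 1)) := by
  have h := mem_closure_of_orthogonal (LinearMap.range (res V 1).toLinearMap) V.toSubmodule
    V.isClosed (by rintro _ ⟨u, rfl⟩; exact res_mem V 1 u) (fun y hy h => ?_) hx
  · rw [← SetLike.mem_coe, Submodule.topologicalClosure_coe] at h
    exact h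
  · apply hV y hy
    have h1 := h _ ⟨y none, rfl⟩
    have h2 := res_inner one_pos (y none) hy
    change inner ℂ (res V 1 (y none)) y = 0 at h1
    rw [← inner_conj_symm, map_eq_zero, inner_jet] at h1
    rw [inner_sub_right, Complex.ofReal_one, one_mul] at h2
    have h3 : inner ℂ (y none) (y none) = (0 : ℂ) := by linear_combination h2 + h1
    exact inner_self_eq_zero.1 h3

/-- The usual argument with three small terms. The bound `hA` is asked on `S` only, because the
contraction estimate for jets holds on `V` only. -/
theorem tendsto_of_dense_of_bound {E F G : Type*} [NormedAddCommGroup E] [NormedAddCommGroup F]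
    {l : Filter G} (A : G → E → F) (B : E → F) (S D : Set E) (hSD : S ⊆ closure D) (hDS : D ⊆ S)
    (hA : ∀ᶠ a in l, ∀ x ∈ S, ∀ y ∈ S, ‖A a x - A a y‖ ≤ ‖x - y‖)
    (hB : ∀ x y, ‖B x - B y‖ ≤ ‖x - y‖)
    (hD : ∀ x ∈ D, Tendsto (fun a => A a x) l (𝓝 (B x))) {x : E} (hx : x ∈ S) :
    Tendsto (fun a => A a x) l (𝓝 (B x)) := by
  rw [Metric.tendsto_nhds]
  intro e he
  obtain ⟨y, hy, hxy⟩ := Metric.mem_closure_iff.1 (hSD hx) (e / 3) (by positivity)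
  filter_upwards [hA, Metric.tendsto_nhds.1 (hD y hy) (e / 3) (by positivity)] with a h1 h2
  have h3 := h1 x hx y (hDS hy)
  have h4 := hB y x
  rw [dist_eq_norm] at hxy h2 ⊢
  rw [norm_sub_rev y x] at h4
  calc ‖A a x - B x‖ = ‖(A a x - A a y) + (A a y - B y) + (B y - B x)‖ := by congr 1; abel
    _ ≤ ‖A a x - A a y‖ + ‖A a y - B y‖ + ‖B y - B x‖ := norm_add₃_le
    _ < e := by linarith

theorem tendsto_res (hV : HasUniqueDerivs V) {x : Jet H ι} (hx : x ∈ V) :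
    Tendsto (fun ε => res V ε (x none)) (𝓝[>] 0) (𝓝 x) := by
  refine tendsto_of_dense_of_bound (fun ε (x : Jet H ι) => res V ε (x none)) id (V : Set (Jet H ι))
    (Set.range (res V 1)) (fun x hx => mem_closure_range_res hV hx) ?_ ?_ (fun x y => le_rfl) ?_ hx
  · rintro _ ⟨u, rfl⟩; exact res_mem V 1 u
  · filter_upwards [self_mem_nhdsWithin] with ε hε x hx y hy
    rw [← map_sub, ← PiLp.sub_apply]
    exact norm_res_le hε (V.sub_mem hx hy)
  · rintro _ ⟨u, rfl⟩
    rw [tendsto_iff_norm_sub_tendsto_zero]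
    have h1 : Tendsto (fun ε : ℝ => √((ε ^ 2 + ε) * ‖u - res V 1 u none‖ ^ 2)) (𝓝[>] 0) (𝓝 0) := by
      have : Continuous fun ε : ℝ => √((ε ^ 2 + ε) * ‖u - res V 1 u none‖ ^ 2) := by fun_prop
      have h := this.tendsto 0
      simp only [ne_eq, OfNat.ofNat_ne_zero, not_false_eq_true, zero_pow, add_zero, zero_mul,
        Real.sqrt_zero] at h
      exact h.mono_left nhdsWithin_le_nhds
    refine squeeze_zero' (Eventually.of_forall fun _ => norm_nonneg _) ?_ h1
    filter_upwards [self_mem_nhdsWithin] with ε hε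
    rw [id, norm_sub_rev]
    exact Real.le_sqrt_of_sq_le (norm_sub_res_res_le hε u)

/-- The values of the elements of `V` are dense and converge by `tendsto_res`; the contraction
property in `L²` does the rest. -/
theorem tendsto_res_none (hV : HasUniqueDerivs V) (hd : HasDenseDomain V) (u : H) :
    Tendsto (fun ε => res V ε u none) (𝓝[>] 0) (𝓝 u) := by
  let R : Submodule ℂ H := V.toSubmodule.map (PiLp.proj (𝕜 := ℂ) 2 (fun _ : Option ι => H) none).toLinearMap
  refine tendsto_of_dense_of_bound (fun ε (u : H) => res V ε u none) id Set.univ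
    (R : Set H) (fun u _ => ?_) (Set.subset_univ _) ?_ (fun x y => le_rfl) ?_ (Set.mem_univ u)
  · have h := mem_closure_of_orthogonal R ⊤ isClosed_univ le_top (fun y _ h => hd y fun x hx =>
      h _ ⟨x, hx, rfl⟩) (Submodule.mem_top (x := u))
    simpa [← SetLike.mem_coe, Submodule.topologicalClosure_coe] using h
  · filter_upwards [self_mem_nhdsWithin] with ε hε x _ y _
    rw [← PiLp.sub_apply, ← map_sub]
    exact norm_res_none_le hε _
  · rintro _ ⟨x, hx, rfl⟩
    exact ((continuous_apply_jet none).tendsto _).comp (tendsto_res hV hx)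

theorem continuous_res (ε : ℝ) : Continuous (res V ε) := (res V ε).continuous

theorem continuous_res_none (ε : ℝ) : Continuous fun u => res V ε u none :=
  (continuous_apply_jet none).comp (res V ε).continuous

end Resolvent

/-! ### Radial maps `z ↦ h(|z|²) z` of the plane. -/

section Radial

/-- The map `z ↦ h(|z|²) z`. -/
def radial (h : ℝ → ℝ) (z : ℂ) : ℂ := h (‖z‖ ^ 2) • z

/-- The derivative of `radial h` at `z` in the direction `w`; `h'` is the derivative of `h`. -/
def radialDeriv (h h' : ℝ → ℝ) (z w : ℂ) : ℂ :=
  h (‖z‖ ^ 2) • w + (2 * h' (‖z‖ ^ 2) * (starRingEnd ℂ z * w).re) • z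

/-- The current density `h'(|z|²) Re(z̄ w) Im(z̄ w)`. -/
def current (h' : ℝ → ℝ) (z w : ℂ) : ℝ :=
  h' (‖z‖ ^ 2) * (starRingEnd ℂ z * w).re * (starRingEnd ℂ z * w).im

/-- `h` is `C¹` on `[0, ∞)` with derivative `h'`, and `h s` and `s h'(s)` are bounded by `C`. -/
structure IsRadial (h h' : ℝ → ℝ) (C : ℝ) : Prop where
  hasDeriv : ∀ s, 0 ≤ s → HasDerivAt h (h' s) s
  cont : ContinuousOn h' (Set.Ici 0)
  bound : ∀ s, 0 ≤ s → |h s| ≤ C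
  bound_deriv : ∀ s, 0 ≤ s → |s * h' s| ≤ C

variable {h h' : ℝ → ℝ} {C : ℝ}

theorem IsRadial.nonneg (hr : IsRadial h h' C) : 0 ≤ C := (abs_nonneg _).trans (hr.bound 0 le_rfl)

theorem IsRadial.continuousOn (hr : IsRadial h h' C) : ContinuousOn h (Set.Ici 0) :=
  fun s hs => (hr.hasDeriv s hs).continuousAt.continuousWithinAt

theorem IsRadial.continuous_sq (hr : IsRadial h h' C) : Continuous fun z : ℂ => h (‖z‖ ^ 2) :=
  hr.continuousOn.comp_continuous (by fun_prop) fun z => Set.mem_Ici.2 (sq_nonneg _)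

theorem continuous_comp_norm_sq {g : ℝ → ℝ} (hg : ContinuousOn g (Set.Ici 0)) :
    Continuous fun z : ℂ => g (‖z‖ ^ 2) :=
  hg.comp_continuous (by fun_prop) fun z => Set.mem_Ici.2 (sq_nonneg _)

theorem IsRadial.continuous_radial (hr : IsRadial h h' C) : Continuous (radial h) :=
  hr.continuous_sq.smul continuous_id

theorem IsRadial.continuous_radialDeriv (hr : IsRadial h h' C) :
    Continuous fun p : ℂ × ℂ => radialDeriv h h' p.1 p.2 := by
  have h1 := hr.continuous_sq.comp (continuous_fst (X := ℂ) (Y := ℂ))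
  have h2 := (continuous_comp_norm_sq hr.cont).comp (continuous_fst (X := ℂ) (Y := ℂ))
  unfold radialDeriv
  refine (h1.smul continuous_snd).add (Continuous.smul (Continuous.mul (continuous_const.mul h2) ?_) continuous_fst)
  fun_prop

theorem continuous_current (hh : ContinuousOn h' (Set.Ici 0)) :
    Continuous fun p : ℂ × ℂ => current h' p.1 p.2 := by
  have h2 := (continuous_comp_norm_sq hh).comp (continuous_fst (X := ℂ) (Y := ℂ))
  unfold current
  refine (h2.mul ?_).mul ?_ <;> fun_prop

theorem IsRadial.norm_radial_le (hr : IsRadial h h' C) (z : ℂ) : ‖radial h z‖ ≤ C * ‖z‖ := by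
  rw [radial, norm_smul, Real.norm_eq_abs]
  exact mul_le_mul_of_nonneg_right (hr.bound _ (sq_nonneg _)) (norm_nonneg _)

theorem abs_re_conj_mul_le (z w : ℂ) : |(starRingEnd ℂ z * w).re| ≤ ‖z‖ * ‖w‖ := by
  refine (Complex.abs_re_le_norm _).trans ?_
  rw [norm_mul, RCLike.norm_conj]

theorem abs_im_conj_mul_le (z w : ℂ) : |(starRingEnd ℂ z * w).im| ≤ ‖z‖ * ‖w‖ := by
  refine (Complex.abs_im_le_norm _).trans ?_
  rw [norm_mul, RCLike.norm_conj]

theorem abs_current_le (hb : ∀ s, 0 ≤ s → |s * h' s| ≤ C) (z w : ℂ) :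
    |current h' z w| ≤ C * ‖w‖ ^ 2 := by
  rw [current, abs_mul, abs_mul]
  calc |h' (‖z‖ ^ 2)| * |(starRingEnd ℂ z * w).re| * |(starRingEnd ℂ z * w).im|
      ≤ |h' (‖z‖ ^ 2)| * (‖z‖ * ‖w‖) * (‖z‖ * ‖w‖) := by
        gcongr
        · exact abs_re_conj_mul_le z w
        · exact abs_im_conj_mul_le z w
    _ = |‖z‖ ^ 2 * h' (‖z‖ ^ 2)| * ‖w‖ ^ 2 := by
        rw [abs_mul, abs_of_nonneg (sq_nonneg ‖z‖)]; ring
    _ ≤ C * ‖w‖ ^ 2 := by gcongr; exact hb _ (sq_nonneg _)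

theorem IsRadial.norm_radialDeriv_le (hr : IsRadial h h' C) (z w : ℂ) :
    ‖radialDeriv h h' z w‖ ≤ 3 * C * ‖w‖ := by
  rw [radialDeriv]
  refine (norm_add_le _ _).trans ?_
  rw [norm_smul, norm_smul, Real.norm_eq_abs, Real.norm_eq_abs, abs_mul, abs_mul]
  have h1 : |(2 : ℝ)| * |h' (‖z‖ ^ 2)| * |(starRingEnd ℂ z * w).re| * ‖z‖ ≤ 2 * C * ‖w‖ := by
    calc |(2 : ℝ)| * |h' (‖z‖ ^ 2)| * |(starRingEnd ℂ z * w).re| * ‖z‖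
        ≤ |(2 : ℝ)| * |h' (‖z‖ ^ 2)| * (‖z‖ * ‖w‖) * ‖z‖ := by
          gcongr; exact abs_re_conj_mul_le z w
      _ = 2 * |‖z‖ ^ 2 * h' (‖z‖ ^ 2)| * ‖w‖ := by
          rw [abs_mul (‖z‖ ^ 2), abs_of_nonneg (sq_nonneg ‖z‖), abs_two]; ring
      _ ≤ 2 * C * ‖w‖ := by gcongr; exact hr.bound_deriv _ (sq_nonneg _)
  have h2 := mul_le_mul_of_nonneg_right (hr.bound (‖z‖ ^ 2) (sq_nonneg _)) (norm_nonneg w)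
  linarith

/-- The Fréchet derivative of `radial h`. -/
def radialFDeriv (h h' : ℝ → ℝ) (z : ℂ) : ℂ →L[ℝ] ℂ :=
  h (‖z‖ ^ 2) • ContinuousLinearMap.id ℝ ℂ +
    (h' (‖z‖ ^ 2) • (2 • innerSL ℝ z)).smulRight z

theorem radialFDeriv_apply (z w : ℂ) : radialFDeriv h h' z w = radialDeriv h h' z w := by
  simp only [radialFDeriv, radialDeriv, add_apply,
    smul_apply, ContinuousLinearMap.id_apply,
    ContinuousLinearMap.smulRight_apply, innerSL_apply_apply, Complex.inner]
  congr 2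
  simp only [nsmul_eq_mul, smul_eq_mul]
  push_cast
  rw [mul_comm w]
  ring

theorem IsRadial.hasFDerivAt (hr : IsRadial h h' C) (z : ℂ) :
    HasFDerivAt (radial h) (radialFDeriv h h' z) z := by
  have h1 : HasFDerivAt (fun x : ℂ => ‖x‖ ^ 2) (2 • innerSL ℝ z) z :=
    (hasStrictFDerivAt_norm_sq z).hasFDerivAt
  have h2 := (hr.hasDeriv _ (sq_nonneg ‖z‖)).comp_hasFDerivAt z h1
  exact h2.smul (hasFDerivAt_id z)

theorem IsRadial.contDiff (hr : IsRadial h h' C) : ContDiff ℝ 1 (radial h) := by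
  rw [contDiff_one_iff_hasFDerivAt]
  refine ⟨radialFDeriv h h', ?_, hr.hasFDerivAt⟩
  unfold radialFDeriv
  have h1 := hr.continuous_sq
  have h2 := continuous_comp_norm_sq hr.cont
  have h3 : Continuous fun z : ℂ => (innerSL ℝ z : ℂ →L[ℝ] ℝ) := (innerSL ℝ).continuous
  refine (h1.smul continuous_const).add ?_
  have h4 : Continuous fun z : ℂ => h' (‖z‖ ^ 2) • (2 • (innerSL ℝ z : ℂ →L[ℝ] ℝ)) :=
    h2.smul (h3.const_smul 2)
  exact (ContinuousLinearMap.smulRightL ℝ ℂ ℂ).continuous₂.comp (h4.prodMk continuous_id)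

/-- The part `h(|z|²) |w|²` is real, so only the derivative of `h` is left. This is where the
current comes from. -/
theorem im_mul_conj_radialDeriv (z w : ℂ) :
    (starRingEnd ℂ (radialDeriv h h' z w) * w).im = 2 * current h' z w := by
  simp only [radialDeriv, current, Complex.real_smul, map_add, map_mul, Complex.conj_ofReal]
  generalize h (‖z‖ ^ 2) = a
  generalize h' (‖z‖ ^ 2) = b
  simp only [Complex.mul_im, Complex.mul_re, Complex.add_re, Complex.add_im, Complex.ofReal_re,
    Complex.ofReal_im, Complex.conj_re, Complex.conj_im]
  ring

/-- Both terms on the right are nonnegative if `h` and `h'` are: this is the source of the maximum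
principle for the resolvents. -/
theorem re_mul_conj_radialDeriv (z w : ℂ) :
    (starRingEnd ℂ (radialDeriv h h' z w) * w).re =
      h (‖z‖ ^ 2) * ‖w‖ ^ 2 + 2 * h' (‖z‖ ^ 2) * (starRingEnd ℂ z * w).re ^ 2 := by
  rw [← Complex.normSq_eq_norm_sq w]
  simp only [radialDeriv, Complex.real_smul, map_add, map_mul, Complex.conj_ofReal,
    Complex.normSq_apply]
  generalize h (‖z‖ ^ 2) = a
  generalize h' (‖z‖ ^ 2) = b
  simp only [Complex.mul_im, Complex.mul_re, Complex.add_re, Complex.add_im, Complex.ofReal_re,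
    Complex.ofReal_im, Complex.conj_re, Complex.conj_im]
  ring

/-- The variation of `h(|z|²)`, weighted with the smaller modulus. -/
theorem abs_sub_mul_le (hd : ∀ s, 0 ≤ s → HasDerivAt h (h' s) s)
    (hb : ∀ s, 0 ≤ s → |s * h' s| ≤ C) {a b : ℝ} (ha : 0 ≤ a) (hab : a ≤ b) :
    |h (b ^ 2) - h (a ^ 2)| * a ≤ 2 * C * (b - a) := by
  rcases ha.eq_or_lt with rfl | ha
  · have : 0 ≤ C := (abs_nonneg _).trans (hb 0 le_rfl)
    simp only [mul_zero]
    have : 0 ≤ b - 0 := by linarith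
    positivity
  have h1 : ∀ x ∈ Set.Icc a b, HasDerivWithinAt (fun x => h (x ^ 2)) (h' (x ^ 2) * (2 * x))
      (Set.Icc a b) x := fun x hx => by
    have h3 : HasDerivAt (fun x : ℝ => x ^ 2) (2 * x) x := by simpa using hasDerivAt_pow 2 x
    exact (HasDerivAt.comp (h := fun x : ℝ => x ^ 2) x (hd (x ^ 2) (sq_nonneg x))
      h3).hasDerivWithinAt
  -- On `[a, b]` the derivative satisfies `|2 x h'(x²)| ≤ 2 C / x ≤ 2 C / a`.
  have h2 := Convex.norm_image_sub_le_of_norm_hasDerivWithin_le (C := 2 * C / a) h1 (fun x hx => by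
    have hx0 : 0 < x := ha.trans_le hx.1
    have h3 := hb (x ^ 2) (sq_nonneg x)
    rw [Real.norm_eq_abs, le_div_iff₀ ha, abs_mul, abs_of_pos (by positivity : 0 < 2 * x)]
    rw [abs_mul, abs_of_nonneg (sq_nonneg x)] at h3
    have h4 : |h' (x ^ 2)| * x * a ≤ |h' (x ^ 2)| * x * x := by gcongr; exact hx.1
    nlinarith) (convex_Icc a b) (Set.left_mem_Icc.2 hab) (Set.right_mem_Icc.2 hab)
  rw [Real.norm_eq_abs, Real.norm_of_nonneg (by linarith)] at h2
  calc |h (b ^ 2) - h (a ^ 2)| * a ≤ 2 * C / a * (b - a) * a := by gcongr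
    _ = _ := by field_simp

/-- The Cazenave-Haraux inequality. -/
theorem abs_im_radial_le (hd : ∀ s, 0 ≤ s → HasDerivAt h (h' s) s)
    (hb : ∀ s, 0 ≤ s → |s * h' s| ≤ C) (u v : ℂ) :
    |(starRingEnd ℂ (radial h u - radial h v) * (u - v)).im| ≤ 2 * C * ‖u - v‖ ^ 2 := by
  have key : ∀ u v : ℂ, ‖u‖ ≤ ‖v‖ →
      |(starRingEnd ℂ (radial h u - radial h v) * (u - v)).im| ≤ 2 * C * ‖u - v‖ ^ 2 := by
    intro u v huv
    -- The diagonal terms are real. What is left involves only the difference of the two factors,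
    -- multiplied by the vector of smaller modulus, as `abs_sub_mul_le` requires.
    have e : (starRingEnd ℂ (radial h u - radial h v) * (u - v)).im =
        (h (‖v‖ ^ 2) - h (‖u‖ ^ 2)) * (starRingEnd ℂ u * (v - u)).im := by
      simp only [radial, Complex.real_smul, map_sub, map_mul, Complex.conj_ofReal]
      generalize h (‖u‖ ^ 2) = a
      generalize h (‖v‖ ^ 2) = b
      simp only [Complex.mul_im, Complex.mul_re, Complex.sub_re, Complex.sub_im, Complex.ofReal_re,
        Complex.ofReal_im, Complex.conj_re, Complex.conj_im]
      ring
    rw [e, abs_mul]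
    have h1 := abs_sub_mul_le hd hb (norm_nonneg u) huv
    have h2 := abs_im_conj_mul_le u (v - u)
    have h3 : ‖v‖ - ‖u‖ ≤ ‖v - u‖ := norm_sub_norm_le v u
    rw [norm_sub_rev u v]
    have hC : 0 ≤ C := (abs_nonneg _).trans (hb 0 le_rfl)
    calc |h (‖v‖ ^ 2) - h (‖u‖ ^ 2)| * |(starRingEnd ℂ u * (v - u)).im|
        ≤ |h (‖v‖ ^ 2) - h (‖u‖ ^ 2)| * (‖u‖ * ‖v - u‖) := by gcongr
      _ = |h (‖v‖ ^ 2) - h (‖u‖ ^ 2)| * ‖u‖ * ‖v - u‖ := by ring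
      _ ≤ 2 * C * (‖v‖ - ‖u‖) * ‖v - u‖ := by gcongr
      _ ≤ 2 * C * ‖v - u‖ * ‖v - u‖ := by gcongr
      _ = _ := by ring
  rcases le_total ‖u‖ ‖v‖ with h1 | h1
  · exact key u v h1
  · have h2 := key v u h1
    rw [norm_sub_rev v u] at h2
    have e : starRingEnd ℂ (radial h u - radial h v) * (u - v) =
        starRingEnd ℂ (radial h v - radial h u) * (v - u) := by
      simp only [map_sub]; ring
    rwa [e]

open Real in
-- The derivative vanishes beyond `1`, so only the compact interval `[-1, 1]` matters. Under `x = s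
-- / k - 1` the weight `s` times the derivative of the cutoff becomes `x + 1` times this derivative,
-- so that one constant serves all `k`.
theorem exists_bound_smoothTransition :
    ∃ B : ℝ, 1 ≤ B ∧ ∀ x, -1 ≤ x → |(x + 1) * deriv smoothTransition x| ≤ B := by
  have hc : Continuous fun x : ℝ => (x + 1) * deriv smoothTransition x := by
    have : Continuous (deriv smoothTransition) :=
      (smoothTransition.contDiff (n := 1)).continuous_deriv le_rfl
    fun_prop
  obtain ⟨B, hB⟩ := (isCompact_Icc (a := (-1 : ℝ)) (b := 1)).exists_bound_of_continuousOn
    hc.continuousOn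
  refine ⟨max B 1, le_max_right _ _, fun x hx => ?_⟩
  by_cases h1 : x ≤ 1
  · exact (hB x ⟨hx, h1⟩).trans (le_max_left _ _)
  · have : deriv smoothTransition x = 0 := by
      have h2 : smoothTransition =ᶠ[𝓝 x] fun _ => 1 := by
        filter_upwards [Ioi_mem_nhds (not_le.1 h1)] with y hy
        exact smoothTransition.one_of_one_le (Set.mem_Ioi.1 hy).le
      rw [h2.deriv_eq, deriv_const]
    rw [this]; simp

/-- A smooth function that vanishes on `[0, k]` and equals `1` on `[2k, ∞)`. -/
def tailCut (k s : ℝ) : ℝ := Real.smoothTransition (s / k - 1)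

/-- The derivative of `tailCut k`. -/
def tailCutDeriv (k s : ℝ) : ℝ := deriv Real.smoothTransition (s / k - 1) / k

theorem hasDerivAt_tailCut (k s : ℝ) : HasDerivAt (tailCut k) (tailCutDeriv k s) s := by
  have h1 : HasDerivAt (fun s : ℝ => s / k - 1) (1 / k) s := ((hasDerivAt_id s).div_const k).sub_const 1
  have h2 : DifferentiableAt ℝ Real.smoothTransition (s / k - 1) :=
    (Real.smoothTransition.contDiff (n := 1)).differentiable one_ne_zero _
  have h3 := h2.hasDerivAt.comp s h1
  rw [mul_one_div] at h3
  exact h3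

theorem continuous_tailCutDeriv (k : ℝ) : Continuous (tailCutDeriv k) := by
  have : Continuous (deriv Real.smoothTransition) :=
    (Real.smoothTransition.contDiff (n := 1)).continuous_deriv le_rfl
  unfold tailCutDeriv
  fun_prop

theorem exists_isRadial_tailCut : ∃ B, ∀ k, 0 < k → IsRadial (tailCut k) (tailCutDeriv k) B := by
  obtain ⟨B, hB1, hB⟩ := exists_bound_smoothTransition
  refine ⟨B, fun k hk => ⟨fun s _ => hasDerivAt_tailCut k s,
    (continuous_tailCutDeriv k).continuousOn, fun s _ => ?_, fun s hs => ?_⟩⟩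
  · rw [tailCut, abs_of_nonneg (Real.smoothTransition.nonneg _)]
    exact (Real.smoothTransition.le_one _).trans hB1
  · have h1 := hB (s / k - 1) (by have : 0 ≤ s / k := by positivity
                                  linarith)
    have e : s * tailCutDeriv k s = (s / k - 1 + 1) * deriv Real.smoothTransition (s / k - 1) := by
      rw [tailCutDeriv]; field_simp; ring
    rwa [e]

theorem tailCut_nonneg (k s : ℝ) : 0 ≤ tailCut k s := Real.smoothTransition.nonneg _

theorem tailCutDeriv_nonneg {k : ℝ} (hk : 0 < k) (s : ℝ) : 0 ≤ tailCutDeriv k s :=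
  div_nonneg Real.smoothTransition.monotone.deriv_nonneg hk.le

theorem tailCut_pos {k s : ℝ} (hk : 0 < k) (h : k < s) : 0 < tailCut k s :=
  Real.smoothTransition.pos_of_pos (by rw [sub_pos, lt_div_iff₀ hk]; linarith)

theorem tailCut_eq_zero {k s : ℝ} (hk : 0 < k) (h : s ≤ k) : tailCut k s = 0 :=
  Real.smoothTransition.zero_of_nonpos (by rw [sub_nonpos, div_le_iff₀ hk]; linarith)

theorem tailCut_eq_one {k s : ℝ} (hk : 0 < k) (h : 2 * k ≤ s) : tailCut k s = 1 :=
  Real.smoothTransition.one_of_one_le (by rw [le_sub_iff_add_le, le_div_iff₀ hk]; linarith)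

end Radial

/-! ### Abstract Sobolev spaces of jets and the maximum principle. -/

section Sobolev

variable {Ω : Type*} [MeasurableSpace Ω] {μ : Measure Ω} [IsProbabilityMeasure μ]
  {ι : Type*} [Fintype ι]

theorem inner_Lp (f g : Lp ℂ 2 μ) :
    inner ℂ f g = ∫ ω, starRingEnd ℂ (f ω) * g ω ∂μ := by
  rw [L2.inner_def]
  exact integral_congr_ae (ae_of_all _ fun ω => by simp [mul_comm])

theorem integrable_conj_mul (f g : Lp ℂ 2 μ) :
    Integrable (fun ω => starRingEnd ℂ (f ω) * g ω) μ := by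
  refine (L2.integrable_inner (𝕜 := ℂ) f g).congr (ae_of_all _ fun ω => by simp [mul_comm])

theorem continuous_pair {G : Type*} [TopologicalSpace G] {F : ℂ → ℂ → G}
    (hF : Continuous fun p : ℂ × ℂ => F p.1 p.2) :
    Continuous fun z : Fin 2 → ℂ => F (z 0) (z 1) :=
  hF.comp (f := fun z : Fin 2 → ℂ => (z 0, z 1)) (by fun_prop)

/-- Superposition operators of one variable. -/
def sup1 (F : ℂ → ℂ) (u : Lp ℂ 2 μ) : Lp ℂ 2 μ :=
  superposition (κ := Fin 1) (fun z => F (z 0)) ![u]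

/-- Superposition operators of two variables. -/
def sup2 (F : ℂ → ℂ → ℂ) (u v : Lp ℂ 2 μ) : Lp ℂ 2 μ :=
  superposition (κ := Fin 2) (fun z => F (z 0) (z 1)) ![u, v]

theorem coeFn_sup1 {F : ℂ → ℂ} (hF : Continuous F) {C : ℝ} (hC : ∀ z, ‖F z‖ ≤ C * (1 + ‖z‖))
    (u : Lp ℂ 2 μ) : sup1 F u =ᵐ[μ] fun ω => F (u ω) :=
  coeFn_superposition (κ := Fin 1) (F := fun z => F (z 0)) (by fun_prop) (C := C)
    (fun z => by simpa using hC (z 0)) ![u]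

theorem continuous_sup1 {F : ℂ → ℂ} (hF : Continuous F) {C : ℝ}
    (hC : ∀ z, ‖F z‖ ≤ C * (1 + ‖z‖)) : Continuous (sup1 F : Lp ℂ 2 μ → Lp ℂ 2 μ) := by
  have h := continuous_superposition (μ := μ) (κ := Fin 1) (F := fun z => F (z 0)) (by fun_prop)
    (C := C) (fun z => by simpa using hC (z 0))
  exact h.comp (by fun_prop : Continuous fun u : Lp ℂ 2 μ => ![u])

theorem coeFn_sup2 {F : ℂ → ℂ → ℂ} (hF : Continuous fun p : ℂ × ℂ => F p.1 p.2) {C : ℝ}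
    (hC : ∀ z w, ‖F z w‖ ≤ C * (1 + (‖z‖ + ‖w‖))) (u v : Lp ℂ 2 μ) :
    sup2 F u v =ᵐ[μ] fun ω => F (u ω) (v ω) :=
  coeFn_superposition (κ := Fin 2) (F := fun z => F (z 0) (z 1))
    (continuous_pair hF) (C := C)
    (fun z => by simpa [Fin.sum_univ_two] using hC (z 0) (z 1)) ![u, v]

theorem continuous_sup2 {F : ℂ → ℂ → ℂ} (hF : Continuous fun p : ℂ × ℂ => F p.1 p.2) {C : ℝ}
    (hC : ∀ z w, ‖F z w‖ ≤ C * (1 + (‖z‖ + ‖w‖))) :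
    Continuous fun p : Lp ℂ 2 μ × Lp ℂ 2 μ => sup2 F p.1 p.2 := by
  have h := continuous_superposition (μ := μ) (κ := Fin 2) (F := fun z => F (z 0) (z 1))
    (continuous_pair hF) (C := C)
    (fun z => by simpa [Fin.sum_univ_two] using hC (z 0) (z 1))
  exact h.comp (by fun_prop : Continuous fun p : Lp ℂ 2 μ × Lp ℂ 2 μ => ![p.1, p.2])

theorem continuous_int1 {G : Type*} [NormedAddCommGroup G] [NormedSpace ℝ G] {F : ℂ → G}
    (hF : Continuous F) {C : ℝ} (hC : ∀ z, ‖F z‖ ≤ C * (1 + ‖z‖ ^ 2)) :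
    Continuous fun u : Lp ℂ 2 μ => ∫ ω, F (u ω) ∂μ := by
  have h := continuous_integral_superposition (μ := μ) (κ := Fin 1) (F := fun z => F (z 0))
    (by fun_prop) (C := C) (fun z => by simpa using hC (z 0))
  exact h.comp (by fun_prop : Continuous fun u : Lp ℂ 2 μ => ![u])

theorem integrable_int1 {G : Type*} [NormedAddCommGroup G] {F : ℂ → G}
    (hF : Continuous F) {C : ℝ} (hC : ∀ z, ‖F z‖ ≤ C * (1 + ‖z‖ ^ 2)) (u : Lp ℂ 2 μ) :
    Integrable (fun ω => F (u ω)) μ :=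
  integrable_superposition (μ := μ) (κ := Fin 1) (F := fun z => F (z 0))
    (by fun_prop) (C := C) (fun z => by simpa using hC (z 0)) ![u]

theorem continuous_int2 {G : Type*} [NormedAddCommGroup G] [NormedSpace ℝ G] {F : ℂ → ℂ → G}
    (hF : Continuous fun p : ℂ × ℂ => F p.1 p.2) {C : ℝ}
    (hC : ∀ z w, ‖F z w‖ ≤ C * (1 + (‖z‖ ^ 2 + ‖w‖ ^ 2))) :
    Continuous fun p : Lp ℂ 2 μ × Lp ℂ 2 μ => ∫ ω, F (p.1 ω) (p.2 ω) ∂μ := by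
  have h := continuous_integral_superposition (μ := μ) (κ := Fin 2) (F := fun z => F (z 0) (z 1))
    (continuous_pair hF) (C := C)
    (fun z => by simpa [Fin.sum_univ_two] using hC (z 0) (z 1))
  exact h.comp (by fun_prop : Continuous fun p : Lp ℂ 2 μ × Lp ℂ 2 μ => ![p.1, p.2])

theorem integrable_int2 {G : Type*} [NormedAddCommGroup G] {F : ℂ → ℂ → G}
    (hF : Continuous fun p : ℂ × ℂ => F p.1 p.2) {C : ℝ}
    (hC : ∀ z w, ‖F z w‖ ≤ C * (1 + (‖z‖ ^ 2 + ‖w‖ ^ 2))) (u v : Lp ℂ 2 μ) :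
    Integrable (fun ω => F (u ω) (v ω)) μ :=
  integrable_superposition (μ := μ) (κ := Fin 2) (F := fun z => F (z 0) (z 1))
    (continuous_pair hF) (C := C)
    (fun z => by simpa [Fin.sum_univ_two] using hC (z 0) (z 1)) ![u, v]

variable {h h' : ℝ → ℝ} {C : ℝ}

/-- The jet of `radial h u`, according to the chain rule. -/
def radialJet (h h' : ℝ → ℝ) (x : Jet (Lp ℂ 2 μ) ι) : Jet (Lp ℂ 2 μ) ι :=
  WithLp.toLp 2 fun o => o.elim (sup1 (radial h) (x none)) fun j =>
    sup2 (radialDeriv h h') (x none) (x (some j))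

theorem IsRadial.growth_radial (hr : IsRadial h h' C) (z : ℂ) : ‖radial h z‖ ≤ C * (1 + ‖z‖) := by
  have := hr.norm_radial_le z
  have := hr.nonneg
  linarith

theorem IsRadial.growth_radialDeriv (hr : IsRadial h h' C) (z w : ℂ) :
    ‖radialDeriv h h' z w‖ ≤ 3 * C * (1 + (‖z‖ + ‖w‖)) := by
  have h1 := hr.norm_radialDeriv_le z w
  have := hr.nonneg
  have : 0 ≤ 3 * C * (1 + ‖z‖) := by positivity
  linarith

theorem IsRadial.coeFn_radialJet_none (hr : IsRadial h h' C) (x : Jet (Lp ℂ 2 μ) ι) :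
    radialJet h h' x none =ᵐ[μ] fun ω => radial h (x none ω) :=
  coeFn_sup1 hr.continuous_radial hr.growth_radial _

theorem IsRadial.coeFn_radialJet_some (hr : IsRadial h h' C) (x : Jet (Lp ℂ 2 μ) ι) (j : ι) :
    radialJet h h' x (some j) =ᵐ[μ] fun ω => radialDeriv h h' (x none ω) (x (some j) ω) :=
  coeFn_sup2 hr.continuous_radialDeriv hr.growth_radialDeriv _ _

theorem IsRadial.continuous_radialJet (hr : IsRadial h h' C) :
    Continuous (radialJet h h' : Jet (Lp ℂ 2 μ) ι → Jet (Lp ℂ 2 μ) ι) := by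
  have h0 : Continuous fun x : Jet (Lp ℂ 2 μ) ι => sup1 (radial h) (x none) :=
    (continuous_sup1 hr.continuous_radial hr.growth_radial).comp (continuous_apply_jet none)
  have h1 : ∀ j, Continuous fun x : Jet (Lp ℂ 2 μ) ι =>
      sup2 (radialDeriv h h') (x none) (x (some j)) := fun j =>
    (continuous_sup2 (μ := μ) hr.continuous_radialDeriv hr.growth_radialDeriv).comp
      (f := fun x : Jet (Lp ℂ 2 μ) ι => (x none, x (some j)))
      ((continuous_apply_jet none).prodMk (continuous_apply_jet (some j)))
  have h2 : Continuous fun x : Jet (Lp ℂ 2 μ) ι => fun o : Option ι =>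
      (o.elim (sup1 (radial h) (x none)) fun j => sup2 (radialDeriv h h') (x none) (x (some j)) :
        Lp ℂ 2 μ) :=
    continuous_pi fun o => match o with
      | none => h0
      | some j => h1 j
  exact (PiLp.continuous_toLp 2 (fun _ : Option ι => Lp ℂ 2 μ)).comp h2

/-- A Sobolev space of `L²` functions with a finite family of derivatives: closed, with unique
derivatives, dense in `L²`, and stable under the maps `z ↦ h(|z|²) z`, with the chain rule. -/
structure IsSobolev (V : ClosedSubmodule ℂ (Jet (Lp ℂ 2 μ) ι)) : Prop where
  unique : HasUniqueDerivs V
  dense : HasDenseDomain V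
  chain : ∀ {h h' : ℝ → ℝ} {C : ℝ}, IsRadial h h' C → ∀ x ∈ V, radialJet h h' x ∈ V

/-- The integrated current `∑_j ∫ h'(|u|²) Re(ū ∂_j u) Im(ū ∂_j u)`. -/
def totalCurrent (h' : ℝ → ℝ) (x : Jet (Lp ℂ 2 μ) ι) : ℝ :=
  ∑ j, ∫ ω, current h' (x none ω) (x (some j) ω) ∂μ

theorem growth_current (hb : ∀ s, 0 ≤ s → |s * h' s| ≤ C) (z w : ℂ) :
    ‖current h' z w‖ ≤ C * (1 + (‖z‖ ^ 2 + ‖w‖ ^ 2)) := by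
  have h1 := abs_current_le hb z w
  have h0 : 0 ≤ C := (abs_nonneg _).trans (hb 0 le_rfl)
  rw [Real.norm_eq_abs]
  nlinarith [mul_nonneg h0 (sq_nonneg ‖z‖)]

theorem continuous_totalCurrent (hc : ContinuousOn h' (Set.Ici 0))
    (hb : ∀ s, 0 ≤ s → |s * h' s| ≤ C) :
    Continuous (totalCurrent h' : Jet (Lp ℂ 2 μ) ι → ℝ) := by
  unfold totalCurrent
  refine continuous_finsetSum _ fun j _ => ?_
  exact (continuous_int2 (μ := μ) (continuous_current hc) (growth_current hb)).comp
    ((continuous_apply_jet none).prodMk (continuous_apply_jet (some j)))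

theorem abs_totalCurrent_le (hb : ∀ s, 0 ≤ s → |s * h' s| ≤ C) (x : Jet (Lp ℂ 2 μ) ι) :
    |totalCurrent h' x| ≤ C * gsq x := by
  unfold totalCurrent gsq
  rw [Finset.mul_sum]
  refine (Finset.abs_sum_le_sum_abs _ _).trans (Finset.sum_le_sum fun j _ => ?_)
  rw [← Real.norm_eq_abs, ← integral_norm_sq, ← integral_const_mul]
  refine norm_integral_le_of_norm_le ((integrable_norm_sq _).const_mul _) (ae_of_all _ fun ω => ?_)
  exact abs_current_le hb _ _

theorem IsRadial.im_form_radialJet (hr : IsRadial h h' C) (x : Jet (Lp ℂ 2 μ) ι) :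
    (form (radialJet h h' x) x).im = 2 * totalCurrent h' x := by
  unfold form totalCurrent
  rw [Complex.im_sum, Finset.mul_sum]
  refine Finset.sum_congr rfl fun j _ => ?_
  rw [inner_Lp, ← integral_const_mul]
  have h1 := integral_im (integrable_conj_mul (radialJet h h' x (some j)) (x (some j)))
  simp only [RCLike.im_to_complex] at h1
  rw [← h1]
  refine integral_congr_ae ?_
  filter_upwards [hr.coeFn_radialJet_some x j] with ω hω
  rw [hω, im_mul_conj_radialDeriv]

theorem IsRadial.re_form_radialJet_nonneg (hr : IsRadial h h' C) (h0 : ∀ s, 0 ≤ s → 0 ≤ h s)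
    (h0' : ∀ s, 0 ≤ s → 0 ≤ h' s) (x : Jet (Lp ℂ 2 μ) ι) :
    0 ≤ (form (radialJet h h' x) x).re := by
  unfold form
  rw [Complex.re_sum]
  refine Finset.sum_nonneg fun j _ => ?_
  rw [inner_Lp]
  have h1 := integral_re (integrable_conj_mul (radialJet h h' x (some j)) (x (some j)))
  simp only [RCLike.re_to_complex] at h1
  rw [← h1]
  refine integral_nonneg_of_ae ?_
  filter_upwards [hr.coeFn_radialJet_some x j] with ω hω
  rw [hω, re_mul_conj_radialDeriv]
  have := h0 _ (sq_nonneg ‖x none ω‖)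
  have := h0' _ (sq_nonneg ‖x none ω‖)
  simp only [Pi.zero_apply]
  positivity

variable {V : ClosedSubmodule ℂ (Jet (Lp ℂ 2 μ) ι)}

/-- By the chain rule `h(|J u|²) J u` may be inserted in the Euler equation of `J u`. Its form with
`J u` has nonnegative real part, since `h` is nonnegative and nondecreasing. A cutoff `h` gives the
maximum principle, a logarithmic `h` the bound in `L² log L`. -/
theorem IsSobolev.integral_res_le (hV : IsSobolev V) (hr : IsRadial h h' C)
    (h0 : ∀ s, 0 ≤ s → 0 ≤ h s) (h0' : ∀ s, 0 ≤ s → 0 ≤ h' s) {ε : ℝ} (hε : 0 < ε)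
    (u : Lp ℂ 2 μ) :
    ∫ ω, h (‖res V ε u none ω‖ ^ 2) * ‖res V ε u none ω‖ ^ 2 ∂μ ≤
      ∫ ω, h (‖res V ε u none ω‖ ^ 2) * (‖res V ε u none ω‖ * ‖u ω‖) ∂μ := by
  set x := res V ε u with hx
  set y := radialJet h h' x with hy
  have h1 := res_inner hε u (hV.chain hr x (res_mem V ε u))
  have h2 : 0 ≤ (inner ℂ (y none) (u - x none)).re := by
    rw [hy, h1, Complex.re_ofReal_mul]
    exact mul_nonneg hε.le (hr.re_form_radialJet_nonneg h0 h0' x)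
  rw [inner_sub_right, Complex.sub_re, sub_nonneg, inner_Lp, inner_Lp] at h2
  have h3 := integral_re (integrable_conj_mul (y none) (x none))
  have h4 := integral_re (integrable_conj_mul (y none) u)
  simp only [RCLike.re_to_complex] at h3 h4
  rw [← h3, ← h4] at h2
  have hy0 := hr.coeFn_radialJet_none x
  have e : ∫ ω, h (‖x none ω‖ ^ 2) * ‖x none ω‖ ^ 2 ∂μ =
      ∫ ω, (starRingEnd ℂ (y none ω) * x none ω).re ∂μ := by
    refine integral_congr_ae ?_
    filter_upwards [hy0] with ω hω
    rw [hy, hω, radial, Complex.real_smul, map_mul, Complex.conj_ofReal, mul_assoc,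
      Complex.re_ofReal_mul, ← Complex.normSq_eq_conj_mul_self, Complex.ofReal_re,
      Complex.normSq_eq_norm_sq]
  rw [e]
  refine h2.trans (integral_mono_ae (integrable_conj_mul (y none) u).re ?_ ?_)
  · have h5 : Integrable (fun ω => ‖x none ω‖ * ‖u ω‖) μ :=
      (integrable_conj_mul (x none) u).norm.congr (ae_of_all _ fun ω => by simp)
    refine h5.bdd_mul (c := C) ?_ (ae_of_all _ fun ω => hr.bound _ (sq_nonneg _))
    exact hr.continuous_sq.comp_aestronglyMeasurable (Lp.aestronglyMeasurable _)
  · filter_upwards [hy0] with ω hω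
    rw [hy, hω, radial, Complex.real_smul, map_mul, Complex.conj_ofReal, mul_assoc]
    rw [Complex.re_ofReal_mul]
    refine mul_le_mul_of_nonneg_left ?_ (h0 _ (sq_nonneg _))
    exact (le_abs_self _).trans (abs_re_conj_mul_le _ _)

/-- The maximum principle for the resolvent. -/
theorem IsSobolev.norm_res_le_of_bound (hV : IsSobolev V) {M : ℝ} (hM : 0 < M) {ε : ℝ}
    (hε : 0 < ε) {u : Lp ℂ 2 μ} (hu : ∀ᵐ ω ∂μ, ‖u ω‖ ≤ M) :
    ∀ᵐ ω ∂μ, ‖res V ε u none ω‖ ≤ M := by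
  obtain ⟨B, hB⟩ := exists_isRadial_tailCut
  have hM2 : 0 < M ^ 2 := by positivity
  have hr := hB (M ^ 2) hM2
  have h1 := hV.integral_res_le hr (fun s _ => tailCut_nonneg _ s)
    (fun s _ => tailCutDeriv_nonneg hM2 s) hε u
  set w := res V ε u none with hw
  have hm : AEStronglyMeasurable (fun ω => tailCut (M ^ 2) (‖w ω‖ ^ 2)) μ :=
    hr.continuous_sq.comp_aestronglyMeasurable (Lp.aestronglyMeasurable _)
  have i1 : Integrable (fun ω => tailCut (M ^ 2) (‖w ω‖ ^ 2) * ‖w ω‖ ^ 2) μ :=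
    (integrable_norm_sq w).bdd_mul (c := B) hm (ae_of_all _ fun ω => hr.bound _ (sq_nonneg _))
  have i2 : Integrable (fun ω => tailCut (M ^ 2) (‖w ω‖ ^ 2) * (‖w ω‖ * ‖u ω‖)) μ := by
    have h5 : Integrable (fun ω => ‖w ω‖ * ‖u ω‖) μ :=
      (integrable_conj_mul w u).norm.congr (ae_of_all _ fun ω => by simp)
    exact h5.bdd_mul (c := B) hm (ae_of_all _ fun ω => hr.bound _ (sq_nonneg _))
  -- The cutoff vanishes where `|w| ≤ M`, and elsewhere `|u| ≤ M ≤ |w|`. Since `h1` bounds the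
  -- integral of this nonnegative function by zero, it vanishes almost everywhere.
  have hpos : ∀ᵐ ω ∂μ, 0 ≤ tailCut (M ^ 2) (‖w ω‖ ^ 2) * ‖w ω‖ ^ 2 -
      tailCut (M ^ 2) (‖w ω‖ ^ 2) * (‖w ω‖ * ‖u ω‖) := by
    filter_upwards [hu] with ω hω
    by_cases h2 : ‖w ω‖ ^ 2 ≤ M ^ 2
    · rw [tailCut_eq_zero hM2 h2]; simp
    · have h3 : M ≤ ‖w ω‖ := by
        by_contra! h4
        exact h2 (pow_le_pow_left₀ (norm_nonneg _) h4.le 2)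
      rw [← mul_sub]
      refine mul_nonneg (tailCut_nonneg _ _) ?_
      have h5 : ‖w ω‖ * ‖u ω‖ ≤ ‖w ω‖ * ‖w ω‖ :=
        mul_le_mul_of_nonneg_left (hω.trans h3) (norm_nonneg _)
      nlinarith
  have h0 : ∫ ω, (tailCut (M ^ 2) (‖w ω‖ ^ 2) * ‖w ω‖ ^ 2 -
      tailCut (M ^ 2) (‖w ω‖ ^ 2) * (‖w ω‖ * ‖u ω‖)) ∂μ = 0 :=
    le_antisymm (by rw [integral_sub i1 i2]; linarith) (integral_nonneg_of_ae hpos)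
  rw [integral_eq_zero_iff_of_nonneg_ae hpos (i1.sub i2)] at h0
  filter_upwards [h0, hu] with ω h2 hω
  by_contra! h3
  have h4 : M ^ 2 < ‖w ω‖ ^ 2 := pow_lt_pow_left₀ h3 hM.le two_ne_zero
  have h5 := tailCut_pos hM2 h4
  simp only [Pi.zero_apply] at h2
  rw [← mul_sub, mul_eq_zero, or_iff_right h5.ne'] at h2
  have h6 : ‖w ω‖ * ‖u ω‖ < ‖w ω‖ * ‖w ω‖ :=
    mul_lt_mul_of_pos_left (hω.trans_lt h3) (hM.trans h3)
  nlinarith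

end Sobolev

/-! ### Pointwise properties of the logarithmic nonlinearity. -/

section Nonlinearity

/-- The logarithmic nonlinearity `λ z log(|z|² / m)`. -/
def logNL (lam m : ℝ) (z : ℂ) : ℂ := (lam * Real.log (‖z‖ ^ 2 / m)) • z

/-- The nonlinearity `z log |z|²`. -/
def logMap (z : ℂ) : ℂ := Real.log (‖z‖ ^ 2) • z

/-- The radial retraction of `ℂ` onto the ball of radius `M`. -/
def clamp (M : ℝ) (z : ℂ) : ℂ := (M / max M ‖z‖) • z

/-- For `x ≥ 1` one has `log x ≤ sinh (log x) = (x - 1/x) / 2`; apply this to `y` or to `1/y`. -/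
theorem abs_log_sq_mul_le {y : ℝ} (hy : 0 ≤ y) : |Real.log (y ^ 2)| * y ≤ 1 + y ^ 2 := by
  rcases hy.eq_or_lt with rfl | hy
  · simp
  rw [Real.log_pow, abs_mul]
  have h1 : |Real.log y| * y ≤ (1 + y ^ 2) / 2 := by
    have key : ∀ x : ℝ, 1 ≤ x → Real.log x ≤ (x - x⁻¹) / 2 := by
      intro x hx
      have h2 := Real.log_le_sub_one_of_pos (x := √x) (by positivity)
      have h3 := Real.self_le_sinh_iff.2 (Real.log_nonneg hx)
      rwa [Real.sinh_eq, Real.exp_log (by linarith), Real.exp_neg, Real.exp_log (by linarith)] at h3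
    rcases le_total 1 y with h | h
    · rw [abs_of_nonneg (Real.log_nonneg h)]
      have h2 := mul_le_mul_of_nonneg_right (key y h) hy.le
      have h3 : (y - y⁻¹) / 2 * y = (y ^ 2 - 1) / 2 := by field_simp
      rw [h3] at h2
      linarith
    · rw [abs_of_nonpos (Real.log_nonpos hy.le h), ← Real.log_inv]
      have h2 := mul_le_mul_of_nonneg_right (key y⁻¹ ((one_le_inv₀ hy).2 h)) hy.le
      have h3 : (y⁻¹ - y⁻¹⁻¹) / 2 * y = (1 - y ^ 2) / 2 := by field_simp
      rw [h3] at h2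
      nlinarith
  push_cast
  rw [abs_two]
  linarith

theorem norm_logMap_le (z : ℂ) : ‖logMap z‖ ≤ 1 + ‖z‖ ^ 2 := by
  rw [logMap, norm_smul, Real.norm_eq_abs]
  exact abs_log_sq_mul_le (norm_nonneg z)

theorem continuous_logMap : Continuous logMap := by
  rw [continuous_iff_continuousAt]
  intro z
  by_cases hz : z = 0
  · subst hz
    have h1 : Tendsto (fun z : ℂ => ‖logMap z‖) (𝓝 0) (𝓝 0) := by
      have h2 : ∀ z : ℂ, ‖logMap z‖ = 2 * |‖z‖ * Real.log ‖z‖| := fun z => by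
        rw [logMap, norm_smul, Real.norm_eq_abs, Real.log_pow, abs_mul, abs_mul,
          abs_of_nonneg (norm_nonneg z)]
        push_cast
        rw [abs_two]; ring
      simp_rw [h2]
      have h3 : Continuous fun z : ℂ => 2 * |‖z‖ * Real.log ‖z‖| :=
        continuous_const.mul (Real.continuous_mul_log.comp continuous_norm).abs
      have h4 := h3.tendsto 0
      simpa using h4
    have h2 : logMap 0 = 0 := by simp [logMap]
    rw [ContinuousAt, h2]
    exact tendsto_zero_iff_norm_tendsto_zero.2 h1
  · unfold logMap
    refine ContinuousAt.smul (ContinuousAt.log (by fun_prop) ?_) continuousAt_id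
    simpa using hz

theorem logNL_eq {m : ℝ} (hm : 0 < m) (lam : ℝ) (z : ℂ) :
    logNL lam m z = lam • logMap z - (lam * Real.log m) • z := by
  by_cases hz : z = 0
  · simp [hz, logNL, logMap]
  · have : ‖z‖ ^ 2 ≠ 0 := by simpa using hz
    rw [logNL, logMap, Real.log_div this hm.ne', smul_smul, mul_sub, sub_smul]

/-- `abs_log_sq_mul_le` for `y = |z| / √m`, multiplied by `√m`. This form stays small with `m` once
`|z|²` is integrated to `m`. -/
theorem norm_logNL_le {m : ℝ} (hm : 0 ≤ m) (lam : ℝ) (z : ℂ) :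
    ‖logNL lam m z‖ ≤ |lam| * (√m + ‖z‖ ^ 2 / √m) := by
  rw [logNL, norm_smul, Real.norm_eq_abs, abs_mul, mul_assoc]
  refine mul_le_mul_of_nonneg_left ?_ (abs_nonneg _)
  -- For `m = 0`, the conventions `x / 0 = 0` and `log 0 = 0` make both sides vanish.
  rcases hm.eq_or_lt with rfl | hm
  · simp
  have hs : 0 < √m := Real.sqrt_pos.2 hm
  have h1 := abs_log_sq_mul_le (y := ‖z‖ / √m) (by positivity)
  rw [div_pow, Real.sq_sqrt hm.le] at h1
  have h2 := mul_le_mul_of_nonneg_right h1 hs.le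
  have h3 : |Real.log (‖z‖ ^ 2 / m)| * (‖z‖ / √m) * √m = |Real.log (‖z‖ ^ 2 / m)| * ‖z‖ := by
    field_simp
  have h4 : (1 + ‖z‖ ^ 2 / m) * √m = √m + ‖z‖ ^ 2 / √m := by
    have h5 : m = √m * √m := (Real.mul_self_sqrt hm.le).symm
    rw [add_mul, one_mul, h5, Real.sqrt_mul_self hs.le]
    field_simp
  rw [h3, h4] at h2
  exact h2

theorem measurable_logNL (lam m : ℝ) : Measurable (logNL lam m) := by
  unfold logNL; fun_prop

theorem continuous_clamp {M : ℝ} (hM : 0 < M) : Continuous (clamp M) := by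
  unfold clamp
  refine Continuous.smul (continuous_const.div (continuous_const.max continuous_norm) fun z => ?_) continuous_id
  exact (lt_of_lt_of_le hM (le_max_left _ _)).ne'

theorem norm_clamp_le {M : ℝ} (hM : 0 < M) (z : ℂ) : ‖clamp M z‖ ≤ M := by
  have h : 0 < max M ‖z‖ := lt_of_lt_of_le hM (le_max_left _ _)
  rw [clamp, norm_smul, Real.norm_of_nonneg (by positivity), div_mul_eq_mul_div, div_le_iff₀ h]
  exact mul_le_mul_of_nonneg_left (le_max_right _ _) hM.le

theorem clamp_eq {M : ℝ} (hM : 0 < M) {z : ℂ} (hz : ‖z‖ ≤ M) : clamp M z = z := by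
  rw [clamp, max_eq_left hz, div_self hM.ne', one_smul]

end Nonlinearity

/-! ### The weak equation in the space of jets. -/

section Solutions

variable {Ω : Type*} [MeasurableSpace Ω] {μ : Measure Ω} [IsProbabilityMeasure μ]
  {ι : Type*} [Fintype ι]

/-- The pairing of the nonlinear term at `u` with `v`. -/
def pairNL (lam : ℝ) (u v : Lp ℂ 2 μ) : ℂ :=
  ∫ ω, starRingEnd ℂ (v ω) * logNL lam (‖u‖ ^ 2) (u ω) ∂μ

theorem integrable_logNL (lam : ℝ) (u : Lp ℂ 2 μ) :
    Integrable (fun ω => logNL lam (‖u‖ ^ 2) (u ω)) μ := by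
  refine Integrable.mono' (g := fun ω => |lam| * (√(‖u‖ ^ 2) + ‖u ω‖ ^ 2 / √(‖u‖ ^ 2))) ?_ ?_
    (ae_of_all _ fun ω => norm_logNL_le (sq_nonneg _) lam _)
  · exact ((integrable_const _).add ((integrable_norm_sq u).div_const _)).const_mul _
  · exact ((measurable_logNL lam _).comp_aemeasurable
      (Lp.aestronglyMeasurable u).aemeasurable).aestronglyMeasurable

/-- With `m = ‖u‖²`, the pointwise bound `√m + |u|² / √m` integrates to `2 ‖u‖`. The normalized
nonlinearity thus tends to zero in `L¹` as `u → 0`, although `log ‖u‖²` diverges. -/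
theorem integral_norm_logNL_le (lam : ℝ) (u : Lp ℂ 2 μ) :
    ∫ ω, ‖logNL lam (‖u‖ ^ 2) (u ω)‖ ∂μ ≤ 2 * |lam| * ‖u‖ := by
  refine (integral_mono (integrable_logNL lam u).norm ?_
    fun ω => norm_logNL_le (sq_nonneg _) lam (u ω)).trans ?_
  · exact ((integrable_const _).add ((integrable_norm_sq u).div_const _)).const_mul _
  · rw [integral_const_mul, integral_add (integrable_const _) ((integrable_norm_sq u).div_const _),
      integral_div, integral_norm_sq, Real.sqrt_sq (norm_nonneg u)]
    simp only [integral_const, probReal_univ, smul_eq_mul, one_mul]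
    have : ‖u‖ ^ 2 / ‖u‖ = ‖u‖ := by
      rcases eq_or_ne ‖u‖ 0 with h | h
      · simp [h]
      · field_simp
    rw [this]
    linarith

theorem norm_pairNL_le {M : ℝ} (hM : 0 ≤ M) (lam : ℝ) (u : Lp ℂ 2 μ) {v : Lp ℂ 2 μ}
    (hv : ∀ᵐ ω ∂μ, ‖v ω‖ ≤ M) : ‖pairNL lam u v‖ ≤ M * (2 * |lam| * ‖u‖) := by
  refine (norm_integral_le_of_norm_le ((integrable_logNL lam u).norm.const_mul M) ?_).trans ?_
  · filter_upwards [hv] with ω hω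
    rw [norm_mul, RCLike.norm_conj]
    gcongr
  · rw [integral_const_mul]
    exact mul_le_mul_of_nonneg_left (integral_norm_logNL_le lam u) hM

theorem pairNL_zero (lam : ℝ) (v : Lp ℂ 2 μ) : pairNL lam (0 : Lp ℂ 2 μ) v = 0 := by
  rw [pairNL]
  simp [logNL]

theorem growth_clamp_logMap {M : ℝ} (hM : 0 < M) (z w : ℂ) :
    ‖starRingEnd ℂ (clamp M w) * logMap z‖ ≤ M * (1 + (‖z‖ ^ 2 + ‖w‖ ^ 2)) := by
  rw [norm_mul, RCLike.norm_conj]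
  have h1 := norm_clamp_le hM w
  have h2 := norm_logMap_le z
  calc ‖clamp M w‖ * ‖logMap z‖ ≤ M * (1 + ‖z‖ ^ 2) := by gcongr
    _ ≤ _ := by gcongr; nlinarith [sq_nonneg ‖w‖]

theorem continuous_clamp_logMap {M : ℝ} (hM : 0 < M) :
    Continuous fun p : ℂ × ℂ => starRingEnd ℂ (clamp M p.2) * logMap p.1 :=
  (Complex.continuous_conj.comp ((continuous_clamp hM).comp continuous_snd)).mul
    (continuous_logMap.comp continuous_fst)

theorem integrable_conj_mul_logMap {M : ℝ} (hM : 0 < M) (u : Lp ℂ 2 μ) {v : Lp ℂ 2 μ}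
    (hv : ∀ᵐ ω ∂μ, ‖v ω‖ ≤ M) : Integrable (fun ω => starRingEnd ℂ (v ω) * logMap (u ω)) μ := by
  refine (integrable_int2 (F := fun z w => starRingEnd ℂ (clamp M w) * logMap z)
    (continuous_clamp_logMap hM) (growth_clamp_logMap hM) u v).congr ?_
  filter_upwards [hv] with ω hω
  rw [clamp_eq hM hω]

theorem pairNL_eq (lam : ℝ) {u v : Lp ℂ 2 μ} (hu : u ≠ 0)
    (hi : Integrable (fun ω => starRingEnd ℂ (v ω) * logMap (u ω)) μ) :
    pairNL lam u v = lam * (∫ ω, starRingEnd ℂ (v ω) * logMap (u ω) ∂μ) -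
      (lam * Real.log (‖u‖ ^ 2) : ℝ) * inner ℂ v u := by
  rw [inner_Lp, ← integral_const_mul, ← integral_const_mul, ← integral_sub (hi.const_mul _)
    ((integrable_conj_mul v u).const_mul _), pairNL]
  refine integral_congr_ae (ae_of_all _ fun ω => ?_)
  simp only
  rw [logNL_eq (by positivity), Complex.real_smul, Complex.real_smul]
  push_cast
  ring

/-- At `u₀ = 0` the `L¹` bound of the nonlinearity is enough. Elsewhere `log ‖u‖²` is continuous and
splits off. The map `clamp M` changes nothing on functions bounded by `M`, but turns the integrand
into one of quadratic growth on `ℂ × ℂ`, to which the theorems on superposition operators apply. -/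
theorem tendsto_pairNL {A : Type*} {l : Filter A} {lam M : ℝ} (hM : 0 < M) {u v : A → Lp ℂ 2 μ}
    {u₀ v₀ : Lp ℂ 2 μ} (hu : Tendsto u l (𝓝 u₀)) (hv : Tendsto v l (𝓝 v₀))
    (hvM : ∀ᶠ a in l, ∀ᵐ ω ∂μ, ‖v a ω‖ ≤ M) (hv₀ : ∀ᵐ ω ∂μ, ‖v₀ ω‖ ≤ M) :
    Tendsto (fun a => pairNL lam (u a) (v a)) l (𝓝 (pairNL lam u₀ v₀)) := by
  by_cases h0 : u₀ = 0
  · subst h0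
    rw [pairNL_zero]
    have h1 : Tendsto (fun a => M * (2 * |lam| * ‖u a‖)) l (𝓝 (M * (2 * |lam| * ‖(0 : Lp ℂ 2 μ)‖))) :=
      ((hu.norm).const_mul _).const_mul _
    rw [norm_zero, mul_zero, mul_zero] at h1
    refine squeeze_zero_norm' ?_ h1
    filter_upwards [hvM] with a ha
    exact norm_pairNL_le hM.le lam _ ha
  · have hne : ∀ᶠ a in l, u a ≠ 0 := hu.eventually_ne h0
    rw [pairNL_eq lam h0 (integrable_conj_mul_logMap hM _ hv₀)]
    have h1 : Tendsto (fun a => (lam : ℂ) * (∫ ω, starRingEnd ℂ (clamp M (v a ω)) * logMap (u a ω) ∂μ) -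
        (lam * Real.log (‖u a‖ ^ 2) : ℝ) * inner ℂ (v a) (u a)) l
        (𝓝 (lam * (∫ ω, starRingEnd ℂ (clamp M (v₀ ω)) * logMap (u₀ ω) ∂μ) -
          (lam * Real.log (‖u₀‖ ^ 2) : ℝ) * inner ℂ v₀ u₀)) := by
      have hc := continuous_int2 (μ := μ) (F := fun z w => starRingEnd ℂ (clamp M w) * logMap z)
        (continuous_clamp_logMap hM) (growth_clamp_logMap hM)
      have h2 := (hc.tendsto (u₀, v₀)).comp (hu.prodMk_nhds hv)
      have h3 : Tendsto (fun a => lam * Real.log (‖u a‖ ^ 2)) l (𝓝 (lam * Real.log (‖u₀‖ ^ 2))) :=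
        ((hu.norm.pow 2).log (by simpa using h0)).const_mul _
      exact (h2.const_mul _).sub (((Complex.continuous_ofReal.tendsto _).comp h3).mul (hv.inner hu))
    have e0 : ∫ ω, starRingEnd ℂ (clamp M (v₀ ω)) * logMap (u₀ ω) ∂μ =
        ∫ ω, starRingEnd ℂ (v₀ ω) * logMap (u₀ ω) ∂μ := by
      refine integral_congr_ae ?_
      filter_upwards [hv₀] with ω hω
      rw [clamp_eq hM hω]
    rw [e0] at h1
    refine h1.congr' ?_
    filter_upwards [hne, hvM] with a ha hva
    rw [pairNL_eq lam ha (integrable_conj_mul_logMap hM _ hva)]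
    congr 2
    refine integral_congr_ae ?_
    filter_upwards [hva] with ω hω
    rw [clamp_eq hM hω]

variable {V : ClosedSubmodule ℂ (Jet (Lp ℂ 2 μ) ι)}

/-- The weak equation between the times `s` and `t`, tested against `x`. -/
def TestedBy (lam : ℝ) (φ : ℝ → Lp ℂ 2 μ) (Φ : ℝ → Jet (Lp ℂ 2 μ) ι)
    (x : Jet (Lp ℂ 2 μ) ι) (s t : ℝ) : Prop :=
  IntervalIntegrable (fun r => form x (Φ r) + pairNL lam (φ r) (x none)) volume s t ∧
    inner ℂ (x none) (φ t - φ s) =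
      -Complex.I * ∫ r in s..t, (form x (Φ r) + pairNL lam (φ r) (x none))

/-- Weak solutions of the logarithmic Schrödinger equation in the Sobolev space `V`: `Φ t` is the
jet of `φ t`, and the equation is tested against bounded elements of `V`. -/
structure IsSol (V : ClosedSubmodule ℂ (Jet (Lp ℂ 2 μ) ι)) (lam : ℝ) (φ : ℝ → Lp ℂ 2 μ)
    (Φ : ℝ → Jet (Lp ℂ 2 μ) ι) : Prop where
  mem : ∀ t, 0 ≤ t → Φ t ∈ V
  none_eq : ∀ t, 0 ≤ t → Φ t none = φ t
  bounded : ∀ T, 0 ≤ T → ∃ C, ∀ t, 0 ≤ t → t ≤ T → ‖Φ t‖ ≤ C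
  cont : ContinuousOn φ (Set.Ici 0)
  eqn : ∀ x ∈ V, ∀ M, (∀ᵐ ω ∂μ, ‖x none ω‖ ≤ M) → ∀ s t, 0 ≤ s → 0 ≤ t → TestedBy lam φ Φ x s t

variable {lam : ℝ} {φ : ℝ → Lp ℂ 2 μ} {Φ : ℝ → Jet (Lp ℂ 2 μ) ι}

/-- The derivatives are moved away from the solution. The right side is continuous in `r`, whereas
no continuity in time is assumed of `Φ`. -/
theorem IsSol.form_res (hs : IsSol V lam φ Φ) {δ : ℝ} (hδ : 0 < δ) (η : Lp ℂ 2 μ) {r : ℝ}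
    (hr : 0 ≤ r) : form (res V δ η) (Φ r) = (δ⁻¹ : ℝ) * inner ℂ (η - res V δ η none) (φ r) := by
  have h := congrArg (starRingEnd ℂ) (res_inner hδ η (hs.mem r hr))
  rw [inner_conj_symm, map_mul, Complex.conj_ofReal, form_conj, hs.none_eq r hr] at h
  rw [h]
  have : (δ : ℂ) ≠ 0 := by exact_mod_cast hδ.ne'
  push_cast
  field_simp

/-- The integrand may depend on the end point `t'` of the interval, because the weak equation will
be tested with functions that depend on `t'`. A joint limit in `(r, t')` takes the place of
continuity; the derivative is `Re (-i g₀) = Im g₀`. -/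
theorem hasDerivWithinAt_of_average {y : ℝ → ℝ} {t : ℝ} (ht : 0 ≤ t) (g : ℝ → ℝ → ℂ) (g₀ : ℂ)
    (hg : Tendsto (fun p : ℝ × ℝ => g p.1 p.2) (𝓝[Set.Ici 0] t ×ˢ 𝓝[Set.Ici 0] t) (𝓝 g₀))
    (hi : ∀ t', 0 ≤ t' → IntervalIntegrable (fun r => g r t') volume t t')
    (hy : ∀ t', 0 ≤ t' → y t' - y t = (-Complex.I * ∫ r in t..t', g r t').re) :
    HasDerivWithinAt y g₀.im (Set.Ici 0) t := by
  rw [hasDerivWithinAt_iff_isLittleO, Asymptotics.isLittleO_iff]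
  intro c hc
  have h1 := Metric.tendsto_nhds.1 hg c hc
  rw [Filter.eventually_prod_iff] at h1
  obtain ⟨pa, hpa, pb, hpb, hab⟩ := h1
  obtain ⟨e, he, hpa'⟩ := Metric.mem_nhdsWithin_iff.1 hpa
  have hball : ∀ᶠ t' in 𝓝[Set.Ici 0] t, t' ∈ Metric.ball t e :=
    mem_nhdsWithin_of_mem_nhds (Metric.ball_mem_nhds t he)
  filter_upwards [hpb, hball, self_mem_nhdsWithin] with t' h1 h2 h3
  rw [hy t' h3]
  have h4 : ‖∫ r in t..t', (g r t' - g₀)‖ ≤ c * |t' - t| := by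
    refine intervalIntegral.norm_integral_le_of_norm_le_const fun r hr => ?_
    have hr' : r ∈ Set.uIcc t t' := Set.uIoc_subset_uIcc hr
    have hr0 : 0 ≤ r := by
      have := (Set.mem_uIcc.1 hr')
      rcases this with h | h
      · exact ht.trans h.1
      · exact (Set.mem_Ici.1 h3).trans h.1
    have hrb : r ∈ Metric.ball t e := by
      rw [Metric.mem_ball, Real.dist_eq] at h2 ⊢
      refine lt_of_le_of_lt ?_ h2
      exact Set.abs_sub_left_of_mem_uIcc hr'
    have := hab (hpa' ⟨hrb, hr0⟩) h1
    rw [dist_eq_norm] at this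
    exact this.le
  rw [intervalIntegral.integral_sub (hi t' h3) (by simp), intervalIntegral.integral_const] at h4
  rw [smul_eq_mul, Real.norm_eq_abs, Real.norm_eq_abs]
  have h5 : (-Complex.I * ∫ r in t..t', g r t').re - (t' - t) * g₀.im =
      ((∫ r in t..t', g r t') - (t' - t) • g₀).im := by
    simp
  rw [h5]
  exact (Complex.abs_im_le_norm _).trans h4

/-- Differentiation of functionals of the regularized solution. -/
theorem IsSol.hasDerivWithinAt_res (hs : IsSol V lam φ Φ) {δ : ℝ} (hδ : 0 < δ) {t : ℝ} (ht : 0 ≤ t)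
    (η : ℝ → Lp ℂ 2 μ) (η₀ : Lp ℂ 2 μ) (hη : Tendsto η (𝓝[Set.Ici 0] t) (𝓝 η₀))
    (hp : Tendsto (fun p : ℝ × ℝ => pairNL lam (φ p.1) (res V δ (η p.2) none))
      (𝓝[Set.Ici 0] t ×ˢ 𝓝[Set.Ici 0] t) (𝓝 (pairNL lam (φ t) (res V δ η₀ none))))
    (he : ∀ t', 0 ≤ t' → TestedBy lam φ Φ (res V δ (η t')) t t')
    {y : ℝ → ℝ} (hy : ∀ t', 0 ≤ t' → y t' - y t =
      (inner ℂ (res V δ (η t') none) (φ t' - φ t)).re) :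
    HasDerivWithinAt y ((δ⁻¹ : ℝ) * inner ℂ (η₀ - res V δ η₀ none) (φ t) +
      pairNL lam (φ t) (res V δ η₀ none)).im (Set.Ici 0) t := by
  refine hasDerivWithinAt_of_average ht
    (fun r t' => form (res V δ (η t')) (Φ r) + pairNL lam (φ r) (res V δ (η t') none)) _ ?_
    (fun t' h => (he t' h).1) (fun t' h => by rw [hy t' h, (he t' h).2])
  refine Tendsto.add ?_ hp
  have hφ : Tendsto φ (𝓝[Set.Ici 0] t) (𝓝 (φ t)) := hs.cont t ht
  have h1 : Tendsto (fun p : ℝ × ℝ => ((δ⁻¹ : ℝ) : ℂ) *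
      inner ℂ (η p.2 - res V δ (η p.2) none) (φ p.1)) (𝓝[Set.Ici 0] t ×ˢ 𝓝[Set.Ici 0] t)
      (𝓝 ((δ⁻¹ : ℝ) * inner ℂ (η₀ - res V δ η₀ none) (φ t))) := by
    have h2 := hη.comp (tendsto_snd (f := 𝓝[Set.Ici (0 : ℝ)] t) (g := 𝓝[Set.Ici (0 : ℝ)] t))
    have h3 := hφ.comp (tendsto_fst (f := 𝓝[Set.Ici (0 : ℝ)] t) (g := 𝓝[Set.Ici (0 : ℝ)] t))
    have h4 := ((continuous_res_none (V := V) δ).tendsto η₀).comp h2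
    exact ((h2.sub h4).inner h3).const_mul _
  refine h1.congr' ?_
  have : ∀ᶠ p : ℝ × ℝ in 𝓝[Set.Ici 0] t ×ˢ 𝓝[Set.Ici 0] t, 0 ≤ p.1 :=
    tendsto_fst.eventually self_mem_nhdsWithin
  filter_upwards [this] with p hp
  rw [hs.form_res hδ _ hp]

end Solutions

/-! ### Divided differences of `z ↦ b(|z|²)`. -/

section DividedDifference

/-- The mean of `h` over the segment from `s` to `s'`: the divided difference of a primitive. -/
def segMean (h : ℝ → ℝ) (s s' : ℝ) : ℝ := ∫ θ in (0 : ℝ)..1, h (max (s + θ * (s' - s)) 0)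

/-- The divided difference of `z ↦ b(|z|²)`, where `h` is the derivative of `b`. -/
def gradMean (h : ℝ → ℝ) (z w : ℂ) : ℂ := segMean h (‖z‖ ^ 2) (‖w‖ ^ 2) • (z + w)

variable {b h h' : ℝ → ℝ} {C M : ℝ}

/-- The function `h` is controlled on `[0, ∞)` only. On segments between nonnegative numbers the
maximum is inactive; it serves to have continuity on the whole line. -/
theorem continuous_max_zero (hh : ContinuousOn h (Set.Ici 0)) : Continuous fun s => h (max s 0) :=
  hh.comp_continuous (by fun_prop) fun s => Set.mem_Ici.2 (le_max_right _ _)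

theorem continuous_segMean (hh : ContinuousOn h (Set.Ici 0)) :
    Continuous fun p : ℝ × ℝ => segMean h p.1 p.2 := by
  unfold segMean
  refine intervalIntegral.continuous_parametric_intervalIntegral_of_continuous' ?_ 0 1
  exact (continuous_max_zero hh).comp
    (by fun_prop : Continuous fun q : (ℝ × ℝ) × ℝ => q.1.1 + q.2 * (q.1.2 - q.1.1))

theorem segMean_self (h : ℝ → ℝ) {s : ℝ} (hs : 0 ≤ s) : segMean h s s = h s := by
  simp [segMean, max_eq_left hs]

theorem segMean_mul_sub (hh : ContinuousOn h (Set.Ici 0))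
    (hb : ∀ s, 0 ≤ s → HasDerivAt b (h s) s) {s s' : ℝ} (hs : 0 ≤ s) (hs' : 0 ≤ s') :
    segMean h s s' * (s' - s) = b s' - b s := by
  have hc : Continuous fun θ : ℝ => h (max (s + θ * (s' - s)) 0) * (s' - s) :=
    ((continuous_max_zero hh).comp
      (by fun_prop : Continuous fun θ : ℝ => s + θ * (s' - s))).mul continuous_const
  have h1 := intervalIntegral.integral_eq_sub_of_hasDerivAt (a := 0) (b := 1)
    (f := fun θ => b (s + θ * (s' - s))) (f' := fun θ => h (max (s + θ * (s' - s)) 0) * (s' - s))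
    (fun θ hθ => ?_) (hc.intervalIntegrable _ _)
  · rw [intervalIntegral.integral_mul_const] at h1
    rw [segMean, h1]
    simp
  · rw [Set.uIcc_of_le zero_le_one] at hθ
    have h0 : 0 ≤ s + θ * (s' - s) := by nlinarith [hθ.1, hθ.2, mul_nonneg hθ.1 hs', mul_nonneg (sub_nonneg.2 hθ.2) hs]
    rw [max_eq_left h0]
    have h2 : HasDerivAt (fun θ : ℝ => s + θ * (s' - s)) (s' - s) θ := by
      simpa using ((hasDerivAt_id θ).mul_const (s' - s)).const_add s
    exact HasDerivAt.comp θ (hb _ h0) h2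

theorem continuous_gradMean (hh : ContinuousOn h (Set.Ici 0)) :
    Continuous fun p : ℂ × ℂ => gradMean h p.1 p.2 := by
  unfold gradMean
  have h1 : Continuous fun p : ℂ × ℂ => p.1 + p.2 := by fun_prop
  have h2 : Continuous fun p : ℂ × ℂ => segMean h (‖p.1‖ ^ 2) (‖p.2‖ ^ 2) :=
    (continuous_segMean hh).comp
      (by fun_prop : Continuous fun p : ℂ × ℂ => (‖p.1‖ ^ 2, ‖p.2‖ ^ 2))
  exact h2.smul h1

theorem gradMean_self (h : ℝ → ℝ) (z : ℂ) : gradMean h z z = (2 : ℝ) • radial h z := by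
  rw [gradMean, segMean_self h (sq_nonneg _), radial, smul_comm, ← two_smul ℝ z]

/-- An exact chain rule for finite differences, resting on `|w|² - |z|² = Re (conj (z + w) (w -
z))`. It turns increments in time of `∫ b(|φ|²)` into tests of the weak equation, without
differentiating `φ` in time. -/
theorem re_conj_gradMean_mul (hh : ContinuousOn h (Set.Ici 0))
    (hb : ∀ s, 0 ≤ s → HasDerivAt b (h s) s) (z w : ℂ) :
    (starRingEnd ℂ (gradMean h z w) * (w - z)).re = b (‖w‖ ^ 2) - b (‖z‖ ^ 2) := by
  rw [← segMean_mul_sub hh hb (sq_nonneg _) (sq_nonneg _), gradMean, Complex.real_smul, map_mul,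
    Complex.conj_ofReal, mul_assoc, Complex.re_ofReal_mul]
  congr 1
  rw [← Complex.normSq_eq_norm_sq, ← Complex.normSq_eq_norm_sq]
  simp only [Complex.normSq_apply, Complex.mul_re, Complex.conj_re, Complex.conj_im,
    Complex.add_re, Complex.add_im, Complex.sub_re, Complex.sub_im]
  ring

/-- The function `x ↦ b(x²)` has derivative `2 x h(x²)`, of modulus at most `2 M`. Dividing its
increment by `|w| - |z|` leaves `segMean` times `|z| + |w|`. If the moduli agree, the divided
difference is `h` itself. -/
theorem norm_gradMean_le (hh : ContinuousOn h (Set.Ici 0))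
    (hb : ∀ s, 0 ≤ s → HasDerivAt b (h s) s) (hM : ∀ z, ‖radial h z‖ ≤ M) (z w : ℂ) :
    ‖gradMean h z w‖ ≤ 2 * M := by
  have hlip : |b (‖w‖ ^ 2) - b (‖z‖ ^ 2)| ≤ 2 * M * |‖w‖ - ‖z‖| := by
    have h1 : ∀ x ∈ Set.Ici (0 : ℝ), HasDerivWithinAt (fun x => b (x ^ 2)) (h (x ^ 2) * (2 * x))
        (Set.Ici 0) x := fun x hx => by
      have h3 : HasDerivAt (fun x : ℝ => x ^ 2) (2 * x) x := by simpa using hasDerivAt_pow 2 x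
      exact (HasDerivAt.comp (h := fun x : ℝ => x ^ 2) x (hb (x ^ 2) (sq_nonneg x))
        h3).hasDerivWithinAt
    have h2 := Convex.norm_image_sub_le_of_norm_hasDerivWithin_le (C := 2 * M) h1 (fun x hx => by
      have h4 := hM x
      have hx0 : 0 ≤ x := hx
      rw [radial, norm_smul, Complex.norm_real, Real.norm_eq_abs, Real.norm_of_nonneg hx0] at h4
      rw [Real.norm_eq_abs, abs_mul, abs_of_nonneg (by positivity : 0 ≤ 2 * x)]
      linarith) (convex_Ici 0) (Set.mem_Ici.2 (norm_nonneg z)) (Set.mem_Ici.2 (norm_nonneg w))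
    exact h2
  rw [gradMean, norm_smul, Real.norm_eq_abs]
  have h1 : |segMean h (‖z‖ ^ 2) (‖w‖ ^ 2)| * (‖z‖ + ‖w‖) ≤ 2 * M := by
    by_cases e : ‖z‖ = ‖w‖
    · have h4 := hM w
      rw [e, segMean_self h (sq_nonneg _)]
      rw [radial, norm_smul, Real.norm_eq_abs] at h4
      linarith
    · rw [← segMean_mul_sub hh hb (sq_nonneg _) (sq_nonneg _), abs_mul] at hlip
      have h5 : ‖w‖ ^ 2 - ‖z‖ ^ 2 = (‖z‖ + ‖w‖) * (‖w‖ - ‖z‖) := by ring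
      rw [h5, abs_mul, abs_of_nonneg (by positivity : 0 ≤ ‖z‖ + ‖w‖), ← mul_assoc] at hlip
      exact le_of_mul_le_mul_right hlip (abs_pos.2 (sub_ne_zero.2 (Ne.symm e)))
  exact (mul_le_mul_of_nonneg_left (norm_add_le z w) (abs_nonneg _)).trans h1

theorem abs_primitive_le (hb : ∀ s, 0 ≤ s → HasDerivAt b (h s) s)
    (hC : ∀ s, 0 ≤ s → |h s| ≤ C) {s : ℝ} (hs : 0 ≤ s) : |b s| ≤ |b 0| + C * s := by
  have h2 := Convex.norm_image_sub_le_of_norm_hasDerivWithin_le (C := C) (f := b) (f' := h)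
    (s := Set.Ici 0) (fun x hx => (hb x hx).hasDerivWithinAt) (fun x hx => hC x hx) (convex_Ici 0)
    (Set.mem_Ici.2 le_rfl) (Set.mem_Ici.2 hs)
  rw [sub_zero, Real.norm_eq_abs, Real.norm_of_nonneg hs] at h2
  have := abs_sub_abs_le_abs_sub (b s) (b 0)
  linarith

end DividedDifference

/-! ### The integrated local conservation law. -/

section Balance

variable {Ω : Type*} [MeasurableSpace Ω] {μ : Measure Ω} [IsProbabilityMeasure μ]
  {ι : Type*} [Fintype ι] {V : ClosedSubmodule ℂ (Jet (Lp ℂ 2 μ) ι)}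
  {lam : ℝ} {φ : ℝ → Lp ℂ 2 μ} {Φ : ℝ → Jet (Lp ℂ 2 μ) ι} {b h h' : ℝ → ℝ} {C M : ℝ}

theorem growth_primitive (hr : IsRadial h h' C) (hb : ∀ s, 0 ≤ s → HasDerivAt b (h s) s) (z : ℂ) :
    ‖b (‖z‖ ^ 2)‖ ≤ (|b 0| + C) * (1 + ‖z‖ ^ 2) := by
  have h1 := abs_primitive_le hb hr.bound (sq_nonneg ‖z‖)
  have := hr.nonneg
  have := abs_nonneg (b 0)
  rw [Real.norm_eq_abs]
  nlinarith [mul_nonneg (abs_nonneg (b 0)) (sq_nonneg ‖z‖)]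

theorem continuous_primitive (hb : ∀ s, 0 ≤ s → HasDerivAt b (h s) s) :
    Continuous fun z : ℂ => b (‖z‖ ^ 2) :=
  continuous_comp_norm_sq fun s hs => (hb s hs).continuousAt.continuousWithinAt

theorem IsSol.pos_bound (hM : ∀ z, ‖radial h z‖ ≤ M) : 0 ≤ M := (norm_nonneg _).trans (hM 0)

theorem IsSol.integral_sub_eq (hr : IsRadial h h' C) (hb : ∀ s, 0 ≤ s → HasDerivAt b (h s) s)
    (hM : ∀ z, ‖radial h z‖ ≤ M) (u w : Lp ℂ 2 μ) :
    ∫ ω, b (‖w ω‖ ^ 2) ∂μ - ∫ ω, b (‖u ω‖ ^ 2) ∂μ =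
      (inner ℂ (sup2 (gradMean h) u w) (w - u)).re := by
  have hM0 := IsSol.pos_bound hM
  have hg : ∀ z w, ‖gradMean h z w‖ ≤ 2 * M * (1 + (‖z‖ + ‖w‖)) := fun z w => by
    have := norm_gradMean_le hr.continuousOn hb hM z w
    have : 0 ≤ 2 * M * (‖z‖ + ‖w‖) := by positivity
    linarith
  have h1 := integral_re (integrable_conj_mul (sup2 (gradMean h) u w) (w - u))
  simp only [RCLike.re_to_complex] at h1
  rw [inner_Lp, ← h1, ← integral_sub
    (integrable_int1 (continuous_primitive hb) (growth_primitive hr hb) w)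
    (integrable_int1 (continuous_primitive hb) (growth_primitive hr hb) u)]
  refine integral_congr_ae ?_
  filter_upwards [coeFn_sup2 (continuous_gradMean hr.continuousOn) hg u w, Lp.coeFn_sub w u]
    with ω h2 h3
  rw [h2, h3, Pi.sub_apply, re_conj_gradMean_mul hr.continuousOn hb]

theorem ae_norm_sup2_gradMean_le (hr : IsRadial h h' C)
    (hb : ∀ s, 0 ≤ s → HasDerivAt b (h s) s)
    (hM : ∀ z, ‖radial h z‖ ≤ M) (u w : Lp ℂ 2 μ) :
    ∀ᵐ ω ∂μ, ‖sup2 (gradMean h) u w ω‖ ≤ 2 * M := by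
  have hM0 := IsSol.pos_bound hM
  have hg : ∀ z w, ‖gradMean h z w‖ ≤ 2 * M * (1 + (‖z‖ + ‖w‖)) := fun z w => by
    have := norm_gradMean_le hr.continuousOn hb hM z w
    have : 0 ≤ 2 * M * (‖z‖ + ‖w‖) := by positivity
    linarith
  filter_upwards [coeFn_sup2 (continuous_gradMean hr.continuousOn) hg u w] with ω h2
  rw [h2]
  exact norm_gradMean_le hr.continuousOn hb hM _ _

theorem continuous_sup2_gradMean (hr : IsRadial h h' C)
    (hb : ∀ s, 0 ≤ s → HasDerivAt b (h s) s)
    (hM : ∀ z, ‖radial h z‖ ≤ M) :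
    Continuous fun p : Lp ℂ 2 μ × Lp ℂ 2 μ => sup2 (gradMean h) p.1 p.2 := by
  have hM0 := IsSol.pos_bound hM
  have hg : ∀ z w, ‖gradMean h z w‖ ≤ 2 * M * (1 + (‖z‖ + ‖w‖)) := fun z w => by
    have := norm_gradMean_le hr.continuousOn hb hM z w
    have : 0 ≤ 2 * M * (‖z‖ + ‖w‖) := by positivity
    linarith
  exact continuous_sup2 (continuous_gradMean hr.continuousOn) hg

theorem sup2_gradMean_self (hr : IsRadial h h' C)
    (hb : ∀ s, 0 ≤ s → HasDerivAt b (h s) s)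
    (hM : ∀ z, ‖radial h z‖ ≤ M) (u : Lp ℂ 2 μ) :
    sup2 (gradMean h) u u = (2 : ℂ) • sup1 (radial h) u := by
  have hM0 := IsSol.pos_bound hM
  have hg : ∀ z w, ‖gradMean h z w‖ ≤ 2 * M * (1 + (‖z‖ + ‖w‖)) := fun z w => by
    have := norm_gradMean_le hr.continuousOn hb hM z w
    have : 0 ≤ 2 * M * (‖z‖ + ‖w‖) := by positivity
    linarith
  refine Lp.ext ?_
  filter_upwards [coeFn_sup2 (continuous_gradMean hr.continuousOn) hg u u,
    coeFn_sup1 hr.continuous_radial hr.growth_radial u,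
    Lp.coeFn_smul (2 : ℂ) (sup1 (radial h) u)] with ω h1 h2 h3
  rw [h1, h3, Pi.smul_apply, h2, gradMean_self, Complex.real_smul, smul_eq_mul]
  norm_num

/-- Write `J` for the resolvent and `G` for the divided difference of `b` between `J φ(t)` and `J
φ(t')`. Since `J` is symmetric, the increment of the functional is the weak equation tested with `J
G`. This is admissible: `G` is bounded by `norm_gradMean_le`, and so is `J G` by the maximum
principle. As `t' → t`, `G` tends to `2 h(|J φ|²) J φ`. -/
theorem IsSol.hasDerivWithinAt_integral (hs : IsSol V lam φ Φ) (hV : IsSobolev V)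
    (hr : IsRadial h h' C) (hb : ∀ s, 0 ≤ s → HasDerivAt b (h s) s)
    (hM0 : 0 < M) (hM : ∀ z, ‖radial h z‖ ≤ M) {δ : ℝ} (hδ : 0 < δ) {t : ℝ} (ht : 0 ≤ t) :
    HasDerivWithinAt (fun t => ∫ ω, b (‖res V δ (φ t) none ω‖ ^ 2) ∂μ)
      (4 * totalCurrent h' (res V δ (φ t)) +
        2 * (pairNL lam (φ t) (res V δ (sup1 (radial h) (res V δ (φ t) none)) none)).im)
      (Set.Ici 0) t := by
  set J : Lp ℂ 2 μ → Lp ℂ 2 μ := fun u => res V δ u none with hJ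
  have hJc : Continuous J := continuous_res_none δ
  have hφ : Tendsto φ (𝓝[Set.Ici 0] t) (𝓝 (φ t)) := hs.cont t ht
  set η : ℝ → Lp ℂ 2 μ := fun t' => sup2 (gradMean h) (J (φ t)) (J (φ t')) with hη
  have hηt : Tendsto η (𝓝[Set.Ici 0] t) (𝓝 ((2 : ℂ) • sup1 (radial h) (J (φ t)))) := by
    have h1 := (continuous_sup2_gradMean (μ := μ) hr hb hM).tendsto (J (φ t), J (φ t))
    have h2 : Tendsto (fun t' => (J (φ t), J (φ t'))) (𝓝[Set.Ici 0] t)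
        (𝓝 (J (φ t), J (φ t))) :=
      (tendsto_const_nhds (x := J (φ t))).prodMk_nhds ((hJc.tendsto (φ t)).comp hφ)
    have h3 := h1.comp h2
    rw [sup2_gradMean_self hr hb hM] at h3
    exact h3
  have hbd : ∀ u w : Lp ℂ 2 μ, ∀ᵐ ω ∂μ, ‖res V δ (sup2 (gradMean h) u w) none ω‖ ≤ 2 * M :=
    fun u w => hV.norm_res_le_of_bound (by positivity) hδ (ae_norm_sup2_gradMean_le hr hb hM u w)
  have hbd0 : ∀ᵐ ω ∂μ, ‖res V δ ((2 : ℂ) • sup1 (radial h) (J (φ t))) none ω‖ ≤ 2 * M := by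
    rw [← sup2_gradMean_self hr hb hM]
    exact hbd _ _
  have hmain := hs.hasDerivWithinAt_res hδ ht η _ hηt ?_
    (fun t' ht' => hs.eqn _ (res_mem V δ _) (2 * M) (hbd _ _) t t' ht ht')
    (y := fun t => ∫ ω, b (‖J (φ t) ω‖ ^ 2) ∂μ) ?_
  · convert hmain using 1
    rw [Complex.add_im]
    congr 1
    -- With `η₀` the limit of the divided differences, `δ⁻¹ ⟨η₀ - J η₀, φ⟩ = δ⁻¹ ⟨η₀, φ - J φ⟩`,
    -- which by the Euler equation is the form of the jet of `η₀` and `J φ`. Its imaginary part is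
    -- the current.
    · have h1 := res_inner hδ (φ t) (hV.chain hr _ (res_mem V δ (φ t)))
      have h2 : (radialJet h h' (res V δ (φ t)) : Jet (Lp ℂ 2 μ) ι) none =
        sup1 (radial h) (J (φ t)) := rfl
      rw [h2] at h1
      rw [inner_sub_left, res_selfadjoint hδ, ← inner_sub_right, inner_smul_left, h1]
      have h3 := hr.im_form_radialJet (res V δ (φ t))
      have h4 : ((δ⁻¹ : ℝ) : ℂ) * (starRingEnd ℂ 2 *
          (δ * form (radialJet h h' (res V δ (φ t))) (res V δ (φ t)))) =
          ((2 : ℝ) : ℂ) * form (radialJet h h' (res V δ (φ t))) (res V δ (φ t)) := by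
        have : (δ : ℂ) ≠ 0 := by exact_mod_cast hδ.ne'
        rw [Complex.conj_ofNat]
        push_cast
        field_simp
      rw [h4, Complex.im_ofReal_mul, h3]
      ring
    · rw [map_smul, PiLp.smul_apply]
      have h5 : ∀ v : Lp ℂ 2 μ, pairNL lam (φ t) ((2 : ℂ) • v) = ((2 : ℝ) : ℂ) * pairNL lam (φ t) v := by
        intro v
        rw [pairNL, pairNL, ← integral_const_mul]
        refine integral_congr_ae ?_
        filter_upwards [Lp.coeFn_smul (2 : ℂ) v] with ω hω
        rw [hω, Pi.smul_apply, smul_eq_mul, map_mul, Complex.conj_ofNat]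
        push_cast
        ring
      rw [h5, Complex.im_ofReal_mul]
  · refine tendsto_pairNL (M := 2 * M) (by positivity) (hφ.comp tendsto_fst) ?_ ?_ hbd0
    · exact (hJc.tendsto _).comp (hηt.comp tendsto_snd)
    · exact Eventually.of_forall fun p => hbd _ _
  · intro t' _
    rw [IsSol.integral_sub_eq hr hb hM, ← PiLp.sub_apply, ← map_sub, ← res_selfadjoint hδ]

theorem integral_eq_sub_of_hasDerivWithinAt_Ici {f f' : ℝ → ℝ} {T : ℝ} (hT : 0 ≤ T)
    (hf : ∀ t, 0 ≤ t → HasDerivWithinAt f (f' t) (Set.Ici 0) t)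
    (hc : ContinuousOn f' (Set.Ici 0)) : ∫ t in (0 : ℝ)..T, f' t = f T - f 0 := by
  refine intervalIntegral.integral_eq_sub_of_hasDeriv_right_of_le hT ?_ ?_ ?_
  · exact fun t ht => ((hf t ht.1).continuousWithinAt).mono Set.Icc_subset_Ici_self
  · intro t ht
    exact (hf t ht.1.le).mono (Set.Ioi_subset_Ici ht.1.le)
  · exact (hc.mono (by rw [Set.uIcc_of_le hT]; exact Set.Icc_subset_Ici_self)).intervalIntegrable

/-- Strong convergence at the limit `u₀`, combined with the contraction property for `u δ - u₀`. -/
theorem tendsto_res_none_of_tendsto (hV : IsSobolev V) {u : ℝ → Lp ℂ 2 μ} {u₀ : Lp ℂ 2 μ}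
    (hu : Tendsto u (𝓝[>] 0) (𝓝 u₀)) :
    Tendsto (fun δ => res V δ (u δ) none) (𝓝[>] 0) (𝓝 u₀) := by
  have h1 := tendsto_res_none hV.unique hV.dense u₀
  have h2 : Tendsto (fun δ => res V δ (u δ - u₀) none) (𝓝[>] 0) (𝓝 0) := by
    refine squeeze_zero_norm' (a := fun δ => ‖u δ - u₀‖) ?_ ?_
    · filter_upwards [self_mem_nhdsWithin] with δ hδ
      exact norm_res_none_le hδ _
    · simpa using (hu.sub_const u₀).norm
  have h3 := h2.add h1
  rw [zero_add] at h3
  refine h3.congr fun δ => ?_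
  rw [map_sub, PiLp.sub_apply, sub_add_cancel]

/-- The integrand is real, the nonlinearity being a real multiple of `u`. For this reason the
nonlinear term disappears from the conservation law when the regularization is removed. -/
theorem pairNL_radial_im (hr : IsRadial h h' C) (lam : ℝ) (u : Lp ℂ 2 μ) :
    (pairNL lam u (sup1 (radial h) u)).im = 0 := by
  have e : pairNL lam u (sup1 (radial h) u) =
      ((∫ ω, h (‖u ω‖ ^ 2) * (lam * Real.log (‖u ω‖ ^ 2 / ‖u‖ ^ 2)) * ‖u ω‖ ^ 2 ∂μ : ℝ) : ℂ) := by
    rw [pairNL, ← integral_complex_ofReal]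
    refine integral_congr_ae ?_
    filter_upwards [coeFn_sup1 hr.continuous_radial hr.growth_radial u] with ω hω
    rw [hω, radial, logNL, Complex.real_smul, Complex.real_smul, map_mul, Complex.conj_ofReal]
    have h1 : starRingEnd ℂ (u ω) * u ω = ((‖u ω‖ ^ 2 : ℝ) : ℂ) := by
      rw [← Complex.normSq_eq_conj_mul_self, Complex.normSq_eq_norm_sq]
    calc _ = (h (‖u ω‖ ^ 2) : ℂ) * ((lam * Real.log (‖u ω‖ ^ 2 / ‖u‖ ^ 2) : ℝ) : ℂ) *
          (starRingEnd ℂ (u ω) * u ω) := by ring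
      _ = _ := by rw [h1]; push_cast; ring
  rw [e, Complex.ofReal_im]

/-- The local conservation law, integrated: `d/dt ∫ b(|φ|²) = 4 ∑_j ∫ b''(|φ|²) Re Im (φ̄ ∂_j φ)`. -/
theorem IsSol.integral_balance (hs : IsSol V lam φ Φ) (hV : IsSobolev V)
    (hr : IsRadial h h' C) (hb : ∀ s, 0 ≤ s → HasDerivAt b (h s) s)
    (hM0 : 0 < M) (hM : ∀ z, ‖radial h z‖ ≤ M) {T : ℝ} (hT : 0 ≤ T) :
    ∫ ω, b (‖φ T ω‖ ^ 2) ∂μ - ∫ ω, b (‖φ 0 ω‖ ^ 2) ∂μ =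
      4 * ∫ t in (0 : ℝ)..T, totalCurrent h' (Φ t) := by
  set f' : ℝ → ℝ → ℝ := fun δ t => 4 * totalCurrent h' (res V δ (φ t)) +
        2 * (pairNL lam (φ t) (res V δ (sup1 (radial h) (res V δ (φ t) none)) none)).im with hf'
  have hsupM : ∀ u : Lp ℂ 2 μ, ∀ᵐ ω ∂μ, ‖sup1 (radial h) u ω‖ ≤ M := fun u => by
    filter_upwards [coeFn_sup1 hr.continuous_radial hr.growth_radial u] with ω hω
    rw [hω]; exact hM _
  have hbd : ∀ δ, 0 < δ → ∀ u : Lp ℂ 2 μ, ∀ᵐ ω ∂μ, ‖res V δ (sup1 (radial h) u) none ω‖ ≤ M :=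
    fun δ hδ u => hV.norm_res_le_of_bound hM0 hδ (hsupM u)
  have hsc : Continuous (sup1 (radial h) : Lp ℂ 2 μ → Lp ℂ 2 μ) :=
    continuous_sup1 hr.continuous_radial hr.growth_radial
  have hcont : ∀ δ, 0 < δ → ContinuousOn (f' δ) (Set.Ici 0) := by
    intro δ hδ t ht
    have hφ : Tendsto φ (𝓝[Set.Ici 0] t) (𝓝 (φ t)) := hs.cont t ht
    have h1 := ((continuous_totalCurrent hr.cont hr.bound_deriv).tendsto _).comp
      (((continuous_res (V := V) δ).tendsto _).comp hφ)
    have h2 := ((continuous_res_none (V := V) δ).tendsto _).comp ((hsc.tendsto _).comp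
      (((continuous_res_none (V := V) δ).tendsto _).comp hφ))
    have h3 := tendsto_pairNL (lam := lam) hM0 hφ h2
      (Eventually.of_forall fun t' => hbd δ hδ _) (hbd δ hδ _)
    exact (h1.const_mul 4).add (((Complex.continuous_im.tendsto _).comp h3).const_mul 2)
  have heq : ∀ δ, 0 < δ → ∫ t in (0 : ℝ)..T, f' δ t =
      ∫ ω, b (‖res V δ (φ T) none ω‖ ^ 2) ∂μ - ∫ ω, b (‖res V δ (φ 0) none ω‖ ^ 2) ∂μ :=
    fun δ hδ => integral_eq_sub_of_hasDerivWithinAt_Ici hT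
      (fun t ht => hs.hasDerivWithinAt_integral hV hr hb hM0 hM hδ ht) (hcont δ hδ)
  have hlhs : Tendsto (fun δ => ∫ ω, b (‖res V δ (φ T) none ω‖ ^ 2) ∂μ -
      ∫ ω, b (‖res V δ (φ 0) none ω‖ ^ 2) ∂μ) (𝓝[>] 0)
      (𝓝 (∫ ω, b (‖φ T ω‖ ^ 2) ∂μ - ∫ ω, b (‖φ 0 ω‖ ^ 2) ∂μ)) := by
    have hc := continuous_int1 (μ := μ) (continuous_primitive hb) (growth_primitive hr hb)
    exact ((hc.tendsto _).comp (tendsto_res_none hV.unique hV.dense _)).sub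
      ((hc.tendsto _).comp (tendsto_res_none hV.unique hV.dense _))
  obtain ⟨K, hK⟩ := hs.bounded T hT
  have hC0 := hr.nonneg
  -- The bounds are uniform in `δ`: resolvents contract the Dirichlet energy, and by the maximum
  -- principle they preserve the bound `M` of the function that the nonlinearity is paired with.
  have hrhs : Tendsto (fun δ => ∫ t in (0 : ℝ)..T, f' δ t) (𝓝[>] 0)
      (𝓝 (∫ t in (0 : ℝ)..T, 4 * totalCurrent h' (Φ t))) := by
    refine intervalIntegral.tendsto_integral_filter_of_dominated_convergence
      (fun _ => 4 * (C * K ^ 2) + 2 * (M * (2 * |lam| * K))) ?_ ?_ (by simp) ?_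
    · filter_upwards [self_mem_nhdsWithin] with δ hδ
      rw [Set.uIoc_of_le hT]
      exact ((hcont δ hδ).mono (fun t ht => ht.1.le)).aestronglyMeasurable measurableSet_Ioc
    · filter_upwards [self_mem_nhdsWithin] with δ hδ
      refine ae_of_all _ fun t ht => ?_
      rw [Set.uIoc_of_le hT] at ht
      have h0 := hs.none_eq t ht.1.le
      have hKt := hK t ht.1.le ht.2
      have h1 : |totalCurrent h' (res V δ (φ t))| ≤ C * K ^ 2 := by
        refine (abs_totalCurrent_le hr.bound_deriv _).trans ?_
        rw [← h0]
        refine mul_le_mul_of_nonneg_left ?_ hC0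
        refine (gsq_res_le hδ (hs.mem t ht.1.le)).trans ((gsq_le _).trans ?_)
        exact pow_le_pow_left₀ (norm_nonneg _) hKt 2
      have h2 := norm_pairNL_le hM0.le lam (φ t) (hbd δ hδ (res V δ (φ t) none))
      have h3 : ‖φ t‖ ≤ K := by rw [← h0]; exact (norm_none_le _).trans hKt
      have h4 : M * (2 * |lam| * ‖φ t‖) ≤ M * (2 * |lam| * K) := by gcongr
      have h5 := Complex.abs_im_le_norm
        (pairNL lam (φ t) (res V δ (sup1 (radial h) (res V δ (φ t) none)) none))
      rw [hf', Real.norm_eq_abs]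
      refine (abs_add_le _ _).trans ?_
      rw [abs_mul, abs_mul, abs_two, abs_of_pos (by norm_num : (0 : ℝ) < 4)]
      linarith
    · refine ae_of_all _ fun t ht => ?_
      rw [Set.uIoc_of_le hT] at ht
      have h0 := hs.none_eq t ht.1.le
      have h1 : Tendsto (fun δ => res V δ (φ t)) (𝓝[>] 0) (𝓝 (Φ t)) := by
        rw [← h0]; exact tendsto_res hV.unique (hs.mem t ht.1.le)
      have h2 := ((continuous_totalCurrent hr.cont hr.bound_deriv).tendsto _).comp h1
      have h3 : Tendsto (fun δ => res V δ (sup1 (radial h) (res V δ (φ t) none)) none) (𝓝[>] 0)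
          (𝓝 (sup1 (radial h) (φ t))) :=
        tendsto_res_none_of_tendsto hV
          ((hsc.tendsto _).comp (tendsto_res_none hV.unique hV.dense _))
      have h4 := tendsto_pairNL (lam := lam) hM0 (tendsto_const_nhds (x := φ t)) h3
        (by filter_upwards [self_mem_nhdsWithin] with δ hδ using hbd δ hδ _) (hsupM _)
      have h5 := (h2.const_mul 4).add (((Complex.continuous_im.tendsto _).comp h4).const_mul 2)
      rw [pairNL_radial_im hr, mul_zero, add_zero] at h5
      exact h5
  have h6 := hlhs.congr' (by
    filter_upwards [self_mem_nhdsWithin] with δ hδ using (heq δ hδ).symm)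
  rw [tendsto_nhds_unique h6 hrhs, intervalIntegral.integral_const_mul]

end Balance

/-! ### Limits of currents and their measurability in time. -/

section Limits

variable {Ω : Type*} [MeasurableSpace Ω] {μ : Measure Ω} [IsProbabilityMeasure μ]
  {ι : Type*} [Fintype ι] {V : ClosedSubmodule ℂ (Jet (Lp ℂ 2 μ) ι)}
  {lam : ℝ} {φ : ℝ → Lp ℂ 2 μ} {Φ : ℝ → Jet (Lp ℂ 2 μ) ι} {C : ℝ}

/-- Fatou's lemma. -/
theorem integrable_of_tendsto_of_integral_le {F : ℕ → Ω → ℝ} {G : Ω → ℝ} {B : ℝ}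
    (hi : ∀ n, Integrable (F n) μ) (h0 : ∀ n ω, 0 ≤ F n ω)
    (hG : ∀ ω, Tendsto (fun n => F n ω) atTop (𝓝 (G ω))) (hB : ∀ᶠ n in atTop, ∫ ω, F n ω ∂μ ≤ B) :
    Integrable G μ ∧ ∫ ω, G ω ∂μ ≤ B := by
  have hG0 : ∀ ω, 0 ≤ G ω := fun ω => ge_of_tendsto' (hG ω) fun n => h0 n ω
  have hm : AEStronglyMeasurable G μ :=
    aestronglyMeasurable_of_tendsto_ae atTop (fun n => (hi n).aestronglyMeasurable)
      (ae_of_all _ hG)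
  obtain ⟨n₀, hn₀⟩ := hB.exists
  have hB0 : 0 ≤ B := (integral_nonneg (h0 n₀)).trans hn₀
  have h1 : ∫⁻ ω, ENNReal.ofReal (G ω) ∂μ ≤ ENNReal.ofReal B := by
    have h2 : ∀ ω, ENNReal.ofReal (G ω) = liminf (fun n => ENNReal.ofReal (F n ω)) atTop :=
      fun ω => (((ENNReal.continuous_ofReal.tendsto _).comp (hG ω)).liminf_eq).symm
    simp_rw [h2]
    refine (lintegral_liminf_le' fun n => (hi n).aemeasurable.ennreal_ofReal).trans ?_
    refine liminf_le_of_frequently_le' (hB.mono fun n hn => ?_).frequently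
    rw [← ofReal_integral_eq_lintegral_ofReal (hi n) (ae_of_all _ (h0 n))]
    exact ENNReal.ofReal_le_ofReal hn
  have hint : Integrable G μ := by
    refine ⟨hm, ?_⟩
    rw [hasFiniteIntegral_iff_ofReal (ae_of_all _ hG0)]
    exact h1.trans_lt ENNReal.ofReal_lt_top
  refine ⟨hint, ?_⟩
  rw [← ofReal_integral_eq_lintegral_ofReal hint (ae_of_all _ hG0)] at h1
  exact (ENNReal.ofReal_le_ofReal_iff hB0).1 h1

/-- At `z = 0` the current vanishes whatever the density is, so convergence of the densities is
needed for `s > 0` only. This admits the singular limit `1 / s`. -/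
theorem tendsto_current {h' : ℕ → ℝ → ℝ} {g : ℝ → ℝ}
    (hg : ∀ s, 0 < s → Tendsto (fun n => h' n s) atTop (𝓝 (g s))) (z w : ℂ) :
    Tendsto (fun n => current (h' n) z w) atTop (𝓝 (current g z w)) := by
  unfold current
  by_cases hz : z = 0
  · simp [hz]
  · exact ((hg _ (by positivity)).mul_const _).mul_const _

/-- Convergence of the currents when the densities converge. -/
theorem tendsto_totalCurrent {h' : ℕ → ℝ → ℝ} {g : ℝ → ℝ}
    (hc : ∀ n, ContinuousOn (h' n) (Set.Ici 0)) (hb : ∀ n s, 0 ≤ s → |s * h' n s| ≤ C)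
    (hg : ∀ s, 0 < s → Tendsto (fun n => h' n s) atTop (𝓝 (g s))) (x : Jet (Lp ℂ 2 μ) ι) :
    Tendsto (fun n => totalCurrent (h' n) x) atTop (𝓝 (totalCurrent g x)) := by
  unfold totalCurrent
  refine tendsto_finsetSum _ fun j _ => ?_
  refine tendsto_integral_of_dominated_convergence (fun ω => C * ‖x (some j) ω‖ ^ 2)
    (fun n => (integrable_int2 (continuous_current (hc n)) (growth_current (hb n)) _ _).1) ((integrable_norm_sq _).const_mul _) ?_ ?_
  · exact fun n => ae_of_all _ fun ω => abs_current_le (hb n) _ _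
  · exact ae_of_all _ fun ω => tendsto_current hg _ _

/-- Measurability of `t ↦ Φ t` is not part of the notion of a solution. It is recovered here from
the resolvents of `φ t`, which depend continuously on `t` and converge to `Φ t`. -/
theorem IsSol.aestronglyMeasurable_totalCurrent (hs : IsSol V lam φ Φ) (hV : IsSobolev V)
    {h' : ℝ → ℝ} (hc : ContinuousOn h' (Set.Ici 0)) (hb : ∀ s, 0 ≤ s → |s * h' s| ≤ C) :
    AEStronglyMeasurable (fun t => totalCurrent h' (Φ t)) (volume.restrict (Set.Ici 0)) := by
  refine aestronglyMeasurable_of_tendsto_ae (u := 𝓝[>] (0 : ℝ))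
    (f := fun δ t => totalCurrent h' (res V δ (φ t))) ?_ ?_
  · intro δ
    refine ContinuousOn.aestronglyMeasurable ?_ measurableSet_Ici
    exact ((continuous_totalCurrent hc hb).comp (continuous_res δ)).comp_continuousOn hs.cont
  · refine (ae_restrict_iff' measurableSet_Ici).2 (ae_of_all _ fun t ht => ?_)
    have h1 := ((continuous_totalCurrent hc hb).tendsto _).comp
      (tendsto_res hV.unique (hs.mem t ht))
    rw [hs.none_eq t ht] at h1
    exact h1

theorem IsSol.abs_totalCurrent_le (hs : IsSol V lam φ Φ) {T : ℝ} (hT : 0 ≤ T) :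
    ∃ K, 0 ≤ K ∧ ∀ t, 0 ≤ t → t ≤ T → ∀ (h' : ℝ → ℝ) (C : ℝ), (∀ s, 0 ≤ s → |s * h' s| ≤ C) →
      |totalCurrent h' (Φ t)| ≤ C * K := by
  obtain ⟨K, hK⟩ := hs.bounded T hT
  refine ⟨K ^ 2, sq_nonneg _, fun t h0 h1 h' C hb => (LatticeLSE.abs_totalCurrent_le hb _).trans ?_⟩
  have hC : 0 ≤ C := (abs_nonneg _).trans (hb 0 le_rfl)
  exact mul_le_mul_of_nonneg_left
    ((gsq_le _).trans (pow_le_pow_left₀ (norm_nonneg _) (hK t h0 h1) 2)) hC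

theorem IsSol.intervalIntegrable_totalCurrent (hs : IsSol V lam φ Φ) {h' : ℝ → ℝ} {T : ℝ}
    (hT : 0 ≤ T) (hm : AEStronglyMeasurable (fun t => totalCurrent h' (Φ t))
      (volume.restrict (Set.Ici 0))) (hb : ∀ s, 0 ≤ s → |s * h' s| ≤ C) :
    IntervalIntegrable (fun t => totalCurrent h' (Φ t)) volume 0 T := by
  obtain ⟨K, _, hK⟩ := hs.abs_totalCurrent_le hT
  have h1 : IntervalIntegrable (fun _ : ℝ => C * K) volume 0 T := intervalIntegrable_const
  refine h1.mono_fun ?_ ?_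
  · rw [Set.uIoc_of_le hT]
    exact hm.mono_measure (Measure.restrict_mono (fun t ht => ht.1.le) le_rfl)
  · rw [Set.uIoc_of_le hT]
    refine (ae_restrict_iff' measurableSet_Ioc).2 (ae_of_all _ fun t ht => ?_)
    exact (hK t ht.1.le ht.2 h' C hb).trans (le_abs_self _)

theorem IsSol.tendsto_integral_totalCurrent (hs : IsSol V lam φ Φ) (hV : IsSobolev V)
    {h' : ℕ → ℝ → ℝ} {g : ℝ → ℝ}
    (hc : ∀ n, ContinuousOn (h' n) (Set.Ici 0)) (hb : ∀ n s, 0 ≤ s → |s * h' n s| ≤ C)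
    (hg : ∀ s, 0 < s → Tendsto (fun n => h' n s) atTop (𝓝 (g s))) {T : ℝ} (hT : 0 ≤ T) :
    Tendsto (fun n => ∫ t in (0 : ℝ)..T, totalCurrent (h' n) (Φ t)) atTop
      (𝓝 (∫ t in (0 : ℝ)..T, totalCurrent g (Φ t))) := by
  obtain ⟨K, _, hK⟩ := hs.abs_totalCurrent_le hT
  refine intervalIntegral.tendsto_integral_filter_of_dominated_convergence (fun _ => C * K)
    ?_ ?_ intervalIntegrable_const ?_
  · refine Eventually.of_forall fun n => ?_
    rw [Set.uIoc_of_le hT]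
    exact (hs.aestronglyMeasurable_totalCurrent hV (hc n) (hb n)).mono_measure
      (Measure.restrict_mono (fun t ht => ht.1.le) le_rfl)
  · refine Eventually.of_forall fun n => ae_of_all _ fun t ht => ?_
    rw [Set.uIoc_of_le hT] at ht
    exact hK t ht.1.le ht.2 _ _ (hb n)
  · exact ae_of_all _ fun t _ => tendsto_totalCurrent hc hb hg _

end Limits

/-! ### Conservation of mass. -/

section Mass

variable {Ω : Type*} [MeasurableSpace Ω] {μ : Measure Ω} [IsProbabilityMeasure μ]
  {ι : Type*} [Fintype ι] {V : ClosedSubmodule ℂ (Jet (Lp ℂ 2 μ) ι)}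
  {lam : ℝ} {φ : ℝ → Lp ℂ 2 μ} {Φ : ℝ → Jet (Lp ℂ 2 μ) ι} {C : ℝ}

/-- The derivative of `s / (1 + s / n)`. -/
def massCut (n s : ℝ) : ℝ := n ^ 2 / (n + s) ^ 2

def massCutDeriv (n s : ℝ) : ℝ := -(2 * n ^ 2 / (n + s) ^ 3)

theorem isRadial_massCut {n : ℝ} (hn : 1 ≤ n) : IsRadial (massCut n) (massCutDeriv n) 2 where
  hasDeriv s hs := by
    have h0 : n + s ≠ 0 := by positivity
    have h1 := ((hasDerivAt_id s).const_add n).pow 2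
    have h2 := (hasDerivAt_const s (n ^ 2)).div h1 (by simpa using h0)
    refine h2.congr_deriv ?_
    simp only [massCutDeriv, Pi.pow_apply, id_eq]
    field_simp
    push_cast
    ring
  cont := by
    unfold massCutDeriv
    refine ContinuousOn.neg (ContinuousOn.div continuousOn_const (by fun_prop) fun s hs => ?_)
    have : 0 ≤ s := hs
    positivity
  bound s hs := by
    rw [massCut, abs_of_nonneg (by positivity), div_le_iff₀ (by positivity)]
    nlinarith [mul_nonneg (by linarith : 0 ≤ n) hs, sq_nonneg s]
  bound_deriv s hs := by
    rw [massCutDeriv, mul_neg, abs_neg, abs_of_nonneg (by positivity), ← mul_div_assoc,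
      div_le_iff₀ (by positivity)]
    have h1 : 0 ≤ n * s ^ 2 := by positivity
    have h2 : 0 ≤ n ^ 2 * s := by positivity
    have h3 : 0 ≤ n ^ 3 := by positivity
    have h4 : 0 ≤ s ^ 3 := by positivity
    nlinarith

theorem tendsto_massCutDeriv (s : ℝ) (hs : 0 < s) :
    Tendsto (fun n : ℕ => massCutDeriv (n + 1) s) atTop (𝓝 0) := by
  have h1 : ∀ n : ℕ, ‖massCutDeriv (n + 1) s‖ ≤ 2 * (1 / ((n : ℝ) + 1)) := fun n => by
    rw [massCutDeriv, norm_neg, Real.norm_of_nonneg (by positivity), mul_div_assoc]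
    refine mul_le_mul_of_nonneg_left ?_ (by norm_num)
    rw [div_le_div_iff₀ (by positivity) (by positivity), one_mul]
    have h0 : (n : ℝ) + 1 ≤ n + 1 + s := by linarith
    calc ((n : ℝ) + 1) ^ 2 * (n + 1) = ((n : ℝ) + 1) ^ 3 := by ring
      _ ≤ _ := pow_le_pow_left₀ (by positivity) h0 3
  refine squeeze_zero_norm h1 ?_
  simpa using tendsto_one_div_add_atTop_nhds_zero_nat.const_mul (2 : ℝ)

/-- Conservation of mass. -/
theorem IsSol.norm_eq (hs : IsSol V lam φ Φ) (hV : IsSobolev V) {T : ℝ} (hT : 0 ≤ T) :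
    ‖φ T‖ = ‖φ 0‖ := by
  have hb : ∀ n : ℕ, ∀ s : ℝ, 0 ≤ s → HasDerivAt (fun s : ℝ => ((n : ℝ) + 1) * s / (n + 1 + s))
      (massCut (n + 1) s) s := fun n s hs => by
    have h0 : (n : ℝ) + 1 + s ≠ 0 := by positivity
    have h2 := ((hasDerivAt_id s).const_mul ((n : ℝ) + 1)).div
      ((hasDerivAt_id s).const_add ((n : ℝ) + 1)) h0
    refine h2.congr_deriv ?_
    simp only [massCut, id_eq]
    ring
  have hM : ∀ n : ℕ, ∀ z : ℂ, ‖radial (massCut (n + 1)) z‖ ≤ n + 1 := fun n z => by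
    rw [radial, norm_smul, massCut, Real.norm_of_nonneg (by positivity), div_mul_eq_mul_div,
      div_le_iff₀ (by positivity)]
    have h1 : ‖z‖ ≤ (n : ℝ) + 1 + ‖z‖ ^ 2 := by nlinarith [sq_nonneg (‖z‖ - 1), norm_nonneg z]
    have h2 : ((n : ℝ) + 1) ≤ (n : ℝ) + 1 + ‖z‖ ^ 2 := by nlinarith [sq_nonneg (‖z‖)]
    have h3 : ((n : ℝ) + 1) * ‖z‖ ≤ (n + 1 + ‖z‖ ^ 2) * (n + 1 + ‖z‖ ^ 2) := by gcongr
    nlinarith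
  have hr := fun n : ℕ => isRadial_massCut (n := n + 1) (by linarith [n.cast_nonneg (α := ℝ)])
  have hbal := fun n : ℕ => hs.integral_balance hV (hr n) (hb n) (M := n + 1) (by positivity)
    (hM n) hT
  have hlim : ∀ u : Lp ℂ 2 μ, Tendsto (fun n : ℕ => ∫ ω, ((n : ℝ) + 1) * ‖u ω‖ ^ 2 /
      (n + 1 + ‖u ω‖ ^ 2) ∂μ) atTop (𝓝 (‖u‖ ^ 2)) := fun u => by
    rw [← integral_norm_sq]
    refine tendsto_integral_of_dominated_convergence (fun ω => ‖u ω‖ ^ 2) (fun n => ?_)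
      (integrable_norm_sq u) (fun n => ae_of_all _ fun ω => ?_) (ae_of_all _ fun ω => ?_)
    · exact (integrable_int1 (continuous_primitive (hb n)) (growth_primitive (hr n) (hb n)) u).1
    · rw [Real.norm_of_nonneg (by positivity), div_le_iff₀ (by positivity)]
      nlinarith [sq_nonneg (‖u ω‖ ^ 2)]
    · have h1 : Tendsto (fun n : ℕ => ‖u ω‖ ^ 2 / (1 + ‖u ω‖ ^ 2 * (1 / ((n : ℝ) + 1)))) atTop
          (𝓝 (‖u ω‖ ^ 2 / (1 + ‖u ω‖ ^ 2 * 0))) :=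
        tendsto_const_nhds.div ((tendsto_one_div_add_atTop_nhds_zero_nat.const_mul _).const_add _)
          (by simp)
      rw [mul_zero, add_zero, div_one] at h1
      refine h1.congr fun n => ?_
      have : (n : ℝ) + 1 ≠ 0 := by positivity
      field_simp
  have h1 := (hlim (φ T)).sub (hlim (φ 0))
  simp_rw [hbal] at h1
  -- The densities `b''` tend to zero pointwise while `s b''(s)` stays bounded uniformly in `n`, so
  -- the currents disappear in the limit.
  have h2 := (hs.tendsto_integral_totalCurrent hV (fun n => (hr n).cont)
    (fun n => (hr n).bound_deriv) tendsto_massCutDeriv hT).const_mul 4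
  have h3 := tendsto_nhds_unique h1 h2
  have h4 : ∀ t, totalCurrent (fun _ => (0 : ℝ)) (Φ t) = 0 := fun t => by
    simp [totalCurrent, current]
  simp only [h4, intervalIntegral.integral_zero, mul_zero] at h3
  exact (pow_left_inj₀ (norm_nonneg _) (norm_nonneg _) two_ne_zero).1 (sub_eq_zero.1 h3)

end Mass

/-! ### Regular approximations of `s log s` and of `log s`. -/

section EntropyCut

/-- The derivative of `s (log (s + n) - log (s + a))`, an approximation of `s log n - s log s`. -/
def entCut (a n s : ℝ) : ℝ :=
  Real.log (s + n) - Real.log (s + a) + s * (1 / (s + n) - 1 / (s + a))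

def entCutDeriv (a n s : ℝ) : ℝ :=
  2 * (1 / (s + n) - 1 / (s + a)) + s * (1 / (s + a) ^ 2 - 1 / (s + n) ^ 2)

variable {a n : ℝ}

theorem hasDerivAt_log_sub_log (ha : 0 < a) (hn : 0 < n) {s : ℝ} (hs : 0 ≤ s) :
    HasDerivAt (fun s => Real.log (s + n) - Real.log (s + a)) (1 / (s + n) - 1 / (s + a)) s := by
  have h1 := ((hasDerivAt_id s).add_const n).log (by simp only [id_eq]; positivity)
  have h2 := ((hasDerivAt_id s).add_const a).log (by simp only [id_eq]; positivity)
  exact h1.sub h2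

theorem hasDerivAt_entCut_primitive (ha : 0 < a) (hn : 0 < n) {s : ℝ} (hs : 0 ≤ s) :
    HasDerivAt (fun s => s * (Real.log (s + n) - Real.log (s + a))) (entCut a n s) s := by
  have h := (hasDerivAt_id s).mul (hasDerivAt_log_sub_log ha hn hs)
  refine h.congr_deriv ?_
  simp only [entCut, id_eq, one_mul]

theorem hasDerivAt_entCut (ha : 0 < a) (hn : 0 < n) {s : ℝ} (hs : 0 ≤ s) :
    HasDerivAt (entCut a n) (entCutDeriv a n s) s := by
  have h1 : HasDerivAt (fun s : ℝ => 1 / (s + n) - 1 / (s + a))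
      (1 / (s + a) ^ 2 - 1 / (s + n) ^ 2) s := by
    have h2 := ((hasDerivAt_id s).add_const n).inv (by simp only [id_eq]; positivity)
    have h3 := ((hasDerivAt_id s).add_const a).inv (by simp only [id_eq]; positivity)
    simp only [one_div]
    refine (h2.sub h3).congr_deriv ?_
    simp only [id_eq]
    ring
  have h := (hasDerivAt_log_sub_log ha hn hs).add ((hasDerivAt_id s).mul h1)
  refine h.congr_deriv ?_
  simp only [entCutDeriv, id_eq, one_mul]
  ring

theorem mul_one_div_add_mem (ha : 0 < a) {s : ℝ} (hs : 0 ≤ s) :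
    0 ≤ s * (1 / (s + a)) ∧ s * (1 / (s + a)) ≤ 1 := by
  refine ⟨by positivity, ?_⟩
  rw [mul_one_div, div_le_one (by positivity)]
  linarith

/-- In terms of `p = s / (s + a)` and `q = s / (s + n)`, both in `[0, 1]`, the quantity is `2 (q -
p) + p² - q²`. That the bound is independent of `a` and `n` makes the entropy estimates uniform in
the truncation. -/
theorem abs_mul_entCutDeriv_le (ha : 0 < a) (hn : 0 < n) {s : ℝ} (hs : 0 ≤ s) :
    |s * entCutDeriv a n s| ≤ 4 := by
  obtain ⟨h1, h2⟩ := mul_one_div_add_mem ha hs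
  obtain ⟨h3, h4⟩ := mul_one_div_add_mem hn hs
  have e : s * entCutDeriv a n s = 2 * (s * (1 / (s + n)) - s * (1 / (s + a))) +
      ((s * (1 / (s + a))) ^ 2 - (s * (1 / (s + n))) ^ 2) := by
    rw [entCutDeriv, mul_pow, mul_pow, one_div_pow, one_div_pow]
    ring
  rw [e]
  generalize s * (1 / (s + a)) = p at *
  generalize s * (1 / (s + n)) = q at *
  rw [abs_le]
  constructor <;> nlinarith

/-- The difference of the logarithms and the absolute value of the product term both lie in `[0, n /
(s + a)]`, and they enter with opposite signs. The decay in `s` makes `z ↦ h(|z|²) z` bounded, as a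
test function has to be. -/
theorem abs_entCut_le (ha : 0 < a) (han : a ≤ n) {s : ℝ} (hs : 0 ≤ s) :
    |entCut a n s| ≤ n / (s + a) := by
  have hn : 0 < n := ha.trans_le han
  have h0 : 0 < s + a := by positivity
  have h0' : 0 < s + n := by positivity
  have h1 : 0 ≤ Real.log (s + n) - Real.log (s + a) :=
    sub_nonneg.2 (Real.log_le_log h0 (by linarith))
  have h2 : Real.log (s + n) - Real.log (s + a) ≤ n / (s + a) := by
    rw [← Real.log_div h0'.ne' h0.ne']
    refine (Real.log_le_sub_one_of_pos (by positivity)).trans ?_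
    rw [sub_le_iff_le_add, div_add_one h0.ne']
    exact div_le_div_of_nonneg_right (by linarith) h0.le
  have h3 : 0 ≤ s * (1 / (s + a) - 1 / (s + n)) :=
    mul_nonneg hs (sub_nonneg.2 (one_div_le_one_div_of_le h0 (by linarith)))
  have h4 : s * (1 / (s + a) - 1 / (s + n)) ≤ n / (s + a) := by
    have h5 := (mul_one_div_add_mem hn hs).2
    have h6 : s * (1 / (s + a) - 1 / (s + n)) = (n - a) / (s + a) * (s * (1 / (s + n))) := by
      field_simp
      ring
    rw [h6]
    calc (n - a) / (s + a) * (s * (1 / (s + n))) ≤ (n - a) / (s + a) * 1 := by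
          have : 0 ≤ n - a := by linarith
          gcongr
      _ ≤ _ := by rw [mul_one]; gcongr; linarith
  rw [entCut, abs_le]
  constructor <;> nlinarith

theorem isRadial_entCut (ha : 0 < a) (han : a ≤ n) :
    IsRadial (entCut a n) (entCutDeriv a n) (n / a + 4) where
  hasDeriv s hs := hasDerivAt_entCut ha (ha.trans_le han) hs
  cont := by
    have hn : 0 < n := ha.trans_le han
    have h1 : ∀ b : ℝ, 0 < b → ∀ s ∈ Set.Ici (0 : ℝ), s + b ≠ 0 := fun b hb s hs => by
      have : 0 ≤ s := hs
      positivity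
    unfold entCutDeriv
    refine ContinuousOn.add (continuousOn_const.mul ((continuousOn_const.div (by fun_prop)
      (h1 n hn)).sub (continuousOn_const.div (by fun_prop) (h1 a ha)))) (continuousOn_id.mul
      ((continuousOn_const.div (by fun_prop) fun s hs => pow_ne_zero 2 (h1 a ha s hs)).sub
      (continuousOn_const.div (by fun_prop) fun s hs => pow_ne_zero 2 (h1 n hn s hs))))
  bound s hs := by
    refine (abs_entCut_le ha han hs).trans ?_
    have hn : 0 < n := ha.trans_le han
    have : n / (s + a) ≤ n / a := by gcongr; linarith
    linarith
  bound_deriv s hs := by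
    have hn : 0 < n := ha.trans_le han
    have := abs_mul_entCutDeriv_le ha hn hs
    have : 0 ≤ n / a := by positivity
    linarith

theorem norm_radial_entCut_le (ha : 0 < a) (han : a ≤ n) (z : ℂ) :
    ‖radial (entCut a n) z‖ ≤ n * (1 / a + 1) := by
  have hn : 0 < n := ha.trans_le han
  rw [radial, norm_smul, Real.norm_eq_abs]
  have h1 := abs_entCut_le ha han (sq_nonneg ‖z‖)
  calc _ ≤ n / (‖z‖ ^ 2 + a) * ‖z‖ := by gcongr
    _ ≤ _ := by
      rw [div_mul_eq_mul_div, div_le_iff₀ (by positivity), mul_assoc]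
      refine mul_le_mul_of_nonneg_left ?_ hn.le
      have h2 : (1 / a + 1) * (‖z‖ ^ 2 + a) = ‖z‖ ^ 2 / a + 1 + ‖z‖ ^ 2 + a := by
        field_simp
        ring
      rw [h2]
      have : 0 ≤ ‖z‖ ^ 2 / a := by positivity
      nlinarith [sq_nonneg (‖z‖ - 1), norm_nonneg z]

/-- `log (s + a) - log (1 + s / n)`, a bounded approximation of `log s`. -/
def logCut (a n s : ℝ) : ℝ := Real.log (s + a) - Real.log (1 + s / n)

theorem logCut_eq (hn : 0 < n) {s : ℝ} (hs : 0 ≤ s) :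
    logCut a n s = Real.log n - (Real.log (s + n) - Real.log (s + a)) := by
  have : 1 + s / n = (s + n) / n := by field_simp; ring
  rw [logCut, this, Real.log_div (by positivity) hn.ne']
  ring

/-- The truncation is the logarithm of `(s + 1/n) / (1 + s/n)`, a Möbius transformation that fixes
`1` and whose value lies between `s` and `1/s`. Hence `|log s|` dominates all the truncations at
once. -/
theorem abs_logCut_le (hn : 1 ≤ n) {s : ℝ} (hs : 0 < s) :
    |logCut (1 / n) n s| ≤ |Real.log s| := by
  have hn0 : 0 < n := by linarith
  have h0 : 0 < 1 + s / n := by positivity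
  have h1 : 0 < (s + 1 / n) / (1 + s / n) := by positivity
  have h3 : 0 < 1 / n := by positivity
  have h4 : 1 / n ≤ 1 := by rw [div_le_one hn0]; exact hn
  have h5 : s / n = s * (1 / n) := by ring
  have key : ∀ x y : ℝ, 0 < x → 0 < y → x ≤ y → 1 ≤ x * y → |Real.log x| ≤ |Real.log y| := by
    intro x y hx hy hxy h
    have hy1 : 0 ≤ Real.log y := Real.log_nonneg (by nlinarith)
    rw [abs_of_nonneg hy1, abs_le]
    refine ⟨?_, Real.log_le_log hx hxy⟩
    rw [← Real.log_inv]
    exact Real.log_le_log (by positivity) ((inv_le_iff_one_le_mul₀ hy).2 h)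
  rw [logCut, ← Real.log_div (by positivity) h0.ne']
  rcases le_total 1 s with h | h
  · refine key _ _ h1 hs ?_ ?_
    · rw [div_le_iff₀ h0, h5]
      have h6 : 0 ≤ 1 / n * (s * s - 1) := mul_nonneg h3.le (by nlinarith)
      linarith
    · rw [div_mul_eq_mul_div, one_le_div h0, h5]
      nlinarith
  · have h2 := key ((s + 1 / n) / (1 + s / n)) s⁻¹ h1 (by positivity) ?_ ?_
    · rwa [Real.log_inv, abs_neg] at h2
    · rw [div_le_iff₀ h0, h5, le_inv_mul_iff₀ hs]
      nlinarith
    · rw [← div_eq_mul_inv, one_le_div hs, le_div_iff₀ h0, h5]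
      have h6 : 0 ≤ 1 / n * (1 - s * s) := mul_nonneg h3.le (by nlinarith)
      linarith

theorem tendsto_logCut {a : ℕ → ℝ} {a₀ : ℝ} (ha : Tendsto a atTop (𝓝 a₀)) {s : ℝ}
    (hs : s + a₀ ≠ 0) :
    Tendsto (fun n : ℕ => logCut (a n) (n + 1) s) atTop (𝓝 (Real.log (s + a₀))) := by
  have h1 : Tendsto (fun n : ℕ => s / ((n : ℝ) + 1)) atTop (𝓝 0) := by
    simpa [div_eq_mul_inv] using tendsto_one_div_add_atTop_nhds_zero_nat.const_mul s
  have h2 := ((ha.const_add s).log hs).sub ((h1.const_add 1).log (by simp))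
  simpa [logCut] using h2

theorem tendsto_entCutDeriv {a : ℕ → ℝ} {a₀ : ℝ} (ha : Tendsto a atTop (𝓝 a₀)) {s : ℝ}
    (hs : s + a₀ ≠ 0) :
    Tendsto (fun n : ℕ => entCutDeriv (a n) (n + 1) s) atTop
      (𝓝 (-2 * (1 / (s + a₀)) + s * (1 / (s + a₀) ^ 2))) := by
  have h1 : Tendsto (fun n : ℕ => 1 / (s + ((n : ℝ) + 1))) atTop (𝓝 0) := by
    have h2 : Tendsto (fun n : ℕ => s + ((n : ℝ) + 1)) atTop atTop :=
      tendsto_atTop_add_const_left _ _ (tendsto_atTop_add_const_right _ _ tendsto_natCast_atTop_atTop)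
    simp only [one_div]
    exact h2.inv_tendsto_atTop
  have h3 : Tendsto (fun n : ℕ => 1 / (s + a n)) atTop (𝓝 (1 / (s + a₀))) :=
    tendsto_const_nhds.div (ha.const_add s) hs
  have h4 := ((h1.sub h3).const_mul 2).add (((h3.pow 2).sub (h1.pow 2)).const_mul s)
  have e : 2 * (0 - 1 / (s + a₀)) + s * ((1 / (s + a₀)) ^ 2 - 0 ^ 2) =
      -2 * (1 / (s + a₀)) + s * (1 / (s + a₀) ^ 2) := by rw [one_div_pow]; ring
  rw [e] at h4
  refine h4.congr fun n => ?_
  rw [entCutDeriv, one_div_pow, one_div_pow]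

end EntropyCut

/-! ### Pointwise inequalities for the Young function of `L² log L`. -/

section Orlicz

/-- The Young function `|z|² (1 + log (1 + |z|²))`. -/
def young (z : ℂ) : ℝ := ‖z‖ ^ 2 * (1 + Real.log (1 + ‖z‖ ^ 2))

/-- A truncation of `young` of quadratic growth. -/
def youngCut (k : ℝ) (z : ℂ) : ℝ := ‖z‖ ^ 2 * min (1 + Real.log (1 + ‖z‖ ^ 2)) k

theorem log_one_add_sq_nonneg (x : ℝ) : 0 ≤ Real.log (1 + x ^ 2) :=
  Real.log_nonneg (by nlinarith [sq_nonneg x])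

theorem continuous_young : Continuous young := by
  unfold young
  refine (continuous_norm.pow 2).mul (continuous_const.add (Continuous.log (by fun_prop) fun z => ?_))
  positivity

theorem continuous_youngCut (k : ℝ) : Continuous (youngCut k) := by
  unfold youngCut
  refine (continuous_norm.pow 2).mul ((continuous_const.add (Continuous.log (by fun_prop) fun z => ?_)).min
    continuous_const)
  positivity

theorem sq_le_young (z : ℂ) : ‖z‖ ^ 2 ≤ young z := by
  have := log_one_add_sq_nonneg ‖z‖
  unfold young
  nlinarith [sq_nonneg ‖z‖]

theorem young_nonneg (z : ℂ) : 0 ≤ young z := (sq_nonneg _).trans (sq_le_young z)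

theorem young_le_young {z w : ℂ} (h : ‖z‖ ≤ ‖w‖) : young z ≤ young w := by
  have h1 := log_one_add_sq_nonneg ‖z‖
  have h2 : Real.log (1 + ‖z‖ ^ 2) ≤ Real.log (1 + ‖w‖ ^ 2) :=
    Real.log_le_log (by positivity) (by gcongr)
  unfold young
  gcongr

theorem young_zero : young 0 = 0 := by simp [young]

theorem youngCut_nonneg {k : ℝ} (hk : 0 ≤ k) (z : ℂ) : 0 ≤ youngCut k z := by
  have := log_one_add_sq_nonneg ‖z‖
  unfold youngCut
  exact mul_nonneg (sq_nonneg _) (le_min (by linarith) hk)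

theorem youngCut_le_young (k : ℝ) (z : ℂ) : youngCut k z ≤ young z :=
  mul_le_mul_of_nonneg_left (min_le_left _ _) (sq_nonneg _)

theorem youngCut_le {k : ℝ} (z : ℂ) : youngCut k z ≤ k * ‖z‖ ^ 2 := by
  rw [mul_comm k]
  exact mul_le_mul_of_nonneg_left (min_le_right _ _) (sq_nonneg _)

/-- Let `|z| ≤ |w|`. Then `|z - w| ≤ 2 |w|`, so the logarithm at `z - w` exceeds the one at `w` by
at most `log 4 ≤ 2`. Splitting the factor `1 + log (1 + |w|²)` at level `k` leaves the square of the
distance times `2 + k`, and the part of `young w` above the level. Convergence in `L²` controls the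
first, uniform integrability the second. -/
theorem young_sub_le {k : ℝ} (hk : 0 ≤ k) (z w : ℂ) :
    young (z - w) ≤ (2 + k) * ‖z - w‖ ^ 2 +
      4 * ((young z - youngCut k z) + (young w - youngCut k w)) := by
  wlog hzw : ‖z‖ ≤ ‖w‖ generalizing z w
  · have := this w z (le_of_not_ge hzw)
    rw [norm_sub_rev w z] at this
    have e : young (w - z) = young (z - w) := by rw [young, young, norm_sub_rev]
    linarith
  have h1 : ‖z - w‖ ≤ 2 * ‖w‖ := (norm_sub_le _ _).trans (by linarith)
  have h2 : Real.log (1 + ‖z - w‖ ^ 2) ≤ 2 + Real.log (1 + ‖w‖ ^ 2) := by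
    have h3 : 1 + ‖z - w‖ ^ 2 ≤ 4 * (1 + ‖w‖ ^ 2) := by nlinarith [norm_nonneg (z - w)]
    have h4 := Real.log_le_log (by positivity) h3
    rw [Real.log_mul (by norm_num) (by positivity)] at h4
    have h5 : Real.log 4 ≤ 2 := by
      have : Real.log 4 = 2 * Real.log 2 := by
        rw [show (4 : ℝ) = 2 ^ 2 by norm_num, Real.log_pow]; norm_num
      have := Real.log_two_lt_d9
      linarith
    linarith
  have h6 : 0 ≤ young z - youngCut k z := sub_nonneg.2 (youngCut_le_young k z)
  have h7 : young w - youngCut k w = ‖w‖ ^ 2 *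
      (1 + Real.log (1 + ‖w‖ ^ 2) - min (1 + Real.log (1 + ‖w‖ ^ 2)) k) := by
    rw [young, youngCut]; ring
  set L := 1 + Real.log (1 + ‖w‖ ^ 2) with hL
  have h8 : 0 ≤ L - min L k := sub_nonneg.2 (min_le_left _ _)
  have h9 : min L k ≤ k := min_le_right _ _
  have h10 : ‖z - w‖ ^ 2 ≤ 4 * ‖w‖ ^ 2 := by nlinarith [norm_nonneg (z - w)]
  have h11 : young (z - w) ≤ ‖z - w‖ ^ 2 * ((2 + k) + (L - min L k)) := by
    rw [young]
    exact mul_le_mul_of_nonneg_left (by linarith) (sq_nonneg _)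
  rw [h7]
  nlinarith [mul_le_mul_of_nonneg_right h10 h8]

/-- Young's inequality with a parameter. If `|v| ≤ σ |u|`, the product is absorbed by `σ young u`.
Otherwise `|u| ≤ |v| / σ`, and the logarithm at `u` exceeds the one at `v` by at most `-2 log σ`. A
small `σ` followed by a small modular of `v` makes the pairing small while the modular of `u` is
only bounded. -/
theorem norm_mul_logMap_le {σ : ℝ} (h0 : 0 < σ) (h1 : σ ≤ 1) (v u : ℂ) :
    ‖v‖ * ‖logMap u‖ ≤ σ * (1 + young u) + σ⁻¹ * (2 - 2 * Real.log σ) * young v := by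
  have hl : ‖logMap u‖ ≤ 2 + ‖u‖ * Real.log (1 + ‖u‖ ^ 2) := by
    rw [logMap, norm_smul, Real.norm_eq_abs]
    have hL := log_one_add_sq_nonneg ‖u‖
    rcases le_total 1 ‖u‖ with h | h
    · rw [abs_of_nonneg (Real.log_nonneg (by nlinarith))]
      have : Real.log (‖u‖ ^ 2) ≤ Real.log (1 + ‖u‖ ^ 2) :=
        Real.log_le_log (by positivity) (by linarith)
      nlinarith
    · have h2 := abs_log_sq_mul_le (norm_nonneg u)
      have h3 : ‖u‖ ^ 2 ≤ 1 := pow_le_one₀ (norm_nonneg u) h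
      have : 0 ≤ ‖u‖ * Real.log (1 + ‖u‖ ^ 2) := by positivity
      linarith
  have hv : 2 * ‖v‖ ≤ σ + σ⁻¹ * ‖v‖ ^ 2 := by
    have h2 : σ + σ⁻¹ * ‖v‖ ^ 2 - 2 * ‖v‖ = σ⁻¹ * (σ - ‖v‖) ^ 2 := by
      field_simp
      ring
    have : 0 ≤ σ⁻¹ * (σ - ‖v‖) ^ 2 := by positivity
    linarith
  have hlog : 0 ≤ -Real.log σ := neg_nonneg.2 (Real.log_nonpos h0.le h1)
  have hLv := log_one_add_sq_nonneg ‖v‖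
  have hLu := log_one_add_sq_nonneg ‖u‖
  have hmain : ‖v‖ * (‖u‖ * Real.log (1 + ‖u‖ ^ 2)) ≤ σ * young u +
      σ⁻¹ * (1 - 2 * Real.log σ) * young v := by
    rcases le_total ‖v‖ (σ * ‖u‖) with h | h
    · have h2 : ‖v‖ * (‖u‖ * Real.log (1 + ‖u‖ ^ 2)) ≤ σ * young u := by
        calc _ ≤ σ * ‖u‖ * (‖u‖ * Real.log (1 + ‖u‖ ^ 2)) := by gcongr
          _ ≤ _ := by
            rw [young]
            nlinarith [mul_nonneg h0.le (sq_nonneg ‖u‖)]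
      have := young_nonneg v
      have : 0 ≤ σ⁻¹ * (1 - 2 * Real.log σ) * young v :=
        mul_nonneg (mul_nonneg (by positivity) (by linarith)) this
      linarith
    · have h2 : ‖u‖ ≤ σ⁻¹ * ‖v‖ := (le_inv_mul_iff₀ h0).2 h
      have h3 : Real.log (1 + ‖u‖ ^ 2) ≤ -2 * Real.log σ + Real.log (1 + ‖v‖ ^ 2) := by
        have h4 : 1 + ‖u‖ ^ 2 ≤ (σ ^ 2)⁻¹ * (1 + ‖v‖ ^ 2) := by
          rw [le_inv_mul_iff₀ (by positivity)]
          nlinarith [mul_nonneg h0.le (norm_nonneg u)]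
        have h5 := Real.log_le_log (by positivity) h4
        rw [Real.log_mul (by positivity) (by positivity), Real.log_inv, Real.log_pow] at h5
        push_cast at h5
        linarith
      have h6 : ‖v‖ * (‖u‖ * Real.log (1 + ‖u‖ ^ 2)) ≤
          ‖v‖ * (σ⁻¹ * ‖v‖ * (-2 * Real.log σ + Real.log (1 + ‖v‖ ^ 2))) := by
        gcongr
      have h7 : ‖v‖ * (σ⁻¹ * ‖v‖ * (-2 * Real.log σ + Real.log (1 + ‖v‖ ^ 2))) ≤
          σ⁻¹ * (1 - 2 * Real.log σ) * young v := by
        have h8 : ‖v‖ ^ 2 * (-2 * Real.log σ + Real.log (1 + ‖v‖ ^ 2)) ≤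
            (1 - 2 * Real.log σ) * young v := by
          rw [young]
          have : 0 ≤ ‖v‖ ^ 2 * (1 + 2 * (-Real.log σ) * Real.log (1 + ‖v‖ ^ 2)) := by positivity
          nlinarith
        calc _ = σ⁻¹ * (‖v‖ ^ 2 * (-2 * Real.log σ + Real.log (1 + ‖v‖ ^ 2))) := by ring
          _ ≤ σ⁻¹ * ((1 - 2 * Real.log σ) * young v) := by gcongr
          _ = _ := by ring
      have := mul_nonneg h0.le (young_nonneg u)
      linarith
  have h9 := sq_le_young v
  calc ‖v‖ * ‖logMap u‖ ≤ ‖v‖ * (2 + ‖u‖ * Real.log (1 + ‖u‖ ^ 2)) := by gcongr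
    _ = 2 * ‖v‖ + ‖v‖ * (‖u‖ * Real.log (1 + ‖u‖ ^ 2)) := by ring
    _ ≤ (σ + σ⁻¹ * young v) + (σ * young u + σ⁻¹ * (1 - 2 * Real.log σ) * young v) := by
        refine add_le_add (hv.trans ?_) hmain
        gcongr
    _ = _ := by ring

end Orlicz

/-! ### The truncated logarithm as a radial multiplier. -/

section LogCut

variable {a n : ℝ}

def logCutDeriv (a n s : ℝ) : ℝ := 1 / (s + a) - 1 / (s + n)

theorem hasDerivAt_logCut (ha : 0 < a) (hn : 0 < n) {s : ℝ} (hs : 0 ≤ s) :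
    HasDerivAt (logCut a n) (logCutDeriv a n s) s := by
  have h1 := ((hasDerivAt_id s).add_const a).log (by simp only [id_eq]; positivity)
  have h2 := (((hasDerivAt_id s).div_const n).const_add 1).log (by simp only [id_eq]; positivity)
  refine (h1.sub h2).congr_deriv ?_
  simp only [id_eq, logCutDeriv]
  have : 1 + s / n = (s + n) / n := by field_simp; ring
  rw [this]
  have : s + n ≠ 0 := by positivity
  field_simp

theorem logCutDeriv_nonneg (ha : 0 < a) (han : a ≤ n) {s : ℝ} (hs : 0 ≤ s) :
    0 ≤ logCutDeriv a n s :=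
  sub_nonneg.2 (one_div_le_one_div_of_le (by positivity) (by linarith))

theorem abs_mul_logCutDeriv_le (ha : 0 < a) (han : a ≤ n) {s : ℝ} (hs : 0 ≤ s) :
    |s * logCutDeriv a n s| ≤ 1 := by
  obtain ⟨h1, h2⟩ := mul_one_div_add_mem ha hs
  obtain ⟨h3, h4⟩ := mul_one_div_add_mem (ha.trans_le han) hs
  rw [logCutDeriv, mul_sub, abs_le]
  constructor <;> linarith

theorem continuousOn_logCutDeriv (ha : 0 < a) (han : a ≤ n) :
    ContinuousOn (logCutDeriv a n) (Set.Ici 0) := by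
  have h1 : ∀ b : ℝ, 0 < b → ∀ s ∈ Set.Ici (0 : ℝ), s + b ≠ 0 := fun b hb s hs => by
    have : 0 ≤ s := hs
    positivity
  unfold logCutDeriv
  exact (continuousOn_const.div (by fun_prop) (h1 a ha)).sub
    (continuousOn_const.div (by fun_prop) (h1 n (ha.trans_le han)))

theorem abs_logCut_le_const (ha : 0 < a) (han : a ≤ n) {s : ℝ} (hs : 0 ≤ s) :
    |logCut a n s| ≤ |Real.log a| + |Real.log n| := by
  have hn : 0 < n := ha.trans_le han
  have h0 : 0 < 1 + s / n := by positivity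
  have h1 : 0 < (s + a) / (1 + s / n) := by positivity
  rw [logCut, ← Real.log_div (by positivity) h0.ne']
  have h2 : Real.log a ≤ Real.log ((s + a) / (1 + s / n)) := by
    refine Real.log_le_log ha ?_
    rw [le_div_iff₀ h0]
    have : a * (s / n) ≤ s := by
      rw [← mul_div_assoc, div_le_iff₀ hn]
      nlinarith
    linarith
  have h3 : Real.log ((s + a) / (1 + s / n)) ≤ Real.log n := by
    refine Real.log_le_log h1 ?_
    rw [div_le_iff₀ h0]
    have : n * (1 + s / n) = n + s := by field_simp
    linarith
  have h4 := neg_abs_le (Real.log a)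
  have h5 := le_abs_self (Real.log n)
  have := abs_nonneg (Real.log a)
  have := abs_nonneg (Real.log n)
  rw [abs_le]
  constructor <;> linarith

/-- The constant depends on `a` and `n` through the bound of the function. The weighted derivative
alone is bounded by `1`, by `abs_mul_logCutDeriv_le`, and this uniform bound is the one that the
limit of the energy balance relies on. -/
theorem isRadial_add_logCut (ha : 0 < a) (han : a ≤ n) (c : ℝ) :
    IsRadial (fun s => c + logCut a n s) (logCutDeriv a n)
      (|c| + |Real.log a| + |Real.log n| + 1) where
  hasDeriv s hs := (hasDerivAt_logCut ha (ha.trans_le han) hs).const_add c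
  cont := continuousOn_logCutDeriv ha han
  bound s hs := by
    refine (abs_add_le _ _).trans ?_
    have := abs_logCut_le_const ha han hs
    linarith
  bound_deriv s hs := by
    have := abs_mul_logCutDeriv_le ha han hs
    have := abs_nonneg c
    have := abs_nonneg (Real.log a)
    have := abs_nonneg (Real.log n)
    linarith

theorem isRadial_logCut (ha : 0 < a) (han : a ≤ n) :
    IsRadial (logCut a n) (logCutDeriv a n) (|Real.log a| + |Real.log n| + 1) := by
  simpa using isRadial_add_logCut ha han 0

theorem tendsto_logCutDeriv {a : ℕ → ℝ} {a₀ : ℝ} (ha : Tendsto a atTop (𝓝 a₀)) {s : ℝ}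
    (hs : s + a₀ ≠ 0) :
    Tendsto (fun n : ℕ => logCutDeriv (a n) (n + 1) s) atTop (𝓝 (1 / (s + a₀))) := by
  have h1 : Tendsto (fun n : ℕ => 1 / (s + ((n : ℝ) + 1))) atTop (𝓝 0) := by
    have h2 : Tendsto (fun n : ℕ => s + ((n : ℝ) + 1)) atTop atTop :=
      tendsto_atTop_add_const_left _ _ (tendsto_atTop_add_const_right _ _ tendsto_natCast_atTop_atTop)
    simp only [one_div]
    exact h2.inv_tendsto_atTop
  have h3 : Tendsto (fun n : ℕ => 1 / (s + a n)) atTop (𝓝 (1 / (s + a₀))) :=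
    tendsto_const_nhds.div (ha.const_add s) hs
  simpa [logCutDeriv] using h3.sub h1

end LogCut

/-! ### The space `L² log L`: convergence in modular, resolvents, pairing with the nonlinearity. -/

section Tame

variable {Ω : Type*} [MeasurableSpace Ω] {μ : Measure Ω} [IsProbabilityMeasure μ]
  {ι : Type*} [Fintype ι] {V : ClosedSubmodule ℂ (Jet (Lp ℂ 2 μ) ι)}

/-- Finite entropy: membership in the Orlicz space `L² log L`. -/
def Tame (u : Lp ℂ 2 μ) : Prop := Integrable (fun ω => young (u ω)) μ

/-- The modular of the Orlicz space `L² log L`. -/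
def modular (u : Lp ℂ 2 μ) : ℝ := ∫ ω, young (u ω) ∂μ

theorem modular_nonneg (u : Lp ℂ 2 μ) : 0 ≤ modular u := integral_nonneg fun _ => young_nonneg _

theorem aestronglyMeasurable_young (u : Lp ℂ 2 μ) :
    AEStronglyMeasurable (fun ω => young (u ω)) μ :=
  continuous_young.comp_aestronglyMeasurable (Lp.aestronglyMeasurable u)

theorem growth_youngCut {k : ℝ} (hk : 0 ≤ k) (z : ℂ) : ‖youngCut k z‖ ≤ k * (1 + ‖z‖ ^ 2) := by
  rw [Real.norm_of_nonneg (youngCut_nonneg hk z)]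
  have := youngCut_le (k := k) z
  linarith

theorem integrable_youngCut {k : ℝ} (hk : 0 ≤ k) (u : Lp ℂ 2 μ) :
    Integrable (fun ω => youngCut k (u ω)) μ :=
  integrable_int1 (continuous_youngCut k) (growth_youngCut hk) u

theorem Tame.integrable_sub {u v : Lp ℂ 2 μ} (hu : Tame u) (hv : Tame v) {k : ℝ} (hk : 0 ≤ k) :
    Tame (u - v) ∧ modular (u - v) ≤ (2 + k) * ‖u - v‖ ^ 2 +
      4 * ((modular u - ∫ ω, youngCut k (u ω) ∂μ) + (modular v - ∫ ω, youngCut k (v ω) ∂μ)) := by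
  have hi : Integrable (fun ω => (2 + k) * ‖(u - v) ω‖ ^ 2 +
      4 * ((young (u ω) - youngCut k (u ω)) + (young (v ω) - youngCut k (v ω)))) μ :=
    ((integrable_norm_sq _).const_mul _).add (((hu.sub (integrable_youngCut hk u)).add
      (hv.sub (integrable_youngCut hk v))).const_mul _)
  have hle : ∀ᵐ ω ∂μ, young ((u - v) ω) ≤ (2 + k) * ‖(u - v) ω‖ ^ 2 +
      4 * ((young (u ω) - youngCut k (u ω)) + (young (v ω) - youngCut k (v ω))) := by
    filter_upwards [Lp.coeFn_sub u v] with ω hω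
    rw [hω]
    exact young_sub_le hk _ _
  have ht : Tame (u - v) := by
    refine Integrable.mono' hi (aestronglyMeasurable_young _) ?_
    filter_upwards [hle] with ω hω
    rwa [Real.norm_of_nonneg (young_nonneg _)]
  refine ⟨ht, (integral_mono_ae ht hi hle).trans (le_of_eq ?_)⟩
  have e1 : ∫ ω, (young (u ω) - youngCut k (u ω)) ∂μ = modular u - ∫ ω, youngCut k (u ω) ∂μ :=
    integral_sub hu (integrable_youngCut hk u)
  have e2 : ∫ ω, (young (v ω) - youngCut k (v ω)) ∂μ = modular v - ∫ ω, youngCut k (v ω) ∂μ :=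
    integral_sub hv (integrable_youngCut hk v)
  have i1 : Integrable (fun ω => young (u ω) - youngCut k (u ω)) μ :=
    Integrable.sub hu (integrable_youngCut hk u)
  have i2 : Integrable (fun ω => young (v ω) - youngCut k (v ω)) μ :=
    Integrable.sub hv (integrable_youngCut hk v)
  have i3 : Integrable (fun ω => 4 * ((young (u ω) - youngCut k (u ω)) +
      (young (v ω) - youngCut k (v ω)))) μ := (i1.add i2).const_mul 4
  rw [integral_add ((integrable_norm_sq _).const_mul _) i3,
    integral_const_mul, integral_const_mul, integral_norm_sq, integral_add i1 i2, e1, e2]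

theorem Tame.sub {u v : Lp ℂ 2 μ} (hu : Tame u) (hv : Tame v) : Tame (u - v) :=
  (hu.integrable_sub hv le_rfl).1

theorem Tame.neg {u : Lp ℂ 2 μ} (hu : Tame u) : Tame (-u) := by
  refine hu.congr ?_
  filter_upwards [Lp.coeFn_neg u] with ω hω
  rw [hω, Pi.neg_apply, young, young, norm_neg]

theorem Tame.add {u v : Lp ℂ 2 μ} (hu : Tame u) (hv : Tame v) : Tame (u + v) := by
  simpa using hu.sub hv.neg

theorem tendsto_integral_youngCut {u : Lp ℂ 2 μ} (hu : Tame u) :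
    Tendsto (fun k : ℕ => modular u - ∫ ω, youngCut k (u ω) ∂μ) atTop (𝓝 0) := by
  rw [← sub_self (modular u)]
  refine Tendsto.const_sub _ ?_
  refine tendsto_integral_of_dominated_convergence (fun ω => young (u ω))
    (fun k => (integrable_youngCut k.cast_nonneg u).1) hu
    (fun k => ae_of_all _ fun ω => ?_) (ae_of_all _ fun ω => ?_)
  · rw [Real.norm_of_nonneg (youngCut_nonneg k.cast_nonneg _)]
    exact youngCut_le_young _ _
  · refine tendsto_const_nhds.congr' ?_
    obtain ⟨N, hN⟩ := exists_nat_ge (1 + Real.log (1 + ‖u ω‖ ^ 2))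
    filter_upwards [eventually_ge_atTop N] with k hk
    rw [young, youngCut, min_eq_left (hN.trans (by exact_mod_cast hk))]

theorem tendsto_zero_of_double {A B : Type*} {l : Filter A} {m : Filter B} [m.NeBot] {x : A → ℝ}
    {y : B → A → ℝ} {Y : B → ℝ} (h0 : ∀ᶠ a in l, 0 ≤ x a) (hxy : ∀ k, ∀ᶠ a in l, x a ≤ y k a)
    (hy : ∀ k, Tendsto (y k) l (𝓝 (Y k))) (hY : Tendsto Y m (𝓝 0)) : Tendsto x l (𝓝 0) := by
  rw [Metric.tendsto_nhds]
  intro e he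
  obtain ⟨k, hk⟩ := (hY.eventually (gt_mem_nhds he)).exists
  filter_upwards [h0, hxy k, (hy k).eventually (gt_mem_nhds hk)] with a h1 h2 h3
  rw [Real.dist_eq, sub_zero, abs_of_nonneg h1]
  linarith

/-- Convergence of the modulars excludes concentration at large values. By `young_sub_le` the
modular of the difference is at most a multiple of the squared `L²` distance plus tails above level
`k`. The truncated modulars are continuous on `L²`, so the tails converge to those of `u₀`, which
are small for large `k`. -/
theorem tendsto_modular_sub {A : Type*} {l : Filter A} {u : A → Lp ℂ 2 μ} {u₀ : Lp ℂ 2 μ}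
    (hu : Tendsto u l (𝓝 u₀)) (ht : ∀ᶠ a in l, Tame (u a)) (ht₀ : Tame u₀)
    (hm : Tendsto (fun a => modular (u a)) l (𝓝 (modular u₀))) :
    Tendsto (fun a => modular (u a - u₀)) l (𝓝 0) := by
  refine tendsto_zero_of_double (m := atTop) (y := fun (k : ℕ) a => (2 + k) * ‖u a - u₀‖ ^ 2 +
      4 * ((modular (u a) - ∫ ω, youngCut k (u a ω) ∂μ) +
        (modular u₀ - ∫ ω, youngCut k (u₀ ω) ∂μ)))
    (Y := fun k => 4 * ((modular u₀ - ∫ ω, youngCut k (u₀ ω) ∂μ) +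
      (modular u₀ - ∫ ω, youngCut k (u₀ ω) ∂μ)))
    (Eventually.of_forall fun a => modular_nonneg _) (fun k => ?_) (fun k => ?_) ?_
  · filter_upwards [ht] with a ha
    exact (ha.integrable_sub ht₀ k.cast_nonneg).2
  · have h1 : Tendsto (fun a => ‖u a - u₀‖) l (𝓝 0) := tendsto_iff_norm_sub_tendsto_zero.1 hu
    have h2 := ((continuous_int1 (μ := μ) (continuous_youngCut k)
      (growth_youngCut k.cast_nonneg)).tendsto u₀).comp hu
    have h3 := ((h1.pow 2).const_mul (2 + (k : ℝ))).add
      (((hm.sub h2).add (tendsto_const_nhds (x := modular u₀ - ∫ ω, youngCut k (u₀ ω) ∂μ))).const_mul 4)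
    simpa using h3
  · have := ((tendsto_integral_youngCut ht₀).add (tendsto_integral_youngCut ht₀)).const_mul 4
    simpa using this

theorem norm_clamp_le_norm {M : ℝ} (hM : 0 < M) (z : ℂ) : ‖clamp M z‖ ≤ ‖z‖ := by
  have h : 0 < max M ‖z‖ := lt_of_lt_of_le hM (le_max_left _ _)
  rw [clamp, norm_smul, Real.norm_of_nonneg (by positivity)]
  refine mul_le_of_le_one_left (norm_nonneg _) ?_
  rw [div_le_one h]
  exact le_max_left _ _

theorem norm_sub_clamp_le {M : ℝ} (hM : 0 < M) (z : ℂ) : ‖z - clamp M z‖ ≤ ‖z‖ := by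
  have h : 0 < max M ‖z‖ := lt_of_lt_of_le hM (le_max_left _ _)
  have e : z - clamp M z = (1 - M / max M ‖z‖) • z := by rw [clamp, sub_smul, one_smul]
  have h1 : M / max M ‖z‖ ≤ 1 := by rw [div_le_one h]; exact le_max_left _ _
  have h2 : 0 ≤ M / max M ‖z‖ := by positivity
  rw [e, norm_smul, Real.norm_of_nonneg (by linarith)]
  exact mul_le_of_le_one_left (norm_nonneg _) (by linarith)

theorem growth_clamp {M : ℝ} (hM : 0 < M) (z : ℂ) : ‖clamp M z‖ ≤ 1 * (1 + ‖z‖) := by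
  have := norm_clamp_le_norm hM z
  linarith

theorem norm_sup1_clamp_le {M : ℝ} (hM : 0 < M) (u : Lp ℂ 2 μ) :
    ∀ᵐ ω ∂μ, ‖sup1 (clamp M) u ω‖ ≤ M := by
  filter_upwards [coeFn_sup1 (continuous_clamp hM) (growth_clamp hM) u] with ω hω
  rw [hω]
  exact norm_clamp_le hM _

theorem tendsto_clamp (z : ℂ) : Tendsto (fun k : ℕ => clamp (k + 1) z) atTop (𝓝 z) := by
  refine tendsto_const_nhds.congr' ?_
  obtain ⟨N, hN⟩ := exists_nat_ge ‖z‖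
  filter_upwards [eventually_ge_atTop N] with k hk
  refine (clamp_eq (by positivity) ?_).symm
  have : (N : ℝ) ≤ k := by exact_mod_cast hk
  linarith

theorem tame_of_bounded {M : ℝ} {u : Lp ℂ 2 μ} (hu : ∀ᵐ ω ∂μ, ‖u ω‖ ≤ M) : Tame u := by
  refine Integrable.mono' (integrable_const (young (M : ℂ))) (aestronglyMeasurable_young u) ?_
  filter_upwards [hu] with ω hω
  rw [Real.norm_of_nonneg (young_nonneg _)]
  refine young_le_young (hω.trans ?_)
  rw [Complex.norm_real]
  exact le_abs_self M

theorem tendsto_sup1_clamp (u : Lp ℂ 2 μ) :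
    Tendsto (fun k : ℕ => sup1 (clamp (k + 1)) u) atTop (𝓝 u) := by
  rw [tendsto_iff_norm_sub_tendsto_zero]
  have h1 : Tendsto (fun k : ℕ => ∫ ω, ‖(sup1 (clamp (k + 1)) u - u) ω‖ ^ 2 ∂μ) atTop
      (𝓝 (∫ ω, (0 : ℝ) ∂μ)) := by
    refine tendsto_integral_of_dominated_convergence (fun ω => ‖u ω‖ ^ 2)
      (fun k => (integrable_norm_sq _).1) (integrable_norm_sq u) (fun k => ?_) ?_
    · have hk : (0 : ℝ) < k + 1 := by positivity
      filter_upwards [coeFn_sup1 (continuous_clamp hk) (growth_clamp hk) u,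
        Lp.coeFn_sub (sup1 (clamp (k + 1)) u) u] with ω h1 h2
      rw [h2, Pi.sub_apply, h1, Real.norm_of_nonneg (by positivity), norm_sub_rev]
      exact pow_le_pow_left₀ (norm_nonneg _) (norm_sub_clamp_le hk _) 2
    · have h3 : ∀ᵐ ω ∂μ, ∀ k : ℕ, (sup1 (clamp (k + 1)) u - u) ω = clamp (k + 1) (u ω) - u ω := by
        rw [ae_all_iff]
        intro k
        have hk : (0 : ℝ) < k + 1 := by positivity
        filter_upwards [coeFn_sup1 (continuous_clamp hk) (growth_clamp hk) u,
          Lp.coeFn_sub (sup1 (clamp (k + 1)) u) u] with ω h1 h2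
        rw [h2, Pi.sub_apply, h1]
      filter_upwards [h3] with ω hω
      simp_rw [hω]
      have := (((tendsto_clamp (u ω)).sub_const (u ω)).norm).pow 2
      simpa using this
  simp only [integral_zero] at h1
  simp_rw [integral_norm_sq] at h1
  have h2 := h1.sqrt
  simpa [Real.sqrt_sq] using h2

theorem tendsto_modular_sub_clamp {u : Lp ℂ 2 μ} (hu : Tame u) :
    Tendsto (fun k : ℕ => modular (sup1 (clamp (k + 1)) u - u)) atTop (𝓝 0) := by
  have hb : ∀ k : ℕ, ∀ᵐ ω ∂μ, young (sup1 (clamp (k + 1)) u ω) ≤ young (u ω) := fun k => by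
    have hk : (0 : ℝ) < k + 1 := by positivity
    filter_upwards [coeFn_sup1 (continuous_clamp hk) (growth_clamp hk) u] with ω h1
    rw [h1]
    exact young_le_young (norm_clamp_le_norm hk _)
  refine tendsto_modular_sub (tendsto_sup1_clamp u) ?_ hu ?_
  · exact Eventually.of_forall fun k => tame_of_bounded (norm_sup1_clamp_le (by positivity) u)
  · refine tendsto_integral_of_dominated_convergence (fun ω => young (u ω))
      (fun k => aestronglyMeasurable_young _) hu (fun k => ?_) ?_
    · filter_upwards [hb k] with ω hω
      rwa [Real.norm_of_nonneg (young_nonneg _)]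
    · have h3 : ∀ᵐ ω ∂μ, ∀ k : ℕ, sup1 (clamp (k + 1)) u ω = clamp (k + 1) (u ω) := by
        rw [ae_all_iff]
        intro k
        have hk : (0 : ℝ) < k + 1 := by positivity
        exact coeFn_sup1 (continuous_clamp hk) (growth_clamp hk) u
      filter_upwards [h3] with ω hω
      simp_rw [hω]
      exact (continuous_young.tendsto _).comp (tendsto_clamp _)

/-- The resolvents are bounded on `L² log L`. -/
theorem IsSobolev.tame_res (hV : IsSobolev V) {ε : ℝ} (hε : 0 < ε) {u : Lp ℂ 2 μ} (hu : Tame u) :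
    Tame (res V ε u none) ∧ modular (res V ε u none) ≤ 10 * modular u := by
  set ψ := res V ε u none with hψ
  have h1n : ∀ n : ℕ, (1 : ℝ) ≤ (n : ℝ) + 1 := fun n => by linarith [n.cast_nonneg (α := ℝ)]
  have hr := fun n : ℕ => isRadial_add_logCut one_pos (h1n n) 1
  have hcut0 : ∀ (n : ℕ) (s : ℝ), 0 ≤ s → 0 ≤ logCut 1 (n + 1) s := fun n s hs => by
    rw [logCut]
    refine sub_nonneg.2 (Real.log_le_log (by positivity) ?_)
    have : s / ((n : ℝ) + 1) ≤ s := div_le_self hs (h1n n)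
    linarith
  have hcut1 : ∀ (n : ℕ) (s : ℝ), 0 ≤ s → logCut 1 (n + 1) s ≤ Real.log (1 + s) := fun n s hs => by
    have : 0 ≤ Real.log (1 + s / ((n : ℝ) + 1)) := Real.log_nonneg (by
      have : 0 ≤ s / ((n : ℝ) + 1) := by positivity
      linarith)
    rw [logCut, add_comm s 1]
    linarith
  -- If `|z| ≤ 2 |w|`, the logarithm at `z` is at most `3/2` plus the one at `w`; otherwise `|z| |w|
  -- ≤ |z|² / 2`. The term with factor `1/2` is then absorbed by the left side of
  -- `IsSobolev.integral_res_le`, which doubles the constant `5`.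
  have hpt : ∀ (n : ℕ) (z w : ℂ), (1 + logCut 1 (n + 1) (‖z‖ ^ 2)) * (‖z‖ * ‖w‖) ≤
      1 / 2 * ((1 + logCut 1 (n + 1) (‖z‖ ^ 2)) * ‖z‖ ^ 2) + 5 * young w := fun n z w => by
    have h0 := hcut0 n _ (sq_nonneg ‖z‖)
    rcases le_total ‖z‖ (2 * ‖w‖) with h | h
    · have h2 : Real.log (1 + ‖z‖ ^ 2) ≤ 3 / 2 + Real.log (1 + ‖w‖ ^ 2) := by
        have h3 : 1 + ‖z‖ ^ 2 ≤ 4 * (1 + ‖w‖ ^ 2) := by nlinarith [norm_nonneg z]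
        have h4 := Real.log_le_log (by positivity) h3
        rw [Real.log_mul (by norm_num) (by positivity)] at h4
        have h5 : Real.log 4 ≤ 3 / 2 := by
          have : Real.log 4 = 2 * Real.log 2 := by
            rw [show (4 : ℝ) = 2 ^ 2 by norm_num, Real.log_pow]; norm_num
          have := Real.log_two_lt_d9
          linarith
        linarith
      have h3 := (hcut1 n _ (sq_nonneg ‖z‖)).trans h2
      have h4 := log_one_add_sq_nonneg ‖w‖
      have h5 : (1 + logCut 1 (n + 1) (‖z‖ ^ 2)) * (‖z‖ * ‖w‖) ≤
          (5 / 2 + Real.log (1 + ‖w‖ ^ 2)) * (2 * ‖w‖ * ‖w‖) :=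
        mul_le_mul (by linarith) (by gcongr) (by positivity) (by positivity)
      have h6 : 0 ≤ (1 + logCut 1 (n + 1) (‖z‖ ^ 2)) * ‖z‖ ^ 2 := by positivity
      rw [young]
      nlinarith [mul_nonneg h4 (sq_nonneg ‖w‖)]
    · have h2 := young_nonneg w
      have h3 : (1 + logCut 1 (n + 1) (‖z‖ ^ 2)) * (‖z‖ * (2 * ‖w‖)) ≤
          (1 + logCut 1 (n + 1) (‖z‖ ^ 2)) * (‖z‖ * ‖z‖) := by gcongr
      nlinarith
  have hi : ∀ n : ℕ, Integrable (fun ω => (1 + logCut 1 (n + 1) (‖ψ ω‖ ^ 2)) * ‖ψ ω‖ ^ 2) μ := by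
    intro n
    refine integrable_int1 (F := fun z => (1 + logCut 1 (n + 1) (‖z‖ ^ 2)) * ‖z‖ ^ 2)
      ((hr n).continuous_sq.mul (by fun_prop))
      (C := |1| + |Real.log 1| + |Real.log ((n : ℝ) + 1)| + 1) (fun z => ?_) ψ
    · rw [norm_mul, Real.norm_eq_abs, Real.norm_of_nonneg (sq_nonneg ‖z‖)]
      have h1 := (hr n).bound _ (sq_nonneg ‖z‖)
      have h2 := (hr n).nonneg
      exact mul_le_mul h1 (by linarith) (sq_nonneg _) h2
  have hi2 : ∀ n : ℕ, Integrable
      (fun ω => (1 + logCut 1 (n + 1) (‖ψ ω‖ ^ 2)) * (‖ψ ω‖ * ‖u ω‖)) μ := by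
    intro n
    refine integrable_int2 (F := fun z w => (1 + logCut 1 (n + 1) (‖z‖ ^ 2)) * (‖z‖ * ‖w‖))
      (((hr n).continuous_sq.comp (continuous_fst (X := ℂ) (Y := ℂ))).mul (by fun_prop))
      (C := |1| + |Real.log 1| + |Real.log ((n : ℝ) + 1)| + 1) (fun z w => ?_) ψ u
    · rw [norm_mul, Real.norm_eq_abs, Real.norm_of_nonneg (by positivity)]
      have h1 := (hr n).bound _ (sq_nonneg ‖z‖)
      have h2 := (hr n).nonneg
      exact mul_le_mul h1 (by nlinarith [sq_nonneg (‖z‖ - ‖w‖), sq_nonneg (‖z‖ + ‖w‖)])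
        (by positivity) h2
  have hle : ∀ n : ℕ, ∫ ω, (1 + logCut 1 (n + 1) (‖ψ ω‖ ^ 2)) * ‖ψ ω‖ ^ 2 ∂μ ≤
      10 * modular u := fun n => by
    have h2 := hV.integral_res_le (hr n) (fun s hs => by have := hcut0 n s hs; linarith)
      (fun s hs => logCutDeriv_nonneg one_pos (h1n n) hs) hε u
    have h3 : ∫ ω, (1 + logCut 1 (n + 1) (‖ψ ω‖ ^ 2)) * (‖ψ ω‖ * ‖u ω‖) ∂μ ≤
        ∫ ω, (1 / 2 * ((1 + logCut 1 (n + 1) (‖ψ ω‖ ^ 2)) * ‖ψ ω‖ ^ 2) + 5 * young (u ω)) ∂μ :=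
      integral_mono (hi2 n) (((hi n).const_mul _).add (Integrable.const_mul hu _))
        fun ω => hpt n _ _
    rw [integral_add ((hi n).const_mul _) (Integrable.const_mul hu _), integral_const_mul,
      integral_const_mul] at h3
    change _ ≤ _ at h2
    have h4 : ∫ ω, young (u ω) ∂μ = modular u := rfl
    rw [h4] at h3
    linarith
  refine integrable_of_tendsto_of_integral_le hi (fun n ω => ?_) (fun ω => ?_)
    (Eventually.of_forall hle)
  · have := hcut0 n _ (sq_nonneg ‖ψ ω‖)
    positivity
  · have h2 := tendsto_logCut (a := fun _ => 1) tendsto_const_nhds (s := ‖ψ ω‖ ^ 2)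
      (by positivity)
    have h3 := (h2.const_add 1).mul_const (‖ψ ω‖ ^ 2)
    rw [young, mul_comm, add_comm 1 (‖ψ ω‖ ^ 2)]
    exact h3

/-- The pairing of `u log |u|²` with `v`. -/
def logPair (u v : Lp ℂ 2 μ) : ℂ := ∫ ω, starRingEnd ℂ (v ω) * logMap (u ω) ∂μ

theorem Tame.norm_logPair_le {u v : Lp ℂ 2 μ} (hu : Tame u) (hv : Tame v) {σ : ℝ} (h0 : 0 < σ)
    (h1 : σ ≤ 1) : Integrable (fun ω => starRingEnd ℂ (v ω) * logMap (u ω)) μ ∧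
      ‖logPair u v‖ ≤ σ * (1 + modular u) + σ⁻¹ * (2 - 2 * Real.log σ) * modular v := by
  have hi : Integrable (fun ω => σ * (1 + young (u ω)) +
      σ⁻¹ * (2 - 2 * Real.log σ) * young (v ω)) μ :=
    (((integrable_const _).add hu).const_mul _).add (Integrable.const_mul hv _)
  have hle : ∀ ω, ‖starRingEnd ℂ (v ω) * logMap (u ω)‖ ≤ σ * (1 + young (u ω)) +
      σ⁻¹ * (2 - 2 * Real.log σ) * young (v ω) := fun ω => by
    rw [norm_mul, RCLike.norm_conj]
    exact norm_mul_logMap_le h0 h1 _ _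
  refine ⟨Integrable.mono' hi ?_ (ae_of_all _ hle), ?_⟩
  · exact (Complex.continuous_conj.comp_aestronglyMeasurable (Lp.aestronglyMeasurable v)).mul
      (continuous_logMap.comp_aestronglyMeasurable (Lp.aestronglyMeasurable u))
  · refine (norm_integral_le_of_norm_le hi (ae_of_all _ hle)).trans (le_of_eq ?_)
    have i1 : Integrable (fun ω => 1 + young (u ω)) μ := (integrable_const _).add hu
    have i2 : Integrable (fun ω => young (v ω)) μ := hv
    have i3 : Integrable (fun ω => young (u ω)) μ := hu
    rw [integral_add (i1.const_mul _) (i2.const_mul _),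
      integral_const_mul, integral_const_mul, integral_add (integrable_const _) i3]
    simp [modular]

theorem Tame.integrable_logPair {u v : Lp ℂ 2 μ} (hu : Tame u) (hv : Tame v) :
    Integrable (fun ω => starRingEnd ℂ (v ω) * logMap (u ω)) μ :=
  (hu.norm_logPair_le hv one_pos le_rfl).1

theorem Tame.logPair_sub {u v w : Lp ℂ 2 μ} (hu : Tame u) (hv : Tame v) (hw : Tame w) :
    logPair u (v - w) = logPair u v - logPair u w := by
  rw [logPair, logPair, logPair, ← integral_sub (hu.integrable_logPair hv)
    (hu.integrable_logPair hw)]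
  refine integral_congr_ae ?_
  filter_upwards [Lp.coeFn_sub v w] with ω hω
  rw [hω, Pi.sub_apply, map_sub, sub_mul]

theorem tendsto_logPair_bounded {A : Type*} {l : Filter A} {M : ℝ} (hM : 0 < M) {u : A → Lp ℂ 2 μ}
    {u₀ v : Lp ℂ 2 μ} (hu : Tendsto u l (𝓝 u₀)) (hv : ∀ᵐ ω ∂μ, ‖v ω‖ ≤ M) :
    Tendsto (fun a => logPair (u a) v) l (𝓝 (logPair u₀ v)) := by
  have hc := continuous_int2 (μ := μ) (F := fun z w => starRingEnd ℂ (clamp M w) * logMap z)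
    (continuous_clamp_logMap hM) (growth_clamp_logMap hM)
  have h2 := (hc.tendsto (u₀, v)).comp (hu.prodMk_nhds (tendsto_const_nhds (x := v)))
  have e : ∀ w : Lp ℂ 2 μ, ∫ ω, starRingEnd ℂ (clamp M (v ω)) * logMap (w ω) ∂μ = logPair w v := by
    intro w
    refine integral_congr_ae ?_
    filter_upwards [hv] with ω hω
    rw [clamp_eq hM hω]
  have h3 : ((fun p : Lp ℂ 2 μ × Lp ℂ 2 μ =>
      ∫ ω, starRingEnd ℂ (clamp M (p.2 ω)) * logMap (p.1 ω) ∂μ) ∘ fun a => (u a, v)) =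
      fun a => logPair (u a) v := funext fun a => e (u a)
  rw [h3] at h2
  simpa only [e] using h2

/-- The parameter `σ` is chosen first, so that the part with the modular of `u` is at most `e / 2`;
`δ` then compensates the factor `σ⁻¹ (2 - 2 log σ)`. -/
theorem exists_logPair_le {B e : ℝ} (hB : 0 ≤ B) (he : 0 < e) : ∃ δ, 0 < δ ∧ ∀ u v : Lp ℂ 2 μ,
    Tame u → Tame v → modular u ≤ B → modular v ≤ δ → ‖logPair u v‖ ≤ e := by
  set σ := min 1 (e / (2 * (1 + B))) with hσ
  have h0 : 0 < σ := lt_min one_pos (by positivity)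
  have h1 : σ ≤ 1 := min_le_left _ _
  have h2 : σ * (1 + B) ≤ e / 2 := by
    calc σ * (1 + B) ≤ e / (2 * (1 + B)) * (1 + B) := by gcongr; exact min_le_right _ _
      _ = e / 2 := by field_simp
  have hlog : Real.log σ ≤ 0 := Real.log_nonpos h0.le h1
  have hC : 0 < σ⁻¹ * (2 - 2 * Real.log σ) := mul_pos (by positivity) (by linarith)
  refine ⟨e / 2 / (σ⁻¹ * (2 - 2 * Real.log σ)), by positivity, fun u v hu hv hm hd => ?_⟩
  refine (hu.norm_logPair_le hv h0 h1).2.trans ?_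
  have h3 : σ * (1 + modular u) ≤ σ * (1 + B) := by gcongr
  have h4 := (le_div_iff₀' hC).1 hd
  linarith

/-- Here `u a` converges in `L²` with bounded modulars only, while `v a` converges in modular. The
limit `v₀` is replaced by a bounded truncation, against which `L²` convergence of `u a` is enough;
the remaining terms are small by `exists_logPair_le`. -/
theorem tendsto_logPair {A : Type*} {l : Filter A} {B : ℝ} {u v : A → Lp ℂ 2 μ}
    {u₀ v₀ : Lp ℂ 2 μ} (hu : Tendsto u l (𝓝 u₀)) (hut : ∀ᶠ a in l, Tame (u a) ∧ modular (u a) ≤ B)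
    (hvt : ∀ᶠ a in l, Tame (v a)) (hu₀ : Tame u₀) (hv₀ : Tame v₀)
    (hv : Tendsto (fun a => modular (v a - v₀)) l (𝓝 0)) :
    Tendsto (fun a => logPair (u a) (v a)) l (𝓝 (logPair u₀ v₀)) := by
  have hB0 : 0 ≤ modular u₀ := modular_nonneg _
  rw [Metric.tendsto_nhds]
  intro e he
  obtain ⟨δ, hδ, hδe⟩ := exists_logPair_le (μ := μ) (le_max_of_le_right hB0 : 0 ≤ max B (modular u₀))
    (show 0 < e / 4 by positivity)
  obtain ⟨k, hk⟩ := ((tendsto_modular_sub_clamp hv₀).eventually (gt_mem_nhds hδ)).exists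
  have hkb : ∀ᵐ ω ∂μ, ‖sup1 (clamp (k + 1)) v₀ ω‖ ≤ k + 1 := norm_sup1_clamp_le (by positivity) v₀
  have hkt : Tame (sup1 (clamp (k + 1)) v₀) := tame_of_bounded hkb
  have h1 := Metric.tendsto_nhds.1 (tendsto_logPair_bounded (by positivity) hu hkb) (e / 4)
    (by positivity)
  filter_upwards [h1, hut, hvt, hv.eventually (gt_mem_nhds hδ)] with a h1 ⟨h2, h3⟩ h4 h5
  rw [dist_eq_norm] at h1 ⊢
  set w := sup1 (clamp (k + 1)) v₀ with hw
  have e1 : logPair (u a) (v a) - logPair u₀ v₀ = logPair (u a) (v a - v₀) -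
      logPair (u a) (w - v₀) + (logPair (u a) w - logPair u₀ w) + logPair u₀ (w - v₀) := by
    rw [h2.logPair_sub h4 hv₀, h2.logPair_sub hkt hv₀, hu₀.logPair_sub hkt hv₀]
    ring
  have b1 := hδe (u a) (v a - v₀) h2 (h4.sub hv₀) (h3.trans (le_max_left _ _)) h5.le
  have b2 := hδe (u a) (w - v₀) h2 (hkt.sub hv₀) (h3.trans (le_max_left _ _)) hk.le
  have b3 := hδe u₀ (w - v₀) hu₀ (hkt.sub hv₀) (le_max_right _ _) hk.le
  rw [e1]
  have c1 := norm_add_le (logPair (u a) (v a - v₀) - logPair (u a) (w - v₀) +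
    (logPair (u a) w - logPair u₀ w)) (logPair u₀ (w - v₀))
  have c2 := norm_add_le (logPair (u a) (v a - v₀) - logPair (u a) (w - v₀))
    (logPair (u a) w - logPair u₀ w)
  have c3 := norm_sub_le (logPair (u a) (v a - v₀)) (logPair (u a) (w - v₀))
  linarith

end Tame

/-! ### Propagation and evolution of the entropy. -/

section EntropyBalance

variable {Ω : Type*} [MeasurableSpace Ω] {μ : Measure Ω} [IsProbabilityMeasure μ]
  {ι : Type*} [Fintype ι] {V : ClosedSubmodule ℂ (Jet (Lp ℂ 2 μ) ι)}
  {lam : ℝ} {φ : ℝ → Lp ℂ 2 μ} {Φ : ℝ → Jet (Lp ℂ 2 μ) ι} {a n : ℝ}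

/-- An approximation of `∫ |u|² log |u|²`. -/
def logMomentCut (a n : ℝ) (u : Lp ℂ 2 μ) : ℝ := ∫ ω, ‖u ω‖ ^ 2 * logCut a n (‖u ω‖ ^ 2) ∂μ

/-- `∫ |u|² log |u|²`. -/
def logMoment (u : Lp ℂ 2 μ) : ℝ := ∫ ω, ‖u ω‖ ^ 2 * Real.log (‖u ω‖ ^ 2) ∂μ

theorem integrable_logMomentCut (ha : 0 < a) (han : a ≤ n) (u : Lp ℂ 2 μ) :
    Integrable (fun ω => ‖u ω‖ ^ 2 * logCut a n (‖u ω‖ ^ 2)) μ := by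
  have hr := isRadial_logCut ha han
  refine integrable_int1 (F := fun z => ‖z‖ ^ 2 * logCut a n (‖z‖ ^ 2))
    ((by fun_prop : Continuous fun z : ℂ => ‖z‖ ^ 2).mul hr.continuous_sq)
    (C := |Real.log a| + |Real.log n| + 1) (fun z => ?_) u
  rw [norm_mul, Real.norm_eq_abs, Real.norm_eq_abs, abs_of_nonneg (sq_nonneg ‖z‖), mul_comm]
  have h1 := hr.bound _ (sq_nonneg ‖z‖)
  exact mul_le_mul h1 (by linarith) (sq_nonneg _) hr.nonneg

/-- The conservation law for `b(s) = s (log (s + n) - log (s + a))`. The functions `b(s)` and `-s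
logCut a n s` differ by `s log n`, whose integral is constant by conservation of mass. -/
theorem IsSol.logMomentCut_sub (hs : IsSol V lam φ Φ) (hV : IsSobolev V) (ha : 0 < a)
    (han : a ≤ n) {T : ℝ} (hT : 0 ≤ T) :
    logMomentCut a n (φ T) - logMomentCut a n (φ 0) =
      -4 * ∫ t in (0 : ℝ)..T, totalCurrent (entCutDeriv a n) (Φ t) := by
  have hn : 0 < n := ha.trans_le han
  have hbal := hs.integral_balance hV (isRadial_entCut ha han)
    (fun s h => hasDerivAt_entCut_primitive ha hn h)
    (M := n * (1 / a + 1)) (by positivity) (norm_radial_entCut_le ha han) hT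
  have h1 : ∀ u : Lp ℂ 2 μ, ∫ ω, ‖u ω‖ ^ 2 * (Real.log (‖u ω‖ ^ 2 + n) - Real.log (‖u ω‖ ^ 2 + a)) ∂μ =
      Real.log n * ‖u‖ ^ 2 - logMomentCut a n u := fun u => by
    rw [logMomentCut, ← integral_norm_sq, ← integral_const_mul, ← integral_sub
      ((integrable_norm_sq u).const_mul _) (integrable_logMomentCut ha han u)]
    refine integral_congr_ae (ae_of_all _ fun ω => ?_)
    simp only
    rw [logCut_eq hn (sq_nonneg _)]
    ring
  rw [h1, h1, hs.norm_eq hV hT] at hbal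
  linarith

theorem mul_logCut_one_mem (k : ℕ) (z : ℂ) : 0 ≤ ‖z‖ ^ 2 * logCut 1 (k + 1) (‖z‖ ^ 2) ∧
    ‖z‖ ^ 2 * logCut 1 (k + 1) (‖z‖ ^ 2) ≤ young z := by
  have hs := sq_nonneg ‖z‖
  have h1n : (1 : ℝ) ≤ (k : ℝ) + 1 := by linarith [k.cast_nonneg (α := ℝ)]
  have h1 : Real.log (1 + ‖z‖ ^ 2 / ((k : ℝ) + 1)) ≤ Real.log (1 + ‖z‖ ^ 2) := by
    refine Real.log_le_log (by positivity) ?_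
    have := div_le_self hs h1n
    linarith
  have h2 : 0 ≤ Real.log (1 + ‖z‖ ^ 2 / ((k : ℝ) + 1)) := Real.log_nonneg (by
    have : 0 ≤ ‖z‖ ^ 2 / ((k : ℝ) + 1) := by positivity
    linarith)
  rw [logCut, add_comm (‖z‖ ^ 2) 1, young]
  exact ⟨mul_nonneg hs (by linarith), mul_le_mul_of_nonneg_left (by linarith) hs⟩

theorem tendsto_mul_logCut_one (z : ℂ) :
    Tendsto (fun k : ℕ => ‖z‖ ^ 2 * logCut 1 (k + 1) (‖z‖ ^ 2)) atTop
      (𝓝 (young z - ‖z‖ ^ 2)) := by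
  have h := (tendsto_logCut (a := fun _ => 1) tendsto_const_nhds (s := ‖z‖ ^ 2)
    (by positivity)).const_mul (‖z‖ ^ 2)
  convert h using 2
  rw [young, add_comm 1 (‖z‖ ^ 2)]
  ring

/-- For `a = 1` the truncations are nonnegative and tend to `young z - |z|²`, so a uniform bound of
their integrals suffices. -/
theorem tame_of_logMomentCut_le {u : Lp ℂ 2 μ} {B : ℝ}
    (h : ∀ k : ℕ, logMomentCut 1 (k + 1) u ≤ B) : Tame u := by
  have h1n : ∀ k : ℕ, (1 : ℝ) ≤ (k : ℝ) + 1 := fun k => by linarith [k.cast_nonneg (α := ℝ)]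
  have h1 := (integrable_of_tendsto_of_integral_le
    (fun k : ℕ => integrable_logMomentCut one_pos (h1n k) u) (fun k ω => (mul_logCut_one_mem k _).1)
    (fun ω => tendsto_mul_logCut_one _) (Eventually.of_forall h)).1
  have h2 := h1.add (integrable_norm_sq u)
  refine h2.congr (ae_of_all _ fun ω => ?_)
  simp

theorem Tame.logMomentCut_le {u : Lp ℂ 2 μ} (hu : Tame u) (k : ℕ) :
    logMomentCut 1 (k + 1) u ≤ modular u :=
  integral_mono (integrable_logMomentCut one_pos (by linarith [k.cast_nonneg (α := ℝ)]) u) hu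
    fun ω => (mul_logCut_one_mem k _).2

theorem Tame.tendsto_logMomentCut_one {u : Lp ℂ 2 μ} (hu : Tame u) :
    Tendsto (fun k : ℕ => logMomentCut 1 (k + 1) u) atTop (𝓝 (modular u - ‖u‖ ^ 2)) := by
  have e : modular u - ‖u‖ ^ 2 = ∫ ω, (young (u ω) - ‖u ω‖ ^ 2) ∂μ := by
    rw [integral_sub hu (integrable_norm_sq u), integral_norm_sq]; rfl
  rw [e]
  refine tendsto_integral_of_dominated_convergence (fun ω => young (u ω)) (fun k =>
    (integrable_logMomentCut one_pos (by linarith [k.cast_nonneg (α := ℝ)]) u).1) hu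
    (fun k => ae_of_all _ fun ω => ?_) (ae_of_all _ fun ω => tendsto_mul_logCut_one _)
  rw [Real.norm_of_nonneg (mul_logCut_one_mem k _).1]
  exact (mul_logCut_one_mem k _).2

theorem Tame.tendsto_logMomentCut {u : Lp ℂ 2 μ} (hu : Tame u) :
    Tendsto (fun k : ℕ => logMomentCut (1 / ((k : ℝ) + 1)) (k + 1) u) atTop (𝓝 (logMoment u)) := by
  have h1n : ∀ k : ℕ, (1 : ℝ) ≤ (k : ℝ) + 1 := fun k => by linarith [k.cast_nonneg (α := ℝ)]
  have hle : ∀ k : ℕ, 1 / ((k : ℝ) + 1) ≤ k + 1 := fun k =>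
    ((div_le_one (by positivity)).2 (h1n k)).trans (h1n k)
  have hi : Integrable (fun ω => 1 + young (u ω) + 2 * young (u ω)) μ :=
    ((integrable_const _).add hu).add (Integrable.const_mul hu _)
  refine tendsto_integral_of_dominated_convergence _ (fun k =>
    (integrable_logMomentCut (by positivity) (hle k) u).1) hi
    (fun k => ae_of_all _ fun ω => ?_) (ae_of_all _ fun ω => ?_)
  · rcases eq_or_ne (u ω) 0 with h | h
    · rw [h, young_zero]; simp
    · have h2 := norm_mul_logMap_le one_pos le_rfl (u ω) (u ω)
      rw [Real.log_one] at h2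
      have h3 := abs_logCut_le (h1n k) (s := ‖u ω‖ ^ 2) (by positivity)
      rw [norm_mul, Real.norm_eq_abs, Real.norm_eq_abs, abs_of_nonneg (sq_nonneg _)]
      have h4 : ‖u ω‖ * ‖logMap (u ω)‖ = ‖u ω‖ ^ 2 * |Real.log (‖u ω‖ ^ 2)| := by
        rw [logMap, norm_smul, Real.norm_eq_abs]; ring
      have h5 := mul_le_mul_of_nonneg_left h3 (sq_nonneg ‖u ω‖)
      rw [h4] at h2
      norm_num at h2 h5 ⊢
      linarith
  · rcases eq_or_ne (u ω) 0 with h | h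
    · rw [h]; simp
    · have h2 := tendsto_logCut tendsto_one_div_add_atTop_nhds_zero_nat (s := ‖u ω‖ ^ 2)
        (by rw [add_zero]; positivity)
      rw [add_zero] at h2
      exact h2.const_mul _

/-- Up to time `T` the truncated moments change by at most `16 K T`, whatever the truncation is, so
their boundedness passes from one time to the other. The backward direction excludes that an
infinite entropy becomes finite. -/
theorem IsSol.tame_of_tame_zero (hs : IsSol V lam φ Φ) (hV : IsSobolev V) {T : ℝ} (hT : 0 ≤ T) :
    Tame (φ T) ↔ Tame (φ 0) := by
  have h1n : ∀ k : ℕ, (1 : ℝ) ≤ (k : ℝ) + 1 := fun k => by linarith [k.cast_nonneg (α := ℝ)]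
  obtain ⟨K, hK0, hK⟩ := hs.abs_totalCurrent_le hT
  have h1 : ∀ k : ℕ, |logMomentCut 1 (k + 1) (φ T) - logMomentCut 1 (k + 1) (φ 0)| ≤
      4 * (4 * K * T) := fun k => by
    rw [hs.logMomentCut_sub hV one_pos (h1n k) hT, abs_mul, abs_neg,
      abs_of_pos (by norm_num : (0 : ℝ) < 4)]
    refine mul_le_mul_of_nonneg_left ?_ (by norm_num)
    have h2 := intervalIntegral.norm_integral_le_of_norm_le_const (a := 0) (b := T) (C := 4 * K)
      (f := fun t => totalCurrent (entCutDeriv 1 ((k : ℝ) + 1)) (Φ t)) (fun t ht => by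
        rw [Set.uIoc_of_le hT] at ht
        exact hK t ht.1.le ht.2 _ _ fun s h => abs_mul_entCutDeriv_le one_pos (by positivity) h)
    rwa [sub_zero, abs_of_nonneg hT] at h2
  constructor
  · intro h
    refine tame_of_logMomentCut_le (B := modular (φ T) + 4 * (4 * K * T)) fun k => ?_
    have := (abs_le.1 (h1 k)).1
    have := h.logMomentCut_le k
    linarith
  · intro h
    refine tame_of_logMomentCut_le (B := modular (φ 0) + 4 * (4 * K * T)) fun k => ?_
    have := (abs_le.1 (h1 k)).2
    have := h.logMomentCut_le k
    linarith

/-- The limit of the densities `entCutDeriv 1 n` as `n → ∞`. -/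
def modularDensity (s : ℝ) : ℝ := -2 * (1 / (s + 1)) + s * (1 / (s + 1) ^ 2)

theorem abs_mul_modularDensity_le {s : ℝ} (hs : 0 ≤ s) : |s * modularDensity s| ≤ 4 := by
  have h := (tendsto_entCutDeriv (a := fun _ => 1) tendsto_const_nhds (s := s)
    (by positivity)).const_mul s
  exact le_of_tendsto' h.abs fun k => abs_mul_entCutDeriv_le one_pos (by positivity) hs

theorem continuousOn_modularDensity : ContinuousOn modularDensity (Set.Ici 0) := by
  have h1 : ∀ s ∈ Set.Ici (0 : ℝ), s + 1 ≠ 0 := fun s hs => by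
    have : 0 ≤ s := hs
    positivity
  unfold modularDensity
  exact (continuousOn_const.mul (continuousOn_const.div (by fun_prop) h1)).add
    (continuousOn_id.mul (continuousOn_const.div (by fun_prop) fun s hs => pow_ne_zero 2 (h1 s hs)))

/-- With `a = 1` the moments converge to `∫ |φ|² log (1 + |φ|²)`, the modular minus the mass. The
formula is used for the continuity of the modular in time. -/
theorem IsSol.modular_eq (hs : IsSol V lam φ Φ) (hV : IsSobolev V) (h0 : Tame (φ 0)) {T : ℝ}
    (hT : 0 ≤ T) :
    modular (φ T) = modular (φ 0) - 4 * ∫ t in (0 : ℝ)..T, totalCurrent modularDensity (Φ t) := by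
  have h1n : ∀ k : ℕ, (1 : ℝ) ≤ (k : ℝ) + 1 := fun k => by linarith [k.cast_nonneg (α := ℝ)]
  have hTt := (hs.tame_of_tame_zero hV hT).2 h0
  have h1 := hTt.tendsto_logMomentCut_one.sub h0.tendsto_logMomentCut_one
  simp_rw [hs.logMomentCut_sub hV one_pos (h1n _) hT] at h1
  have h2 := (hs.tendsto_integral_totalCurrent hV
    (h' := fun k : ℕ => entCutDeriv 1 ((k : ℝ) + 1)) (g := modularDensity) (C := 4)
    (fun k => (isRadial_entCut one_pos (h1n k)).cont)
    (fun k s h => abs_mul_entCutDeriv_le one_pos (by positivity) h)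
    (fun s h => tendsto_entCutDeriv (a := fun _ => 1) tendsto_const_nhds (by positivity)) hT).const_mul
      (-4)
  have h3 := tendsto_nhds_unique h1 h2
  rw [hs.norm_eq hV hT] at h3
  linarith

theorem IsSol.continuousOn_modular (hs : IsSol V lam φ Φ) (hV : IsSobolev V) (h0 : Tame (φ 0)) :
    ContinuousOn (fun t => modular (φ t)) (Set.Ici 0) := by
  have hm := hs.aestronglyMeasurable_totalCurrent hV continuousOn_modularDensity
    fun s h => abs_mul_modularDensity_le h
  intro t ht
  have ht0 : 0 ≤ t := ht
  have hT : 0 ≤ t + 1 := by linarith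
  have hi := hs.intervalIntegrable_totalCurrent hT hm fun s h => abs_mul_modularDensity_le h
  have h1 : ContinuousOn (fun x => ∫ t in (0 : ℝ)..x, totalCurrent modularDensity (Φ t))
      (Set.uIcc 0 (t + 1)) := by
    refine intervalIntegral.continuousOn_primitive_interval ?_
    rw [Set.uIcc_of_le hT]
    exact (intervalIntegrable_iff_integrableOn_Icc_of_le hT).1 hi
  rw [Set.uIcc_of_le hT] at h1
  have h2 : ContinuousWithinAt (fun x => ∫ t in (0 : ℝ)..x, totalCurrent modularDensity (Φ t))
      (Set.Ici 0) t := by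
    refine (h1 t ⟨ht0, by linarith⟩).mono_of_mem_nhdsWithin ?_
    rw [← Set.Ici_inter_Iic]
    exact inter_mem self_mem_nhdsWithin (mem_nhdsWithin_of_mem_nhds (Iic_mem_nhds (by linarith)))
  have h3 : ContinuousWithinAt (fun T => modular (φ 0) -
      4 * ∫ t in (0 : ℝ)..T, totalCurrent modularDensity (Φ t)) (Set.Ici 0) t :=
    continuousWithinAt_const.sub (continuousWithinAt_const.mul h2)
  exact h3.congr (fun s hs' => hs.modular_eq hV h0 hs') (hs.modular_eq hV h0 ht0)

theorem IsSol.modular_le (hs : IsSol V lam φ Φ) (hV : IsSobolev V) (h0 : Tame (φ 0)) {T : ℝ}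
    (hT : 0 ≤ T) : ∃ B, ∀ t, 0 ≤ t → t ≤ T → modular (φ t) ≤ B := by
  obtain ⟨B, hB⟩ := isCompact_Icc.bddAbove_image
    ((hs.continuousOn_modular hV h0).mono (Set.Icc_subset_Ici_self : Set.Icc 0 T ⊆ Set.Ici 0))
  exact ⟨B, fun t h1 h2 => hB ⟨t, ⟨h1, h2⟩, rfl⟩⟩

/-- The evolution of the entropy. -/
theorem IsSol.logMoment_sub (hs : IsSol V lam φ Φ) (hV : IsSobolev V) (h0 : Tame (φ 0)) {T : ℝ}
    (hT : 0 ≤ T) : logMoment (φ T) - logMoment (φ 0) =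
      4 * ∫ t in (0 : ℝ)..T, totalCurrent (fun s => 1 / s) (Φ t) := by
  have h1n : ∀ k : ℕ, (1 : ℝ) ≤ (k : ℝ) + 1 := fun k => by linarith [k.cast_nonneg (α := ℝ)]
  have hle : ∀ k : ℕ, 1 / ((k : ℝ) + 1) ≤ k + 1 := fun k =>
    ((div_le_one (by positivity)).2 (h1n k)).trans (h1n k)
  have hTt := (hs.tame_of_tame_zero hV hT).2 h0
  have h1 := hTt.tendsto_logMomentCut.sub h0.tendsto_logMomentCut
  simp_rw [fun k : ℕ => hs.logMomentCut_sub hV (by positivity : 0 < 1 / ((k : ℝ) + 1)) (hle k) hT]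
    at h1
  have h2 := (hs.tendsto_integral_totalCurrent hV
    (h' := fun k : ℕ => entCutDeriv (1 / ((k : ℝ) + 1)) ((k : ℝ) + 1)) (g := fun s => -(1 / s))
    (C := 4) (fun k => (isRadial_entCut (by positivity) (hle k)).cont)
    (fun k s h => abs_mul_entCutDeriv_le (by positivity) (by positivity) h)
    -- As `a → 0` and `n → ∞` the density becomes `-2/s + s/s² = -1/s`.
    (fun s h => by
      have h3 := tendsto_entCutDeriv tendsto_one_div_add_atTop_nhds_zero_nat (s := s)
        (by rw [add_zero]; exact h.ne')
      convert h3 using 2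
      rw [add_zero]
      field_simp
      norm_num) hT).const_mul (-4)
  rw [tendsto_nhds_unique h1 h2]
  have h4 : ∀ t, totalCurrent (fun s => -(1 / s)) (Φ t) =
      -totalCurrent (fun s => 1 / s) (Φ t) := fun t => by
    simp only [totalCurrent, current, neg_mul, integral_neg, Finset.sum_neg_distrib]
  simp_rw [h4, intervalIntegral.integral_neg]
  ring

end EntropyBalance

/-! ### Test functions of finite entropy and the regularized quadratic functional. -/

section Pairing

variable {Ω : Type*} [MeasurableSpace Ω] {μ : Measure Ω} [IsProbabilityMeasure μ]
  {ι : Type*} [Fintype ι] {V : ClosedSubmodule ℂ (Jet (Lp ℂ 2 μ) ι)}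
  {lam : ℝ} {φ : ℝ → Lp ℂ 2 μ} {Φ : ℝ → Jet (Lp ℂ 2 μ) ι}

theorem tendsto_form {A : Type*} {l : Filter A} {x y : A → Jet (Lp ℂ 2 μ) ι}
    {x₀ y₀ : Jet (Lp ℂ 2 μ) ι} (hx : Tendsto x l (𝓝 x₀)) (hy : Tendsto y l (𝓝 y₀)) :
    Tendsto (fun a => form (x a) (y a)) l (𝓝 (form x₀ y₀)) :=
  tendsto_finsetSum _ fun j _ => (((continuous_apply_jet _).tendsto _).comp hx).inner
    (((continuous_apply_jet _).tendsto _).comp hy)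

theorem pairNL_lam_zero (u v : Lp ℂ 2 μ) : pairNL 0 u v = 0 := by
  simp [pairNL, logNL]

/-- Finite entropy is demanded only if `lam ≠ 0`; for `lam = 0` the pairing vanishes. With
conditional hypotheses, one argument covers the linear equation with initial data of infinite
entropy. -/
theorem norm_pairNL_le_of_tame {u v : Lp ℂ 2 μ} (h0 : u ≠ 0) (hu : lam ≠ 0 → Tame u)
    (hv : lam ≠ 0 → Tame v) : ‖pairNL lam u v‖ ≤
      |lam| * (1 + modular u + 2 * modular v) + |lam * Real.log (‖u‖ ^ 2)| * (‖v‖ * ‖u‖) := by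
  by_cases hl : lam = 0
  · subst hl
    simp [pairNL_lam_zero]
  · rw [pairNL_eq lam h0 ((hu hl).integrable_logPair (hv hl))]
    have h1 := ((hu hl).norm_logPair_le (hv hl) one_pos le_rfl).2
    rw [Real.log_one] at h1
    refine (norm_sub_le _ _).trans (add_le_add ?_ ?_)
    · rw [norm_mul, Complex.norm_real, Real.norm_eq_abs]
      refine mul_le_mul_of_nonneg_left (h1.trans (le_of_eq ?_)) (abs_nonneg _)
      norm_num
    · rw [norm_mul, Complex.norm_real, Real.norm_eq_abs]
      exact mul_le_mul_of_nonneg_left (norm_inner_le_norm _ _) (abs_nonneg _)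

theorem tendsto_pairNL_of_tame {A : Type*} {l : Filter A} {B : ℝ} {u v : A → Lp ℂ 2 μ}
    {u₀ v₀ : Lp ℂ 2 μ} (h0 : u₀ ≠ 0) (hu : Tendsto u l (𝓝 u₀)) (hv : Tendsto v l (𝓝 v₀))
    (hut : lam ≠ 0 → ∀ᶠ a in l, Tame (u a) ∧ modular (u a) ≤ B)
    (hvt : lam ≠ 0 → ∀ᶠ a in l, Tame (v a)) (hu₀ : lam ≠ 0 → Tame u₀) (hv₀ : lam ≠ 0 → Tame v₀)
    (hvm : lam ≠ 0 → Tendsto (fun a => modular (v a - v₀)) l (𝓝 0)) :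
    Tendsto (fun a => pairNL lam (u a) (v a)) l (𝓝 (pairNL lam u₀ v₀)) := by
  by_cases hl : lam = 0
  · subst hl
    simp_rw [pairNL_lam_zero]
    exact tendsto_const_nhds
  · rw [pairNL_eq lam h0 ((hu₀ hl).integrable_logPair (hv₀ hl))]
    have h1 := tendsto_logPair hu (hut hl) (hvt hl) (hu₀ hl) (hv₀ hl) (hvm hl)
    have h3 : Tendsto (fun a => lam * Real.log (‖u a‖ ^ 2)) l (𝓝 (lam * Real.log (‖u₀‖ ^ 2))) :=
      ((hu.norm.pow 2).log (by simpa using h0)).const_mul _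
    have h4 := (h1.const_mul (lam : ℂ)).sub
      (((Complex.continuous_ofReal.tendsto _).comp h3).mul (hv.inner hu))
    refine h4.congr' ?_
    filter_upwards [hut hl, hvt hl, hu.eventually_ne h0] with a h5 h6 h7
    rw [pairNL_eq lam h7 (h5.1.integrable_logPair h6)]
    rfl

theorem IsSol.ne_zero (hs : IsSol V lam φ Φ) (hV : IsSobolev V) (h0 : φ 0 ≠ 0) {t : ℝ}
    (ht : 0 ≤ t) : φ t ≠ 0 := by
  rw [← norm_ne_zero_iff, hs.norm_eq hV ht, norm_ne_zero_iff]
  exact h0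

theorem modular_sup1_clamp_le {u : Lp ℂ 2 μ} (hu : Tame u) {M : ℝ} (hM : 0 < M) :
    modular (sup1 (clamp M) u) ≤ modular u := by
  refine integral_mono_ae (tame_of_bounded (norm_sup1_clamp_le hM u)) hu ?_
  filter_upwards [coeFn_sup1 (continuous_clamp hM) (growth_clamp hM) u] with ω h1
  rw [h1]
  exact young_le_young (norm_clamp_le_norm hM _)

/-- The equation tested against resolvents of functions in `L² log L`. -/
theorem IsSol.testedBy_res (hs : IsSol V lam φ Φ) (hV : IsSobolev V) (hne : φ 0 ≠ 0)
    (h0 : lam ≠ 0 → Tame (φ 0)) {ε : ℝ} (hε : 0 < ε) {η : Lp ℂ 2 μ} (hη : lam ≠ 0 → Tame η)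
    {s t : ℝ} (hs0 : 0 ≤ s) (ht0 : 0 ≤ t) : TestedBy lam φ Φ (res V ε η) s t := by
  have hφt : ∀ r, 0 ≤ r → lam ≠ 0 → Tame (φ r) := fun r hr hl =>
    (hs.tame_of_tame_zero hV hr).2 (h0 hl)
  -- Truncating `η` makes its resolvent bounded, by the maximum principle, hence admissible in the
  -- weak equation. The truncations converge to `η` in `L²` and in modular, and the resolvents are
  -- bounded on `L² log L`, so the equation passes to the limit.
  set x : ℕ → Jet (Lp ℂ 2 μ) ι := fun k => res V ε (sup1 (clamp (k + 1)) η) with hx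
  set m : ℝ := max s t with hm
  have hm0 : 0 ≤ m := hs0.trans (le_max_left _ _)
  have hmem : ∀ r ∈ Set.uIoc s t, 0 ≤ r ∧ r ≤ m := fun r hr => by
    rw [Set.uIoc, Set.mem_Ioc] at hr
    exact ⟨(le_min hs0 ht0).trans hr.1.le, hr.2⟩
  have hxt : Tendsto x atTop (𝓝 (res V ε η)) :=
    ((continuous_res ε).tendsto η).comp (tendsto_sup1_clamp η)
  have hxt0 : Tendsto (fun k => x k none) atTop (𝓝 (res V ε η none)) :=
    ((continuous_apply_jet none).tendsto _).comp hxt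
  have hk1 : ∀ k : ℕ, (0 : ℝ) < k + 1 := fun k => by positivity
  have hclt : ∀ k : ℕ, Tame (sup1 (clamp (k + 1)) η) := fun k =>
    tame_of_bounded (norm_sup1_clamp_le (hk1 k) η)
  have htest : ∀ k, TestedBy lam φ Φ (x k) s t := fun k =>
    hs.eqn _ (res_mem V ε _) (k + 1)
      (hV.norm_res_le_of_bound (hk1 k) hε (norm_sup1_clamp_le (hk1 k) η)) s t hs0 ht0
  obtain ⟨K, hK⟩ := hs.bounded m hm0
  obtain ⟨X, hX⟩ := hxt.norm.bddAbove_range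
  have hX' : ∀ k, ‖x k‖ ≤ X := fun k => hX ⟨k, rfl⟩
  have hX0 : 0 ≤ X := (norm_nonneg _).trans (hX' 0)
  obtain ⟨B, hB⟩ : ∃ B, lam ≠ 0 → ∀ r, 0 ≤ r → r ≤ m → modular (φ r) ≤ B := by
    by_cases hl : lam = 0
    · exact ⟨0, fun h => absurd hl h⟩
    · obtain ⟨B, hB⟩ := hs.modular_le hV (h0 hl) hm0
      exact ⟨B, fun _ => hB⟩
  set D : ℝ := X * K + (|lam| * (1 + B + 2 * (10 * modular η)) +
    |lam * Real.log (‖φ 0‖ ^ 2)| * (X * ‖φ 0‖)) with hD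
  set g : ℕ → ℝ → ℂ := fun k r => form (x k) (Φ r) + pairNL lam (φ r) (x k none) with hg
  set g₀ : ℝ → ℂ := fun r => form (res V ε η) (Φ r) + pairNL lam (φ r) (res V ε η none) with hg₀
  have hbound : ∀ k, ∀ r ∈ Set.uIoc s t, ‖g k r‖ ≤ D := fun k r hr => by
    obtain ⟨hr0, hrm⟩ := hmem r hr
    have h1 := norm_form_le (x k) (Φ r)
    have h2 : ‖x k‖ * ‖Φ r‖ ≤ X * K := mul_le_mul (hX' k) (hK r hr0 hrm) (norm_nonneg _) hX0
    have h3 := norm_pairNL_le_of_tame (lam := lam) (v := x k none) (hs.ne_zero hV hne hr0)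
      (hφt r hr0) fun hl => (hV.tame_res hε (hclt k)).1
    rw [hs.norm_eq hV hr0] at h3
    have h4 : |lam| * (1 + modular (φ r) + 2 * modular (x k none)) ≤
        |lam| * (1 + B + 2 * (10 * modular η)) := by
      by_cases hl : lam = 0
      · simp [hl]
      · have h5 := (hV.tame_res hε (hclt k)).2
        have h6 := modular_sup1_clamp_le (hη hl) (hk1 k)
        have h7 := hB hl r hr0 hrm
        have h8 : modular (x k none) ≤ 10 * modular η := by linarith
        gcongr
    have h5 : ‖x k none‖ * ‖φ 0‖ ≤ X * ‖φ 0‖ := by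
      gcongr
      exact (norm_none_le _).trans (hX' k)
    have h6 := mul_le_mul_of_nonneg_left h5 (abs_nonneg (lam * Real.log (‖φ 0‖ ^ 2)))
    exact (norm_add_le _ _).trans (by linarith)
  have hlim : ∀ r ∈ Set.uIoc s t, Tendsto (fun k => g k r) atTop (𝓝 (g₀ r)) := fun r hr => by
    obtain ⟨hr0, hrm⟩ := hmem r hr
    have h1 : Tendsto (fun k => form (x k) (Φ r)) atTop (𝓝 (form (res V ε η) (Φ r))) :=
      tendsto_form hxt tendsto_const_nhds
    refine h1.add (tendsto_pairNL_of_tame (B := B) (hs.ne_zero hV hne hr0) tendsto_const_nhds hxt0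
      (fun hl => Eventually.of_forall fun _ => ⟨hφt r hr0 hl, hB hl r hr0 hrm⟩)
      (fun hl => Eventually.of_forall fun k => (hV.tame_res hε (hclt k)).1)
      (hφt r hr0) (fun hl => (hV.tame_res hε (hη hl)).1) fun hl => ?_)
    refine squeeze_zero (fun k => modular_nonneg _) (fun k => ?_)
      (by simpa using (tendsto_modular_sub_clamp (hη hl)).const_mul 10)
    rw [← PiLp.sub_apply, ← map_sub]
    exact (hV.tame_res hε ((hclt k).sub (hη hl))).2
  have hmeas : ∀ k, AEStronglyMeasurable (g k) (volume.restrict (Set.uIoc s t)) := fun k =>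
    (intervalIntegrable_iff.1 (htest k).1).aestronglyMeasurable
  have hD0 : ∀ r ∈ Set.uIoc s t, ‖g₀ r‖ ≤ D := fun r hr =>
    le_of_tendsto' (hlim r hr).norm fun k => hbound k r hr
  refine ⟨?_, ?_⟩
  · rw [intervalIntegrable_iff]
    have h1 : IntegrableOn (fun _ => D) (Set.uIoc s t) volume :=
      intervalIntegrable_iff.1 intervalIntegrable_const
    refine Integrable.mono' h1 ?_ ?_
    · exact aestronglyMeasurable_of_tendsto_ae atTop hmeas
        ((ae_restrict_iff' measurableSet_uIoc).2 (ae_of_all _ hlim))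
    · exact (ae_restrict_iff' measurableSet_uIoc).2 (ae_of_all _ hD0)
  · have h1 := intervalIntegral.tendsto_integral_filter_of_dominated_convergence (F := g) (f := g₀)
      (fun _ => D) (Eventually.of_forall hmeas)
      (Eventually.of_forall fun k => ae_of_all _ (hbound k)) intervalIntegrable_const
      (ae_of_all _ hlim)
    have h2 : Tendsto (fun k => inner ℂ (x k none) (φ t - φ s)) atTop
        (𝓝 (inner ℂ (res V ε η none) (φ t - φ s))) := hxt0.inner tendsto_const_nhds
    refine tendsto_nhds_unique h2 ((h1.const_mul (-Complex.I)).congr fun k => ?_)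
    exact (htest k).2.symm

/-- Continuity in `L²` and continuity of the modular together give continuity with respect to the
modular. -/
theorem IsSol.tendsto_modular (hs : IsSol V lam φ Φ) (hV : IsSobolev V) (h0 : Tame (φ 0)) {t : ℝ}
    (ht : 0 ≤ t) : Tendsto (fun r => modular (φ r - φ t)) (𝓝[Set.Ici 0] t) (𝓝 0) := by
  refine tendsto_modular_sub (hs.cont t ht) ?_ ((hs.tame_of_tame_zero hV ht).2 h0)
    (hs.continuousOn_modular hV h0 t ht)
  filter_upwards [self_mem_nhdsWithin] with r hr
  exact (hs.tame_of_tame_zero hV hr).2 h0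

theorem IsSol.tendsto_pairNL_res (hs : IsSol V lam φ Φ) (hV : IsSobolev V) (hne : φ 0 ≠ 0)
    (h0 : lam ≠ 0 → Tame (φ 0)) {ε : ℝ} (hε : 0 < ε) {A : Type*} {l : Filter A} {t : ℝ}
    (ht : 0 ≤ t) {r : A → ℝ} (hr : Tendsto r l (𝓝[Set.Ici 0] t)) {η : A → Lp ℂ 2 μ}
    {η₀ : Lp ℂ 2 μ} (hη : Tendsto η l (𝓝 η₀)) (hηt : lam ≠ 0 → ∀ᶠ a in l, Tame (η a))
    (hη₀ : lam ≠ 0 → Tame η₀) (hηm : lam ≠ 0 → Tendsto (fun a => modular (η a - η₀)) l (𝓝 0)) :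
    Tendsto (fun a => pairNL lam (φ (r a)) (res V ε (η a) none)) l
      (𝓝 (pairNL lam (φ t) (res V ε η₀ none))) := by
  have hr0 : ∀ᶠ a in l, 0 ≤ r a := hr.eventually self_mem_nhdsWithin
  have hφt : ∀ r, 0 ≤ r → lam ≠ 0 → Tame (φ r) := fun r hr hl =>
    (hs.tame_of_tame_zero hV hr).2 (h0 hl)
  refine tendsto_pairNL_of_tame (B := modular (φ t) + 1) (hs.ne_zero hV hne ht)
    ((hs.cont t ht).tendsto.comp hr) (((continuous_res_none ε).tendsto _).comp hη) (fun hl => ?_)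
    (fun hl => ?_) (hφt t ht) (fun hl => (hV.tame_res hε (hη₀ hl)).1) fun hl => ?_
  · have h1 : Tendsto (fun a => modular (φ (r a))) l (𝓝 (modular (φ t))) :=
      ((hs.continuousOn_modular hV (h0 hl)) t ht).tendsto.comp hr
    filter_upwards [hr0, h1.eventually (gt_mem_nhds (lt_add_one _))] with a h2 h3
    exact ⟨hφt _ h2 hl, h3.le⟩
  · filter_upwards [hηt hl] with a h2
    exact (hV.tame_res hε h2).1
  · refine squeeze_zero' (Eventually.of_forall fun k => modular_nonneg _) ?_
      (by simpa using (hηm hl).const_mul 10)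
    filter_upwards [hηt hl] with a h2
    rw [← PiLp.sub_apply, ← map_sub]
    exact (hV.tame_res hε (h2.sub (hη₀ hl))).2

/-- By symmetry of the resolvent `J` the increment is exactly `Re ⟨J (φ(t') + φ(t)), φ(t') - φ(t)⟩`,
a test of the weak equation. The linear part contributes nothing, because `⟨φ - J φ, φ⟩` is real. -/
theorem IsSol.hasDerivWithinAt_inner_res (hs : IsSol V lam φ Φ) (hV : IsSobolev V) (hne : φ 0 ≠ 0)
    (h0 : lam ≠ 0 → Tame (φ 0)) {ε : ℝ} (hε : 0 < ε) {t : ℝ} (ht : 0 ≤ t) :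
    HasDerivWithinAt (fun t => (inner ℂ (res V ε (φ t) none) (φ t)).re)
      (2 * (pairNL lam (φ t) (res V ε (φ t) none)).im) (Set.Ici 0) t := by
  have hφt : ∀ r, 0 ≤ r → lam ≠ 0 → Tame (φ r) := fun r hr hl =>
    (hs.tame_of_tame_zero hV hr).2 (h0 hl)
  have hη : Tendsto (fun t' => φ t' + φ t) (𝓝[Set.Ici 0] t) (𝓝 (φ t + φ t)) :=
    (hs.cont t ht).tendsto.add tendsto_const_nhds
  have hmain := hs.hasDerivWithinAt_res (V := V) hε ht (fun t' => φ t' + φ t) (φ t + φ t) hη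
    (y := fun t => (inner ℂ (res V ε (φ t) none) (φ t)).re) ?_
    (fun t' ht' => hs.testedBy_res hV hne h0 hε (fun hl => (hφt t' ht' hl).add (hφt t ht hl)) ht ht')
    ?_
  · refine hmain.congr_deriv ?_
    have hreal : ∀ u : Lp ℂ 2 μ, (inner ℂ (res V ε u none) u).im = 0 := fun u => by
      have h1 := congrArg Complex.im (inner_conj_symm (𝕜 := ℂ) u (res V ε u none))
      rw [← res_selfadjoint hε, Complex.conj_im] at h1
      linarith
    have h2 : pairNL lam (φ t) (res V ε (φ t + φ t) none) =
        ((2 : ℝ) : ℂ) * pairNL lam (φ t) (res V ε (φ t) none) := by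
      rw [map_add, PiLp.add_apply, pairNL, pairNL, ← integral_const_mul]
      refine integral_congr_ae ?_
      filter_upwards [Lp.coeFn_add (res V ε (φ t) none) (res V ε (φ t) none)] with ω hω
      rw [hω, Pi.add_apply, map_add]
      push_cast
      ring
    rw [h2, Complex.add_im, Complex.im_ofReal_mul, Complex.im_ofReal_mul, inner_sub_left, map_add,
      PiLp.add_apply, inner_add_left, inner_add_left, Complex.sub_im, Complex.add_im,
      Complex.add_im, hreal, inner_self_ofReal, Complex.ofReal_im]
    ring
  · refine hs.tendsto_pairNL_res hV hne h0 hε ht tendsto_fst (hη.comp tendsto_snd) (fun hl => ?_)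
      (fun hl => (hφt t ht hl).add (hφt t ht hl)) fun hl => ?_
    · have h1 : ∀ᶠ p in 𝓝[Set.Ici (0 : ℝ)] t ×ˢ 𝓝[Set.Ici (0 : ℝ)] t, 0 ≤ p.2 :=
        tendsto_snd.eventually self_mem_nhdsWithin
      filter_upwards [h1] with p hp
      exact (hφt _ hp hl).add (hφt t ht hl)
    · have h1 := (hs.tendsto_modular hV (h0 hl) ht).comp
        (tendsto_snd (f := 𝓝[Set.Ici (0 : ℝ)] t) (g := 𝓝[Set.Ici (0 : ℝ)] t))
      refine h1.congr fun p => ?_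
      simp only [Function.comp_apply, add_sub_add_right_eq_sub]
  · intro t' ht'
    have h1 := congrArg Complex.re (inner_conj_symm (𝕜 := ℂ) (φ t) (res V ε (φ t') none))
    rw [← res_selfadjoint hε, Complex.conj_re] at h1
    rw [map_add, PiLp.add_apply, inner_add_left, inner_sub_right, inner_sub_right, Complex.add_re,
      Complex.sub_re, Complex.sub_re]
    linarith

end Pairing

/-! ### Derivatives on the zero set and continuity of the singular current. -/

section ZeroSet

variable {Ω : Type*} [MeasurableSpace Ω] {μ : Measure Ω} [IsProbabilityMeasure μ]
  {ι : Type*} [Fintype ι] {V : ClosedSubmodule ℂ (Jet (Lp ℂ 2 μ) ι)}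
  {lam : ℝ} {φ : ℝ → Lp ℂ 2 μ} {Φ : ℝ → Jet (Lp ℂ 2 μ) ι}

/-- A bump of the value `0`. -/
def zeroCut (n s : ℝ) : ℝ := 1 / (1 + n * s)

def zeroCutDeriv (n s : ℝ) : ℝ := -(n / (1 + n * s) ^ 2)

theorem isRadial_zeroCut {n : ℝ} (hn : 0 ≤ n) : IsRadial (zeroCut n) (zeroCutDeriv n) 1 where
  hasDeriv s hs := by
    have h0 : 1 + n * s ≠ 0 := by positivity
    have h1 := (((hasDerivAt_id s).const_mul n).const_add 1).inv h0
    simp only [id_eq, mul_one] at h1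
    unfold zeroCut
    simp only [one_div]
    exact h1.congr_deriv (by rw [zeroCutDeriv, neg_div])
  cont := by
    unfold zeroCutDeriv
    refine (continuousOn_const.div (by fun_prop) fun s hs => ?_).neg
    have : 0 ≤ s := hs
    positivity
  bound s hs := by
    rw [zeroCut, abs_of_nonneg (by positivity), div_le_one (by positivity)]
    have : 0 ≤ n * s := by positivity
    linarith
  bound_deriv s hs := by
    rw [zeroCutDeriv, mul_neg, abs_neg, abs_of_nonneg (by positivity), ← mul_div_assoc,
      div_le_one (by positivity)]
    nlinarith [mul_nonneg hn hs, sq_nonneg (n * s)]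

theorem tendsto_div_one_add_mul {c : ℝ} (hc : 0 < c) (a : ℝ) :
    Tendsto (fun n : ℕ => a / (1 + (n : ℝ) * c)) atTop (𝓝 0) :=
  tendsto_const_nhds.div_atTop (tendsto_atTop_add_const_left _ _
    (tendsto_natCast_atTop_atTop.atTop_mul_const hc))

theorem tendsto_radialDeriv_zeroCut (z w : ℂ) :
    Tendsto (fun n : ℕ => radialDeriv (zeroCut n) (zeroCutDeriv n) z w) atTop
      (𝓝 (if z = 0 then w else 0)) := by
  by_cases hz : z = 0
  · simp [hz, radialDeriv, zeroCut]
  · rw [if_neg hz]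
    have hc : 0 < ‖z‖ ^ 2 := by positivity
    have h1 : Tendsto (fun n : ℕ => zeroCut n (‖z‖ ^ 2)) atTop (𝓝 0) :=
      tendsto_div_one_add_mul hc 1
    have h2 : Tendsto (fun n : ℕ => zeroCutDeriv n (‖z‖ ^ 2)) atTop (𝓝 0) := by
      have h3 := h1.mul (((h1.const_sub 1).mul_const (‖z‖ ^ 2)⁻¹).neg)
      rw [zero_mul] at h3
      refine h3.congr fun n => ?_
      have : 1 + (n : ℝ) * ‖z‖ ^ 2 ≠ 0 := by positivity
      rw [zeroCut, zeroCutDeriv]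
      field_simp
      ring
    unfold radialDeriv
    have h4 := (h1.smul_const w).add ((((h2.const_mul 2).mul_const (starRingEnd ℂ z * w).re)).smul_const z)
    simpa using h4

theorem tendsto_radial_zeroCut (z : ℂ) :
    Tendsto (fun n : ℕ => radial (zeroCut n) z) atTop (𝓝 0) := by
  by_cases hz : z = 0
  · simp [hz, radial]
  · have hc : 0 < ‖z‖ ^ 2 := by positivity
    have h1 : Tendsto (fun n : ℕ => zeroCut n (‖z‖ ^ 2)) atTop (𝓝 0) :=
      tendsto_div_one_add_mul hc 1
    unfold radial
    simpa using h1.smul_const z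

theorem tendsto_Lp_of_dominated {u : ℕ → Lp ℂ 2 μ} {v w : Lp ℂ 2 μ} {C : ℝ}
    (hb : ∀ n, ∀ᵐ ω ∂μ, ‖u n ω‖ ≤ C * ‖w ω‖) (h : ∀ᵐ ω ∂μ, Tendsto (fun n => u n ω) atTop (𝓝 (v ω))) :
    Tendsto u atTop (𝓝 v) := by
  rw [tendsto_iff_norm_sub_tendsto_zero]
  have h1 : Tendsto (fun n => ∫ ω, ‖(u n - v) ω‖ ^ 2 ∂μ) atTop (𝓝 (∫ ω, (0 : ℝ) ∂μ)) := by
    refine tendsto_integral_of_dominated_convergence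
      (fun ω => 2 * (C ^ 2 * ‖w ω‖ ^ 2) + 2 * ‖v ω‖ ^ 2)
      (fun k => (integrable_norm_sq _).1)
      ((((integrable_norm_sq w).const_mul _).const_mul _).add ((integrable_norm_sq v).const_mul _))
      (fun n => ?_) ?_
    · filter_upwards [hb n, Lp.coeFn_sub (u n) v] with ω h1 h2
      rw [h2, Pi.sub_apply, Real.norm_of_nonneg (by positivity)]
      have h3 := norm_sub_le (u n ω) (v ω)
      have h4 : ‖u n ω - v ω‖ ^ 2 ≤ (‖u n ω‖ + ‖v ω‖) ^ 2 := by gcongr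
      have h5 : ‖u n ω‖ ^ 2 ≤ (C * ‖w ω‖) ^ 2 := by gcongr
      nlinarith [sq_nonneg (‖u n ω‖ - ‖v ω‖)]
    · have h3 : ∀ᵐ ω ∂μ, ∀ n, (u n - v) ω = u n ω - v ω := by
        rw [ae_all_iff]
        exact fun n => Lp.coeFn_sub (u n) v
      filter_upwards [h3, h] with ω h4 h5
      simp_rw [h4]
      simpa using ((h5.sub_const (v ω)).norm).pow 2
  simp only [integral_zero] at h1
  simp_rw [integral_norm_sq] at h1
  simpa [Real.sqrt_sq] using h1.sqrt

/-- The derivatives of `u` vanish almost everywhere on the zero set of `u`. -/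
theorem IsSobolev.ae_eq_zero (hV : IsSobolev V) {x : Jet (Lp ℂ 2 μ) ι} (hx : x ∈ V) (j : ι) :
    ∀ᵐ ω ∂μ, x none ω = 0 → x (some j) ω = 0 := by
  have hr := fun n : ℕ => isRadial_zeroCut (n := n) n.cast_nonneg
  have hmem : ∀ j : ι, MemLp (fun ω => if x none ω = 0 then x (some j) ω else 0) 2 μ := fun j => by
    refine MemLp.of_le (Lp.memLp (x (some j))) ?_ (ae_of_all _ fun ω => ?_)
    · have h1 := fun n : ℕ => (Lp.aestronglyMeasurable (radialJet (zeroCut n) (zeroCutDeriv n) x (some j)))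
      refine aestronglyMeasurable_of_tendsto_ae atTop h1 ?_
      have h2 : ∀ᵐ ω ∂μ, ∀ n : ℕ, radialJet (zeroCut n) (zeroCutDeriv n) x (some j) ω =
          radialDeriv (zeroCut n) (zeroCutDeriv n) (x none ω) (x (some j) ω) := by
        rw [ae_all_iff]
        exact fun n => (hr n).coeFn_radialJet_some x j
      filter_upwards [h2] with ω hω
      simp_rw [hω]
      exact tendsto_radialDeriv_zeroCut _ _
    · split_ifs
      · rfl
      · simp
  -- The jets of `u / (1 + n |u|²)` belong to `V` and converge to this jet. Its value is zero, so
  -- its derivatives, those of `u` restricted to the zero set, vanish by uniqueness.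
  set y : Jet (Lp ℂ 2 μ) ι := WithLp.toLp 2 fun o => o.elim 0 fun j => (hmem j).toLp with hy
  have hlim : Tendsto (fun n : ℕ => radialJet (zeroCut n) (zeroCutDeriv n) x) atTop (𝓝 y) := by
    have h1 : ∀ o, Tendsto (fun n : ℕ => radialJet (zeroCut n) (zeroCutDeriv n) x o) atTop
        (𝓝 (y o)) := by
      rintro (_ | j)
      · refine tendsto_Lp_of_dominated (w := x none) (C := 1) (fun n => ?_) ?_
        · filter_upwards [(hr n).coeFn_radialJet_none x] with ω hω
          rw [hω]
          exact (hr n).norm_radial_le _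
        · have h2 : ∀ᵐ ω ∂μ, ∀ n : ℕ, radialJet (zeroCut n) (zeroCutDeriv n) x none ω =
              radial (zeroCut n) (x none ω) := by
            rw [ae_all_iff]
            exact fun n => (hr n).coeFn_radialJet_none x
          filter_upwards [h2, Lp.coeFn_zero ℂ 2 μ] with ω h3 h4
          simp_rw [h3]
          have h5 : y none ω = 0 := h4
          rw [h5]
          exact tendsto_radial_zeroCut _
      · refine tendsto_Lp_of_dominated (w := x (some j)) (C := 3 * 1) (fun n => ?_) ?_
        · filter_upwards [(hr n).coeFn_radialJet_some x j] with ω hω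
          rw [hω]
          exact (hr n).norm_radialDeriv_le _ _
        · have h2 : ∀ᵐ ω ∂μ, ∀ n : ℕ, radialJet (zeroCut n) (zeroCutDeriv n) x (some j) ω =
              radialDeriv (zeroCut n) (zeroCutDeriv n) (x none ω) (x (some j) ω) := by
            rw [ae_all_iff]
            exact fun n => (hr n).coeFn_radialJet_some x j
          filter_upwards [h2, (hmem j).coeFn_toLp] with ω h3 h4
          simp_rw [h3]
          have h5 : y (some j) ω = if x none ω = 0 then x (some j) ω else 0 := h4
          rw [h5]
          exact tendsto_radialDeriv_zeroCut _ _
    have h2 : Tendsto (fun n : ℕ => WithLp.ofLp (radialJet (zeroCut n) (zeroCutDeriv n) x)) atTop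
        (𝓝 (WithLp.ofLp y)) := tendsto_pi_nhds.2 h1
    have h3 := ((PiLp.continuous_toLp 2 (fun _ : Option ι => Lp ℂ 2 μ)).tendsto _).comp h2
    exact h3
  have hyV : y ∈ V := V.isClosed.mem_of_tendsto hlim
    (Eventually.of_forall fun n => hV.chain (hr n) x hx)
  have hy0 : y = 0 := hV.unique y hyV rfl
  have hyj : (hmem j).toLp = 0 := by
    have h1 : y (some j) = (hmem j).toLp := rfl
    rw [← h1, hy0]
    rfl
  have h2 := (hmem j).coeFn_toLp
  rw [hyj] at h2
  filter_upwards [h2, Lp.coeFn_zero ℂ 2 μ] with ω h3 h4 h5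
  rw [h4] at h3
  rw [if_pos h5] at h3
  exact h3.symm

/-- The defect of the approximation of the singular current. -/
def defect (k : ℝ) (z w : ℂ) : ℝ := ‖w‖ ^ 2 / (1 + k * ‖z‖ ^ 2)

theorem continuous_defect {k : ℝ} (hk : 0 ≤ k) : Continuous fun p : ℂ × ℂ => defect k p.1 p.2 := by
  unfold defect
  refine Continuous.div (by fun_prop) (by fun_prop) fun p => ?_
  positivity

theorem defect_nonneg {k : ℝ} (hk : 0 ≤ k) (z w : ℂ) : 0 ≤ defect k z w := by
  unfold defect; positivity

theorem defect_le {k : ℝ} (hk : 0 ≤ k) (z w : ℂ) : defect k z w ≤ ‖w‖ ^ 2 :=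
  div_le_self (sq_nonneg _) (by
    have : 0 ≤ k * ‖z‖ ^ 2 := by positivity
    linarith)

theorem growth_defect {k : ℝ} (hk : 0 ≤ k) (z w : ℂ) :
    ‖defect k z w‖ ≤ 1 * (1 + (‖z‖ ^ 2 + ‖w‖ ^ 2)) := by
  rw [Real.norm_of_nonneg (defect_nonneg hk z w)]
  have := defect_le hk z w
  nlinarith [sq_nonneg ‖z‖]

/-- A regular approximation of `1 / s`. -/
def invCut (k s : ℝ) : ℝ := k / (1 + k * s)

theorem abs_mul_invCut_le {k : ℝ} (hk : 0 ≤ k) (s : ℝ) (hs : 0 ≤ s) : |s * invCut k s| ≤ 1 := by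
  rw [invCut, abs_of_nonneg (by positivity), ← mul_div_assoc, div_le_one (by positivity)]
  linarith

theorem continuousOn_invCut {k : ℝ} (hk : 0 ≤ k) : ContinuousOn (invCut k) (Set.Ici 0) := by
  unfold invCut
  refine continuousOn_const.div (by fun_prop) fun s hs => ?_
  have : 0 ≤ s := hs
  positivity

theorem abs_mul_one_div_le (s : ℝ) (hs : 0 ≤ s) : |s * (1 / s)| ≤ 1 := by
  rcases hs.eq_or_lt with rfl | h
  · simp
  · rw [mul_one_div_cancel h.ne', abs_one]

/-- With `s = |z|²`, the difference `1/s - k/(1 + k s)` of the densities is `1/(s (1 + k s))`, and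
the product of real and imaginary part is at most `|z|² |w|²`. -/
theorem abs_current_sub_le {k : ℝ} (hk : 0 ≤ k) (z w : ℂ) :
    |current (fun s => 1 / s) z w - current (invCut k) z w| ≤ defect k z w := by
  by_cases hz : z = 0
  · simp only [hz, current, map_zero, zero_mul, Complex.zero_re, Complex.zero_im, mul_zero, sub_zero,
      abs_zero]
    exact defect_nonneg hk _ _
  · have h0 : 0 < ‖z‖ := by positivity
    have e : current (fun s => 1 / s) z w - current (invCut k) z w =
        1 / (‖z‖ ^ 2 * (1 + k * ‖z‖ ^ 2)) * ((starRingEnd ℂ z * w).re * (starRingEnd ℂ z * w).im) := by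
      rw [current, current, invCut]
      have : 1 + k * ‖z‖ ^ 2 ≠ 0 := by positivity
      field_simp
      ring
    rw [e, abs_mul, abs_mul, abs_of_nonneg (by positivity)]
    calc _ ≤ 1 / (‖z‖ ^ 2 * (1 + k * ‖z‖ ^ 2)) * ((‖z‖ * ‖w‖) * (‖z‖ * ‖w‖)) := by
          gcongr
          · exact abs_re_conj_mul_le z w
          · exact abs_im_conj_mul_le z w
      _ = _ := by
          rw [defect]
          field_simp

theorem integrable_current_one_div (u v : Lp ℂ 2 μ) :
    Integrable (fun ω => current (fun s => 1 / s) (u ω) (v ω)) μ := by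
  refine Integrable.mono' (g := fun ω => 1 * ‖v ω‖ ^ 2) ((integrable_norm_sq v).const_mul 1) ?_
    (ae_of_all _ fun ω => abs_current_le abs_mul_one_div_le _ _)
  have h1 := fun n : ℕ => (integrable_int2 (continuous_current (continuousOn_invCut (k := n) n.cast_nonneg))
    (growth_current (abs_mul_invCut_le (k := n) n.cast_nonneg)) u v).1
  refine aestronglyMeasurable_of_tendsto_ae atTop h1 (ae_of_all _ fun ω => ?_)
  refine tendsto_current (fun s hs => ?_) _ _
  have h2 := (tendsto_div_one_add_mul hs 1).const_sub 1
  have h3 := h2.mul_const (1 / s)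
  rw [sub_zero, one_mul] at h3
  refine h3.congr fun n => ?_
  have : 1 + (n : ℝ) * s ≠ 0 := by positivity
  rw [invCut]
  field_simp
  ring

/-- The total defect. -/
def totalDefect (k : ℝ) (x : Jet (Lp ℂ 2 μ) ι) : ℝ :=
  ∑ j, ∫ ω, defect k (x none ω) (x (some j) ω) ∂μ

theorem abs_totalCurrent_sub_le {k : ℝ} (hk : 0 ≤ k) (x : Jet (Lp ℂ 2 μ) ι) :
    |totalCurrent (fun s => 1 / s) x - totalCurrent (invCut k) x| ≤ totalDefect k x := by
  rw [totalCurrent, totalCurrent, ← Finset.sum_sub_distrib]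
  refine (Finset.abs_sum_le_sum_abs _ _).trans (Finset.sum_le_sum fun j _ => ?_)
  have h1 := integrable_int2 (continuous_current (continuousOn_invCut hk))
    (growth_current (abs_mul_invCut_le hk)) (x none) (x (some j))
  rw [← integral_sub (integrable_current_one_div _ _) h1, ← Real.norm_eq_abs]
  exact norm_integral_le_of_norm_le (integrable_int2 (continuous_defect hk) (growth_defect hk) _ _)
    (ae_of_all _ fun ω => abs_current_sub_le hk _ _)

theorem continuous_totalDefect {k : ℝ} (hk : 0 ≤ k) :
    Continuous (totalDefect k : Jet (Lp ℂ 2 μ) ι → ℝ) := by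
  unfold totalDefect
  refine continuous_finsetSum _ fun j _ => ?_
  exact (continuous_int2 (μ := μ) (continuous_defect hk) (growth_defect hk)).comp
    ((continuous_apply_jet none).prodMk (continuous_apply_jet (some j)))

/-- The defect tends to zero where `u ≠ 0` and stays equal to `|∂_j u|²` where `u = 0`; there the
derivative vanishes almost everywhere. -/
theorem IsSobolev.tendsto_totalDefect (hV : IsSobolev V) {x : Jet (Lp ℂ 2 μ) ι} (hx : x ∈ V) :
    Tendsto (fun k : ℕ => totalDefect k x) atTop (𝓝 0) := by
  have h0 : (0 : ℝ) = ∑ j : ι, ∫ ω, (0 : ℝ) ∂μ := by simp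
  rw [h0]
  refine tendsto_finsetSum _ fun j _ => ?_
  refine tendsto_integral_of_dominated_convergence (fun ω => ‖x (some j) ω‖ ^ 2)
    (fun k => (integrable_int2 (continuous_defect k.cast_nonneg) (growth_defect k.cast_nonneg) _ _).1)
    (integrable_norm_sq _) (fun k => ae_of_all _ fun ω => ?_) ?_
  · rw [Real.norm_of_nonneg (defect_nonneg k.cast_nonneg _ _)]
    exact defect_le k.cast_nonneg _ _
  · filter_upwards [hV.ae_eq_zero hx j] with ω hω
    by_cases h : x none ω = 0
    · simp [defect, hω h]
    · exact tendsto_div_one_add_mul (by positivity) _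

/-- The singular current is continuous at the elements of `V`. -/
theorem IsSobolev.tendsto_totalCurrent_one_div (hV : IsSobolev V) {A : Type*} {l : Filter A}
    {y : A → Jet (Lp ℂ 2 μ) ι} {x : Jet (Lp ℂ 2 μ) ι} (hx : x ∈ V) (hy : Tendsto y l (𝓝 x)) :
    Tendsto (fun a => totalCurrent (fun s => 1 / s) (y a)) l
      (𝓝 (totalCurrent (fun s => 1 / s) x)) := by
  rw [tendsto_iff_norm_sub_tendsto_zero]
  refine tendsto_zero_of_double (m := atTop) (y := fun (k : ℕ) a => totalDefect k (y a) +
      totalDefect k x + |totalCurrent (invCut k) (y a) - totalCurrent (invCut k) x|)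
    (Y := fun k => totalDefect k x + totalDefect k x + 0)
    (Eventually.of_forall fun a => norm_nonneg _) (fun k => Eventually.of_forall fun a => ?_)
    (fun k => ?_) ?_
  · have h1 := abs_totalCurrent_sub_le k.cast_nonneg (y a)
    have h2 := abs_totalCurrent_sub_le k.cast_nonneg x
    rw [Real.norm_eq_abs]
    rw [abs_le] at h1 h2
    have h3 := neg_abs_le (totalCurrent (invCut k) (y a) - totalCurrent (invCut k) x)
    have h4 := le_abs_self (totalCurrent (invCut k) (y a) - totalCurrent (invCut k) x)
    rw [abs_le]
    constructor <;> linarith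
  · have h1 := ((continuous_totalDefect (μ := μ) (ι := ι) (k := k) k.cast_nonneg).tendsto x).comp hy
    have h2 := ((continuous_totalCurrent (μ := μ) (ι := ι) (continuousOn_invCut (k := k)
      k.cast_nonneg) (abs_mul_invCut_le k.cast_nonneg)).tendsto x).comp hy
    have h3 := (h2.sub_const (totalCurrent (invCut k) x)).abs
    rw [sub_self, abs_zero] at h3
    exact (h1.add tendsto_const_nhds).add h3
  · simpa using (hV.tendsto_totalDefect hx).add (hV.tendsto_totalDefect hx)

end ZeroSet

/-! ### Evolution of the Dirichlet energy and conservation of the energy. -/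

section Gradient

variable {Ω : Type*} [MeasurableSpace Ω] {μ : Measure Ω} [IsProbabilityMeasure μ]
  {ι : Type*} [Fintype ι] {V : ClosedSubmodule ℂ (Jet (Lp ℂ 2 μ) ι)}
  {lam : ℝ} {φ : ℝ → Lp ℂ 2 μ} {Φ : ℝ → Jet (Lp ℂ 2 μ) ι}

theorem inner_radial_self_im {h h' : ℝ → ℝ} {C : ℝ} (hr : IsRadial h h' C) (u : Lp ℂ 2 μ) :
    (inner ℂ u (sup1 (radial h) u)).im = 0 := by
  rw [inner_Lp]
  have h1 := integral_im (integrable_conj_mul u (sup1 (radial h) u))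
  simp only [RCLike.im_to_complex] at h1
  rw [← h1]
  refine integral_eq_zero_of_ae ?_
  filter_upwards [coeFn_sup1 hr.continuous_radial hr.growth_radial u] with ω hω
  rw [hω, radial, Complex.real_smul]
  simp only [Complex.mul_im, Complex.mul_re, Complex.conj_re, Complex.conj_im, Complex.ofReal_re,
    Complex.ofReal_im, Pi.zero_apply]
  ring

/-- The Cazenave-Haraux inequality, integrated. The constant `D` is kept apart from the constant `C`
of `IsRadial`: only `s h'(s)` matters here, and for truncated logarithms it is bounded uniformly
while the given `C` grows with the truncation. -/
theorem abs_im_inner_sup1_radial_sub_le {h h' : ℝ → ℝ} {C D : ℝ} (hr : IsRadial h h' C)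
    (hD : ∀ s, 0 ≤ s → |s * h' s| ≤ D) (u v : Lp ℂ 2 μ) :
    |(inner ℂ (u - v) (sup1 (radial h) u - sup1 (radial h) v)).im| ≤ 2 * D * ‖u - v‖ ^ 2 := by
  rw [← inner_conj_symm, Complex.conj_im, abs_neg, inner_Lp, ← integral_norm_sq]
  have h1 := integral_im (integrable_conj_mul (sup1 (radial h) u - sup1 (radial h) v) (u - v))
  simp only [RCLike.im_to_complex] at h1
  rw [← h1, ← Real.norm_eq_abs, ← integral_const_mul]
  refine norm_integral_le_of_norm_le ((integrable_norm_sq _).const_mul _) ?_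
  filter_upwards [coeFn_sup1 hr.continuous_radial hr.growth_radial u,
    coeFn_sup1 hr.continuous_radial hr.growth_radial v, Lp.coeFn_sub u v,
    Lp.coeFn_sub (sup1 (radial h) u) (sup1 (radial h) v)] with ω h1 h2 h3 h4
  rw [h3, h4, Pi.sub_apply, Pi.sub_apply, h1, h2]
  exact abs_im_radial_le hr.hasDeriv hD _ _

/-- By `abs_logCut_le` the logarithm itself dominates its truncations, and it is integrable in the
pairing because both entropies are finite. -/
theorem tendsto_inner_sup1_logCut {u v : Lp ℂ 2 μ} (hu : Tame u) (hv : Tame v) :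
    Tendsto (fun n : ℕ => inner ℂ v (sup1 (radial (logCut (1 / ((n : ℝ) + 1)) (n + 1))) u)) atTop
      (𝓝 (logPair u v)) := by
  have h1n : ∀ k : ℕ, (1 : ℝ) ≤ (k : ℝ) + 1 := fun k => by linarith [k.cast_nonneg (α := ℝ)]
  have hle : ∀ k : ℕ, 1 / ((k : ℝ) + 1) ≤ k + 1 := fun k =>
    ((div_le_one (by positivity)).2 (h1n k)).trans (h1n k)
  have hr := fun k : ℕ => isRadial_logCut (by positivity : 0 < 1 / ((k : ℝ) + 1)) (hle k)
  have e : ∀ n : ℕ, ∀ᵐ ω ∂μ, sup1 (radial (logCut (1 / ((n : ℝ) + 1)) (n + 1))) u ω =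
      radial (logCut (1 / ((n : ℝ) + 1)) (n + 1)) (u ω) := fun n =>
    coeFn_sup1 (hr n).continuous_radial (hr n).growth_radial u
  simp_rw [inner_Lp]
  refine tendsto_integral_of_dominated_convergence (fun ω => ‖starRingEnd ℂ (v ω) * logMap (u ω)‖)
    (fun n => (integrable_conj_mul _ _).1) (hu.integrable_logPair hv).norm (fun n => ?_) ?_
  · filter_upwards [e n] with ω hω
    rw [hω, norm_mul, norm_mul]
    refine mul_le_mul_of_nonneg_left ?_ (norm_nonneg _)
    by_cases hz : u ω = 0
    · simp [hz, radial]
    · rw [radial, logMap, norm_smul, norm_smul]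
      exact mul_le_mul_of_nonneg_right (abs_logCut_le (h1n n) (by positivity)) (norm_nonneg _)
  · filter_upwards [ae_all_iff.2 e] with ω hω
    simp_rw [hω]
    refine Tendsto.const_mul _ ?_
    by_cases hz : u ω = 0
    · simp [hz, radial, logMap]
    · have h2 := tendsto_logCut tendsto_one_div_add_atTop_nhds_zero_nat (s := ‖u ω‖ ^ 2)
        (by rw [add_zero]; positivity)
      rw [add_zero] at h2
      exact h2.smul_const _

/-- The nonlinear term tested against the regularized function is, up to a small error, the
current of the entropy. -/
theorem IsSobolev.abs_pairNL_res_sub_le (hV : IsSobolev V) {ε : ℝ} (hε : 0 < ε) {u : Lp ℂ 2 μ}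
    (h0 : u ≠ 0) (hu : lam ≠ 0 → Tame u) :
    |(pairNL lam u (res V ε u none)).im -
      2 * ε * (lam * totalCurrent (fun s => 1 / s) (res V ε u))| ≤
      2 * |lam| * ‖u - res V ε u none‖ ^ 2 := by
  by_cases hl : lam = 0
  · subst hl
    simp [pairNL_lam_zero]
  have h1n : ∀ k : ℕ, (1 : ℝ) ≤ (k : ℝ) + 1 := fun k => by linarith [k.cast_nonneg (α := ℝ)]
  have hle : ∀ k : ℕ, 1 / ((k : ℝ) + 1) ≤ k + 1 := fun k =>
    ((div_le_one (by positivity)).2 (h1n k)).trans (h1n k)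
  have hr := fun k : ℕ => isRadial_logCut (by positivity : 0 < 1 / ((k : ℝ) + 1)) (hle k)
  set x := res V ε u with hx
  set ψ := x none with hψ
  have hψt : Tame ψ := (hV.tame_res hε (hu hl)).1
  -- The inner product of `J u` and `u` is real, so the normalization by the mass does not
  -- contribute.
  have hpair : (pairNL lam u ψ).im = lam * (logPair u ψ).im := by
    have h1 := congrArg Complex.im (inner_conj_symm (𝕜 := ℂ) u ψ)
    rw [hψ, hx, ← res_selfadjoint hε, Complex.conj_im] at h1
    have h2 : (inner ℂ ψ u).im = 0 := by
      rw [hψ, hx]; linarith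
    rw [pairNL_eq lam h0 ((hu hl).integrable_logPair hψt), Complex.sub_im, Complex.im_ofReal_mul,
      Complex.im_ofReal_mul, h2]
    simp [logPair]
  have key : |(logPair u ψ).im - 2 * ε * totalCurrent (fun s => 1 / s) x| ≤ 2 * ‖u - ψ‖ ^ 2 := by
    have h1 := (Complex.continuous_im.tendsto _).comp (tendsto_inner_sup1_logCut (hu hl) hψt)
    have h2 : Tendsto (fun n : ℕ => totalCurrent (logCutDeriv (1 / ((n : ℝ) + 1)) (n + 1)) x) atTop
        (𝓝 (totalCurrent (fun s => 1 / s) x)) :=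
      tendsto_totalCurrent (C := 1) (fun k => (hr k).cont)
        (fun k s hs => abs_mul_logCutDeriv_le (by positivity) (hle k) hs)
        (fun s hs => by
          have := tendsto_logCutDeriv tendsto_one_div_add_atTop_nhds_zero_nat (s := s)
            (by rw [add_zero]; exact hs.ne')
          rwa [add_zero] at this) x
    refine le_of_tendsto' ((h1.sub (h2.const_mul (2 * ε))).abs) fun n => ?_
    simp only [Function.comp_apply]
    set T : Lp ℂ 2 μ → Lp ℂ 2 μ := sup1 (radial (logCut (1 / ((n : ℝ) + 1)) (n + 1))) with hT
    have h3 := res_inner hε u (hV.chain (hr n) x (res_mem V ε u))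
    have h4 : (radialJet (logCut (1 / ((n : ℝ) + 1)) (n + 1))
        (logCutDeriv (1 / ((n : ℝ) + 1)) (n + 1)) x) none = T ψ := rfl
    rw [h4] at h3
    -- The Euler equation tested with the truncated nonlinearity `T ψ` of `ψ = J u`; by the chain
    -- rule the imaginary part of the form is the current.
    have h5 : (inner ℂ (T ψ) (u - ψ)).im =
        2 * ε * totalCurrent (logCutDeriv (1 / ((n : ℝ) + 1)) (n + 1)) x := by
      have h6 := congrArg Complex.im h3
      rw [Complex.im_ofReal_mul, (hr n).im_form_radialJet] at h6
      rw [hψ, hx, h6, hx]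
      ring
    have h6 : (inner ℂ (u - ψ) (T ψ)).im = -(inner ℂ (T ψ) (u - ψ)).im := by
      rw [← inner_conj_symm, Complex.conj_im]
    have h7 := abs_im_inner_sup1_radial_sub_le (hr n)
      (fun s hs => abs_mul_logCutDeriv_le (by positivity) (hle n) hs) u ψ
    -- Since `⟨u, T u⟩` is real, the quantity bounded by the Cazenave-Haraux inequality is the
    -- difference of the current and of the pairing of `T u` with `ψ`.
    have h8 : (inner ℂ (u - ψ) (T u - T ψ)).im = -(inner ℂ ψ (T u)).im +
        2 * ε * totalCurrent (logCutDeriv (1 / ((n : ℝ) + 1)) (n + 1)) x := by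
      rw [inner_sub_right, Complex.sub_im, h6, h5, inner_sub_left, Complex.sub_im,
        inner_radial_self_im (hr n)]
      ring
    rw [h8, mul_one] at h7
    rw [abs_sub_comm]
    rwa [neg_add_eq_sub] at h7
  rw [hpair]
  have e : lam * (logPair u ψ).im - 2 * ε * (lam * totalCurrent (fun s => 1 / s) x) =
      lam * ((logPair u ψ).im - 2 * ε * totalCurrent (fun s => 1 / s) x) := by ring
  rw [e, abs_mul]
  nlinarith [mul_le_mul_of_nonneg_left key (abs_nonneg lam)]

/-- The Euler equation tested with `x - J_ε x`. As the jets `x - J_ε x` tend to zero, the bound is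
`o(ε)`: it still vanishes after the division by `ε` in the energy balance. -/
theorem norm_sub_res_sq_eq {ε : ℝ} (hε : 0 < ε) {x : Jet (Lp ℂ 2 μ) ι} (hx : x ∈ V) :
    ‖x none - res V ε (x none) none‖ ^ 2 ≤
      ε * (‖x - res V ε (x none)‖ * ‖res V ε (x none)‖) := by
  have h := res_inner hε (x none) (V.sub_mem hx (res_mem V ε (x none)))
  rw [PiLp.sub_apply, inner_self_ofReal] at h
  have h1 := congrArg Complex.re h
  rw [Complex.ofReal_re, Complex.re_ofReal_mul] at h1
  rw [h1]
  refine mul_le_mul_of_nonneg_left ?_ hε.le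
  exact (Complex.re_le_norm _).trans (norm_form_le _ _)

/-- The difference quotients of the mass with respect to the resolvents converge to the energy. -/
theorem tendsto_gsq_of_res (hV : HasUniqueDerivs V) {x : Jet (Lp ℂ 2 μ) ι} (hx : x ∈ V) :
    Tendsto (fun ε : ℝ => ε⁻¹ * (‖x none‖ ^ 2 - (inner ℂ (res V ε (x none) none) (x none)).re))
      (𝓝[>] 0) (𝓝 (gsq x)) := by
  have h1 : Tendsto (fun ε => (form x (res V ε (x none))).re) (𝓝[>] 0) (𝓝 (form x x).re) :=
    (Complex.continuous_re.tendsto _).comp (tendsto_form tendsto_const_nhds (tendsto_res hV hx))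
  rw [form_self, Complex.ofReal_re] at h1
  refine h1.congr' ?_
  filter_upwards [self_mem_nhdsWithin] with ε hε
  have hε' : (0 : ℝ) < ε := hε
  have h := congrArg Complex.re (res_inner hε' (x none) hx)
  rw [inner_sub_right, inner_self_ofReal, Complex.sub_re, Complex.ofReal_re, Complex.re_ofReal_mul]
    at h
  have h2 := congrArg Complex.re (inner_conj_symm (𝕜 := ℂ) (x none) (res V ε (x none) none))
  rw [Complex.conj_re] at h2
  rw [h2, h]
  field_simp

/-- The evolution of the Dirichlet energy. -/
theorem IsSol.gsq_sub (hs : IsSol V lam φ Φ) (hV : IsSobolev V) (hne : φ 0 ≠ 0)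
    (h0 : lam ≠ 0 → Tame (φ 0)) {T : ℝ} (hT : 0 ≤ T) :
    gsq (Φ T) - gsq (Φ 0) = -4 * lam * ∫ t in (0 : ℝ)..T, totalCurrent (fun s => 1 / s) (Φ t) := by
  have hφt : ∀ r, 0 ≤ r → lam ≠ 0 → Tame (φ r) := fun r hr hl =>
    (hs.tame_of_tame_zero hV hr).2 (h0 hl)
  set p : ℝ → ℝ → ℝ := fun ε t => (pairNL lam (φ t) (res V ε (φ t) none)).im with hp
  have hcont : ∀ ε, 0 < ε → ContinuousOn (p ε) (Set.Ici 0) := fun ε hε t ht => by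
    refine (Complex.continuous_im.tendsto _).comp (hs.tendsto_pairNL_res hV hne h0 hε ht tendsto_id
      (hs.cont t ht) (fun hl => ?_) (hφt t ht) fun hl => hs.tendsto_modular hV (h0 hl) ht)
    filter_upwards [self_mem_nhdsWithin] with r hr
    exact hφt r hr hl
  have hint : ∀ ε, 0 < ε → ε⁻¹ * (‖φ T‖ ^ 2 - (inner ℂ (res V ε (φ T) none) (φ T)).re) -
      ε⁻¹ * (‖φ 0‖ ^ 2 - (inner ℂ (res V ε (φ 0) none) (φ 0)).re) =
      ∫ t in (0 : ℝ)..T, -(2 * ε⁻¹) * p ε t := fun ε hε => by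
    have h1 := integral_eq_sub_of_hasDerivWithinAt_Ici hT
      (fun t ht => hs.hasDerivWithinAt_inner_res hV hne h0 hε ht) ((hcont ε hε).const_mul 2)
    rw [intervalIntegral.integral_const_mul] at h1 ⊢
    rw [hs.norm_eq hV hT]
    change 2 * ∫ t in (0 : ℝ)..T, p ε t = _ at h1
    linear_combination ε⁻¹ * h1
  have hlhs : ∀ t, 0 ≤ t → Tendsto (fun ε : ℝ => ε⁻¹ * (‖φ t‖ ^ 2 -
      (inner ℂ (res V ε (φ t) none) (φ t)).re)) (𝓝[>] 0) (𝓝 (gsq (Φ t))) := fun t ht => by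
    have h1 := tendsto_gsq_of_res hV.unique (hs.mem t ht)
    rwa [hs.none_eq t ht] at h1
  obtain ⟨K, hK⟩ := hs.bounded T hT
  -- This one estimate serves twice: its right side tends to zero for every `t`, and it is bounded
  -- uniformly in `ε` and `t ≤ T`, as dominated convergence in time requires.
  have hest : ∀ ε, 0 < ε → ∀ t, 0 ≤ t →
      |-(2 * ε⁻¹) * p ε t - -4 * lam * totalCurrent (fun s => 1 / s) (res V ε (φ t))| ≤
      4 * |lam| * (‖Φ t - res V ε (φ t)‖ * ‖res V ε (φ t)‖) := fun ε hε t ht => by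
    have h1 := hV.abs_pairNL_res_sub_le (lam := lam) hε (hs.ne_zero hV hne ht) (hφt t ht)
    have h2 := norm_sub_res_sq_eq hε (hs.mem t ht)
    rw [hs.none_eq t ht] at h2
    have e : -(2 * ε⁻¹) * p ε t - -4 * lam * totalCurrent (fun s => 1 / s) (res V ε (φ t)) =
        -(2 * ε⁻¹) * (p ε t - 2 * ε * (lam * totalCurrent (fun s => 1 / s) (res V ε (φ t)))) := by
      field_simp
      ring
    rw [e, abs_mul, abs_neg, abs_of_pos (by positivity : 0 < 2 * ε⁻¹)]
    calc _ ≤ 2 * ε⁻¹ * (2 * |lam| * (ε * (‖Φ t - res V ε (φ t)‖ * ‖res V ε (φ t)‖))) := by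
          refine mul_le_mul_of_nonneg_left (h1.trans ?_) (by positivity)
          exact mul_le_mul_of_nonneg_left h2 (by positivity)
      _ = _ := by field_simp; ring
  have hres : ∀ ε, 0 < ε → ∀ t, 0 ≤ t → ‖res V ε (φ t)‖ ≤ ‖Φ t‖ := fun ε hε t ht => by
    have h1 := norm_res_le hε (hs.mem t ht)
    rwa [hs.none_eq t ht] at h1
  have hlim : ∀ t, 0 ≤ t → Tendsto (fun ε => -(2 * ε⁻¹) * p ε t) (𝓝[>] 0)
      (𝓝 (-4 * lam * totalCurrent (fun s => 1 / s) (Φ t))) := fun t ht => by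
    have h1 := tendsto_res hV.unique (hs.mem t ht)
    rw [hs.none_eq t ht] at h1
    have h2 := (hV.tendsto_totalCurrent_one_div (hs.mem t ht) h1).const_mul (-4 * lam)
    have h3 : Tendsto (fun ε => 4 * |lam| * (‖Φ t - res V ε (φ t)‖ * ‖res V ε (φ t)‖)) (𝓝[>] 0)
        (𝓝 0) := by
      have h4 := (((h1.const_sub (Φ t)).norm).mul h1.norm).const_mul (4 * |lam|)
      simpa using h4
    have h5 : Tendsto (fun ε => -(2 * ε⁻¹) * p ε t -
        -4 * lam * totalCurrent (fun s => 1 / s) (res V ε (φ t))) (𝓝[>] 0) (𝓝 0) := by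
      refine squeeze_zero_norm' ?_ h3
      filter_upwards [self_mem_nhdsWithin] with ε hε
      exact hest ε hε t ht
    simpa using h5.add h2
  have hrhs : Tendsto (fun ε => ∫ t in (0 : ℝ)..T, -(2 * ε⁻¹) * p ε t) (𝓝[>] 0)
      (𝓝 (∫ t in (0 : ℝ)..T, -4 * lam * totalCurrent (fun s => 1 / s) (Φ t))) := by
    refine intervalIntegral.tendsto_integral_filter_of_dominated_convergence
      (fun _ => 4 * |lam| * (2 * K * K) + 4 * |lam| * K ^ 2) ?_ ?_ intervalIntegrable_const ?_
    · filter_upwards [self_mem_nhdsWithin] with ε hε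
      rw [Set.uIoc_of_le hT]
      exact (((hcont ε hε).const_mul _).mono fun t ht => ht.1.le).aestronglyMeasurable
        measurableSet_Ioc
    · filter_upwards [self_mem_nhdsWithin] with ε hε
      refine ae_of_all _ fun t ht => ?_
      rw [Set.uIoc_of_le hT] at ht
      have h1 := hest ε hε t ht.1.le
      have h2 := (hres ε hε t ht.1.le).trans (hK t ht.1.le ht.2)
      have h3 := hK t ht.1.le ht.2
      have h4 := (norm_sub_le (Φ t) (res V ε (φ t)))
      have h5 := LatticeLSE.abs_totalCurrent_le abs_mul_one_div_le (res V ε (φ t))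
      have h6 : gsq (res V ε (φ t)) ≤ K ^ 2 :=
        (gsq_le _).trans (pow_le_pow_left₀ (norm_nonneg _) h2 2)
      have h7 : ‖Φ t - res V ε (φ t)‖ * ‖res V ε (φ t)‖ ≤ 2 * K * K :=
        mul_le_mul (by linarith) h2 (norm_nonneg _) (by linarith [norm_nonneg (Φ t)])
      have h8 : |-4 * lam * totalCurrent (fun s => 1 / s) (res V ε (φ t))| ≤ 4 * |lam| * K ^ 2 := by
        rw [abs_mul, abs_mul, abs_neg, abs_of_pos (by norm_num : (0 : ℝ) < 4)]
        refine mul_le_mul_of_nonneg_left ?_ (by positivity)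
        linarith
      have h9 : 4 * |lam| * (‖Φ t - res V ε (φ t)‖ * ‖res V ε (φ t)‖) ≤ 4 * |lam| * (2 * K * K) :=
        mul_le_mul_of_nonneg_left h7 (by positivity)
      rw [Real.norm_eq_abs]
      have h10 := abs_sub_abs_le_abs_sub (-(2 * ε⁻¹) * p ε t)
        (-4 * lam * totalCurrent (fun s => 1 / s) (res V ε (φ t)))
      linarith
    · refine ae_of_all _ fun t ht => ?_
      rw [Set.uIoc_of_le hT] at ht
      exact hlim t ht.1.le
  have h1 := (hlhs T hT).sub (hlhs 0 le_rfl)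
  have h2 := h1.congr' (by
    filter_upwards [self_mem_nhdsWithin] with ε hε
    exact hint ε hε)
  rw [tendsto_nhds_unique h2 hrhs, intervalIntegral.integral_const_mul]

/-- Conservation of the energy. -/
theorem IsSol.energy_eq (hs : IsSol V lam φ Φ) (hV : IsSobolev V) (h0 : lam ≠ 0 → Tame (φ 0))
    {T : ℝ} (hT : 0 ≤ T) :
    gsq (Φ T) + lam * logMoment (φ T) = gsq (Φ 0) + lam * logMoment (φ 0) := by
  by_cases hne : φ 0 = 0
  -- The logarithm of the mass is not continuous at zero, so this case is separate; by conservation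
  -- of mass the solution vanishes identically.
  · have h1 : ∀ t, 0 ≤ t → φ t = 0 ∧ Φ t = 0 := fun t ht => by
      have h2 : φ t = 0 := by
        rw [← norm_eq_zero, hs.norm_eq hV ht, hne, norm_zero]
      exact ⟨h2, hV.unique _ (hs.mem t ht) (by rw [hs.none_eq t ht, h2])⟩
    rw [(h1 T hT).1, (h1 T hT).2, (h1 0 le_rfl).1, (h1 0 le_rfl).2]
  · have h1 := hs.gsq_sub hV hne h0 hT
    by_cases hl : lam = 0
    · subst hl
      linarith
    · have h2 := hs.logMoment_sub hV (h0 hl) hT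
      linear_combination h1 + lam * h2

end Gradient

/-! ### Cylinder functions, their partial derivatives and supports. -/

section Cylinder

variable {d : ℕ} {E : Type*} [NormedAddCommGroup E] [NormedSpace ℝ E] {n m : WithTop ℕ∞}
  {Δ Δ' Λ : Finset (Site d)}

/-- `F` is a cylinder function, of class `C^n` in the coordinates in `Δ`. -/
structure Cyl (n : WithTop ℕ∞) (Δ : Finset (Site d)) (F : Config d → E) : Prop where
  dependsOn : DependsOn F (Δ : Set (Site d))
  contDiff : ContDiff ℝ n fun p : Δ → ℝ => F (glue Δ 0 p)

theorem glue_of_mem {ω : Config d} {p : Δ → ℝ} {i : Site d} (h : i ∈ Δ) :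
    glue Δ ω p i = p ⟨i, h⟩ := by
  simp [glue, h]

theorem glue_of_notMem {ω : Config d} {p : Δ → ℝ} {i : Site d} (h : i ∉ Δ) :
    glue Δ ω p i = ω i := by
  simp [glue, h]

theorem restrict_glue (ω : Config d) (p : Δ → ℝ) : Δ.restrict (glue Δ ω p) = p := by
  ext ⟨i, hi⟩
  simp [glue, hi]

theorem glue_restrict (x : Config d) {i : Site d} (h : i ∈ Δ) (ω : Config d) :
    glue Δ ω (Δ.restrict x) i = x i := by
  simp [glue, h]

theorem contDiff_glue_apply (i : Site d) (ω : Config d) :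
    ContDiff ℝ n fun p : Δ → ℝ => glue Δ ω p i := by
  by_cases h : i ∈ Δ
  · simp only [glue, h, dif_pos]
    fun_prop
  · simp only [glue, h, dif_neg, not_false_eq_true]
    exact contDiff_const

theorem contDiff_restrict_glue (ω : Config d) :
    ContDiff ℝ n fun p : Δ → ℝ => Δ'.restrict (glue Δ ω p) :=
  contDiff_pi.2 fun i => contDiff_glue_apply _ _

theorem Cyl.apply_glue_restrict {F : Config d → E} (h : Cyl n Δ F) (x : Config d) :
    F (glue Δ 0 (Δ.restrict x)) = F x :=
  h.dependsOn fun _ hi => glue_restrict x hi 0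

theorem cyl_of_comp {f : (Δ → ℝ) → E} (hf : ContDiff ℝ n f) :
    Cyl n Δ fun x : Config d => f (Δ.restrict x) where
  dependsOn x y hxy := by
    have : Δ.restrict x = Δ.restrict y := by
      ext ⟨i, hi⟩
      exact hxy i hi
    simp only [this]
  contDiff := by
    simp only [restrict_glue]
    exact hf

theorem Cyl.mono {F : Config d → E} (h : Cyl n Δ F) (hΔ : Δ ⊆ Δ') : Cyl n Δ' F where
  dependsOn := h.dependsOn.mono (by exact_mod_cast hΔ)
  contDiff := by
    have h1 := h.contDiff.comp (contDiff_restrict_glue (Δ := Δ') (Δ' := Δ) (n := n) 0)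
    have e : (fun p : Δ' → ℝ => F (glue Δ' 0 p)) =
        (fun p : Δ → ℝ => F (glue Δ 0 p)) ∘ fun p : Δ' → ℝ => Δ.restrict (glue Δ' 0 p) := by
      ext p
      exact (h.apply_glue_restrict _).symm
    rw [e]
    exact h1

theorem Cyl.of_le {F : Config d → E} (h : Cyl n Δ F) (hm : m ≤ n) : Cyl m Δ F :=
  ⟨h.dependsOn, h.contDiff.of_le hm⟩

theorem cyl_const (c : E) : Cyl n Δ fun _ : Config d => c :=
  ⟨fun _ _ _ => rfl, contDiff_const⟩

theorem Cyl.comp {G : Type*} [NormedAddCommGroup G] [NormedSpace ℝ G] {F : Config d → E} {g : E → G}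
    (h : Cyl n Δ F) (hg : ContDiff ℝ n g) : Cyl n Δ fun x => g (F x) where
  dependsOn x y hxy := by simp only [h.dependsOn hxy]
  contDiff := hg.comp h.contDiff

theorem Cyl.prodMk {G : Type*} [NormedAddCommGroup G] [NormedSpace ℝ G] {F₁ : Config d → E}
    {F₂ : Config d → G} (h₁ : Cyl n Δ F₁) (h₂ : Cyl n Δ F₂) : Cyl n Δ fun x => (F₁ x, F₂ x) where
  dependsOn x y hxy := by simp only [h₁.dependsOn hxy, h₂.dependsOn hxy]
  contDiff := h₁.contDiff.prodMk h₂.contDiff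

theorem Cyl.add {F G : Config d → E} (h₁ : Cyl n Δ F) (h₂ : Cyl n Δ G) :
    Cyl n Δ fun x => F x + G x :=
  (h₁.prodMk h₂).comp (g := fun p : E × E => p.1 + p.2) (contDiff_fst.add contDiff_snd)

theorem Cyl.mul {F G : Config d → ℂ} (h₁ : Cyl n Δ F) (h₂ : Cyl n Δ G) :
    Cyl n Δ fun x => F x * G x :=
  (h₁.prodMk h₂).comp (g := fun p : ℂ × ℂ => p.1 * p.2) (contDiff_fst.mul contDiff_snd)

theorem Cyl.translate {F : Config d → E} (h : Cyl n Δ F) (c : Config d) :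
    Cyl n Δ fun x => F (x + c) where
  dependsOn x y hxy := h.dependsOn fun i hi => by simp [hxy i hi]
  contDiff := by
    have h1 : ContDiff ℝ n fun p : Δ → ℝ => F (glue Δ 0 (p + Δ.restrict c)) :=
      h.contDiff.comp (contDiff_id.add contDiff_const)
    have e : (fun p : Δ → ℝ => F (glue Δ 0 p + c)) =
        fun p : Δ → ℝ => F (glue Δ 0 (p + Δ.restrict c)) := by
      ext p
      refine h.dependsOn fun i hi => ?_
      have hi' : i ∈ Δ := hi
      rw [Pi.add_apply, glue_of_mem hi', glue_of_mem hi']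
      rfl
    rw [e]
    exact h1

theorem Cyl.continuous_of_comp {F : Config d → E} (h : Cyl n Δ F) :
    Continuous fun p : Δ → ℝ => F (glue Δ 0 p) := h.contDiff.continuous

theorem Cyl.measurable [MeasurableSpace E] [BorelSpace E] {F : Config d → E}
    (h : Cyl n Δ F) : Measurable F := by
  have h1 := h.continuous_of_comp.measurable.comp (Finset.measurable_restrict (X := fun _ => ℝ) Δ)
  have e : F = (fun p : Δ → ℝ => F (glue Δ 0 p)) ∘ Δ.restrict :=
    funext fun x => (h.apply_glue_restrict x).symm
  rw [e]
  exact h1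

theorem add_smul_single (x : Config d) (j : Site d) (s : ℝ) :
    x + s • Pi.single j (1 : ℝ) = Function.update x j (x j + s) := by
  ext i
  by_cases h : i = j
  · subst h; simp
  · simp [h]

theorem Cyl.hasDerivAt_update {F : Config d → E} (h : Cyl n Δ F) (hn : 1 ≤ n) (j : Site d)
    (x : Config d) : HasDerivAt (fun s => F (Function.update x j s)) (pderiv j F x) (x j) := by
  refine DifferentiableAt.hasDerivAt ?_
  have h1 : ContDiff ℝ n fun s : ℝ => F (glue Δ 0 (Δ.restrict (Function.update x j s))) := by
    refine h.contDiff.comp (contDiff_pi.2 fun i => ?_)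
    simp only [Finset.restrict, Function.update_apply]
    split_ifs
    · exact contDiff_id
    · exact contDiff_const
  have h2 := (h1.differentiable (by
    rintro rfl; simp at hn)) (x j)
  simpa only [h.apply_glue_restrict] using h2

/-- The derivative along a coordinate axis. -/
theorem Cyl.hasDerivAt {F : Config d → E} (h : Cyl n Δ F) (hn : 1 ≤ n) (j : Site d)
    (x : Config d) (s : ℝ) : HasDerivAt (fun s : ℝ => F (x + s • Pi.single j (1 : ℝ)))
      (pderiv j F (x + s • Pi.single j (1 : ℝ))) s := by
  have h1 := h.hasDerivAt_update hn j (x + s • Pi.single j (1 : ℝ))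
  have e : (x + s • Pi.single j (1 : ℝ) : Config d) j = x j + s := by simp
  rw [e] at h1
  have h2 := HasDerivAt.scomp s h1 ((hasDerivAt_id s).const_add (x j))
  rw [one_smul] at h2
  refine h2.congr_of_eventuallyEq (Eventually.of_forall fun t => ?_)
  simp only [Function.comp_apply]
  rw [add_smul_single, add_smul_single, Function.update_idem]

theorem Cyl.pderiv_eq {F : Config d → E} (h : Cyl n Δ F) (hn : 1 ≤ n) (j : Site d)
    (x : Config d) {f' : E} (hf : HasDerivAt (fun s : ℝ => F (x + s • Pi.single j (1 : ℝ))) f' 0) :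
    pderiv j F x = f' := by
  have h1 := h.hasDerivAt hn j x 0
  rw [zero_smul, add_zero] at h1
  exact h1.unique hf

theorem Cyl.hasDerivAt_zero {F : Config d → E} (h : Cyl n Δ F) (hn : 1 ≤ n) (j : Site d)
    (x : Config d) : HasDerivAt (fun s : ℝ => F (x + s • Pi.single j (1 : ℝ))) (pderiv j F x) 0 := by
  simpa using h.hasDerivAt hn j x 0

theorem Cyl.pderiv_eq_fderiv {F : Config d → E} (h : Cyl n Δ F) (hn : 1 ≤ n) (j : Site d)
    (x : Config d) : LatticeLSE.pderiv j F x =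
      fderiv ℝ (fun p : Δ → ℝ => F (glue Δ 0 p)) (Δ.restrict x)
        (Δ.restrict (Pi.single j (1 : ℝ) : Config d)) := by
  refine h.pderiv_eq hn j x ?_
  have h1 : HasFDerivAt (fun p : Δ → ℝ => F (glue Δ 0 p)) _ (Δ.restrict x) :=
    ((h.contDiff.differentiable (by rintro rfl; simp at hn)) _).hasFDerivAt
  have h2 : HasDerivAt (fun s : ℝ => Δ.restrict x + s • Δ.restrict (Pi.single j (1 : ℝ) : Config d))
      (Δ.restrict (Pi.single j (1 : ℝ) : Config d)) 0 := by
    have := ((hasDerivAt_id (0 : ℝ)).smul_const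
      (Δ.restrict (Pi.single j (1 : ℝ) : Config d))).const_add (Δ.restrict x)
    simpa using this
  have h3 := HasFDerivAt.comp_hasDerivAt (0 : ℝ) (l := fun p : Δ → ℝ => F (glue Δ 0 p))
    (f := fun s : ℝ => Δ.restrict x + s • Δ.restrict (Pi.single j (1 : ℝ) : Config d))
    (by simpa using h1) h2
  refine h3.congr_of_eventuallyEq (Eventually.of_forall fun s => ?_)
  exact (h.apply_glue_restrict (x + s • Pi.single j (1 : ℝ))).symm

theorem Cyl.pderiv {F : Config d → E} (h : Cyl n Δ F) (hm : m + 1 ≤ n) (j : Site d) :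
    Cyl m Δ (pderiv j F) := by
  have hn : 1 ≤ n := le_trans (by simp) hm
  have key := h.pderiv_eq_fderiv hn j
  have h1 : ContDiff ℝ m fun p : Δ → ℝ => fderiv ℝ (fun p : Δ → ℝ => F (glue Δ 0 p)) p
      (Δ.restrict (Pi.single j (1 : ℝ) : Config d)) :=
    (h.contDiff.fderiv_right hm).clm_apply contDiff_const
  have h2 := cyl_of_comp (d := d) h1
  simp_rw [← key] at h2
  exact h2

/-- `F` vanishes unless the coordinates in `Δ` are in a bounded set. -/
def BddSupp (Δ : Finset (Site d)) (F : Config d → E) : Prop :=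
  ∃ r : ℝ, ∀ x, F x ≠ 0 → ∀ i ∈ Δ, |x i| ≤ r

theorem Cyl.hasCompactSupport {F : Config d → E} (hb : BddSupp Δ F) :
    HasCompactSupport fun p : Δ → ℝ => F (glue Δ 0 p) := by
  obtain ⟨r, hr⟩ := hb
  refine HasCompactSupport.of_support_subset_isCompact
    (isCompact_closedBall (0 : Δ → ℝ) (max r 0)) fun p hp => ?_
  rw [mem_closedBall_zero_iff, pi_norm_le_iff_of_nonneg (le_max_right _ _)]
  rintro ⟨i, hi⟩
  have := hr _ hp i hi
  rw [glue_of_mem hi] at this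
  exact this.trans (le_max_left _ _)

theorem bddSupp_of_comp {f : (Δ → ℝ) → E} (hf : HasCompactSupport f) :
    BddSupp Δ fun x : Config d => f (Δ.restrict x) := by
  obtain ⟨r, hr⟩ := hf.isCompact.isBounded.subset_closedBall 0
  refine ⟨r, fun x hx i hi => ?_⟩
  have h1 := hr (subset_tsupport f hx)
  rw [mem_closedBall_zero_iff] at h1
  exact (norm_le_pi_norm (Δ.restrict x) ⟨i, hi⟩).trans h1

theorem Cyl.exists_norm_le {F : Config d → E} (h : Cyl n Δ F) (hb : BddSupp Δ F) :
    ∃ C, 0 ≤ C ∧ ∀ x, ‖F x‖ ≤ C := by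
  obtain ⟨C, hC⟩ := (Cyl.hasCompactSupport hb).exists_bound_of_continuous h.continuous_of_comp
  refine ⟨C, (norm_nonneg _).trans (hC 0), fun x => ?_⟩
  rw [← h.apply_glue_restrict x]
  exact hC _

theorem BddSupp.of_imp {G : Type*} [NormedAddCommGroup G] [NormedSpace ℝ G] {F : Config d → E}
    {H : Config d → G} (hb : BddSupp Δ F) (h : ∀ x, F x = 0 → H x = 0) : BddSupp Δ H := by
  obtain ⟨r, hr⟩ := hb
  exact ⟨r, fun x hx => hr x fun h0 => hx (h x h0)⟩

theorem BddSupp.mul_left {F G : Config d → ℂ} (hb : BddSupp Δ G) : BddSupp Δ fun x => F x * G x :=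
  hb.of_imp fun x hx => by simp [hx]

theorem BddSupp.mul_right {F G : Config d → ℂ} (hb : BddSupp Δ F) : BddSupp Δ fun x => F x * G x :=
  hb.of_imp fun x hx => by simp [hx]

/-- A nonzero function with bounded support in the coordinates in `Δ` need not have bounded support
in those of a larger set. Products behave well: each factor confines its own coordinates. -/
theorem BddSupp.mul_union {F G : Config d → ℂ} (hF : BddSupp Δ F) (hG : BddSupp Δ' G) :
    BddSupp (Δ ∪ Δ') fun x => F x * G x := by
  obtain ⟨r, hr⟩ := hF
  obtain ⟨r', hr'⟩ := hG
  refine ⟨max r r', fun x hx i hi => ?_⟩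
  rcases Finset.mem_union.1 hi with h | h
  · exact (hr x (left_ne_zero_of_mul hx) i h).trans (le_max_left _ _)
  · exact (hr' x (right_ne_zero_of_mul hx) i h).trans (le_max_right _ _)

theorem BddSupp.translate {F : Config d → E} (hb : BddSupp Δ F) (c : Config d) :
    BddSupp Δ fun x => F (x + c) := by
  obtain ⟨r, hr⟩ := hb
  refine ⟨r + ∑ i ∈ Δ, |c i|, fun x hx i hi => ?_⟩
  have h1 := hr _ hx i hi
  have h2 : |c i| ≤ ∑ i ∈ Δ, |c i| := Finset.single_le_sum (f := fun i => |c i|)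
    (fun _ _ => abs_nonneg _) hi
  have h3 : |x i| ≤ |(x + c) i| + |c i| := by
    have := abs_sub (x i + c i) (c i)
    rw [add_sub_cancel_right] at this
    exact this
  linarith

theorem BddSupp.pderiv {F : Config d → E} (hb : BddSupp Δ F) (h : Cyl n Δ F) (hn : 1 ≤ n)
    (j : Site d) : BddSupp Δ (pderiv j F) := by
  obtain ⟨r, hr⟩ := hb
  refine ⟨r, fun x hx i hi => ?_⟩
  by_contra! hlt
  refine hx (h.pderiv_eq hn j x ?_)
  have h1 : ∀ᶠ s : ℝ in 𝓝 0, r < |(x + s • Pi.single j (1 : ℝ) : Config d) i| := by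
    have h2 : Continuous fun s : ℝ => |(x + s • Pi.single j (1 : ℝ) : Config d) i| := by
      simp only [Pi.add_apply, Pi.smul_apply, smul_eq_mul]
      fun_prop
    refine (h2.tendsto 0).eventually (lt_mem_nhds ?_)
    simpa using hlt
  refine (hasDerivAt_const (0 : ℝ) (0 : E)).congr_of_eventuallyEq ?_
  filter_upwards [h1] with s hs
  by_contra hne
  exact absurd (hr _ hne i hi) (not_le.2 hs)

theorem Cyl.pderiv_mul {F G : Config d → ℂ} (h₁ : Cyl n Δ F) (h₂ : Cyl n Δ G) (hn : 1 ≤ n)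
    (j : Site d) (x : Config d) : LatticeLSE.pderiv j (fun x => F x * G x) x =
      LatticeLSE.pderiv j F x * G x + F x * LatticeLSE.pderiv j G x := by
  refine (h₁.mul h₂).pderiv_eq hn j x ?_
  have := (h₁.hasDerivAt_zero hn j x).fun_mul (h₂.hasDerivAt_zero hn j x)
  simpa only [zero_smul, add_zero] using this

theorem Cyl.pderiv_translate {F : Config d → E} (h : Cyl n Δ F) (hn : 1 ≤ n) (j : Site d)
    (c x : Config d) : LatticeLSE.pderiv j (fun x => F (x + c)) x = LatticeLSE.pderiv j F (x + c) := by
  refine (h.translate c).pderiv_eq hn j x ?_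
  have := h.hasDerivAt_zero hn j (x + c)
  simpa only [add_right_comm] using this

/-- The description of test functions by cylinder functions. -/
theorem isTest_iff {S : Finset (Site d)} {g : Config d → ℂ} : IsTest S g ↔
    ∃ Δ, S ⊆ Δ ∧ Cyl ((⊤ : ℕ∞) : WithTop ℕ∞) Δ g ∧ BddSupp Δ g := by
  constructor
  · rintro ⟨Δ, h, hS, hc, hs, hg⟩
    obtain rfl : g = fun x => h (Δ.restrict x) := funext hg
    exact ⟨Δ, hS, cyl_of_comp hc, bddSupp_of_comp hs⟩
  · rintro ⟨Δ, hS, hc, hb⟩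
    exact ⟨Δ, fun p => g (glue Δ 0 p), hS, hc.contDiff, Cyl.hasCompactSupport hb,
      fun x => (hc.apply_glue_restrict x).symm⟩

end Cylinder

/-! ### The energies `U_Λ` as finite sums. -/

section Energy

variable {d : ℕ} {Λ Δ : Finset (Site d)}

theorem Cyl.sum {E κ : Type*} [NormedAddCommGroup E] [NormedSpace ℝ E] {n : WithTop ℕ∞}
    (s : Finset κ) {F : κ → Config d → E} (h : ∀ k ∈ s, Cyl n Δ (F k)) :
    Cyl n Δ fun x => ∑ k ∈ s, F k x where
  dependsOn x y hxy := Finset.sum_congr rfl fun k hk => (h k hk).dependsOn hxy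
  contDiff := ContDiff.sum fun k hk => (h k hk).contDiff

theorem nbhd_mono {R : ℕ} (h : Λ ⊆ Δ) : nbhd R Λ ⊆ nbhd R Δ :=
  Finset.biUnion_subset_biUnion_of_subset_left _ h

theorem Interaction.subset_nbhd_of_ne (I : Interaction d) {X : Finset (Site d)}
    (hX : (X ∩ Λ).Nonempty) (hJ : I.J X ≠ 0) : X ⊆ nbhd I.range Λ := by
  obtain ⟨i, hi⟩ := hX
  have hiX := (Finset.mem_inter.1 hi).1
  intro k hk
  refine Finset.mem_biUnion.2 ⟨i, (Finset.mem_inter.1 hi).2, ?_⟩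
  have h1 : Metric.diam (X : Set (Site d)) ≤ I.range :=
    not_lt.1 fun h => hJ (I.eq_zero_of_range_lt X h)
  have h2 : dist i k ≤ I.range :=
    (Metric.dist_le_diam_of_mem X.finite_toSet.isBounded hiX hk).trans h1
  have h3 : ∀ a, |i a - k a| ≤ (I.range : ℤ) := fun a => by
    have h4 := (dist_le_pi_dist i k a).trans h2
    rw [Int.dist_eq] at h4
    exact_mod_cast h4
  refine Finset.mem_Icc.2 ⟨fun a => ?_, fun a => ?_⟩
  · have := (abs_le.1 (h3 a)).2
    simp only [Pi.sub_apply]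
    omega
  · have := (abs_le.1 (h3 a)).1
    simp only [Pi.add_apply]
    omega

open Classical in
-- The set `Δ` is arbitrary as long as it contains the sites that interact with `Λ`. Energies of
-- different sets can then be compared as sums over subsets of one `Δ`.
theorem Interaction.U_eq_sum (I : Interaction d) (h : nbhd I.range Λ ⊆ Δ) (x : Config d) :
    I.U Λ x = ∑ X ∈ Δ.powerset with (X ∩ Λ).Nonempty, I.J X (X.restrict x) := by
  rw [Interaction.U]
  refine finsum_mem_eq_sum_of_inter_support_eq (s := {X | (X ∩ Λ).Nonempty}) _ ?_
  ext X
  simp only [Set.mem_inter_iff, Set.mem_ofPred_eq, Function.mem_support, Finset.coe_filter,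
    Finset.mem_powerset]
  constructor
  · rintro ⟨h1, h2⟩
    exact ⟨⟨(I.subset_nbhd_of_ne h1 fun h0 => h2 (by rw [h0]; rfl)).trans h, h1⟩, h2⟩
  · rintro ⟨⟨_, h1⟩, h2⟩
    exact ⟨h1, h2⟩

theorem Interaction.cyl_U (I : Interaction d) (h : nbhd I.range Λ ⊆ Δ) :
    Cyl 1 Δ (I.U Λ) := by
  classical
  have e : I.U Λ = fun x => ∑ X ∈ Δ.powerset with (X ∩ Λ).Nonempty, I.J X (X.restrict x) :=
    funext fun x => I.U_eq_sum h x
  rw [e]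
  refine Cyl.sum _ fun X hX => ?_
  exact (cyl_of_comp (I.contDiff_J X)).mono
    (Finset.mem_powerset.1 (Finset.mem_filter.1 hX).1)

theorem Interaction.measurable_U (I : Interaction d) (Λ : Finset (Site d)) :
    Measurable (I.U Λ) := (I.cyl_U (Finset.Subset.refl _)).measurable

/-- The force at a site of `Λ` is the same for all energies `U_Λ`. -/
theorem Interaction.pderiv_U (I : Interaction d) {j : Site d} (hj : j ∈ Λ) :
    pderiv j (I.U {j}) = pderiv j (I.U Λ) := by
  classical
  have hsub : nbhd I.range {j} ⊆ nbhd I.range Λ :=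
    nbhd_mono (Finset.singleton_subset_iff.2 hj)
  -- The two energies differ by interactions that do not involve the site `j`.
  have key : ∀ y, I.U Λ y = I.U {j} y + ∑ X ∈ (nbhd I.range Λ).powerset with
      (X ∩ Λ).Nonempty ∧ j ∉ X, I.J X (X.restrict y) := fun y => by
    rw [I.U_eq_sum (Finset.Subset.refl _), I.U_eq_sum hsub,
      ← Finset.sum_filter_add_sum_filter_not _ (fun X => j ∈ X), Finset.filter_filter,
      Finset.filter_filter]
    congr 1
    refine Finset.sum_congr (Finset.filter_congr fun X _ => ?_) fun _ _ => rfl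
    constructor
    · rintro ⟨_, h⟩
      exact ⟨j, Finset.mem_inter.2 ⟨h, Finset.mem_singleton_self j⟩⟩
    · rintro ⟨i, hi⟩
      obtain ⟨h1, h2⟩ := Finset.mem_inter.1 hi
      rw [Finset.mem_singleton] at h2
      subst h2
      exact ⟨⟨i, Finset.mem_inter.2 ⟨h1, hj⟩⟩, h1⟩
  ext x
  unfold pderiv
  simp_rw [key]
  have e : ∀ s : ℝ, (∑ X ∈ (nbhd I.range Λ).powerset with (X ∩ Λ).Nonempty ∧ j ∉ X,
      I.J X (X.restrict (Function.update x j s))) =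
      ∑ X ∈ (nbhd I.range Λ).powerset with (X ∩ Λ).Nonempty ∧ j ∉ X, I.J X (X.restrict x) := by
    intro s
    refine Finset.sum_congr rfl fun X hX => congrArg _ ?_
    ext ⟨i, hi⟩
    have : i ≠ j := by
      rintro rfl
      exact (Finset.mem_filter.1 hX).2.2 hi
    simp [Finset.restrict, this]
  simp_rw [e]
  rw [deriv_add_const]

end Energy

/-! ### Translation invariance of `e^{U_Λ} μ`. -/

section Invariance

variable {d : ℕ} {I : Interaction d} {μ : Measure (Config d)} {Λ Δ : Finset (Site d)}

/-- The reference measure `e^{U_Λ} μ`. -/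
def Interaction.flat (I : Interaction d) (μ : Measure (Config d)) (Λ : Finset (Site d)) :
    Measure (Config d) :=
  μ.withDensity fun x => ENNReal.ofReal (Real.exp (I.U Λ x))

theorem measurable_glue : Measurable fun p : Config d × (Λ → ℝ) => glue Λ p.1 p.2 := by
  refine measurable_pi_iff.2 fun i => ?_
  by_cases h : i ∈ Λ
  · simp only [glue, h, dif_pos]
    exact (measurable_pi_apply _).comp measurable_snd
  · simp only [glue, h, dif_neg, not_false_eq_true]
    exact (measurable_pi_apply _).comp measurable_fst

theorem measurable_glue_right (ω : Config d) : Measurable (glue Λ ω) :=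
  measurable_glue.comp measurable_prodMk_left

theorem glue_add (ω : Config d) (z y : Λ → ℝ) : glue Λ ω z + glue Λ 0 y = glue Λ ω (z + y) := by
  ext i
  by_cases h : i ∈ Λ <;> simp [glue, h]

theorem measurable_weight (I : Interaction d) (Λ : Finset (Site d)) :
    Measurable fun x => ENNReal.ofReal (Real.exp (I.U Λ x)) :=
  (Real.measurable_exp.comp (I.measurable_U Λ)).ennreal_ofReal

theorem measurable_weight_neg (I : Interaction d) (Λ : Finset (Site d)) :
    Measurable fun x => ENNReal.ofReal (Real.exp (-I.U Λ x)) :=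
  (Real.measurable_exp.comp (I.measurable_U Λ).neg).ennreal_ofReal

theorem lintegral_localGibbs (ω : Config d) {G : Config d → ℝ≥0∞} (hG : Measurable G) :
    ∫⁻ x, G x ∂(I.localGibbs Λ ω) = (I.Z Λ ω)⁻¹ *
      ∫⁻ z : Λ → ℝ, ENNReal.ofReal (Real.exp (-I.U Λ (glue Λ ω z))) * G (glue Λ ω z) := by
  rw [Interaction.localGibbs, lintegral_map hG (measurable_glue_right ω), lintegral_smul_measure,
    lintegral_withDensity_eq_lintegral_mul _ (f := fun z => ENNReal.ofReal
      (Real.exp (-I.Ubd Λ ω z))) ?_ (g := fun z => G (glue Λ ω z))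
      (hG.comp (measurable_glue_right ω))]
  · rfl
  · exact (measurable_weight_neg I Λ).comp (measurable_glue_right ω)

theorem measurable_localGibbs : Measurable (I.localGibbs Λ) := by
  refine Measure.measurable_of_measurable_coe _ fun A hA => ?_
  have h1 : Measurable fun p : Config d × (Λ → ℝ) =>
      ENNReal.ofReal (Real.exp (-I.U Λ (glue Λ p.1 p.2))) * A.indicator 1 (glue Λ p.1 p.2) :=
    ((measurable_weight_neg I Λ).comp measurable_glue).mul
      ((measurable_one.indicator hA).comp measurable_glue)
  have h2 : Measurable fun ω => I.Z Λ ω :=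
    ((measurable_weight_neg I Λ).comp (measurable_glue (Λ := Λ))).lintegral_prod_right'
  have e : (fun ω => I.localGibbs Λ ω A) = fun ω => (I.Z Λ ω)⁻¹ *
      ∫⁻ z : Λ → ℝ, ENNReal.ofReal (Real.exp (-I.U Λ (glue Λ ω z))) *
        A.indicator 1 (glue Λ ω z) := by
    ext ω
    rw [← lintegral_localGibbs ω (measurable_one.indicator hA), lintegral_indicator_one hA]
  rw [e]
  exact h2.inv.mul h1.lintegral_prod_right'

theorem Interaction.IsGibbs.lintegral_eq (hμ : I.IsGibbs μ) (Λ : Finset (Site d))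
    {G : Config d → ℝ≥0∞} (hG : Measurable G) :
    ∫⁻ x, G x ∂μ = ∫⁻ ω, ∫⁻ x, G x ∂(I.localGibbs Λ ω) ∂μ := by
  have e : μ = μ.bind (I.localGibbs Λ) := by
    ext A hA
    rw [Measure.bind_apply hA measurable_localGibbs.aemeasurable, hμ.dlr Λ A hA]
  conv_lhs => rw [e]
  exact Measure.lintegral_bind measurable_localGibbs.aemeasurable hG.aemeasurable

theorem ofReal_exp_mul_exp_neg (a : ℝ) :
    ENNReal.ofReal (Real.exp (-a)) * ENNReal.ofReal (Real.exp a) = 1 := by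
  rw [← ENNReal.ofReal_mul (Real.exp_pos _).le, ← Real.exp_add, neg_add_cancel, Real.exp_zero,
    ENNReal.ofReal_one]

/-- The reference measure is invariant under translations of the coordinates in `Λ`. -/
theorem Interaction.IsGibbs.measurePreserving (hμ : I.IsGibbs μ) (y : Λ → ℝ) :
    MeasurePreserving (fun x => x + glue Λ 0 y) (I.flat μ Λ) (I.flat μ Λ) := by
  have hm : Measurable fun x : Config d => x + glue Λ 0 y := measurable_add_const _
  -- By the DLR equations the weight `e^{U_Λ}` cancels the density of the local Gibbs measure. What
  -- is left on the fibre over `ω` is Lebesgue measure on `ℝ^Λ`, up to a factor that depends on `ω`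
  -- only.
  have key : ∀ G : Config d → ℝ≥0∞, Measurable G → ∫⁻ x, G x ∂(I.flat μ Λ) =
      ∫⁻ ω, (I.Z Λ ω)⁻¹ * (∫⁻ z : Λ → ℝ, G (glue Λ ω z)) ∂μ := fun G hG => by
    rw [Interaction.flat, lintegral_withDensity_eq_lintegral_mul _ (measurable_weight I Λ) hG,
      hμ.lintegral_eq Λ ((measurable_weight I Λ).mul hG)]
    refine lintegral_congr fun ω => ?_
    rw [lintegral_localGibbs ω ((measurable_weight I Λ).mul hG)]
    congr 1
    refine lintegral_congr fun z => ?_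
    rw [Pi.mul_apply, ← mul_assoc, ofReal_exp_mul_exp_neg, one_mul]
  refine ⟨hm, Measure.ext fun A hA => ?_⟩
  rw [← lintegral_indicator_one hA, ← lintegral_indicator_one hA,
    lintegral_map (measurable_one.indicator hA) hm, key _ (measurable_one.indicator hA),
    key (fun x => A.indicator 1 (x + glue Λ 0 y)) ((measurable_one.indicator hA).comp hm)]
  refine lintegral_congr fun ω => ?_
  congr 1
  simp_rw [glue_add]
  exact lintegral_add_right_eq_self (fun z => A.indicator 1 (glue Λ ω z)) y

theorem withDensity_flat : (I.flat μ Λ).withDensity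
    (fun x => ENNReal.ofReal (Real.exp (-I.U Λ x))) = μ := by
  rw [Interaction.flat, ← withDensity_mul _ (measurable_weight I Λ) (measurable_weight_neg I Λ)]
  conv_rhs => rw [← withDensity_one (μ := μ)]
  congr 1
  ext x
  rw [Pi.mul_apply, mul_comm, ofReal_exp_mul_exp_neg, Pi.one_apply]

/-- The translations of the coordinates in `Λ` preserve null sets. -/
theorem Interaction.IsGibbs.quasiMeasurePreserving (hμ : I.IsGibbs μ) (y : Λ → ℝ) :
    Measure.QuasiMeasurePreserving (fun x => x + glue Λ 0 y) μ μ := by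
  have h1 : μ ≪ I.flat μ Λ := by
    conv_lhs => rw [← withDensity_flat (I := I) (μ := μ) (Λ := Λ)]
    exact withDensity_absolutelyContinuous _ _
  exact (hμ.measurePreserving y).quasiMeasurePreserving.mono h1
    (withDensity_absolutelyContinuous _ _)

theorem lintegral_flat {G : Config d → ℝ≥0∞} :
    ∫⁻ x, G x ∂(I.flat μ Λ) = ∫⁻ x, ENNReal.ofReal (Real.exp (I.U Λ x)) * G x ∂μ := by
  rw [Interaction.flat, lintegral_withDensity_eq_lintegral_mul_non_measurable _
    (measurable_weight I Λ) (Eventually.of_forall fun _ => ENNReal.ofReal_lt_top)]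
  rfl

theorem integral_flat {E : Type*} [NormedAddCommGroup E] [NormedSpace ℝ E] {G : Config d → E} :
    ∫ x, G x ∂(I.flat μ Λ) = ∫ x, Real.exp (I.U Λ x) • G x ∂μ := by
  rw [Interaction.flat, integral_withDensity_eq_integral_toReal_smul (measurable_weight I Λ)
    (Eventually.of_forall fun _ => ENNReal.ofReal_lt_top)]
  simp only [ENNReal.toReal_ofReal (Real.exp_pos _).le]

/-- Invariance under translations, for integrals. -/
theorem Interaction.IsGibbs.integral_translate (hμ : I.IsGibbs μ) {E : Type*}
    [NormedAddCommGroup E] [NormedSpace ℝ E] (G : Config d → E) (y : Λ → ℝ) :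
    ∫ x, Real.exp (I.U Λ x) • G (x + glue Λ 0 y) ∂μ = ∫ x, Real.exp (I.U Λ x) • G x ∂μ := by
  rw [← integral_flat (G := fun x => G (x + glue Λ 0 y)), ← integral_flat]
  exact (hμ.measurePreserving y).integral_comp (measurableEmbedding_addRight _) G

theorem Interaction.IsGibbs.lintegral_translate (hμ : I.IsGibbs μ) (G : Config d → ℝ≥0∞)
    (y : Λ → ℝ) : ∫⁻ x, ENNReal.ofReal (Real.exp (I.U Λ x)) * G (x + glue Λ 0 y) ∂μ =
      ∫⁻ x, ENNReal.ofReal (Real.exp (I.U Λ x)) * G x ∂μ := by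
  rw [← lintegral_flat (G := fun x => G (x + glue Λ 0 y)), ← lintegral_flat]
  exact (hμ.measurePreserving y).lintegral_comp_emb (measurableEmbedding_addRight _) G

end Invariance

/-! ### Test functions separate integrable functions. -/

section Separation

variable {d : ℕ} {μ : Measure (Config d)} [IsProbabilityMeasure μ] {Δ S : Finset (Site d)}

/-- The `σ`-algebra of the coordinates in `Δ`. -/
abbrev coordSigma (Δ : Finset (Site d)) : MeasurableSpace (Config d) :=
  MeasurableSpace.comap Δ.restrict inferInstance

/-- The conditional expectation of `f` given the coordinates in `Δ` is a function `v` of these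
coordinates, with the same integrals against functions of them. The fundamental lemma of the
calculus of variations on `ℝ^Δ`, for the image of `μ`, gives `v = 0`. -/
theorem setIntegral_preimage_restrict_eq_zero {f : Config d → ℂ} (hf : Integrable f μ)
    (h : ∀ g : (Δ → ℝ) → ℝ, ContDiff ℝ ((⊤ : ℕ∞) : WithTop ℕ∞) g → HasCompactSupport g →
      ∫ x, g (Δ.restrict x) • f x ∂μ = 0) {B : Set (Δ → ℝ)} (hB : MeasurableSet B) :
    ∫ x in Δ.restrict ⁻¹' B, f x ∂μ = 0 := by
  have hr : Measurable (Δ.restrict : Config d → Δ → ℝ) := Finset.measurable_restrict (X := fun _ => ℝ) Δ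
  have hle : coordSigma Δ ≤ MeasurableSpace.pi := hr.comap_le
  obtain ⟨v, hv, hv'⟩ := (stronglyMeasurable_condExp (m := coordSigma Δ) (μ := μ)
    (f := f)).exists_eq_measurable_comp
  have hvi : Integrable v (μ.map Δ.restrict) := by
    rw [integrable_map_measure hv.aestronglyMeasurable hr.aemeasurable, ← hv']
    exact integrable_condExp
  have : IsProbabilityMeasure (μ.map (Δ.restrict : Config d → Δ → ℝ)) :=
    Measure.isProbabilityMeasure_map hr.aemeasurable
  have h0 : ∀ᵐ p ∂(μ.map (Δ.restrict : Config d → Δ → ℝ)), v p = 0 := by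
    refine ae_eq_zero_of_integral_contDiff_smul_eq_zero hvi.locallyIntegrable fun g hg hgs => ?_
    rw [integral_map (f := fun p => g p • v p) hr.aemeasurable
      (hg.continuous.aestronglyMeasurable.smul hv.aestronglyMeasurable)]
    obtain ⟨C, hC⟩ := hgs.exists_bound_of_continuous hg.continuous
    have h1 := condExp_stronglyMeasurable_bilin_of_bound (ContinuousLinearMap.lsmul ℝ ℝ) hle
      (f := fun x => g (Δ.restrict x)) (g := f) (μ := μ)
      (hg.continuous.measurable.comp (comap_measurable _)).stronglyMeasurable hf C
      (Eventually.of_forall fun x => hC _)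
    have h2 := integral_condExp hle (μ := μ) (f := fun x => g (Δ.restrict x) • f x)
    rw [h g hg hgs] at h2
    rw [← h2]
    refine integral_congr_ae ?_
    filter_upwards [h1] with x hx
    have h3 : v (Δ.restrict x) = (μ[f | coordSigma Δ]) x := (congrFun hv' x).symm
    rw [h3]
    exact hx.symm
  rw [← setIntegral_condExp hle hf ⟨B, hB, rfl⟩, hv']
  refine (setIntegral_congr_ae (g := fun _ => 0) (hr hB) ?_).trans (by simp)
  filter_upwards [ae_of_ae_map hr.aemeasurable h0] with x hx _ using hx

/-- Smooth compactly supported cylinder functions separate integrable functions. -/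
theorem ae_eq_zero_of_forall_cylinder {f : Config d → ℂ} (hf : Integrable f μ)
    (h : ∀ Δ, S ⊆ Δ → ∀ g : (Δ → ℝ) → ℝ, ContDiff ℝ ((⊤ : ℕ∞) : WithTop ℕ∞) g →
      HasCompactSupport g → ∫ x, g (Δ.restrict x) • f x ∂μ = 0) : f =ᵐ[μ] 0 := by
  have hcyl : ∀ t ∈ measurableCylinders (fun _ : Site d => ℝ), ∫ x in t, f x ∂μ = 0 := by
    intro t ht
    obtain ⟨s, B, hB, rfl⟩ := (mem_measurableCylinders t).1 ht
    classical
    -- The base of the cylinder is enlarged so that it contains `S`; cylinders form a π-system that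
    -- generates the σ-algebra.
    rw [cylinder_eq_cylinder_union (α := fun _ => ℝ) s B S]
    exact setIntegral_preimage_restrict_eq_zero hf (h _ Finset.subset_union_right)
      (Finset.measurable_restrict₂ _ hB)
  have huniv : ∫ x, f x ∂μ = 0 := by
    have := hcyl _ (univ_mem_measurableCylinders _)
    rwa [setIntegral_univ] at this
  refine hf.ae_eq_zero_of_forall_setIntegral_eq_zero fun s hs _ => ?_
  refine MeasurableSpace.induction_on_inter
    (C := fun s _ => ∫ x in s, f x ∂μ = 0) generateFrom_measurableCylinders.symm
    isPiSystem_measurableCylinders (by simp) hcyl ?_ ?_ s hs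
  · intro t ht h0
    rw [setIntegral_compl ht hf, h0, huniv, sub_zero]
  · intro F hd hF h0
    rw [integral_iUnion hF hd hf.integrableOn]
    simp [h0]

theorem ae_eq_zero_of_forall_isTest {f : Config d → ℂ} (hf : Integrable f μ)
    (h : ∀ g, IsTest S g → ∫ x, f x * g x ∂μ = 0) : f =ᵐ[μ] 0 := by
  refine ae_eq_zero_of_forall_cylinder (S := S) hf fun Δ hΔ g hg hgs => ?_
  have := h (fun x => (g (Δ.restrict x) : ℂ)) ⟨Δ, fun p => (g p : ℂ), hΔ,
    Complex.ofRealCLM.contDiff.comp hg, hgs.comp_left (g := fun a : ℝ => (a : ℂ)) (by simp),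
    fun _ => rfl⟩
  rw [← this]
  exact integral_congr_ae (Eventually.of_forall fun x => by
    simp only [Complex.real_smul, mul_comm])

end Separation

/-! ### Mollification in finite dimension. -/

section ContDiffApprox

open scoped Pointwise Convolution

/-- Approximation of `C^1` functions with compact support by smooth functions. -/
theorem exists_contDiff_approx {V : Type*} [NormedAddCommGroup V] [NormedSpace ℝ V]
    [FiniteDimensional ℝ V] {f : V → ℂ} (hf : ContDiff ℝ 1 f) {r : ℝ}
    (hr : ∀ p, f p ≠ 0 → ‖p‖ ≤ r) {ε : ℝ} (hε : 0 < ε) :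
    ∃ g : V → ℂ, ContDiff ℝ ((⊤ : ℕ∞) : WithTop ℕ∞) g ∧ (∀ p, g p ≠ 0 → ‖p‖ ≤ r + 1) ∧
      (∀ p, ‖g p - f p‖ ≤ ε) ∧ ∀ p, ‖fderiv ℝ g p - fderiv ℝ f p‖ ≤ ε := by
  let _ : MeasurableSpace V := borel V
  have : BorelSpace V := ⟨rfl⟩
  have hcs : HasCompactSupport f := by
    have : ProperSpace V := FiniteDimensional.proper_real V
    exact HasCompactSupport.of_support_subset_isCompact (isCompact_closedBall (0 : V) r)
      fun p hp => mem_closedBall_zero_iff.2 (hr p hp)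
  have hu1 := hcs.uniformContinuous_of_continuous hf.continuous
  have hdc : Continuous (fderiv ℝ f) := hf.continuous_fderiv one_ne_zero
  have hu2 := (hcs.fderiv ℝ).uniformContinuous_of_continuous hdc
  obtain ⟨δ₁, hδ₁, h₁⟩ := Metric.uniformContinuous_iff.1 hu1 ε hε
  obtain ⟨δ₂, hδ₂, h₂⟩ := Metric.uniformContinuous_iff.1 hu2 ε hε
  -- The moduli of uniform continuity of `f` and of its derivative give the two estimates; `δ ≤ 1`
  -- keeps the support in the ball of radius `r + 1`.
  set δ := min (min δ₁ δ₂) 1 with hδ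
  have hδ0 : 0 < δ := lt_min (lt_min hδ₁ hδ₂) one_pos
  let φ : ContDiffBump (0 : V) := ⟨δ / 2, δ, half_pos hδ0, half_lt_self hδ0⟩
  let ν : Measure V := Measure.addHaar
  have hli : LocallyIntegrable (φ.normed ν) ν :=
    (φ.continuous_normed).locallyIntegrable
  have hfd : ∀ p, HasFDerivAt (φ.normed ν ⋆[ContinuousLinearMap.lsmul ℝ ℝ, ν] f)
      ((φ.normed ν ⋆[ContinuousLinearMap.lsmul ℝ ℝ, ν] fderiv ℝ f) p) p := fun p =>
    hcs.hasFDerivAt_convolution_right (ContinuousLinearMap.lsmul ℝ ℝ) hli hf p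
  refine ⟨φ.normed ν ⋆[ContinuousLinearMap.lsmul ℝ ℝ, ν] f, ?_, fun p hp => ?_, fun p => ?_,
    fun p => ?_⟩
  · exact φ.hasCompactSupport_normed.contDiff_convolution_left _ φ.contDiff_normed
      hf.continuous.locallyIntegrable
  · obtain ⟨a, ha, b, hb, rfl⟩ := support_convolution_subset _ hp
    rw [φ.support_normed_eq, mem_ball_zero_iff] at ha
    have : ‖b‖ ≤ r := hr b hb
    have h3 : ‖a‖ < 1 := ha.trans_le (min_le_right _ _)
    calc ‖a + b‖ ≤ ‖a‖ + ‖b‖ := norm_add_le _ _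
      _ ≤ r + 1 := by linarith
  · rw [← dist_eq_norm]
    refine φ.dist_normed_convolution_le hf.continuous.aestronglyMeasurable fun x hx => ?_
    exact (h₁ (lt_of_lt_of_le hx ((min_le_left _ _).trans (min_le_left _ _)))).le
  · rw [(hfd p).fderiv, ← dist_eq_norm]
    refine φ.dist_normed_convolution_le hdc.aestronglyMeasurable fun x hx => ?_
    exact (h₂ (lt_of_lt_of_le hx ((min_le_left _ _).trans (min_le_right _ _)))).le

end ContDiffApprox

/-! ### Classes in `L²` as a total function. -/

section ToL2

variable {Ω : Type*} [MeasurableSpace Ω] {μ : Measure Ω} {F G : Ω → ℂ}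

open Classical in
/-- The class of `F` in `L²(μ)` (zero if `F` is not square integrable). -/
def toL2 (μ : Measure Ω) (F : Ω → ℂ) : Lp ℂ 2 μ := if h : MemLp F 2 μ then h.toLp F else 0

theorem coeFn_toL2 (h : MemLp F 2 μ) : toL2 μ F =ᵐ[μ] F := by
  rw [toL2, dif_pos h]
  exact h.coeFn_toLp

theorem toL2_congr (hF : MemLp F 2 μ) (h : F =ᵐ[μ] G) : toL2 μ F = toL2 μ G :=
  Lp.ext ((coeFn_toL2 hF).trans (h.trans (coeFn_toL2 (hF.ae_eq h)).symm))

theorem toL2_sub (hF : MemLp F 2 μ) (hG : MemLp G 2 μ) :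
    toL2 μ F - toL2 μ G = toL2 μ (F - G) := by
  refine Lp.ext ((Lp.coeFn_sub _ _).trans (EventuallyEq.trans ?_ (coeFn_toL2 (hF.sub hG)).symm))
  filter_upwards [coeFn_toL2 hF, coeFn_toL2 hG] with x h1 h2
  simp [h1, h2]

theorem inner_toL2_right [IsProbabilityMeasure μ] (u : Lp ℂ 2 μ) (hF : MemLp F 2 μ) :
    inner ℂ u (toL2 μ F) = ∫ x, starRingEnd ℂ (u x) * F x ∂μ := by
  rw [inner_Lp]
  refine integral_congr_ae ?_
  filter_upwards [coeFn_toL2 hF] with x h1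
  rw [h1]

theorem inner_toL2_left [IsProbabilityMeasure μ] (u : Lp ℂ 2 μ) (hF : MemLp F 2 μ) :
    inner ℂ (toL2 μ F) u = ∫ x, starRingEnd ℂ (F x) * u x ∂μ := by
  rw [inner_Lp]
  refine integral_congr_ae ?_
  filter_upwards [coeFn_toL2 hF] with x h1
  rw [h1]

theorem norm_toL2_le [IsProbabilityMeasure μ] {C : ℝ} (hC : 0 ≤ C) (hF : ∀ x, ‖F x‖ ≤ C) :
    ‖toL2 μ F‖ ≤ C := by
  rw [toL2]
  split_ifs with h
  · have h1 : ∀ᵐ x ∂μ, ‖h.toLp F x‖ ≤ C := by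
      filter_upwards [h.coeFn_toLp] with x hx
      rw [hx]
      exact hF x
    have := Lp.norm_le_of_ae_bound hC h1
    simpa [measureUnivNNReal] using this
  · simpa using hC

theorem memLp_of_norm_le [IsProbabilityMeasure μ] (hF : Measurable F) {C : ℝ}
    (hC : ∀ x, ‖F x‖ ≤ C) : MemLp F 2 μ :=
  MemLp.of_bound hF.aestronglyMeasurable C (Eventually.of_forall hC)

end ToL2

/-! ### Cylinder functions in `L²` and the formal adjoint of the derivatives. -/

section CylinderL2

variable {d : ℕ} {μ : Measure (Config d)} [IsProbabilityMeasure μ] {Δ Λ : Finset (Site d)}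
  {n : WithTop ℕ∞} {I : Interaction d} {F g : Config d → ℂ}

theorem Cyl.memLp (h : Cyl n Δ F) (hb : BddSupp Δ F) : MemLp F 2 μ := by
  obtain ⟨C, _, hC⟩ := h.exists_norm_le hb
  exact memLp_of_norm_le h.measurable hC

theorem Cyl.exists_bound_on {E : Type*} [NormedAddCommGroup E] [NormedSpace ℝ E]
    {F : Config d → E} (h : Cyl n Δ F) (r : ℝ) :
    ∃ C, 0 ≤ C ∧ ∀ x, (∀ i ∈ Δ, |x i| ≤ r) → ‖F x‖ ≤ C := by
  obtain ⟨C, hC⟩ := (isCompact_closedBall (0 : Δ → ℝ) (max r 0)).exists_bound_of_continuousOn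
    h.continuous_of_comp.continuousOn
  refine ⟨max C 0, le_max_right _ _, fun x hx => ?_⟩
  rw [← h.apply_glue_restrict x]
  refine (hC _ ?_).trans (le_max_left _ _)
  rw [mem_closedBall_zero_iff, pi_norm_le_iff_of_nonneg (le_max_right _ _)]
  rintro ⟨i, hi⟩
  exact (hx i hi).trans (le_max_left _ _)

theorem Cyl.ofReal {f : Config d → ℝ} (h : Cyl n Δ f) : Cyl n Δ fun x => (f x : ℂ) :=
  h.comp Complex.ofRealCLM.contDiff

theorem Cyl.star (h : Cyl n Δ F) : Cyl n Δ fun x => starRingEnd ℂ (F x) :=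
  h.comp Complex.conjCLE.contDiff

theorem Cyl.continuous {E : Type*} [NormedAddCommGroup E] [NormedSpace ℝ E]
    {F : Config d → E} (h : Cyl n Δ F) : Continuous F := by
  have e : F = (fun p : Δ → ℝ => F (glue Δ 0 p)) ∘ Δ.restrict :=
    funext fun x => (h.apply_glue_restrict x).symm
  rw [e]
  exact h.continuous_of_comp.comp (continuous_pi fun i => continuous_apply _)

theorem Cyl.pderiv_star (h : Cyl n Δ F) (hn : 1 ≤ n) (j : Site d) (x : Config d) :
    LatticeLSE.pderiv j (fun x => starRingEnd ℂ (F x)) x =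
      starRingEnd ℂ (LatticeLSE.pderiv j F x) :=
  h.star.pderiv_eq hn j x
    (Complex.conjCLE.toContinuousLinearMap.hasFDerivAt.comp_hasDerivAt 0 (h.hasDerivAt_zero hn j x))

/-- The derivative `∂_j U_Λ`, as a complex number. -/
def Interaction.force (I : Interaction d) (Λ : Finset (Site d)) (j : Site d) (x : Config d) : ℂ :=
  ((pderiv j (I.U Λ) x : ℝ) : ℂ)

/-- The formal adjoint of `-∂_j`, namely `∂_j g - g ∂_j U_Λ`. -/
def Interaction.codiff (I : Interaction d) (Λ : Finset (Site d)) (j : Site d) (g : Config d → ℂ)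
    (x : Config d) : ℂ := pderiv j g x - I.force Λ j x * g x

theorem Interaction.force_singleton (I : Interaction d) {j : Site d} (hj : j ∈ Λ) :
    I.force {j} j = I.force Λ j := by
  ext x
  rw [Interaction.force, Interaction.force, I.pderiv_U hj]

theorem Interaction.codiff_singleton (I : Interaction d) {j : Site d} (hj : j ∈ Λ)
    (g : Config d → ℂ) : I.codiff {j} j g = I.codiff Λ j g := by
  ext x
  rw [Interaction.codiff, Interaction.codiff, I.force_singleton hj]

theorem Interaction.cyl_force (I : Interaction d) (h : nbhd I.range Λ ⊆ Δ) (j : Site d) :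
    Cyl 0 Δ (I.force Λ j) :=
  ((I.cyl_U h).pderiv (m := 0) (by simp) j).ofReal

theorem Interaction.cyl_codiff (I : Interaction d) (hΔ : nbhd I.range Λ ⊆ Δ) (j : Site d)
    (hg : Cyl 1 Δ g) : Cyl 0 Δ (I.codiff Λ j g) := by
  have h1 := (hg.pderiv (m := 0) (by simp) j).add
    (((cyl_const (-1 : ℂ)).mul ((I.cyl_force hΔ j).mul (hg.of_le zero_le_one))))
  have e : I.codiff Λ j g = fun x => pderiv j g x + -1 * (I.force Λ j x * g x) := by
    ext x
    rw [Interaction.codiff]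
    ring
  rw [e]
  exact h1

theorem BddSupp.codiff (hb : BddSupp Δ g) (hg : Cyl 1 Δ g) (j : Site d) :
    BddSupp Δ (I.codiff Λ j g) := by
  obtain ⟨r, hr⟩ := hb
  obtain ⟨r', hr'⟩ := BddSupp.pderiv ⟨r, hr⟩ hg le_rfl j
  refine ⟨max r r', fun x hx i hi => ?_⟩
  by_cases h : g x = 0
  · refine (hr' x (fun h0 => hx ?_) i hi).trans (le_max_right _ _)
    rw [Interaction.codiff, h0, h, mul_zero, sub_zero]
  · exact (hr x h i hi).trans (le_max_left _ _)

end CylinderL2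

/-! ### The space of weakly differentiable functions of a Gibbs measure. -/

section Sobolev

variable {d : ℕ}

/-- The jets of the functions that are weakly differentiable in the directions in `Λ`. -/
def sobolev (I : Interaction d) (μ : Measure (Config d)) (Λ : Finset (Site d)) :
    ClosedSubmodule ℂ (Jet (Lp ℂ 2 μ) Λ) where
  carrier := {x | ∀ (j : Λ) (g : Config d → ℂ), IsTest (nbhd I.range {(j : Site d)}) g →
    inner ℂ (toL2 μ g) (x (some j)) + inner ℂ (toL2 μ (I.codiff {(j : Site d)} j g)) (x none) = 0}
  add_mem' {x y} hx hy j g hg := by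
    rw [PiLp.add_apply, PiLp.add_apply, inner_add_right, inner_add_right]
    linear_combination hx j g hg + hy j g hg
  zero_mem' j g hg := by simp
  smul_mem' c x hx j g hg := by
    rw [PiLp.smul_apply, PiLp.smul_apply, inner_smul_right, inner_smul_right]
    linear_combination c * hx j g hg
  isClosed' := by
    have e : {x : Jet (Lp ℂ 2 μ) Λ | ∀ (j : Λ) (g : Config d → ℂ),
        IsTest (nbhd I.range {(j : Site d)}) g → inner ℂ (toL2 μ g) (x (some j)) +
          inner ℂ (toL2 μ (I.codiff {(j : Site d)} j g)) (x none) = 0} =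
        ⋂ (j : Λ) (g : Config d → ℂ) (_ : IsTest (nbhd I.range {(j : Site d)}) g),
          {x | inner ℂ (toL2 μ g) (x (some j)) +
            inner ℂ (toL2 μ (I.codiff {(j : Site d)} j g)) (x none) = 0} := by
      ext x
      simp only [Set.mem_ofPred_eq, Set.mem_iInter]
    change IsClosed {x : Jet (Lp ℂ 2 μ) Λ | _}
    rw [e]
    refine isClosed_iInter fun j => isClosed_iInter fun g => isClosed_iInter fun _ => ?_
    exact isClosed_eq ((continuous_const.inner (continuous_apply_jet _)).add
      (continuous_const.inner (continuous_apply_jet _))) continuous_const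

theorem mem_sobolev {I : Interaction d} {μ : Measure (Config d)} {Λ : Finset (Site d)}
    {x : Jet (Lp ℂ 2 μ) Λ} : x ∈ sobolev I μ Λ ↔ ∀ (j : Λ) (g : Config d → ℂ),
      IsTest (nbhd I.range {(j : Site d)}) g → inner ℂ (toL2 μ g) (x (some j)) +
        inner ℂ (toL2 μ (I.codiff {(j : Site d)} j g)) (x none) = 0 := Iff.rfl

/-- The jet of a differentiable function. -/
def jetOf (μ : Measure (Config d)) (Λ : Finset (Site d)) (F : Config d → ℂ) :
    Jet (Lp ℂ 2 μ) Λ :=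
  WithLp.toLp 2 fun o => o.elim (toL2 μ F) fun j => toL2 μ (pderiv (j : Site d) F)

variable {I : Interaction d} {μ : Measure (Config d)} [IsProbabilityMeasure μ]
  {Λ Δ : Finset (Site d)}

theorem norm_restrict_single_le (j : Site d) :
    ‖Δ.restrict (Pi.single j (1 : ℝ) : Config d)‖ ≤ 1 := by
  rw [pi_norm_le_iff_of_nonneg zero_le_one]
  rintro ⟨i, hi⟩
  by_cases h : i = j
  · subst h; simp
  · simp [h]

/-- The defining property of weak derivatives holds for test functions of class `C^1`. -/
theorem inner_toL2_add_inner_codiff {x : Jet (Lp ℂ 2 μ) Λ} (hx : x ∈ sobolev I μ Λ) (j : Λ)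
    (hΔ : nbhd I.range Λ ⊆ Δ) {g : Config d → ℂ} (hg : Cyl 1 Δ g) (hb : BddSupp Δ g) :
    inner ℂ (toL2 μ g) (x (some j)) + inner ℂ (toL2 μ (I.codiff Λ j g)) (x none) = 0 := by
  obtain ⟨r, hr⟩ := hb
  -- The force may be unbounded. But `g` and its smooth approximations are supported where the
  -- coordinates in `Δ` are at most `max r 0 + 1`.
  obtain ⟨C, hC0, hC⟩ := (I.cyl_force hΔ j).exists_bound_on (max r 0 + 1)
  have key : ∀ ε : ℝ, 0 < ε → ‖inner ℂ (toL2 μ g) (x (some j)) +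
      inner ℂ (toL2 μ (I.codiff Λ j g)) (x none)‖ ≤
        ε * (‖x (some j)‖ + (1 + C) * ‖x none‖) := by
    intro ε hε
    have hr' : ∀ p : Δ → ℝ, g (glue Δ 0 p) ≠ 0 → ‖p‖ ≤ max r 0 := fun p hp => by
      rw [pi_norm_le_iff_of_nonneg (le_max_right _ _)]
      rintro ⟨i, hi⟩
      have := hr _ hp i hi
      rw [glue_of_mem hi] at this
      exact this.trans (le_max_left _ _)
    obtain ⟨f, hf, hfs, hf1, hf2⟩ := exists_contDiff_approx hg.contDiff hr' hε
    set k : Config d → ℂ := fun x => f (Δ.restrict x) with hk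
    have hkc : Cyl ((⊤ : ℕ∞) : WithTop ℕ∞) Δ k := cyl_of_comp hf
    have hk1 : Cyl 1 Δ k := hkc.of_le (by exact_mod_cast le_top)
    have hks : ∀ x, k x ≠ 0 → ∀ i ∈ Δ, |x i| ≤ max r 0 + 1 := fun x hx i hi =>
      (norm_le_pi_norm (Δ.restrict x) ⟨i, hi⟩).trans (hfs _ hx)
    have hkb : BddSupp Δ k := ⟨_, hks⟩
    have hsub : nbhd I.range {(j : Site d)} ⊆ Δ :=
      (nbhd_mono (Finset.singleton_subset_iff.2 j.2)).trans hΔ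
    have h0 := mem_sobolev.1 hx j k (isTest_iff.2 ⟨Δ, hsub, hkc, hkb⟩)
    rw [I.codiff_singleton j.2] at h0
    have hd1 : ∀ x, ‖(g - k) x‖ ≤ ε := fun x => by
      have := hf1 (Δ.restrict x)
      rw [hg.apply_glue_restrict] at this
      rw [Pi.sub_apply, norm_sub_rev]
      exact this
    have hd2 : ∀ x, ‖pderiv j g x - pderiv j k x‖ ≤ ε := fun x => by
      rw [hg.pderiv_eq_fderiv le_rfl, hk1.pderiv_eq_fderiv le_rfl, ← _root_.sub_apply]
      have e : (fun p : Δ → ℝ => k (glue Δ 0 p)) = f := by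
        ext p
        simp only [hk, restrict_glue]
      rw [e]
      refine (ContinuousLinearMap.le_opNorm _ _).trans ?_
      have h3 := hf2 (Δ.restrict x)
      rw [norm_sub_rev] at h3
      exact (mul_le_mul h3 (norm_restrict_single_le _) (norm_nonneg _) hε.le).trans (mul_one ε).le
    have hd3 : ∀ x, ‖(I.codiff Λ j g - I.codiff Λ j k) x‖ ≤ (1 + C) * ε := fun x => by
      have e : (I.codiff Λ j g - I.codiff Λ j k) x =
          (pderiv j g x - pderiv j k x) - I.force Λ j x * (g - k) x := by
        simp only [Pi.sub_apply, Interaction.codiff]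
        ring
      rw [e]
      refine (norm_sub_le _ _).trans ?_
      have h4 : ‖I.force Λ j x * (g - k) x‖ ≤ C * ε := by
        by_cases h5 : (g - k) x = 0
        · rw [h5, mul_zero, norm_zero]
          positivity
        · rw [norm_mul]
          refine mul_le_mul (hC x fun i hi => ?_) (hd1 x) (norm_nonneg _) hC0
          by_cases h6 : k x = 0
          · have h7 : g x ≠ 0 := fun h7 => h5 (by rw [Pi.sub_apply, h6, h7, sub_zero])
            exact (hr x h7 i hi).trans ((le_max_left _ _).trans (by linarith))
          · exact hks x h6 i hi
      linarith [hd2 x]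
    have hgm : MemLp g 2 μ := hg.memLp ⟨r, hr⟩
    have hkm : MemLp k 2 μ := hk1.memLp hkb
    have hgm' : MemLp (I.codiff Λ j g) 2 μ :=
      (I.cyl_codiff hΔ j hg).memLp (BddSupp.codiff ⟨r, hr⟩ hg j)
    have hkm' : MemLp (I.codiff Λ j k) 2 μ :=
      (I.cyl_codiff hΔ j hk1).memLp (BddSupp.codiff hkb hk1 j)
    have e : inner ℂ (toL2 μ g) (x (some j)) + inner ℂ (toL2 μ (I.codiff Λ j g)) (x none) =
        inner ℂ (toL2 μ (g - k)) (x (some j)) +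
          inner ℂ (toL2 μ (I.codiff Λ j g - I.codiff Λ j k)) (x none) := by
      rw [← toL2_sub hgm hkm, ← toL2_sub hgm' hkm', inner_sub_left, inner_sub_left]
      linear_combination h0
    rw [e]
    refine (norm_add_le _ _).trans ?_
    have h8 := (norm_inner_le_norm (𝕜 := ℂ) (toL2 μ (g - k)) (x (some j))).trans
      (mul_le_mul_of_nonneg_right (norm_toL2_le hε.le hd1) (norm_nonneg _))
    have h9 := (norm_inner_le_norm (𝕜 := ℂ) (toL2 μ (I.codiff Λ j g - I.codiff Λ j k))
      (x none)).trans (mul_le_mul_of_nonneg_right (norm_toL2_le (by positivity) hd3)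
        (norm_nonneg _))
    linarith
  rw [← norm_le_zero_iff]
  have hlim : Tendsto (fun ε : ℝ => ε * (‖x (some j)‖ + (1 + C) * ‖x none‖)) (𝓝[>] 0) (𝓝 0) := by
    have : Tendsto (fun ε : ℝ => ε * (‖x (some j)‖ + (1 + C) * ‖x none‖)) (𝓝 0) (𝓝 (0 * _)) :=
      tendsto_id.mul_const _
    rw [zero_mul] at this
    exact this.mono_left nhdsWithin_le_nhds
  exact ge_of_tendsto hlim (eventually_nhdsWithin_of_forall fun ε hε => key ε hε)

end Sobolev

/-! ### Differentiation of translated integrals and integration by parts. -/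

section Translation

variable {d : ℕ} {μ : Measure (Config d)} [IsProbabilityMeasure μ] {Δ Λ : Finset (Site d)}
  {n : WithTop ℕ∞} {I : Interaction d} {H : Config d → ℂ} {w : Config d → ℂ}

theorem Cyl.integrable_mul_translate (hw : Integrable w μ) (hH : Cyl n Δ H) (hb : BddSupp Δ H)
    (c : Config d) : Integrable (fun x => w x * H (x + c)) μ := by
  obtain ⟨C, _, hC⟩ := hH.exists_norm_le hb
  exact hw.mul_bdd (hH.translate c).measurable.aestronglyMeasurable
    (Eventually.of_forall fun x => hC _)

theorem hasDerivAt_integral_of_bound {Ω : Type*} [MeasurableSpace Ω] {ν : Measure Ω}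
    {F F' : ℝ → Ω → ℂ} {b : Ω → ℝ} (hF : ∀ s, Integrable (F s) ν)
    (hF' : AEStronglyMeasurable (F' 0) ν) (hb : ∀ x s, ‖F' s x‖ ≤ b x) (hbi : Integrable b ν)
    (hd : ∀ x s, HasDerivAt (fun s => F s x) (F' s x) s) :
    HasDerivAt (fun s => ∫ x, F s x ∂ν) (∫ x, F' 0 x ∂ν) 0 :=
  (hasDerivAt_integral_of_dominated_loc_of_deriv_le (s := Set.univ) univ_mem
    (Eventually.of_forall fun s => (hF s).aestronglyMeasurable) (hF 0) hF'
    (Eventually.of_forall fun x s _ => hb x s) hbi (Eventually.of_forall fun x s _ => hd x s)).2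

theorem Cyl.hasDerivAt_integral_translate (hw : Integrable w μ) (hH : Cyl 1 Δ H)
    (hb : BddSupp Δ H) (j : Site d) (c : Config d) :
    HasDerivAt (fun s : ℝ => ∫ x, w x * H (x + (c + s • Pi.single j (1 : ℝ))) ∂μ)
      (∫ x, w x * LatticeLSE.pderiv j H (x + c) ∂μ) 0 := by
  have hd := hH.pderiv (m := 0) (by simp) j
  obtain ⟨C, hC0, hC⟩ := hd.exists_norm_le (hb.pderiv hH le_rfl j)
  have hdiff : ∀ x s, HasDerivAt (fun s : ℝ => w x * H (x + (c + s • Pi.single j (1 : ℝ))))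
      (w x * LatticeLSE.pderiv j H (x + (c + s • Pi.single j (1 : ℝ)))) s := fun x s => by
    have h1 := (hH.hasDerivAt le_rfl j (x + c) s).const_mul (w x)
    simpa only [add_assoc] using h1
  have hi : ∀ s : ℝ, Integrable (fun x => w x * H (x + (c + s • Pi.single j (1 : ℝ)))) μ :=
    fun s => Cyl.integrable_mul_translate hw hH hb _
  have hi' : Integrable (fun x => w x * LatticeLSE.pderiv j H
      (x + (c + (0 : ℝ) • Pi.single j (1 : ℝ)))) μ :=
    Cyl.integrable_mul_translate hw hd (hb.pderiv hH le_rfl j) _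
  have hbd : ∀ x (s : ℝ), ‖w x * LatticeLSE.pderiv j H (x + (c + s • Pi.single j (1 : ℝ)))‖ ≤
      ‖w x‖ * C := fun x s => by
    rw [norm_mul]
    exact mul_le_mul_of_nonneg_left (hC _) (norm_nonneg _)
  have hbi : Integrable (fun x => ‖w x‖ * C) μ := hw.norm.mul_const C
  have h2 := hasDerivAt_integral_of_bound hi hi'.aestronglyMeasurable hbd hbi hdiff
  simp only [zero_smul, add_zero] at h2
  exact h2

theorem continuous_glue (ω : Config d) : Continuous (glue Λ ω) := by
  refine continuous_pi fun i => ?_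
  exact (contDiff_glue_apply (n := 0) i ω).continuous

theorem Cyl.continuous_integral_translate (hw : Integrable w μ) (hH : Cyl n Δ H)
    (hb : BddSupp Δ H) :
    Continuous fun y : Λ → ℝ => ∫ x, w x * H (x + glue Λ 0 y) ∂μ := by
  obtain ⟨C, hC0, hC⟩ := hH.exists_norm_le hb
  refine continuous_of_dominated (bound := fun x => ‖w x‖ * C)
    (fun y => (Cyl.integrable_mul_translate hw hH hb _).aestronglyMeasurable)
    (fun y => Eventually.of_forall fun x => ?_) (hw.norm.mul_const C)
    (Eventually.of_forall fun x => ?_)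
  · rw [norm_mul]
    exact mul_le_mul_of_nonneg_left (hC _) (norm_nonneg _)
  · exact continuous_const.mul (hH.continuous.comp
      (continuous_const.add (continuous_glue 0)))

theorem glue_add_smul_single (j : Λ) (y : Λ → ℝ) (s : ℝ) :
    glue Λ 0 (y + s • Pi.single j (1 : ℝ)) =
      glue Λ 0 y + s • Pi.single (j : Site d) (1 : ℝ) := by
  ext i
  by_cases h : i ∈ Λ
  · rw [Pi.add_apply, glue_of_mem h, glue_of_mem h]
    by_cases hij : i = j
    · subst hij; simp
    · have : (⟨i, h⟩ : Λ) ≠ j := fun h' => hij (by rw [← h'])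
      simp [hij, this]
  · rw [Pi.add_apply, glue_of_notMem h, glue_of_notMem h]
    have : i ≠ j := fun h' => h (h' ▸ j.2)
    simp [this]

theorem glue_smul_single (j : Λ) (s : ℝ) :
    glue Λ (0 : Config d) (s • Pi.single j (1 : ℝ)) = s • Pi.single (j : Site d) (1 : ℝ) := by
  have h := glue_add_smul_single (d := d) j 0 s
  rw [zero_add] at h
  rw [h]
  have : glue Λ (0 : Config d) (0 : Λ → ℝ) = 0 := by
    ext i
    by_cases h : i ∈ Λ <;> simp [glue, h]
  rw [this, zero_add]

theorem Cyl.hasLineDerivAt_integral_translate (hw : Integrable w μ) (hH : Cyl 1 Δ H)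
    (hb : BddSupp Δ H) (j : Λ) (y : Λ → ℝ) :
    HasLineDerivAt ℝ (fun y : Λ → ℝ => ∫ x, w x * H (x + glue Λ 0 y) ∂μ)
      (∫ x, w x * LatticeLSE.pderiv (j : Site d) H (x + glue Λ 0 y) ∂μ) y (Pi.single j 1) := by
  have h := Cyl.hasDerivAt_integral_translate hw hH hb (j : Site d) (glue Λ 0 y)
  simp_rw [← glue_add_smul_single] at h
  exact h

/-- The densities `e^{±U_Λ}`, with complex values. -/
def Interaction.dens (I : Interaction d) (Λ : Finset (Site d)) (x : Config d) : ℂ :=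
  ((Real.exp (I.U Λ x) : ℝ) : ℂ)

def Interaction.densInv (I : Interaction d) (Λ : Finset (Site d)) (x : Config d) : ℂ :=
  ((Real.exp (-I.U Λ x) : ℝ) : ℂ)

theorem Interaction.dens_mul_densInv (x : Config d) : I.dens Λ x * I.densInv Λ x = 1 := by
  rw [Interaction.dens, Interaction.densInv, ← Complex.ofReal_mul, ← Real.exp_add,
    add_neg_cancel, Real.exp_zero, Complex.ofReal_one]

theorem Interaction.cyl_dens (hΔ : nbhd I.range Λ ⊆ Δ) : Cyl 1 Δ (I.dens Λ) :=
  ((I.cyl_U hΔ).comp Real.contDiff_exp).ofReal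

theorem Interaction.cyl_densInv (hΔ : nbhd I.range Λ ⊆ Δ) : Cyl 1 Δ (I.densInv Λ) :=
  ((I.cyl_U hΔ).comp (Real.contDiff_exp.comp contDiff_neg)).ofReal

theorem Interaction.pderiv_dens (j : Site d) (x : Config d) :
    pderiv j (I.dens Λ) x = I.force Λ j x * I.dens Λ x := by
  have hc := I.cyl_U (Λ := Λ) (Finset.Subset.refl _)
  refine (I.cyl_dens (Λ := Λ) (Finset.Subset.refl _)).pderiv_eq le_rfl j x ?_
  have h := (hc.hasDerivAt_zero le_rfl j x).exp.ofReal_comp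
  simp only [zero_smul, add_zero] at h
  refine h.congr_deriv ?_
  rw [Interaction.force, Interaction.dens, Complex.ofReal_mul, mul_comm]

/-- Conjugation by `e^{U_Λ}` turns the formal adjoint into a plain derivative, in accordance with
the translation invariance of `e^{U_Λ} μ`. -/
theorem Interaction.codiff_dens_mul {F : Config d → ℂ} (hΔ : nbhd I.range Λ ⊆ Δ)
    (hF : Cyl 1 Δ F) (j : Site d) (x : Config d) :
    I.codiff Λ j (fun x => I.dens Λ x * F x) x = I.dens Λ x * pderiv j F x := by
  rw [Interaction.codiff, (I.cyl_dens hΔ).pderiv_mul hF le_rfl, Interaction.pderiv_dens]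
  ring

theorem Interaction.pderiv_densInv_mul {F : Config d → ℂ} (hΔ : nbhd I.range Λ ⊆ Δ)
    (hF : Cyl 1 Δ F) (j : Site d) (x : Config d) :
    pderiv j (fun x => I.densInv Λ x * F x) x = I.densInv Λ x * I.codiff Λ j F x := by
  have h := I.codiff_dens_mul hΔ ((I.cyl_densInv hΔ).mul hF) j x
  have e : (fun x => I.dens Λ x * (I.densInv Λ x * F x)) = F := by
    ext x
    rw [← mul_assoc, Interaction.dens_mul_densInv, one_mul]
  rw [e] at h
  rw [h, ← mul_assoc, mul_comm (I.densInv Λ x), Interaction.dens_mul_densInv, one_mul]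

theorem Interaction.IsGibbs.integral_dens_translate (hμ : I.IsGibbs μ) (G : Config d → ℂ)
    (y : Λ → ℝ) : ∫ x, I.dens Λ x * G (x + glue Λ 0 y) ∂μ = ∫ x, I.dens Λ x * G x ∂μ := by
  have h := hμ.integral_translate (Λ := Λ) G y
  simp only [Complex.real_smul] at h
  exact h

/-- Integration by parts for the Gibbs measure. -/
theorem Interaction.IsGibbs.integral_codiff (hμ : I.IsGibbs μ) (hΔ : nbhd I.range Λ ⊆ Δ)
    {G : Config d → ℂ} (hG : Cyl 1 Δ G) (hb : BddSupp Δ G) (j : Λ) :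
    ∫ x, I.codiff Λ j G x ∂μ = 0 := by
  set F : Config d → ℂ := fun x => I.densInv Λ x * G x with hFdef
  have hF : Cyl 1 Δ F := (I.cyl_densInv hΔ).mul hG
  have hFb : BddSupp Δ F := hb.mul_left
  obtain ⟨r, hr⟩ := hFb
  obtain ⟨r', hr'⟩ := BddSupp.pderiv ⟨r, hr⟩ hF le_rfl (j : Site d)
  -- The weight `e^{U_Λ}` need not be integrable. As all the functions `F (x + s e_j)` with `|s| <
  -- 1` vanish outside `K`, it may be cut off there.
  set K : Set (Config d) := {x | ∀ i ∈ Δ, |x i| ≤ max r r' + 1} with hK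
  have hKm : MeasurableSet K := by
    have e : K = ⋂ i ∈ Δ, {x | |x i| ≤ max r r' + 1} := by
      ext x; simp [hK]
    rw [e]
    exact Finset.measurableSet_biInter _ fun i _ =>
      measurableSet_le (measurable_pi_apply i).norm measurable_const
  obtain ⟨C, hC0, hC⟩ := (I.cyl_dens hΔ).exists_bound_on (max r r' + 1)
  set w : Config d → ℂ := K.indicator (I.dens Λ) with hw
  have hwi : Integrable w μ := by
    refine Integrable.of_bound (((I.cyl_dens hΔ).measurable.indicator hKm).aestronglyMeasurable) C
      (Eventually.of_forall fun x => ?_)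
    by_cases hx : x ∈ K
    · rw [hw, Set.indicator_of_mem hx]
      exact hC x hx
    · rw [hw, Set.indicator_of_notMem hx, norm_zero]
      exact hC0
  have h1 := Cyl.hasDerivAt_integral_translate hwi hF ⟨r, hr⟩ (j : Site d) 0
  -- By translation invariance the integral is constant for `|s| < 1`, so its derivative vanishes.
  have h2 : HasDerivAt (fun s : ℝ => ∫ x, w x * F (x + (0 + s • Pi.single (j : Site d) (1 : ℝ))) ∂μ)
      0 0 := by
    refine (hasDerivAt_const (0 : ℝ) (∫ x, I.dens Λ x * F x ∂μ)).congr_of_eventuallyEq ?_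
    filter_upwards [Metric.ball_mem_nhds (0 : ℝ) one_pos] with s hs
    rw [← hμ.integral_dens_translate (Λ := Λ) F (s • Pi.single j (1 : ℝ)), glue_smul_single,
      zero_add]
    refine integral_congr_ae (Eventually.of_forall fun x => ?_)
    by_cases hx : x ∈ K
    · simp only [hw, Set.indicator_of_mem hx]
    · have h0 : F (x + s • Pi.single (j : Site d) (1 : ℝ)) = 0 := by
        by_contra hne
        refine hx fun i hi => ?_
        have h3 : |(x + s • Pi.single (j : Site d) (1 : ℝ) : Config d) i| ≤ r := hr _ hne i hi
        have h4 : |(s • Pi.single (j : Site d) (1 : ℝ) : Config d) i| ≤ 1 := by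
          have hs' : |s| ≤ 1 := by
            rw [mem_ball_zero_iff] at hs
            exact hs.le
          by_cases hij : i = j
          · subst hij; simpa using hs'
          · simp [hij]
        have h5 := abs_sub ((x + s • Pi.single (j : Site d) (1 : ℝ) : Config d) i)
          ((s • Pi.single (j : Site d) (1 : ℝ) : Config d) i)
        rw [Pi.add_apply, add_sub_cancel_right] at h5
        rw [Pi.add_apply] at h3
        linarith [le_max_left r r']
      simp only [h0, mul_zero]
  have h3 := h1.unique h2
  rw [← h3]
  refine integral_congr_ae (Eventually.of_forall fun x => ?_)
  simp only [add_zero]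
  by_cases hx : x ∈ K
  · rw [hw, Set.indicator_of_mem hx, hFdef, I.pderiv_densInv_mul hΔ hG, ← mul_assoc,
      Interaction.dens_mul_densInv, one_mul]
  · have h0 : pderiv (j : Site d) F x = 0 := by
      by_contra hne
      exact hx fun i hi => (hr' x hne i hi).trans (by linarith [le_max_right r r'])
    have h6 := I.pderiv_densInv_mul hΔ hG (j : Site d) x
    rw [← hFdef, h0] at h6
    rw [h0, mul_zero]
    have h7 : I.densInv Λ x ≠ 0 := fun h => by
      have := I.dens_mul_densInv (Λ := Λ) x
      rw [h, mul_zero] at this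
      exact zero_ne_one this
    exact ((mul_eq_zero.1 h6.symm).resolve_left h7)

theorem codiff_star_mul {F g : Config d → ℂ} (hF : Cyl 1 Δ F) (hg : Cyl 1 Δ g) (j : Site d)
    (x : Config d) : I.codiff Λ j (fun x => starRingEnd ℂ (g x) * F x) x =
      starRingEnd ℂ (g x) * pderiv j F x + starRingEnd ℂ (I.codiff Λ j g x) * F x := by
  rw [Interaction.codiff, hg.star.pderiv_mul hF le_rfl, hg.pderiv_star le_rfl, Interaction.codiff,
    map_sub, map_mul]
  have : starRingEnd ℂ (I.force Λ j x) = I.force Λ j x := Complex.conj_ofReal _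
  rw [this]
  ring

/-- The jet of a `C^1` test function is in the Sobolev space. -/
theorem Interaction.IsGibbs.jetOf_mem (hμ : I.IsGibbs μ) (hΔ : nbhd I.range Λ ⊆ Δ)
    {F : Config d → ℂ} (hF : Cyl 1 Δ F) (hb : BddSupp Δ F) : jetOf μ Λ F ∈ sobolev I μ Λ := by
  classical
  refine mem_sobolev.2 fun j g hg => ?_
  obtain ⟨Δ', hΔ', hgc, hgb⟩ := isTest_iff.1 hg
  have hg1 : Cyl 1 Δ' g := hgc.of_le (by exact_mod_cast le_top)
  have hF' : Cyl 1 (Δ' ∪ Δ) F := hF.mono Finset.subset_union_right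
  have hg' : Cyl 1 (Δ' ∪ Δ) g := hg1.mono Finset.subset_union_left
  have hD : nbhd I.range {(j : Site d)} ⊆ Δ' := hΔ'
  have h1 := hμ.integral_codiff (Λ := Λ) (hΔ.trans Finset.subset_union_right)
    (hg'.star.mul hF') (BddSupp.mul_union (hgb.of_imp fun x hx => by rw [hx, map_zero]) hb) j
  have hdF : Cyl 0 Δ (pderiv (j : Site d) F) := hF.pderiv (by simp) j
  have hm1 : MemLp (pderiv (j : Site d) F) 2 μ := hdF.memLp (hb.pderiv hF le_rfl _)
  have hm2 : MemLp F 2 μ := hF.memLp hb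
  have hm3 : MemLp g 2 μ := hg1.memLp hgb
  have hm4 : MemLp (I.codiff {(j : Site d)} j g) 2 μ :=
    (I.cyl_codiff hD j hg1).memLp (hgb.codiff hg1 j)
  change inner ℂ (toL2 μ g) (toL2 μ (pderiv (j : Site d) F)) +
    inner ℂ (toL2 μ (I.codiff {(j : Site d)} j g)) (toL2 μ F) = 0
  rw [inner_toL2_right _ hm1, inner_toL2_right _ hm2, ← integral_add, ← h1]
  · refine integral_congr_ae ?_
    filter_upwards [coeFn_toL2 hm3, coeFn_toL2 hm4] with x h3 h4
    rw [h3, h4, codiff_star_mul hF' hg', I.codiff_singleton j.2]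
  · have := integrable_conj_mul (toL2 μ g) (toL2 μ (pderiv (j : Site d) F))
    refine this.congr ?_
    filter_upwards [coeFn_toL2 hm1] with x hx using by rw [hx]
  · have := integrable_conj_mul (toL2 μ (I.codiff {(j : Site d)} j g)) (toL2 μ F)
    refine this.congr ?_
    filter_upwards [coeFn_toL2 hm2] with x hx using by rw [hx]

/-- Smooth cutoff functions of the coordinates in `Δ`. -/
theorem exists_cutoff (Δ : Finset (Site d)) : ∃ (χ : ℕ → Config d → ℂ) (B : ℝ),
    (∀ k, Cyl ((⊤ : ℕ∞) : WithTop ℕ∞) Δ (χ k)) ∧ (∀ k, BddSupp Δ (χ k)) ∧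
    (∀ k x, starRingEnd ℂ (χ k x) = χ k x) ∧ (∀ k x, ‖χ k x‖ ≤ 1) ∧
    (∀ k j x, ‖pderiv j (χ k) x‖ ≤ B / (k + 1)) ∧ ∀ x, Tendsto (fun k => χ k x) atTop (𝓝 1) := by
  let f : ContDiffBump (0 : Δ → ℝ) := ⟨1, 2, one_pos, one_lt_two⟩
  have hf : ContDiff ℝ ((⊤ : ℕ∞) : WithTop ℕ∞) f := f.contDiff
  have hf1 : ContDiff ℝ 1 f := f.contDiff
  obtain ⟨B, hB⟩ := (f.hasCompactSupport.fderiv ℝ).exists_bound_of_continuous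
    (hf1.continuous_fderiv one_ne_zero)
  have hc0 : ∀ k : ℕ, (0 : ℝ) < (k + 1 : ℝ)⁻¹ := fun k => by positivity
  have hcyl : ∀ k : ℕ, Cyl ((⊤ : ℕ∞) : WithTop ℕ∞) Δ
      fun x : Config d => f ((k + 1 : ℝ)⁻¹ • Δ.restrict x) := fun k =>
    cyl_of_comp (f := fun p : Δ → ℝ => f ((k + 1 : ℝ)⁻¹ • p))
      (hf.comp (contDiff_id.const_smul _))
  refine ⟨fun k x => ((f ((k + 1 : ℝ)⁻¹ • Δ.restrict x) : ℝ) : ℂ), B, fun k => (hcyl k).ofReal,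
    fun k => ⟨2 * (k + 1), fun x hx i hi => ?_⟩, fun k x => Complex.conj_ofReal _, fun k x => ?_,
    fun k j x => ?_, fun x => ?_⟩
  · have h1 : f ((k + 1 : ℝ)⁻¹ • Δ.restrict x) ≠ 0 := fun h => hx (by simp only [h, Complex.ofReal_zero])
    have h2 : (k + 1 : ℝ)⁻¹ • Δ.restrict x ∈ Metric.ball (0 : Δ → ℝ) 2 := by
      rw [← f.support_eq]
      exact h1
    rw [mem_ball_zero_iff, norm_smul, Real.norm_of_nonneg (hc0 k).le, inv_mul_lt_iff₀ (by positivity)]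
      at h2
    have h3 := (norm_le_pi_norm (Δ.restrict x) ⟨i, hi⟩).trans h2.le
    rw [mul_comm] at h3
    exact h3
  · rw [Complex.norm_real, Real.norm_of_nonneg f.nonneg]
    exact f.le_one
  · have h1 : HasFDerivAt f (fderiv ℝ f ((k + 1 : ℝ)⁻¹ • Δ.restrict x))
        ((k + 1 : ℝ)⁻¹ • Δ.restrict (x + (0 : ℝ) • (Pi.single j (1 : ℝ) : Config d))) := by
      rw [zero_smul, add_zero]
      exact (hf1.differentiable one_ne_zero _).hasFDerivAt
    have h2 : HasDerivAt (fun s : ℝ => (k + 1 : ℝ)⁻¹ •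
        Δ.restrict (x + s • (Pi.single j (1 : ℝ) : Config d)))
        ((k + 1 : ℝ)⁻¹ • Δ.restrict (Pi.single j (1 : ℝ) : Config d)) 0 := by
      have := (((hasDerivAt_id (0 : ℝ)).smul_const
        (Δ.restrict (Pi.single j (1 : ℝ) : Config d))).const_add (Δ.restrict x)).fun_const_smul
          (k + 1 : ℝ)⁻¹
      rw [one_smul] at this
      exact this
    have h3 := (h1.comp_hasDerivAt (0 : ℝ) h2).ofReal_comp
    rw [(hcyl k).ofReal.pderiv_eq (by exact_mod_cast le_top) j x h3, Complex.norm_real, map_smul,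
      norm_smul, Real.norm_of_nonneg (hc0 k).le, mul_comm, ← div_eq_mul_inv]
    refine div_le_div_of_nonneg_right ?_ (by positivity)
    have h4 := (ContinuousLinearMap.le_opNorm (fderiv ℝ f ((k + 1 : ℝ)⁻¹ • Δ.restrict x))
      (Δ.restrict (Pi.single j (1 : ℝ) : Config d))).trans
      (mul_le_mul (hB _) (norm_restrict_single_le j) (norm_nonneg _)
        ((norm_nonneg _).trans (hB 0)))
    rwa [mul_one] at h4
  · refine tendsto_const_nhds.congr' ?_
    obtain ⟨N, hN⟩ := exists_nat_ge ‖Δ.restrict x‖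
    filter_upwards [eventually_ge_atTop N] with k hk
    rw [f.one_of_mem_closedBall, Complex.ofReal_one]
    rw [mem_closedBall_zero_iff, norm_smul, Real.norm_of_nonneg (hc0 k).le,
      inv_mul_le_iff₀ (by positivity)]
    change _ ≤ ((k : ℝ) + 1) * 1
    have : (N : ℝ) ≤ k := by exact_mod_cast hk
    linarith

end Translation

/-! ### Localized translations on `L²(μ)`. -/

section Shift

variable {d : ℕ} {μ : Measure (Config d)} [IsProbabilityMeasure μ] {Δ Λ S : Finset (Site d)}
  {n : WithTop ℕ∞} {I : Interaction d} {a : Config d → ℂ}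

theorem IsTest.star {g : Config d → ℂ} (hg : IsTest S g) :
    IsTest S fun x => starRingEnd ℂ (g x) := by
  obtain ⟨Δ, hΔ, hc, hb⟩ := isTest_iff.1 hg
  exact isTest_iff.2 ⟨Δ, hΔ, hc.star, hb.of_imp fun x hx => by rw [hx, map_zero]⟩

theorem IsTest.memLp {g : Config d → ℂ} (hg : IsTest S g) : MemLp g 2 μ := by
  obtain ⟨Δ, hΔ, hc, hb⟩ := isTest_iff.1 hg
  exact hc.memLp hb

/-- Test functions separate `L²(μ)`. -/
theorem eq_zero_of_forall_inner_isTest {u : Lp ℂ 2 μ}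
    (h : ∀ g, IsTest S g → inner ℂ (toL2 μ g) u = 0) : u = 0 := by
  refine Lp.ext ((ae_eq_zero_of_forall_isTest (S := S) ((Lp.memLp u).integrable (by norm_num))
    fun g hg => ?_).trans (Lp.coeFn_zero _ _ _).symm)
  have h1 := h _ hg.star
  rw [inner_toL2_left _ hg.star.memLp] at h1
  rw [← h1]
  exact integral_congr_ae (Eventually.of_forall fun x => by
    simp only [Complex.conj_conj, mul_comm])

/-- A closed subspace of `L²(μ)` that contains all test functions is everything. -/
theorem eq_top_of_isTest {M : Submodule ℂ (Lp ℂ 2 μ)} (hM : IsClosed (M : Set (Lp ℂ 2 μ)))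
    (h : ∀ g, IsTest S g → toL2 μ g ∈ M) : M = ⊤ := by
  have : CompleteSpace M := hM.completeSpace_coe
  rw [← Submodule.orthogonal_eq_bot_iff, Submodule.eq_bot_iff]
  exact fun v hv => eq_zero_of_forall_inner_isTest (S := S) fun g hg =>
    (Submodule.mem_orthogonal _ _).1 hv _ (h g hg)

theorem norm_glue_le {y : Λ → ℝ} {r : ℝ} (hr : 0 ≤ r) (hy : ‖y‖ ≤ r) (i : Site d) :
    |glue Λ (0 : Config d) y i| ≤ r := by
  by_cases h : i ∈ Λ
  · rw [glue_of_mem h]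
    exact (norm_le_pi_norm y ⟨i, h⟩).trans hy
  · rw [glue_of_notMem h]
    simpa using hr

/-- The change of variables produces the factor `e^{U(x) - U(x - y)}`, which is bounded on bounded
sets only, so that translations alone need not act on `L²(μ)`. The cutoff `a` confines the
coordinates that the energy depends on. -/
theorem lintegral_shift_le (hμ : I.IsGibbs μ) (hΔ : nbhd I.range Λ ⊆ Δ) (ha : Cyl n Δ a)
    (hb : BddSupp Δ a) {r : ℝ} (hr0 : 0 ≤ r) : ∃ C : ℝ, 0 ≤ C ∧ ∀ y : Λ → ℝ, ‖y‖ ≤ r →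
      ∀ u : Config d → ℂ, ∫⁻ x, ‖a (x + glue Λ 0 y) * u (x + glue Λ 0 y)‖ₑ ^ 2 ∂μ ≤
        ENNReal.ofReal (C ^ 2) * ∫⁻ x, ‖u x‖ₑ ^ 2 ∂μ := by
  obtain ⟨A, hA0, hA⟩ := ha.exists_norm_le hb
  obtain ⟨r', hr'⟩ := hb
  obtain ⟨C₁, h10, h1⟩ := (I.cyl_dens hΔ).exists_bound_on (r' + r)
  obtain ⟨C₂, h20, h2⟩ := (I.cyl_densInv hΔ).exists_bound_on (r' + r)
  refine ⟨A * (C₁ * C₂ + 1), by positivity, fun y hy u => ?_⟩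
  have key := hμ.lintegral_translate (Λ := Λ) (fun x => ENNReal.ofReal (Real.exp
    (-I.U Λ (x - glue Λ 0 y))) * ‖a x * u x‖ₑ ^ 2) y
  simp only [add_sub_cancel_right] at key
  have e : ∀ x, ENNReal.ofReal (Real.exp (I.U Λ x)) * (ENNReal.ofReal (Real.exp (-I.U Λ x)) *
      ‖a (x + glue Λ 0 y) * u (x + glue Λ 0 y)‖ₑ ^ 2) =
        ‖a (x + glue Λ 0 y) * u (x + glue Λ 0 y)‖ₑ ^ 2 := fun x => by
    rw [← mul_assoc, mul_comm (ENNReal.ofReal _), ofReal_exp_mul_exp_neg, one_mul]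
  simp_rw [e] at key
  rw [key, ← lintegral_const_mul' _ _ ENNReal.ofReal_ne_top]
  refine lintegral_mono fun x => ?_
  by_cases hx : a x = 0
  · simp [hx]
  have hx' := hr' x hx
  have h3 : ∀ i ∈ Δ, |x i| ≤ r' + r := fun i hi => (hx' i hi).trans (by linarith)
  have h4 : ∀ i ∈ Δ, |(x - glue Λ 0 y) i| ≤ r' + r := fun i hi => by
    rw [Pi.sub_apply]
    exact (abs_sub _ _).trans (add_le_add (hx' i hi) (norm_glue_le hr0 hy i))
  have h5 := h1 x h3
  have h6 := h2 _ h4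
  rw [Interaction.dens, Complex.norm_real, Real.norm_of_nonneg (Real.exp_pos _).le] at h5
  rw [Interaction.densInv, Complex.norm_real, Real.norm_of_nonneg (Real.exp_pos _).le] at h6
  have h7 : ‖a x * u x‖ₑ ^ 2 = ENNReal.ofReal (‖a x‖ ^ 2) * ‖u x‖ₑ ^ 2 := by
    rw [enorm_mul, mul_pow, ENNReal.ofReal_pow (norm_nonneg _), ofReal_norm]
  rw [h7, ← mul_assoc, ← mul_assoc, ← ENNReal.ofReal_mul (Real.exp_pos _).le,
    ← ENNReal.ofReal_mul (by positivity)]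
  refine mul_le_mul_left (ENNReal.ofReal_le_ofReal ?_) _
  have h8 : ‖a x‖ ^ 2 ≤ A ^ 2 := pow_le_pow_left₀ (norm_nonneg _) (hA x) 2
  have h9 : Real.exp (I.U Λ x) * Real.exp (-I.U Λ (x - glue Λ 0 y)) ≤ C₁ * C₂ :=
    mul_le_mul h5 h6 (Real.exp_pos _).le h10
  have h10 : C₁ * C₂ ≤ (C₁ * C₂ + 1) ^ 2 := by nlinarith [mul_nonneg h10 h20]
  calc _ ≤ (C₁ * C₂) * A ^ 2 := mul_le_mul h9 h8 (by positivity) (by positivity)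
    _ ≤ (C₁ * C₂ + 1) ^ 2 * A ^ 2 := mul_le_mul_of_nonneg_right h10 (by positivity)
    _ = (A * (C₁ * C₂ + 1)) ^ 2 := by ring

theorem eLpNorm_shift_le (hμ : I.IsGibbs μ) (hΔ : nbhd I.range Λ ⊆ Δ) (ha : Cyl n Δ a)
    (hb : BddSupp Δ a) {r : ℝ} (hr0 : 0 ≤ r) : ∃ C : ℝ, 0 ≤ C ∧ ∀ y : Λ → ℝ, ‖y‖ ≤ r →
      ∀ u : Config d → ℂ, eLpNorm (fun x => a (x + glue Λ 0 y) * u (x + glue Λ 0 y)) 2 μ ≤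
        ENNReal.ofReal C * eLpNorm u 2 μ := by
  obtain ⟨C, hC0, hC⟩ := lintegral_shift_le hμ hΔ ha hb hr0
  refine ⟨C, hC0, fun y hy u => ?_⟩
  have h := hC y hy u
  simp only [eLpNorm_eq_lintegral_rpow_enorm_toReal two_ne_zero ENNReal.ofNat_ne_top,
    ENNReal.toReal_ofNat, ENNReal.rpow_ofNat]
  refine (ENNReal.rpow_le_rpow h (by norm_num : (0 : ℝ) ≤ 1 / 2)).trans_eq ?_
  rw [ENNReal.mul_rpow_of_nonneg _ _ (by norm_num), ENNReal.ofReal_rpow_of_nonneg (by positivity)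
    (by norm_num), ← Real.sqrt_eq_rpow, Real.sqrt_sq hC0]

theorem memLp_shift (hμ : I.IsGibbs μ) (hΔ : nbhd I.range Λ ⊆ Δ) (ha : Cyl n Δ a)
    (hb : BddSupp Δ a) (y : Λ → ℝ) {u : Config d → ℂ} (hu : MemLp u 2 μ) :
    MemLp (fun x => a (x + glue Λ 0 y) * u (x + glue Λ 0 y)) 2 μ := by
  obtain ⟨C, -, hC⟩ := eLpNorm_shift_le hμ hΔ ha hb (norm_nonneg y)
  refine ⟨(ha.translate _).measurable.aestronglyMeasurable.mul
    (hu.1.comp_quasiMeasurePreserving (hμ.quasiMeasurePreserving y)), (hC y le_rfl u).trans_lt ?_⟩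
  exact ENNReal.mul_lt_top ENNReal.ofReal_lt_top hu.2

/-- The operator `u ↦ (a u)(· + y)` on `L²(μ)`. -/
def shiftMul (hμ : I.IsGibbs μ) (hΔ : nbhd I.range Λ ⊆ Δ) (ha : Cyl n Δ a)
    (hb : BddSupp Δ a) (y : Λ → ℝ) : Lp ℂ 2 μ →L[ℂ] Lp ℂ 2 μ :=
  LinearMap.mkContinuousOfExistsBound
    { toFun := fun u => toL2 μ fun x => a (x + glue Λ 0 y) * u (x + glue Λ 0 y)
      map_add' := fun u v => by
        refine Lp.ext ((coeFn_toL2 (memLp_shift hμ hΔ ha hb y (Lp.memLp _))).trans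
          (EventuallyEq.trans ?_ (Lp.coeFn_add _ _).symm))
        filter_upwards [coeFn_toL2 (memLp_shift hμ hΔ ha hb y (Lp.memLp u)),
          coeFn_toL2 (memLp_shift hμ hΔ ha hb y (Lp.memLp v)),
          (hμ.quasiMeasurePreserving y).ae (Lp.coeFn_add u v)] with x h1 h2 h3
        rw [Pi.add_apply, h1, h2, h3, Pi.add_apply, mul_add]
      map_smul' := fun c u => by
        refine Lp.ext ((coeFn_toL2 (memLp_shift hμ hΔ ha hb y (Lp.memLp _))).trans
          (EventuallyEq.trans ?_ (Lp.coeFn_smul _ _).symm))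
        filter_upwards [coeFn_toL2 (memLp_shift hμ hΔ ha hb y (Lp.memLp u)),
          (hμ.quasiMeasurePreserving y).ae (Lp.coeFn_smul c u)] with x h1 h3
        rw [Pi.smul_apply, RingHom.id_apply, h1, h3, Pi.smul_apply, smul_eq_mul, smul_eq_mul]
        ring }
    (by
      obtain ⟨C, hC0, hC⟩ := eLpNorm_shift_le hμ hΔ ha hb (norm_nonneg y)
      refine ⟨C, fun u => ?_⟩
      have h1 := hC y le_rfl u
      have h2 := memLp_shift hμ hΔ ha hb y (Lp.memLp u)
      change ‖toL2 μ _‖ ≤ C * ‖u‖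
      rw [toL2, dif_pos h2, Lp.norm_toLp, Lp.norm_def, ← ENNReal.toReal_ofReal hC0,
        ← ENNReal.toReal_mul]
      refine ENNReal.toReal_mono (ENNReal.mul_ne_top ENNReal.ofReal_ne_top (Lp.eLpNorm_ne_top u)) ?_
      exact h1)

theorem shiftMul_apply (hμ : I.IsGibbs μ) (hΔ : nbhd I.range Λ ⊆ Δ) (ha : Cyl n Δ a)
    (hb : BddSupp Δ a) (y : Λ → ℝ) (u : Lp ℂ 2 μ) : shiftMul hμ hΔ ha hb y u =
      toL2 μ fun x => a (x + glue Λ 0 y) * u (x + glue Λ 0 y) := rfl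

theorem coeFn_shiftMul (hμ : I.IsGibbs μ) (hΔ : nbhd I.range Λ ⊆ Δ) (ha : Cyl n Δ a)
    (hb : BddSupp Δ a) (y : Λ → ℝ) (u : Lp ℂ 2 μ) : shiftMul hμ hΔ ha hb y u =ᵐ[μ]
      fun x => a (x + glue Λ 0 y) * u (x + glue Λ 0 y) :=
  coeFn_toL2 (memLp_shift hμ hΔ ha hb y (Lp.memLp u))

theorem exists_norm_shiftMul_le (hμ : I.IsGibbs μ) (hΔ : nbhd I.range Λ ⊆ Δ) (ha : Cyl n Δ a)
    (hb : BddSupp Δ a) : ∃ C, 0 ≤ C ∧ ∀ y : Λ → ℝ, ‖y‖ ≤ 1 → ‖shiftMul hμ hΔ ha hb y‖ ≤ C := by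
  obtain ⟨C, hC0, hC⟩ := eLpNorm_shift_le hμ hΔ ha hb zero_le_one
  refine ⟨C, hC0, fun y hy => ContinuousLinearMap.opNorm_le_bound _ hC0 fun u => ?_⟩
  have h1 := hC y hy u
  have h2 := memLp_shift hμ hΔ ha hb y (Lp.memLp u)
  rw [shiftMul_apply, toL2, dif_pos h2, Lp.norm_toLp, Lp.norm_def]
  have h3 := ENNReal.toReal_mono (ENNReal.mul_ne_top ENNReal.ofReal_ne_top
    (Lp.eLpNorm_ne_top u)) h1
  rwa [ENNReal.toReal_mul, ENNReal.toReal_ofReal hC0] at h3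

/-- `L²`-functions pair with translated test functions. -/
theorem inner_shiftMul_toL2 (hμ : I.IsGibbs μ) (hΔ : nbhd I.range Λ ⊆ Δ) (ha : Cyl n Δ a)
    (hb : BddSupp Δ a) (ξ : Lp ℂ 2 μ) {g : Config d → ℂ} (hg : MemLp g 2 μ) (y : Λ → ℝ) :
    inner ℂ ξ (shiftMul hμ hΔ ha hb y (toL2 μ g)) =
      ∫ x, starRingEnd ℂ (ξ x) * (a (x + glue Λ 0 y) * g (x + glue Λ 0 y)) ∂μ := by
  rw [inner_Lp]
  refine integral_congr_ae ?_
  filter_upwards [coeFn_shiftMul hμ hΔ ha hb y (toL2 μ g),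
    (hμ.quasiMeasurePreserving y).ae (coeFn_toL2 hg)] with x h1 h2
  rw [h1, h2]

theorem integrable_conj (u : Lp ℂ 2 μ) : Integrable (fun x => starRingEnd ℂ (u x)) μ :=
  Complex.conjCLE.toContinuousLinearMap.integrable_comp
    ((Lp.memLp u).integrable (by norm_num))

/-- For test functions `u` the pairing is an explicit integral, continuous in `y`. The set of all
`u` with this property is a closed subspace, because the operators are uniformly bounded for `‖y‖ ≤
1`. -/
theorem continuousOn_inner_shiftMul (hμ : I.IsGibbs μ) (hΔ : nbhd I.range Λ ⊆ Δ) (ha : Cyl n Δ a)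
    (hb : BddSupp Δ a) (ξ u : Lp ℂ 2 μ) :
    ContinuousOn (fun y : Λ → ℝ => inner ℂ ξ (shiftMul hμ hΔ ha hb y u))
      (Metric.closedBall 0 1) := by
  classical
  obtain ⟨C, hC0, hC⟩ := exists_norm_shiftMul_le hμ hΔ ha hb
  let M : Submodule ℂ (Lp ℂ 2 μ) :=
    { carrier := {u | ContinuousOn (fun y : Λ → ℝ => inner ℂ ξ (shiftMul hμ hΔ ha hb y u))
        (Metric.closedBall 0 1)}
      add_mem' := fun {u v} hu hv => by
        have h : ContinuousOn (fun y : Λ → ℝ => inner ℂ ξ (shiftMul hμ hΔ ha hb y u) +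
          inner ℂ ξ (shiftMul hμ hΔ ha hb y v)) (Metric.closedBall 0 1) := ContinuousOn.add hu hv
        refine h.congr fun y _ => ?_
        rw [map_add, inner_add_right]
      zero_mem' := by
        refine (continuousOn_const (c := (0 : ℂ))).congr fun y _ => ?_
        rw [map_zero, inner_zero_right]
      smul_mem' := fun c u hu => by
        have h : ContinuousOn (fun y : Λ → ℝ => c * inner ℂ ξ (shiftMul hμ hΔ ha hb y u))
          (Metric.closedBall 0 1) := ContinuousOn.mul continuousOn_const hu
        refine h.congr fun y _ => ?_
        rw [map_smul, inner_smul_right] }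
  have hM : IsClosed (M : Set (Lp ℂ 2 μ)) := by
    refine isClosed_of_closure_subset fun u hu => ?_
    refine continuousOn_of_uniform_approx_of_continuousOn fun s hs => ?_
    obtain ⟨ε, hε, hεs⟩ := Metric.mem_uniformity_dist.1 hs
    obtain ⟨v, hv, huv⟩ := Metric.mem_closure_iff.1 hu (ε / (‖ξ‖ * C + 1)) (by positivity)
    refine ⟨_, hv, fun y hy => hεs ?_⟩
    rw [dist_eq_norm, ← inner_sub_right, ← map_sub]
    have h1 := norm_inner_le_norm (𝕜 := ℂ) ξ (shiftMul hμ hΔ ha hb y (u - v))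
    have h2 := (shiftMul hμ hΔ ha hb y).le_of_opNorm_le (hC y (mem_closedBall_zero_iff.1 hy)) (u - v)
    rw [dist_eq_norm, lt_div_iff₀ (by positivity)] at huv
    have h3 : ‖ξ‖ * ‖shiftMul hμ hΔ ha hb y (u - v)‖ ≤ ‖ξ‖ * (C * ‖u - v‖) :=
      mul_le_mul_of_nonneg_left h2 (norm_nonneg _)
    nlinarith [norm_nonneg (u - v), norm_nonneg ξ]
  have hT := eq_top_of_isTest (S := ∅) hM fun g hg => by
    obtain ⟨Δ', -, hc, hgb⟩ := isTest_iff.1 hg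
    have h1 : Cyl 0 (Δ ∪ Δ') fun x => a x * g x :=
      ((ha.of_le zero_le).mono Finset.subset_union_left).mul
        ((hc.of_le zero_le).mono Finset.subset_union_right)
    have h2 := Cyl.continuous_integral_translate (Λ := Λ) (w := fun x => starRingEnd ℂ (ξ x))
      (integrable_conj ξ) h1 (hb.mul_union hgb)
    refine h2.continuousOn.congr fun y _ => ?_
    exact inner_shiftMul_toL2 hμ hΔ ha hb ξ (hc.memLp hgb) y
  have : u ∈ M := by rw [hT]; trivial
  exact this

/-- Weighted averages of a bounded family of functionals. -/
theorem exists_average {X H : Type*} [TopologicalSpace X] [MeasurableSpace X]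
    [OpensMeasurableSpace X] {ν : Measure X} [IsFiniteMeasureOnCompacts ν]
    [NormedAddCommGroup H] [NormedSpace ℂ H] {K : Set X} (hK : IsCompact K) (hKm : MeasurableSet K)
    {w : X → ℂ} (hw : ContinuousOn w K) {L : X → H →L[ℂ] ℂ}
    (hL : ∀ u, ContinuousOn (fun y => L y u) K) {C : ℝ} (hC : ∀ y ∈ K, ‖L y‖ ≤ C) :
    ∃ ℓ : H →L[ℂ] ℂ, ∀ u, ℓ u = ∫ y in K, w y * L y u ∂ν := by
  have hi : ∀ u, IntegrableOn (fun y => w y * L y u) K ν := fun u =>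
    (hw.mul (hL u)).integrableOn_compact' hK hKm
  obtain ⟨B, hB⟩ := hK.exists_bound_of_continuousOn hw
  refine ⟨LinearMap.mkContinuousOfExistsBound
    { toFun := fun u => ∫ y in K, w y * L y u ∂ν
      map_add' := fun u v => by
        rw [← integral_add (hi u) (hi v)]
        simp only [map_add, mul_add]
      map_smul' := fun c u => by
        rw [RingHom.id_apply, smul_eq_mul, ← integral_const_mul]
        refine integral_congr_ae (Eventually.of_forall fun y => ?_)
        simp only [map_smul, smul_eq_mul]
        ring } ⟨B * C * ν.real K, fun u => ?_⟩, fun u => rfl⟩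
  change ‖∫ y in K, w y * L y u ∂ν‖ ≤ _
  refine (norm_setIntegral_le_of_norm_le_const (C := B * (C * ‖u‖)) hK.measure_lt_top
    fun y hy => ?_).trans_eq (by ring)
  rw [norm_mul]
  exact mul_le_mul (hB y hy) ((L y).le_of_opNorm_le (hC y hy) u) (norm_nonneg _)
    ((norm_nonneg _).trans (hB y hy))

end Shift

/-! ### Integration by parts for averaged translations. -/

section Average

variable {d : ℕ} {μ : Measure (Config d)} [IsProbabilityMeasure μ] {Δ Λ S : Finset (Site d)}
  {n : WithTop ℕ∞} {I : Interaction d} {a χ : Config d → ℂ} {ρ : (Λ → ℝ) → ℝ}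

theorem eq_zero_of_notMem_closedBall {y : Λ → ℝ} (hs : tsupport ρ ⊆ Metric.ball 0 1)
    (hy : y ∉ Metric.closedBall (0 : Λ → ℝ) 1) : ρ y = 0 ∧ fderiv ℝ ρ y = 0 := by
  have h : y ∉ tsupport ρ := fun h => hy (Metric.ball_subset_closedBall (hs h))
  exact ⟨image_eq_zero_of_notMem_tsupport h,
    Function.notMem_support.1 fun h' => h (support_fderiv_subset ℝ h')⟩

theorem setIntegral_by_parts (hρ : ContDiff ℝ ((⊤ : ℕ∞) : WithTop ℕ∞) ρ)
    (hs : tsupport ρ ⊆ Metric.ball 0 1) {k k' : (Λ → ℝ) → ℂ} (hk : Continuous k)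
    (hk' : Continuous k') (j : Λ) (hd : ∀ y, HasLineDerivAt ℝ k (k' y) y (Pi.single j 1)) :
    ∫ y in Metric.closedBall 0 1, (fderiv ℝ ρ y (Pi.single j 1) : ℂ) * k y =
      -∫ y in Metric.closedBall 0 1, (ρ y : ℂ) * k' y := by
  have hρ1 : ContDiff ℝ 1 ρ := hρ.of_le (by exact_mod_cast le_top)
  have hcs : HasCompactSupport ρ := HasCompactSupport.of_support_subset_isCompact
    (isCompact_closedBall (0 : Λ → ℝ) 1)
    ((subset_tsupport ρ).trans (hs.trans Metric.ball_subset_closedBall))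
  have hdc : Continuous fun y => fderiv ℝ ρ y (Pi.single j 1) :=
    (hρ1.continuous_fderiv one_ne_zero).clm_apply continuous_const
  have hdcs : HasCompactSupport fun y => fderiv ℝ ρ y (Pi.single j 1) :=
    (hcs.fderiv ℝ).comp_left (g := fun L : (Λ → ℝ) →L[ℝ] ℝ => L (Pi.single j 1)) (by simp)
  rw [setIntegral_eq_integral_of_forall_compl_eq_zero fun y hy => by
      rw [(eq_zero_of_notMem_closedBall hs hy).2]; simp,
    setIntegral_eq_integral_of_forall_compl_eq_zero fun y hy => by
      rw [(eq_zero_of_notMem_closedBall hs hy).1]; simp]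
  have h := integral_bilinear_hasLineDerivAt_right_eq_neg_left_of_integrable
    (μ := (volume : Measure (Λ → ℝ))) (f := ρ) (f' := fun y => fderiv ℝ ρ y (Pi.single j 1))
    (g := k) (g' := k') (v := Pi.single j 1) (B := ContinuousLinearMap.lsmul ℝ ℝ)
    ((hdc.smul hk).integrable_of_hasCompactSupport hdcs.smul_right)
    ((hρ1.continuous.smul hk').integrable_of_hasCompactSupport hcs.smul_right)
    ((hρ1.continuous.smul hk).integrable_of_hasCompactSupport hcs.smul_right)
    (fun y _ => (hρ1.differentiable one_ne_zero y).hasFDerivAt.hasLineDerivAt _)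
    (fun y _ => hd y)
  simp only [ContinuousLinearMap.lsmul_apply, Complex.real_smul] at h
  rw [h, neg_neg]

theorem continuous_fderiv_single (hρ : ContDiff ℝ ((⊤ : ℕ∞) : WithTop ℕ∞) ρ) (j : Λ) :
    Continuous fun y => (fderiv ℝ ρ y (Pi.single j 1) : ℂ) :=
  Complex.continuous_ofReal.comp
    (((hρ.of_le (by exact_mod_cast le_top : (1 : WithTop ℕ∞) ≤ _)).continuous_fderiv
      one_ne_zero).clm_apply continuous_const)

theorem exists_average_inner_right (hμ : I.IsGibbs μ) (hΔ : nbhd I.range Λ ⊆ Δ) (ha : Cyl n Δ a)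
    (hb : BddSupp Δ a) {w : (Λ → ℝ) → ℂ} (hw : Continuous w) (ξ : Lp ℂ 2 μ) :
    ∃ ℓ : Lp ℂ 2 μ →L[ℂ] ℂ, ∀ u, ℓ u =
      ∫ y in Metric.closedBall 0 1, w y * inner ℂ ξ (shiftMul hμ hΔ ha hb y u) := by
  obtain ⟨C, hC0, hC⟩ := exists_norm_shiftMul_le hμ hΔ ha hb
  refine exists_average (isCompact_closedBall (0 : Λ → ℝ) 1) Metric.isClosed_closedBall.measurableSet
    hw.continuousOn (L := fun y => (innerSL ℂ ξ).comp (shiftMul hμ hΔ ha hb y))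
    (C := ‖ξ‖ * C) (continuousOn_inner_shiftMul hμ hΔ ha hb ξ) fun y hy => ?_
  refine (ContinuousLinearMap.opNorm_comp_le _ _).trans ?_
  rw [innerSL_apply_norm]
  exact mul_le_mul_of_nonneg_left (hC y (mem_closedBall_zero_iff.1 hy)) (norm_nonneg _)

theorem continuousOn_inner_shiftMul_left (hμ : I.IsGibbs μ) (hΔ : nbhd I.range Λ ⊆ Δ)
    (ha : Cyl n Δ a) (hb : BddSupp Δ a) (ξ u : Lp ℂ 2 μ) :
    ContinuousOn (fun y : Λ → ℝ => inner ℂ (shiftMul hμ hΔ ha hb y u) ξ)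
      (Metric.closedBall 0 1) := by
  have h := Complex.continuous_conj.comp_continuousOn
    (continuousOn_inner_shiftMul (Λ := Λ) hμ hΔ ha hb ξ u)
  refine h.congr fun y _ => ?_
  rw [Function.comp_apply, inner_conj_symm]

theorem exists_average_inner_left (hμ : I.IsGibbs μ) (hΔ : nbhd I.range Λ ⊆ Δ) (ha : Cyl n Δ a)
    (hb : BddSupp Δ a) {w : (Λ → ℝ) → ℂ} (hw : Continuous w) (u : Lp ℂ 2 μ) :
    ∃ ℓ : Lp ℂ 2 μ →L[ℂ] ℂ, ∀ ξ, ℓ ξ =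
      ∫ y in Metric.closedBall 0 1, w y * inner ℂ (shiftMul hμ hΔ ha hb y u) ξ := by
  obtain ⟨C, hC0, hC⟩ := exists_norm_shiftMul_le hμ hΔ ha hb
  refine exists_average (isCompact_closedBall (0 : Λ → ℝ) 1) Metric.isClosed_closedBall.measurableSet
    hw.continuousOn (L := fun y => innerSL ℂ (shiftMul hμ hΔ ha hb y u))
    (C := C * ‖u‖) (fun ξ => continuousOn_inner_shiftMul_left hμ hΔ ha hb ξ u) fun y hy => ?_
  rw [innerSL_apply_norm]
  exact (shiftMul hμ hΔ ha hb y).le_of_opNorm_le (hC y (mem_closedBall_zero_iff.1 hy)) u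

/-- The averaged translations of `χ u` are orthogonal to whatever is orthogonal to the jets of test
functions. -/
theorem average_shift_of_orthogonal (hμ : I.IsGibbs μ) (hΔ : nbhd I.range Λ ⊆ Δ)
    (hχ : Cyl ((⊤ : ℕ∞) : WithTop ℕ∞) Δ χ) (hb : BddSupp Δ χ) {ξ : Jet (Lp ℂ 2 μ) Λ}
    (hξ : ∀ g, IsTest (nbhd I.range Λ) g → inner ℂ ξ (jetOf μ Λ g) = 0)
    (hρ : ContDiff ℝ ((⊤ : ℕ∞) : WithTop ℕ∞) ρ) (hs : tsupport ρ ⊆ Metric.ball 0 1)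
    (u : Lp ℂ 2 μ) :
    (∫ y in Metric.closedBall 0 1, (ρ y : ℂ) * inner ℂ (ξ none) (shiftMul hμ hΔ hχ hb y u)) =
      ∑ j, ∫ y in Metric.closedBall 0 1, (fderiv ℝ ρ y (Pi.single j 1) : ℂ) *
        inner ℂ (ξ (some j)) (shiftMul hμ hΔ hχ hb y u) := by
  classical
  have hρc : Continuous fun y => (ρ y : ℂ) := Complex.continuous_ofReal.comp hρ.continuous
  obtain ⟨ℓ₀, h₀⟩ := exists_average_inner_right hμ hΔ hχ hb hρc (ξ none)
  choose ℓ hℓ using fun j : Λ => exists_average_inner_right hμ hΔ hχ hb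
    (continuous_fderiv_single hρ j) (ξ (some j))
  -- Both sides are continuous in `u`, so `u` may be a test function `g`. Then the translates of `χ
  -- g` are test functions, to whose jets `ξ` is orthogonal, and integration by parts in `y` moves
  -- the derivatives from them to `ρ`.
  have hT := eq_top_of_isTest (S := nbhd I.range Λ) (ContinuousLinearMap.isClosed_ker
    (ℓ₀ - ∑ j, ℓ j)) fun g hg => by
    obtain ⟨Δ', hΔ', hgc, hgb⟩ := isTest_iff.1 hg
    set F : Config d → ℂ := fun x => χ x * g x with hF
    have hFc : Cyl ((⊤ : ℕ∞) : WithTop ℕ∞) (Δ ∪ Δ') F :=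
      (hχ.mono Finset.subset_union_left).mul (hgc.mono Finset.subset_union_right)
    have hFb : BddSupp (Δ ∪ Δ') F := hb.mul_union hgb
    have hF1 : Cyl 1 (Δ ∪ Δ') F := hFc.of_le (by exact_mod_cast le_top)
    have hF0 : ∀ j : Λ, Cyl 0 (Δ ∪ Δ') (pderiv (j : Site d) F) := fun j => hF1.pderiv (by simp) _
    have hgm : MemLp g 2 μ := hgc.memLp hgb
    have hin : ∀ o y, inner ℂ (ξ o) (shiftMul hμ hΔ hχ hb y (toL2 μ g)) =
        ∫ x, starRingEnd ℂ (ξ o x) * F (x + glue Λ 0 y) ∂μ := fun o y =>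
      inner_shiftMul_toL2 hμ hΔ hχ hb (ξ o) hgm y
    rw [LinearMap.mem_ker]
    change (ℓ₀ - ∑ j, ℓ j) (toL2 μ g) = 0
    rw [_root_.sub_apply, _root_.sum_apply, h₀]
    simp_rw [hℓ, hin]
    have hparts : ∀ j : Λ, ∫ y in Metric.closedBall 0 1, (fderiv ℝ ρ y (Pi.single j 1) : ℂ) *
        (∫ x, starRingEnd ℂ (ξ (some j) x) * F (x + glue Λ 0 y) ∂μ) =
        -∫ y in Metric.closedBall 0 1, (ρ y : ℂ) *
          (∫ x, starRingEnd ℂ (ξ (some j) x) * pderiv (j : Site d) F (x + glue Λ 0 y) ∂μ) :=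
      fun j => setIntegral_by_parts hρ hs
        (Cyl.continuous_integral_translate (integrable_conj _) hF1 hFb)
        (Cyl.continuous_integral_translate (integrable_conj _) (hF0 j) (hFb.pderiv hF1 le_rfl _)) j
        (Cyl.hasLineDerivAt_integral_translate (integrable_conj _) hF1 hFb j)
    simp_rw [hparts]
    rw [Finset.sum_neg_distrib, sub_neg_eq_add, ← integral_finsetSum, ← integral_add]
    · refine (integral_congr_ae (Eventually.of_forall fun y => ?_)).trans (integral_zero _ _)
      set G : Config d → ℂ := fun x => F (x + glue Λ 0 y) with hG
      have hGt : IsTest (nbhd I.range Λ) G := isTest_iff.2 ⟨Δ ∪ Δ',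
        hΔ.trans Finset.subset_union_left, hFc.translate _, hFb.translate _⟩
      have h1 := hξ G hGt
      rw [inner_jet, form] at h1
      change inner ℂ (ξ none) (toL2 μ G) +
        ∑ j : Λ, inner ℂ (ξ (some j)) (toL2 μ (pderiv (j : Site d) G)) = 0 at h1
      have hGe : ∀ j : Λ, pderiv (j : Site d) G = fun x => pderiv (j : Site d) F (x + glue Λ 0 y) :=
        fun j => funext fun x => hF1.pderiv_translate le_rfl _ _ _
      have hGm : ∀ j : Λ, MemLp (pderiv (j : Site d) G) 2 μ := fun j => by
        rw [hGe j]
        exact ((hF0 j).translate _).memLp ((hFb.pderiv hF1 le_rfl _).translate _)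
      rw [inner_toL2_right _ hGt.memLp] at h1
      simp_rw [inner_toL2_right _ (hGm _), hGe] at h1
      rw [← Finset.mul_sum, ← mul_add, h1, mul_zero]
    · exact ((hρc.mul
        (Cyl.continuous_integral_translate (integrable_conj _) hF1 hFb)).continuousOn).integrableOn_compact
          (isCompact_closedBall _ _)
    · refine integrable_finsetSum _ fun j _ => ?_
      exact ((hρc.mul
        (Cyl.continuous_integral_translate (integrable_conj _) (hF0 j)
          (hFb.pderiv hF1 le_rfl _))).continuousOn).integrableOn_compact (isCompact_closedBall _ _)
    · intro j _
      exact ((hρc.mul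
        (Cyl.continuous_integral_translate (integrable_conj _) (hF0 j)
          (hFb.pderiv hF1 le_rfl _))).continuousOn).integrableOn_compact (isCompact_closedBall _ _)
  have hu : (ℓ₀ - ∑ j, ℓ j) u = 0 := by
    have : u ∈ LinearMap.ker (ℓ₀ - ∑ j, ℓ j).toLinearMap := by rw [hT]; trivial
    exact this
  rw [_root_.sub_apply, _root_.sum_apply, h₀, sub_eq_zero] at hu
  simp_rw [hℓ] at hu
  exact hu

theorem integrable_weighted {u : Lp ℂ 2 μ} {b : Config d → ℂ} (hbc : Cyl n Δ b)
    (hb : BddSupp Δ b) : Integrable (fun x => starRingEnd ℂ (u x) * b x) μ := by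
  obtain ⟨C, _, hC⟩ := hbc.exists_norm_le hb
  exact (integrable_conj u).mul_bdd hbc.measurable.aestronglyMeasurable
    (Eventually.of_forall fun x => hC x)

/-- Invariance of `e^{U_Λ} μ` moves the translation from the `L²` function to the smooth factor,
which can be differentiated in `y`. -/
theorem inner_shiftMul_left (hμ : I.IsGibbs μ) (hΔ : nbhd I.range Λ ⊆ Δ) (ha : Cyl n Δ a)
    (hb : BddSupp Δ a) (hr : ∀ x, starRingEnd ℂ (a x) = a x) (u : Lp ℂ 2 μ)
    {h : Config d → ℂ} (hh : MemLp h 2 μ) (y : Λ → ℝ) :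
    inner ℂ (shiftMul hμ hΔ ha hb y u) (toL2 μ h) =
      ∫ x, starRingEnd ℂ (u x) * (a x * I.dens Λ x) *
        (I.densInv Λ (x + glue Λ 0 (-y)) * h (x + glue Λ 0 (-y))) ∂μ := by
  have hneg : glue Λ (0 : Config d) (-y) = -glue Λ 0 y := by
    ext i
    by_cases hi : i ∈ Λ <;> simp [glue, hi]
  have key := hμ.integral_dens_translate (Λ := Λ) (fun x => starRingEnd ℂ (a x * u x) *
    (I.densInv Λ (x - glue Λ 0 y) * h (x - glue Λ 0 y))) y
  simp only [add_sub_cancel_right] at key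
  rw [inner_toL2_right _ hh]
  have e1 : ∫ x, starRingEnd ℂ (shiftMul hμ hΔ ha hb y u x) * h x ∂μ =
      ∫ x, I.dens Λ x * (starRingEnd ℂ (a (x + glue Λ 0 y) * u (x + glue Λ 0 y)) *
        (I.densInv Λ x * h x)) ∂μ := by
    refine integral_congr_ae ?_
    filter_upwards [coeFn_shiftMul hμ hΔ ha hb y u] with x hx
    rw [hx]
    have := I.dens_mul_densInv (Λ := Λ) x
    linear_combination -(starRingEnd ℂ (a (x + glue Λ 0 y) * u (x + glue Λ 0 y)) * h x) * this
  rw [e1, key]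
  refine integral_congr_ae (Eventually.of_forall fun x => ?_)
  simp only [hneg, ← sub_eq_add_neg, map_mul, hr]
  ring

/-- The averaged translations of `χ u` are weakly differentiable. -/
theorem average_shift_deriv_left (hμ : I.IsGibbs μ) (hΔ : nbhd I.range Λ ⊆ Δ)
    (hχ : Cyl ((⊤ : ℕ∞) : WithTop ℕ∞) Δ χ) (hb : BddSupp Δ χ) (hr : ∀ x, starRingEnd ℂ (χ x) = χ x) (j : Λ)
    (hχ' : Cyl 0 Δ (pderiv (j : Site d) χ)) (hb' : BddSupp Δ (pderiv (j : Site d) χ))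
    {x : Jet (Lp ℂ 2 μ) Λ} (hx : x ∈ sobolev I μ Λ)
    (hρ : ContDiff ℝ ((⊤ : ℕ∞) : WithTop ℕ∞) ρ) (hs : tsupport ρ ⊆ Metric.ball 0 1)
    (ξ : Lp ℂ 2 μ) :
    (∫ y in Metric.closedBall 0 1, (fderiv ℝ ρ y (Pi.single j 1) : ℂ) *
        inner ℂ (shiftMul hμ hΔ hχ hb y (x none)) ξ) =
      -((∫ y in Metric.closedBall 0 1, (ρ y : ℂ) *
        inner ℂ (shiftMul hμ hΔ hχ hb y (x (some j))) ξ) +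
        ∫ y in Metric.closedBall 0 1, (ρ y : ℂ) *
        inner ℂ (shiftMul hμ hΔ hχ' hb' y (x none)) ξ) := by
  classical
  have hχ1 : Cyl 1 Δ χ := hχ.of_le (by exact_mod_cast le_top)
  have hρc : Continuous fun y => (ρ y : ℂ) := Complex.continuous_ofReal.comp hρ.continuous
  obtain ⟨ℓ₀, h₀⟩ := exists_average_inner_left hμ hΔ hχ hb
    (continuous_fderiv_single hρ j) (x none)
  obtain ⟨ℓ₁, h₁⟩ := exists_average_inner_left hμ hΔ hχ hb hρc (x (some j))
  obtain ⟨ℓ₂, h₂⟩ := exists_average_inner_left hμ hΔ hχ' hb' hρc (x none)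
  have hr' : ∀ z, starRingEnd ℂ (pderiv (j : Site d) χ z) = pderiv (j : Site d) χ z := fun z => by
    rw [← hχ1.pderiv_star le_rfl]
    congr 1
    exact funext hr
  -- The same density argument, now in the vector `ξ`.
  have hT := eq_top_of_isTest (S := nbhd I.range Λ) (ContinuousLinearMap.isClosed_ker
    (ℓ₀ + (ℓ₁ + ℓ₂))) fun h hh => by
    obtain ⟨Δ', hΔ', hhc, hhb⟩ := isTest_iff.1 hh
    set H : Config d → ℂ := fun z => I.densInv Λ z * h z with hH
    have hHc : Cyl 1 Δ' H := (I.cyl_densInv hΔ').mul (hhc.of_le (by exact_mod_cast le_top))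
    have hHb : BddSupp Δ' H := hhb.mul_left
    have hH' : Cyl 0 Δ' (pderiv (j : Site d) H) := hHc.pderiv (by simp) _
    have hHb' : BddSupp Δ' (pderiv (j : Site d) H) := hHb.pderiv hHc le_rfl _
    have hm : MemLp h 2 μ := hhc.memLp hhb
    have hd0 : Cyl 0 Δ (I.dens Λ) := (I.cyl_dens hΔ).of_le zero_le_one
    have hw : ∀ u : Lp ℂ 2 μ, Integrable
        (fun z => starRingEnd ℂ (u z) * (χ z * I.dens Λ z)) μ := fun u =>
      integrable_weighted ((hχ1.of_le zero_le_one).mul hd0) hb.mul_right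
    have hw' : ∀ u : Lp ℂ 2 μ, Integrable
        (fun z => starRingEnd ℂ (u z) * (pderiv (j : Site d) χ z * I.dens Λ z)) μ := fun u =>
      integrable_weighted (hχ'.mul hd0) hb'.mul_right
    have hline : ∀ y : Λ → ℝ, HasLineDerivAt ℝ
        (fun y : Λ → ℝ => ∫ z, starRingEnd ℂ (x none z) * (χ z * I.dens Λ z) *
          H (z + glue Λ 0 (-y)) ∂μ)
        (-∫ z, starRingEnd ℂ (x none z) * (χ z * I.dens Λ z) *
          pderiv (j : Site d) H (z + glue Λ 0 (-y)) ∂μ) y (Pi.single j 1) := fun y => by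
      have h1 := Cyl.hasLineDerivAt_integral_translate (hw (x none)) hHc hHb j (-y)
      have h2 := HasDerivAt.scomp (0 : ℝ) (h := fun t : ℝ => -t) (by
        rw [neg_zero]
        exact h1) (hasDerivAt_neg (0 : ℝ))
      rw [neg_one_smul] at h2
      refine HasDerivAt.congr_of_eventuallyEq h2 (Eventually.of_forall fun t => ?_)
      simp only [Function.comp_apply, neg_add, neg_smul]
    have hk : Continuous fun y : Λ → ℝ => ∫ z, starRingEnd ℂ (x none z) * (χ z * I.dens Λ z) *
          H (z + glue Λ 0 (-y)) ∂μ :=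
      (Cyl.continuous_integral_translate (hw (x none)) hHc hHb).comp continuous_neg
    have hk' : Continuous fun y : Λ → ℝ => -∫ z, starRingEnd ℂ (x none z) * (χ z * I.dens Λ z) *
          pderiv (j : Site d) H (z + glue Λ 0 (-y)) ∂μ :=
      ((Cyl.continuous_integral_translate (hw (x none)) hH' hHb').comp continuous_neg).neg
    have hparts := setIntegral_by_parts hρ hs hk hk' j hline
    rw [LinearMap.mem_ker]
    change (ℓ₀ + (ℓ₁ + ℓ₂)) (toL2 μ h) = 0
    rw [_root_.add_apply, _root_.add_apply, h₀, h₁, h₂]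
    simp_rw [inner_shiftMul_left hμ hΔ hχ hb hr _ hm, inner_shiftMul_left hμ hΔ hχ' hb' hr' _ hm]
    rw [hparts, ← integral_add, neg_add_eq_zero]
    · refine integral_congr_ae (Eventually.of_forall fun y => ?_)
      simp only
      rw [← mul_add]
      congr 1
      set c := glue Λ (0 : Config d) (-y) with hc
      have hX : Cyl 1 (Δ ∪ Δ') fun z => χ z * H (z + c) :=
        (hχ1.mono Finset.subset_union_left).mul ((hHc.translate c).mono Finset.subset_union_right)
      have hXb : BddSupp (Δ ∪ Δ') fun z => χ z * H (z + c) := hb.mul_union (hHb.translate c)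
      have hsub : nbhd I.range Λ ⊆ Δ ∪ Δ' := hΔ.trans Finset.subset_union_left
      have hG : Cyl 1 (Δ ∪ Δ') fun z => I.dens Λ z * (χ z * H (z + c)) :=
        (I.cyl_dens hsub).mul hX
      have hGb : BddSupp (Δ ∪ Δ') fun z => I.dens Λ z * (χ z * H (z + c)) := hXb.mul_left
      -- The factor `e^{U_Λ}` is only known to be of class `C¹`, so the weak derivative has to be
      -- tested with `C¹` functions.
      have h3 := inner_toL2_add_inner_codiff hx j hsub hG hGb
      have h4 := congrArg (starRingEnd ℂ) h3
      rw [map_add, inner_conj_symm, inner_conj_symm, map_zero, inner_toL2_right _ (hG.memLp hGb),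
        inner_toL2_right _ ((I.cyl_codiff hsub _ hG).memLp (hGb.codiff hG _))] at h4
      simp_rw [I.codiff_dens_mul hsub hX, (hχ1.mono Finset.subset_union_left).pderiv_mul
        ((hHc.translate c).mono Finset.subset_union_right) le_rfl,
        hHc.pderiv_translate le_rfl] at h4
      have h5 : ∫ z, starRingEnd ℂ (x none z) * (I.dens Λ z * (pderiv (j : Site d) χ z * H (z + c) +
          χ z * pderiv (j : Site d) H (z + c))) ∂μ =
          (∫ z, starRingEnd ℂ (x none z) * (pderiv (j : Site d) χ z * I.dens Λ z) * H (z + c) ∂μ) +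
          ∫ z, starRingEnd ℂ (x none z) * (χ z * I.dens Λ z) *
            pderiv (j : Site d) H (z + c) ∂μ := by
        rw [← integral_add (Cyl.integrable_mul_translate (hw' (x none)) hHc hHb c)
          (Cyl.integrable_mul_translate (hw (x none)) hH' hHb' c)]
        refine integral_congr_ae (Eventually.of_forall fun z => ?_)
        simp only
        ring
      have h6 : ∫ z, starRingEnd ℂ (x (some j) z) * (I.dens Λ z * (χ z * H (z + c))) ∂μ =
          ∫ z, starRingEnd ℂ (x (some j) z) * (χ z * I.dens Λ z) * H (z + c) ∂μ := by
        refine integral_congr_ae (Eventually.of_forall fun z => ?_)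
        simp only
        ring
      rw [h5, h6] at h4
      linear_combination -h4
    · exact ((hρc.mul ((Cyl.continuous_integral_translate (hw (x (some j))) hHc hHb).comp
        continuous_neg)).continuousOn).integrableOn_compact (isCompact_closedBall _ _)
    · exact ((hρc.mul ((Cyl.continuous_integral_translate (hw' (x none)) hHc hHb).comp
        continuous_neg)).continuousOn).integrableOn_compact (isCompact_closedBall _ _)
  have hu : (ℓ₀ + (ℓ₁ + ℓ₂)) ξ = 0 := by
    have : ξ ∈ LinearMap.ker (ℓ₀ + (ℓ₁ + ℓ₂)).toLinearMap := by rw [hT]; trivial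
    exact this
  rw [_root_.add_apply, _root_.add_apply, h₀, h₁, h₂] at hu
  exact eq_neg_of_add_eq_zero_left hu

end Average

/-! ### Multiplication by cutoff functions. -/

section Cutoff

variable {Ω : Type*} [MeasurableSpace Ω] {μ : Measure Ω} [IsProbabilityMeasure μ]

theorem memLp_mul_of_norm_le {b : Ω → ℂ} (hb : Measurable b) {C : ℝ} (hC : ∀ x, ‖b x‖ ≤ C)
    (u : Lp ℂ 2 μ) : MemLp (fun x => b x * u x) 2 μ :=
  (Lp.memLp u).of_le_mul (hb.aestronglyMeasurable.mul (Lp.aestronglyMeasurable u))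
    (Eventually.of_forall fun x => by
      rw [norm_mul]
      exact mul_le_mul_of_nonneg_right (hC x) (norm_nonneg _))

theorem norm_toL2_mul_le {b : Ω → ℂ} (hb : Measurable b) {C : ℝ} (hC : ∀ x, ‖b x‖ ≤ C)
    (u : Lp ℂ 2 μ) : ‖toL2 μ fun x => b x * u x‖ ≤ C * ‖u‖ := by
  refine Lp.norm_le_mul_norm_of_ae_le_mul ?_
  filter_upwards [coeFn_toL2 (memLp_mul_of_norm_le hb hC u)] with x hx
  rw [hx, norm_mul]
  exact mul_le_mul_of_nonneg_right (hC x) (norm_nonneg _)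

theorem tendsto_toL2_mul {b : ℕ → Ω → ℂ} (hb : ∀ k, Measurable (b k)) (hC : ∀ k x, ‖b k x‖ ≤ 1)
    (hlim : ∀ x, Tendsto (fun k => b k x) atTop (𝓝 1)) (u : Lp ℂ 2 μ) :
    Tendsto (fun k => toL2 μ fun x => b k x * u x) atTop (𝓝 u) := by
  rw [tendsto_iff_norm_sub_tendsto_zero]
  have h0 : ∀ k, (fun x => ‖(toL2 μ (fun x => b k x * u x) - u) x‖ ^ 2) =ᵐ[μ]
      fun x => ‖b k x - 1‖ ^ 2 * ‖u x‖ ^ 2 := fun k => by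
    filter_upwards [Lp.coeFn_sub (toL2 μ fun x => b k x * u x) u,
      coeFn_toL2 (memLp_mul_of_norm_le (hb k) (hC k) u)] with x h1 h2
    rw [h1, Pi.sub_apply, h2, ← mul_pow, ← norm_mul, sub_mul, one_mul]
  have h1 : Tendsto (fun k => ∫ x, ‖b k x - 1‖ ^ 2 * ‖u x‖ ^ 2 ∂μ) atTop (𝓝 (∫ x, 0 ∂μ)) := by
    refine tendsto_integral_of_dominated_convergence (fun x => 4 * ‖u x‖ ^ 2)
      (fun k => ?_) ((integrable_norm_sq u).const_mul 4) (fun k => Eventually.of_forall fun x => ?_)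
      (Eventually.of_forall fun x => ?_)
    · exact (((hb k).sub_const 1).norm.pow_const 2).aestronglyMeasurable.mul
        (integrable_norm_sq u).aestronglyMeasurable
    · rw [Real.norm_of_nonneg (by positivity)]
      refine mul_le_mul_of_nonneg_right ?_ (by positivity)
      have h2 := norm_sub_le (b k x) 1
      rw [norm_one] at h2
      nlinarith [hC k x, norm_nonneg (b k x - 1)]
    · have h2 := ((((hlim x).sub_const 1).norm).pow 2).mul_const (‖u x‖ ^ 2)
      simpa using h2
  rw [integral_zero] at h1
  have h2 := (Real.continuous_sqrt.tendsto _).comp h1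
  rw [Real.sqrt_zero] at h2
  refine h2.congr fun k => ?_
  rw [Function.comp_apply, ← integral_congr_ae (h0 k), integral_norm_sq,
    Real.sqrt_sq (norm_nonneg _)]

end Cutoff

/-! ### Density of jets of test functions and the chain rule. -/

section Density

variable {d : ℕ} {μ : Measure (Config d)} [IsProbabilityMeasure μ] {Δ Λ : Finset (Site d)}
  {I : Interaction d} {χ : Config d → ℂ}

theorem glue_zero : glue Λ (0 : Config d) 0 = 0 := by
  ext i
  by_cases h : i ∈ Λ <;> simp [glue, h]

/-- The two averaged identities combine to `∫ ρ F = 0` for all smooth `ρ` supported in the unit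
ball, where `F y` pairs `ξ` with the translate by `y` of the formal jet of `χ u`, `u` the value of
`x`. Being continuous, `F` vanishes at `y = 0`, which is the claim. No limit of mollifications is
needed. -/
theorem inner_cutoff_eq_zero (hμ : I.IsGibbs μ) (hΔ : nbhd I.range Λ ⊆ Δ)
    (hχ : Cyl ((⊤ : ℕ∞) : WithTop ℕ∞) Δ χ) (hb : BddSupp Δ χ)
    (hr : ∀ x, starRingEnd ℂ (χ x) = χ x) {ξ x : Jet (Lp ℂ 2 μ) Λ}
    (hξ : ∀ g, IsTest (nbhd I.range Λ) g → inner ℂ ξ (jetOf μ Λ g) = 0)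
    (hx : x ∈ sobolev I μ Λ) :
    inner ℂ (ξ none) (toL2 μ fun z => χ z * x none z) +
      ∑ j : Λ, (inner ℂ (ξ (some j)) (toL2 μ fun z => χ z * x (some j) z) +
        inner ℂ (ξ (some j)) (toL2 μ fun z => pderiv (j : Site d) χ z * x none z)) = 0 := by
  have hχ1 : Cyl 1 Δ χ := hχ.of_le (by exact_mod_cast le_top)
  have hχ' : ∀ j : Λ, Cyl 0 Δ (pderiv (j : Site d) χ) := fun j => hχ1.pderiv (by simp) _
  have hb' : ∀ j : Λ, BddSupp Δ (pderiv (j : Site d) χ) := fun j => hb.pderiv hχ1 le_rfl _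
  set F : (Λ → ℝ) → ℂ := fun y => inner ℂ (ξ none) (shiftMul hμ hΔ hχ hb y (x none)) +
    ∑ j : Λ, (inner ℂ (ξ (some j)) (shiftMul hμ hΔ hχ hb y (x (some j))) +
      inner ℂ (ξ (some j)) (shiftMul hμ hΔ (hχ' j) (hb' j) y (x none))) with hF
  have hc0 := continuousOn_inner_shiftMul (Λ := Λ) hμ hΔ hχ hb (ξ none) (x none)
  have hc1 := fun j : Λ => continuousOn_inner_shiftMul (Λ := Λ) hμ hΔ hχ hb (ξ (some j)) (x (some j))
  have hc2 := fun j : Λ => continuousOn_inner_shiftMul (Λ := Λ) hμ hΔ (hχ' j) (hb' j)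
    (ξ (some j)) (x none)
  have hFc : ContinuousOn F (Metric.closedBall 0 1) :=
    hc0.add (continuousOn_finsetSum _ fun j _ => (hc1 j).add (hc2 j))
  have h0 : ∀ᵐ y : Λ → ℝ, y ∈ Metric.ball (0 : Λ → ℝ) 1 → F y = 0 := by
    refine Metric.isOpen_ball.ae_eq_zero_of_integral_contDiff_smul_eq_zero
      ((hFc.mono Metric.ball_subset_closedBall).locallyIntegrableOn measurableSet_ball)
      fun ρ hρ _ hs => ?_
    have hρc : Continuous fun y => (ρ y : ℂ) := Complex.continuous_ofReal.comp hρ.continuous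
    have hi : ∀ {k : (Λ → ℝ) → ℂ}, ContinuousOn k (Metric.closedBall 0 1) →
        IntegrableOn (fun y => (ρ y : ℂ) * k y) (Metric.closedBall 0 1) := fun hk =>
      (hρc.continuousOn.mul hk).integrableOn_compact (isCompact_closedBall _ _)
    have h1 := average_shift_of_orthogonal hμ hΔ hχ hb hξ hρ hs (x none)
    have h2 : ∀ j : Λ, ∫ y in Metric.closedBall 0 1, (fderiv ℝ ρ y (Pi.single j 1) : ℂ) *
        inner ℂ (ξ (some j)) (shiftMul hμ hΔ hχ hb y (x none)) =
        -∫ y in Metric.closedBall 0 1, ((ρ y : ℂ) *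
          (inner ℂ (ξ (some j)) (shiftMul hμ hΔ hχ hb y (x (some j))) +
          inner ℂ (ξ (some j)) (shiftMul hμ hΔ (hχ' j) (hb' j) y (x none)))) := fun j => by
      have h3 := congrArg (starRingEnd ℂ) (average_shift_deriv_left hμ hΔ hχ hb hr j (hχ' j) (hb' j)
        hx hρ hs (ξ (some j)))
      rw [map_neg, map_add, ← integral_conj, ← integral_conj, ← integral_conj] at h3
      simp only [map_mul, Complex.conj_ofReal, inner_conj_symm] at h3
      rw [h3, ← integral_add (hi (hc1 j)) (hi (hc2 j))]
      simp only [mul_add]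
    have hi' : ∀ j : Λ, IntegrableOn (fun y => (ρ y : ℂ) *
        (inner ℂ (ξ (some j)) (shiftMul hμ hΔ hχ hb y (x (some j))) +
        inner ℂ (ξ (some j)) (shiftMul hμ hΔ (hχ' j) (hb' j) y (x none))))
        (Metric.closedBall 0 1) := fun j => hi ((hc1 j).add (hc2 j))
    simp_rw [h2] at h1
    rw [Finset.sum_neg_distrib, ← integral_finsetSum _ fun j _ => hi' j,
      eq_neg_iff_add_eq_zero, ← integral_add (hi hc0) (integrable_finsetSum _ fun j _ => hi' j)]
      at h1
    rw [← setIntegral_eq_integral_of_forall_compl_eq_zero (s := Metric.closedBall 0 1) fun y hy => by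
      rw [(eq_zero_of_notMem_closedBall hs hy).1, zero_smul], ← h1]
    refine integral_congr_ae (Eventually.of_forall fun y => ?_)
    simp only [hF, Complex.real_smul, mul_add, Finset.mul_sum]
  have h4 : F 0 = 0 := by
    have h5 := Measure.eqOn_open_of_ae_eq (μ := (volume : Measure (Λ → ℝ))) (f := F)
      (g := fun _ => 0) (U := Metric.ball 0 1)
      ((ae_restrict_iff' measurableSet_ball).2 h0) Metric.isOpen_ball
      (hFc.mono Metric.ball_subset_closedBall) continuousOn_const
    exact h5 (Metric.mem_ball_self one_pos)
  simp only [hF, shiftMul_apply, glue_zero, add_zero] at h4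
  exact h4

/-- The cutoffs tend to `1`, and the terms with their derivatives are `O(1/k)`. -/
theorem inner_eq_zero_of_orthogonal (hμ : I.IsGibbs μ) {ξ x : Jet (Lp ℂ 2 μ) Λ}
    (hξ : ∀ g, IsTest (nbhd I.range Λ) g → inner ℂ ξ (jetOf μ Λ g) = 0)
    (hx : x ∈ sobolev I μ Λ) : inner ℂ ξ x = 0 := by
  obtain ⟨χ, B, hχ, hb, hr, h1, hB, hlim⟩ := exists_cutoff (nbhd I.range Λ)
  have hcut := fun k => inner_cutoff_eq_zero hμ (Finset.Subset.refl _) (hχ k) (hb k) (hr k) hξ hx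
  have ht : ∀ u : Lp ℂ 2 μ, Tendsto (fun k => toL2 μ fun z => χ k z * u z) atTop (𝓝 u) :=
    tendsto_toL2_mul (fun k => (hχ k).measurable) h1 hlim
  have ht' : ∀ j : Λ, Tendsto (fun k => toL2 μ fun z => pderiv (j : Site d) (χ k) z * x none z)
      atTop (𝓝 0) := fun j => by
    refine squeeze_zero_norm (fun k => norm_toL2_mul_le (((hχ k).pderiv (m := 0)
      (by simp) _).measurable) (hB k j) _) ?_
    have h2 := (tendsto_const_div_atTop_nhds_zero_nat B).comp (tendsto_add_atTop_nat 1)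
    have h3 := h2.mul_const ‖x none‖
    rw [zero_mul] at h3
    refine h3.congr fun k => ?_
    simp
  have hl := ((tendsto_const_nhds (x := ξ none)).inner (𝕜 := ℂ) (ht (x none))).add
    (tendsto_finsetSum Finset.univ fun j _ =>
      ((tendsto_const_nhds (x := ξ (some j))).inner (𝕜 := ℂ) (ht (x (some j)))).add
        ((tendsto_const_nhds (x := ξ (some j))).inner (𝕜 := ℂ) (ht' j)))
  simp_rw [hcut, inner_zero_right, add_zero] at hl
  rw [inner_jet, form]
  exact tendsto_nhds_unique hl tendsto_const_nhds

/-- Smooth cylinder functions that are bounded with bounded derivatives. -/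
structure BddCyl (Δ : Finset (Site d)) (F : Config d → ℂ) : Prop where
  cyl : Cyl ((⊤ : ℕ∞) : WithTop ℕ∞) Δ F
  bound : ∃ C, ∀ x, ‖F x‖ ≤ C
  bound_deriv : ∀ j, ∃ C, ∀ x, ‖pderiv j F x‖ ≤ C

theorem BddCyl.cyl_one {F : Config d → ℂ} (h : BddCyl Δ F) : Cyl 1 Δ F :=
  h.cyl.of_le (by exact_mod_cast le_top)

theorem BddCyl.memLp {F : Config d → ℂ} (h : BddCyl Δ F) : MemLp F 2 μ :=
  h.bound.elim fun _ hC => memLp_of_norm_le h.cyl.measurable hC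

theorem BddCyl.memLp_deriv {F : Config d → ℂ} (h : BddCyl Δ F) (j : Site d) :
    MemLp (pderiv j F) 2 μ :=
  (h.bound_deriv j).elim fun _ hC =>
    memLp_of_norm_le (h.cyl_one.pderiv (m := 0) (by simp) j).measurable hC

theorem IsTest.bddCyl {S : Finset (Site d)} {g : Config d → ℂ} (hg : IsTest S g) :
    ∃ Δ, S ⊆ Δ ∧ BddCyl Δ g := by
  obtain ⟨Δ, hΔ, hc, hb⟩ := isTest_iff.1 hg
  have h1 : Cyl 1 Δ g := hc.of_le (by exact_mod_cast le_top)
  refine ⟨Δ, hΔ, hc, ?_, fun j => ?_⟩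
  · obtain ⟨C, -, h⟩ := hc.exists_norm_le hb
    exact ⟨C, h⟩
  · obtain ⟨C, -, h⟩ := (h1.pderiv (m := 0) (by simp) j).exists_norm_le (hb.pderiv h1 le_rfl j)
    exact ⟨C, h⟩

theorem BddCyl.mul_add {Δ' : Finset (Site d)} {F G : Config d → ℂ} (c : ℂ) (hF : BddCyl Δ F)
    (hG : BddCyl Δ' G) [DecidableEq (Site d)] : BddCyl (Δ ∪ Δ') (fun x => c * F x + G x) ∧
      jetOf μ Λ (fun x => c * F x + G x) = c • jetOf μ Λ F + jetOf μ Λ G := by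
  have h1 := hF.cyl.mono (Finset.subset_union_left (s₂ := Δ'))
  have h2 := hG.cyl.mono (Finset.subset_union_right (s₁ := Δ))
  have hc := ((cyl_const c).mul h1).add h2
  have hd : ∀ j, pderiv j (fun x => c * F x + G x) = fun x => c * pderiv j F x + pderiv j G x :=
    fun j => funext fun x => hc.pderiv_eq (by exact_mod_cast le_top) j x
      (((h1.hasDerivAt_zero (by exact_mod_cast le_top) j x).const_mul c).add
        (h2.hasDerivAt_zero (by exact_mod_cast le_top) j x))
  have key : ∀ {F G : Config d → ℂ}, MemLp F 2 μ → MemLp G 2 μ →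
      toL2 μ (fun x => c * F x + G x) = c • toL2 μ F + toL2 μ G := fun {F G} hF hG => by
    refine Lp.ext ((coeFn_toL2 ((hF.const_mul c).add hG)).trans
      (EventuallyEq.trans ?_ (Lp.coeFn_add _ _).symm))
    filter_upwards [Lp.coeFn_smul c (toL2 μ F), coeFn_toL2 hF, coeFn_toL2 hG] with x h1 h2 h3
    simp only [Pi.add_apply, h1, Pi.smul_apply, h2, h3, smul_eq_mul]
  have hbd : ∀ {F G : Config d → ℂ}, (∃ C, ∀ x, ‖F x‖ ≤ C) → (∃ C, ∀ x, ‖G x‖ ≤ C) →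
      ∃ C, ∀ x, ‖c * F x + G x‖ ≤ C := by
    rintro F G ⟨C, hC⟩ ⟨C', hC'⟩
    refine ⟨‖c‖ * C + C', fun x => (norm_add_le _ _).trans (add_le_add ?_ (hC' x))⟩
    rw [norm_mul]
    exact mul_le_mul_of_nonneg_left (hC x) (norm_nonneg _)
  refine ⟨⟨hc, hbd hF.bound hG.bound, fun j => ?_⟩, PiLp.ext fun o => ?_⟩
  · rw [hd]
    exact hbd (hF.bound_deriv j) (hG.bound_deriv j)
  · cases o with
    | none => exact key hF.memLp hG.memLp
    | some j =>
      change toL2 μ (pderiv (j : Site d) fun x => c * F x + G x) =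
        c • toL2 μ (pderiv (j : Site d) F) + toL2 μ (pderiv (j : Site d) G)
      rw [hd, key (hF.memLp_deriv _) (hG.memLp_deriv _)]

theorem tendsto_jet {ι H A : Type*} [Fintype ι] [NormedAddCommGroup H] [InnerProductSpace ℂ H]
    {l : Filter A} {x : A → Jet H ι} {y : Jet H ι} (h : ∀ o, Tendsto (fun a => x a o) l (𝓝 (y o))) :
    Tendsto x l (𝓝 y) :=
  ((PiLp.continuous_toLp 2 (fun _ : Option ι => H)).tendsto (WithLp.ofLp y)).comp
    (tendsto_pi_nhds.2 h)

/-- A sum of test functions with different sets `Δ` need not be compactly supported in the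
coordinates of the union, so test functions are not closed under addition. Sums are still bounded
with bounded derivatives, and multiplication by cutoffs leads back to test functions. -/
theorem BddCyl.mem_closure {F : Config d → ℂ} (hF : BddCyl Δ F) (hΔ : nbhd I.range Λ ⊆ Δ) :
    jetOf μ Λ F ∈ closure {z | ∃ g, IsTest (nbhd I.range Λ) g ∧ z = jetOf μ Λ g} := by
  obtain ⟨χ, B, hχ, hb, hr, h1, hB, hlim⟩ := exists_cutoff Δ
  have hχ1 : ∀ k, Cyl 1 Δ (χ k) := fun k => (hχ k).of_le (by exact_mod_cast le_top)
  have hmul : ∀ k {G : Config d → ℂ}, MemLp G 2 μ →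
      (toL2 μ fun z => χ k z * G z) = toL2 μ fun z => χ k z * toL2 μ G z := fun k G hG => by
    refine (toL2_congr (memLp_mul_of_norm_le (hχ k).measurable (h1 k) _) ?_).symm
    filter_upwards [coeFn_toL2 hG] with z hz
    rw [hz]
  refine mem_closure_of_tendsto (b := atTop) (f := fun k => jetOf μ Λ fun z => χ k z * F z)
    (tendsto_jet fun o => ?_) (Eventually.of_forall fun k => ⟨_, isTest_iff.2
      ⟨Δ, hΔ, (hχ k).mul hF.cyl, (hb k).mul_right⟩, rfl⟩)
  cases o with
  | none =>
    refine (tendsto_toL2_mul (fun k => (hχ k).measurable) h1 hlim (toL2 μ F)).congr fun k => ?_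
    exact (hmul k hF.memLp).symm
  | some j =>
    obtain ⟨C, hC⟩ := hF.bound
    have h2 := tendsto_toL2_mul (fun k => (hχ k).measurable) h1 hlim
      (toL2 μ (pderiv (j : Site d) F))
    have hle : ∀ k x, ‖F x * pderiv (j : Site d) (χ k) x‖ ≤ C * (B / (k + 1)) := fun k x => by
      rw [norm_mul]
      exact mul_le_mul (hC x) (hB k j x) (norm_nonneg _) ((norm_nonneg _).trans (hC x))
    have hm : ∀ k, MemLp (fun x => F x * pderiv (j : Site d) (χ k) x) 2 μ := fun k =>
      memLp_of_norm_le (hF.cyl.measurable.mul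
        ((hχ1 k).pderiv (m := 0) (by simp) _).measurable) (hle k)
    have h3 : Tendsto (fun k => toL2 μ fun x => F x * pderiv (j : Site d) (χ k) x) atTop (𝓝 0) := by
      refine squeeze_zero_norm (fun k => norm_toL2_le ((norm_nonneg _).trans (hle k 0)) (hle k)) ?_
      have h4 := ((tendsto_const_div_atTop_nhds_zero_nat B).comp
        (tendsto_add_atTop_nat 1)).const_mul C
      rw [mul_zero] at h4
      refine h4.congr fun k => ?_
      simp
    have h5 := h2.add h3
    rw [add_zero] at h5
    refine h5.congr fun k => ?_
    change _ = toL2 μ (pderiv (j : Site d) fun z => χ k z * F z)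
    have hp : MemLp (fun x => χ k x * pderiv (j : Site d) F x) 2 μ :=
      (hF.memLp_deriv _).of_le_mul (c := 1) ((hχ k).measurable.aestronglyMeasurable.mul
        (hF.memLp_deriv (μ := μ) j).1) (Eventually.of_forall fun x => by
          rw [norm_mul]
          exact mul_le_mul_of_nonneg_right (h1 k x) (norm_nonneg _))
    rw [← hmul k (hF.memLp_deriv _)]
    refine Lp.ext ((Lp.coeFn_add _ _).trans ?_)
    have e : (pderiv (j : Site d) fun z => χ k z * F z) =
        (fun x => χ k x * pderiv (j : Site d) F x) + fun x => F x * pderiv (j : Site d) (χ k) x := by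
      ext x
      rw [(hχ1 k).pderiv_mul hF.cyl_one le_rfl, Pi.add_apply]
      ring
    rw [e]
    refine EventuallyEq.trans ?_ (coeFn_toL2 (hp.add (hm k))).symm
    exact (coeFn_toL2 hp).add (coeFn_toL2 (hm k))

/-- Jets of test functions are dense in the Sobolev space. -/
theorem Interaction.IsGibbs.mem_closure_jetOf (hμ : I.IsGibbs μ) {x : Jet (Lp ℂ 2 μ) Λ}
    (hx : x ∈ sobolev I μ Λ) :
    x ∈ closure {z | ∃ g, IsTest (nbhd I.range Λ) g ∧ z = jetOf μ Λ g} := by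
  classical
  set T : Set (Jet (Lp ℂ 2 μ) Λ) := {z | ∃ g, IsTest (nbhd I.range Λ) g ∧ z = jetOf μ Λ g}
  let R : Submodule ℂ (Jet (Lp ℂ 2 μ) Λ) := Submodule.span ℂ T
  have h1 := mem_closure_of_orthogonal R (sobolev I μ Λ).toSubmodule (sobolev I μ Λ).isClosed
    (Submodule.span_le.2 (by
      rintro _ ⟨g, hg, rfl⟩
      obtain ⟨Δ, hΔ, hc, hb⟩ := isTest_iff.1 hg
      exact hμ.jetOf_mem hΔ (hc.of_le (by exact_mod_cast le_top)) hb))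
    (fun y hy h => inner_self_eq_zero.1 (inner_eq_zero_of_orthogonal hμ (fun g hg => by
      rw [← inner_conj_symm, h _ (Submodule.subset_span ⟨g, hg, rfl⟩), map_zero]) hy)) hx
  rw [← SetLike.mem_coe, Submodule.topologicalClosure_coe] at h1
  refine closure_minimal (fun z hz => ?_) isClosed_closure h1
  -- Orthogonality gives density of the linear span only; each element of the span is the jet of a
  -- function to which `BddCyl.mem_closure` applies.
  have h2 : ∃ Δ F, nbhd I.range Λ ⊆ Δ ∧ BddCyl Δ F ∧ z = jetOf μ Λ F := by
    refine Submodule.span_induction (p := fun z _ => ∃ Δ F, nbhd I.range Λ ⊆ Δ ∧ BddCyl Δ F ∧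
      z = jetOf μ Λ F) ?_ ?_ ?_ ?_ hz
    · rintro _ ⟨g, hg, rfl⟩
      obtain ⟨Δ, hΔ, h⟩ := hg.bddCyl
      exact ⟨Δ, g, hΔ, h, rfl⟩
    · have h0 : IsTest (nbhd I.range Λ) (fun _ : Config d => (0 : ℂ)) := isTest_iff.2
        ⟨_, Finset.Subset.refl _, cyl_const 0, 0, fun x hx => absurd rfl hx⟩
      obtain ⟨Δ, hΔ, h⟩ := h0.bddCyl
      refine ⟨_, _, hΔ.trans Finset.subset_union_left, (h.mul_add (μ := μ) (Λ := Λ) (-1) h).1, ?_⟩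
      rw [(h.mul_add (-1) h).2, neg_one_smul, neg_add_cancel]
    · rintro _ _ _ _ ⟨Δ, F, hΔ, hF, rfl⟩ ⟨Δ', G, hΔ', hG, rfl⟩
      refine ⟨_, _, hΔ.trans Finset.subset_union_left, (hF.mul_add (μ := μ) (Λ := Λ) 1 hG).1, ?_⟩
      rw [(hF.mul_add 1 hG).2, one_smul]
    · rintro c _ _ ⟨Δ, F, hΔ, hF, rfl⟩
      refine ⟨_, _, hΔ.trans Finset.subset_union_left,
        (hF.mul_add (μ := μ) (Λ := Λ) (c - 1) hF).1, ?_⟩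
      rw [(hF.mul_add (c - 1) hF).2, sub_smul, one_smul, sub_add_cancel]
  obtain ⟨Δ, F, hΔ, hF, rfl⟩ := h2
  exact hF.mem_closure hΔ

theorem IsRadial.hasDerivAt_comp {h h' : ℝ → ℝ} {C : ℝ} (hr : IsRadial h h' C) {f : ℝ → ℂ}
    {f' : ℂ} {s : ℝ} (hf : HasDerivAt f f' s) :
    HasDerivAt (fun t => radial h (f t)) (radialDeriv h h' (f s) f') s := by
  rw [← radialFDeriv_apply]
  exact (hr.hasFDerivAt (f s)).comp_hasDerivAt s hf

theorem IsRadial.radialJet_jetOf {h h' : ℝ → ℝ} {C : ℝ} (hr : IsRadial h h' C) {g : Config d → ℂ}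
    (hg : Cyl 1 Δ g) (hb : BddSupp Δ g) :
    radialJet h h' (jetOf μ Λ g) = jetOf μ Λ fun x => radial h (g x) := by
  have hc : Cyl 1 Δ fun x => radial h (g x) := hg.comp hr.contDiff
  have hcb : BddSupp Δ fun x => radial h (g x) := hb.of_imp fun x hx => by simp [radial, hx]
  refine PiLp.ext fun o => ?_
  cases o with
  | none =>
    refine Lp.ext ((hr.coeFn_radialJet_none _).trans
      (EventuallyEq.trans ?_ (coeFn_toL2 (hc.memLp hcb)).symm))
    filter_upwards [coeFn_toL2 (μ := μ) (hg.memLp hb)] with x hx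
    change radial h (toL2 μ g x) = _
    rw [hx]
  | some j =>
    refine Lp.ext ((hr.coeFn_radialJet_some _ j).trans (EventuallyEq.trans ?_ (coeFn_toL2
      ((hc.pderiv (m := 0) (by simp) (j : Site d)).memLp (hcb.pderiv hc le_rfl _))).symm))
    filter_upwards [coeFn_toL2 (μ := μ) (hg.memLp hb), coeFn_toL2 (μ := μ)
      ((hg.pderiv (m := 0) (by simp) (j : Site d)).memLp (hb.pderiv hg le_rfl _))] with x hx hx'
    change radialDeriv h h' (toL2 μ g x) (toL2 μ (pderiv (j : Site d) g) x) = _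
    have hd := hr.hasDerivAt_comp (hg.hasDerivAt_zero le_rfl j x)
    rw [zero_smul, add_zero] at hd
    rw [hx, hx', hc.pderiv_eq le_rfl j x hd]

/-- For jets of test functions the chain rule is classical; it extends by density, as `radialJet` is
continuous and the space closed. Uniqueness and density come from the separation by test functions.
-/
theorem Interaction.IsGibbs.isSobolev (hμ : I.IsGibbs μ) (Λ : Finset (Site d)) :
    IsSobolev (sobolev I μ Λ) where
  unique x hx h0 := by
    refine PiLp.ext fun o => ?_
    cases o with
    | none => exact h0
    | some j =>
      refine eq_zero_of_forall_inner_isTest (S := nbhd I.range {(j : Site d)}) fun g hg => ?_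
      have h1 := mem_sobolev.1 hx j g hg
      rwa [h0, inner_zero_right, add_zero] at h1
  dense u hu := by
    refine eq_zero_of_forall_inner_isTest (S := nbhd I.range Λ) fun g hg => ?_
    obtain ⟨Δ, hΔ, hc, hb⟩ := isTest_iff.1 hg
    exact hu _ (hμ.jetOf_mem hΔ (hc.of_le (by exact_mod_cast le_top)) hb)
  chain {h h' C} hr x hx := by
    have h1 := map_mem_closure (t := (sobolev I μ Λ : Set (Jet (Lp ℂ 2 μ) Λ)))
      hr.continuous_radialJet (hμ.mem_closure_jetOf hx) (by
        rintro _ ⟨g, hg, rfl⟩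
        obtain ⟨Δ, hΔ, hc, hb⟩ := isTest_iff.1 hg
        have hc1 : Cyl 1 Δ g := hc.of_le (by exact_mod_cast le_top)
        rw [hr.radialJet_jetOf hc1 hb]
        exact hμ.jetOf_mem hΔ (hc1.comp hr.contDiff) (hb.of_imp fun x hx => by simp [radial, hx]))
    rwa [(sobolev I μ Λ).isClosed.closure_eq] at h1

end Density

/-! ### Limits of test functions in the weak equation. -/

section Closedness

variable {Ω : Type*} [MeasurableSpace Ω] {μ : Measure Ω} [IsProbabilityMeasure μ] {ι : Type*}
  [Fintype ι]

/-- The integrated equation passes to limits of uniformly bounded test jets. -/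
theorem TestedBy.of_tendsto {lam M C s t : ℝ} {φ : ℝ → Lp ℂ 2 μ} {Φ : ℝ → Jet (Lp ℂ 2 μ) ι}
    {x : ℕ → Jet (Lp ℂ 2 μ) ι} {y : Jet (Lp ℂ 2 μ) ι} (hM : 0 < M)
    (hx : Tendsto x atTop (𝓝 y)) (hxM : ∀ n, ∀ᵐ ω ∂μ, ‖x n none ω‖ ≤ M)
    (hyM : ∀ᵐ ω ∂μ, ‖y none ω‖ ≤ M) (hΦ : ∀ r ∈ Set.uIcc s t, ‖Φ r‖ ≤ C)
    (hφ : ∀ r ∈ Set.uIcc s t, ‖φ r‖ ≤ C) (h : ∀ n, TestedBy lam φ Φ (x n) s t) :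
    TestedBy lam φ Φ y s t := by
  obtain ⟨D, hD⟩ := (Metric.isBounded_range_of_tendsto x hx).exists_norm_le
  have hD' : ∀ n, ‖x n‖ ≤ D := fun n => hD _ ⟨n, rfl⟩
  have hD0 : 0 ≤ D := (norm_nonneg _).trans (hD' 0)
  have hx0 : Tendsto (fun n => x n none) atTop (𝓝 (y none)) :=
    ((continuous_apply_jet none).tendsto y).comp hx
  have hlim : ∀ r, Tendsto (fun n => form (x n) (Φ r) + pairNL lam (φ r) (x n none)) atTop
      (𝓝 (form y (Φ r) + pairNL lam (φ r) (y none))) := fun r =>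
    (tendsto_form hx tendsto_const_nhds).add (tendsto_pairNL hM tendsto_const_nhds hx0
      (Eventually.of_forall hxM) hyM)
  have hb : ∀ n, ∀ r ∈ Set.uIoc s t, ‖form (x n) (Φ r) + pairNL lam (φ r) (x n none)‖ ≤
      D * C + M * (2 * |lam| * C) := fun n r hr => by
    have hr' := Set.uIoc_subset_uIcc hr
    refine (norm_add_le _ _).trans (add_le_add ((norm_form_le _ _).trans
      (mul_le_mul (hD' n) (hΦ r hr') (norm_nonneg _) hD0))
      ((norm_pairNL_le hM.le lam _ (hxM n)).trans ?_))
    gcongr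
    exact hφ r hr'
  have hb' : ∀ r ∈ Set.uIoc s t, ‖form y (Φ r) + pairNL lam (φ r) (y none)‖ ≤
      D * C + M * (2 * |lam| * C) := fun r hr =>
    le_of_tendsto (hlim r).norm (Eventually.of_forall fun n => hb n r hr)
  have hm : ∀ n, AEStronglyMeasurable (fun r => form (x n) (Φ r) + pairNL lam (φ r) (x n none))
      (volume.restrict (Set.uIoc s t)) := fun n => ((intervalIntegrable_iff.1 (h n).1).aestronglyMeasurable)
  refine ⟨?_, ?_⟩
  · rw [intervalIntegrable_iff]
    have : IsFiniteMeasure (volume.restrict (Set.uIoc s t)) := ⟨by simp [Set.uIoc]⟩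
    exact Integrable.of_bound (aestronglyMeasurable_of_tendsto_ae atTop hm
      (Eventually.of_forall hlim)) _
      ((ae_restrict_iff' measurableSet_uIoc).2 (Eventually.of_forall hb'))
  · have h1 := intervalIntegral.tendsto_integral_filter_of_dominated_convergence
      (fun _ => D * C + M * (2 * |lam| * C)) (Eventually.of_forall hm)
      (Eventually.of_forall fun n => Eventually.of_forall (hb n))
      intervalIntegrable_const (Eventually.of_forall fun r _ => hlim r)
    have h2 : Tendsto (fun n => inner ℂ (x n none) (φ t - φ s)) atTop
        (𝓝 (inner ℂ (y none) (φ t - φ s))) := hx0.inner tendsto_const_nhds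
    refine tendsto_nhds_unique h2 (((h1.const_mul (-Complex.I))).congr fun n => ?_)
    exact ((h n).2).symm

end Closedness

/-! ### From weak derivatives to jets. -/

section WeakJet

variable {d : ℕ} {I : Interaction d} {μ : Measure (Config d)} {Λ Δ : Finset (Site d)}
  {f g : Config d → ℂ}

theorem Interaction.hasWeakDeriv_weakDeriv {j : Site d} (h : ∃ v, I.HasWeakDeriv μ j f v) :
    I.HasWeakDeriv μ j f (I.weakDeriv μ j f) := by
  rw [Interaction.weakDeriv, dif_pos h]
  exact h.choose_spec

/-- The jet of `f` and of its weak derivatives in the directions in `Λ`. -/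
def Interaction.weakJet (I : Interaction d) (μ : Measure (Config d)) (Λ : Finset (Site d))
    (f : Config d → ℂ) : Jet (Lp ℂ 2 μ) Λ :=
  WithLp.toLp 2 fun o => o.elim (toL2 μ f) fun j => toL2 μ (I.weakDeriv μ (j : Site d) f)

variable [IsProbabilityMeasure μ]

theorem inner_toL2_toL2 {F G : Config d → ℂ} (hF : MemLp F 2 μ) (hG : MemLp G 2 μ) :
    inner ℂ (toL2 μ F) (toL2 μ G) = ∫ x, starRingEnd ℂ (F x) * G x ∂μ := by
  rw [inner_toL2_right _ hG]
  refine integral_congr_ae ?_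
  filter_upwards [coeFn_toL2 hF] with x h
  rw [h]

theorem norm_toL2_sq {F : Config d → ℂ} (hF : MemLp F 2 μ) :
    ‖toL2 μ F‖ ^ 2 = ∫ x, ‖F x‖ ^ 2 ∂μ := by
  rw [← integral_norm_sq]
  refine integral_congr_ae ?_
  filter_upwards [coeFn_toL2 hF] with x h
  rw [h]

theorem Interaction.MemH1On.weakJet_mem (h : I.MemH1On μ Λ f) : I.weakJet μ Λ f ∈ sobolev I μ Λ := by
  refine mem_sobolev.2 fun j g hg => ?_
  have hw := Interaction.hasWeakDeriv_weakDeriv (h.exists_deriv j j.2)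
  obtain ⟨Δ, hΔ, hc, hb⟩ := isTest_iff.1 hg
  have hc1 : Cyl 1 Δ g := hc.of_le (by exact_mod_cast le_top)
  change inner ℂ (toL2 μ g) (toL2 μ (I.weakDeriv μ (j : Site d) f)) +
    inner ℂ (toL2 μ (I.codiff {(j : Site d)} j g)) (toL2 μ f) = 0
  rw [inner_toL2_toL2 hg.memLp hw.memLp_deriv,
    inner_toL2_toL2 ((I.cyl_codiff hΔ _ hc1).memLp (hb.codiff hc1 _)) h.memLp]
  have h1 := hw.integral_eq _ hg.star
  have e1 : ∫ x, starRingEnd ℂ (g x) * I.weakDeriv μ (j : Site d) f x ∂μ =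
      ∫ x, I.weakDeriv μ (j : Site d) f x * starRingEnd ℂ (g x) ∂μ := by
    simp only [mul_comm]
  have e2 : ∫ x, starRingEnd ℂ (I.codiff {(j : Site d)} j g x) * f x ∂μ =
      ∫ x, f x * (pderiv j (fun x => starRingEnd ℂ (g x)) x -
        ((pderiv j (I.U {(j : Site d)}) x : ℝ) : ℂ) * starRingEnd ℂ (g x)) ∂μ := by
    refine integral_congr_ae (Eventually.of_forall fun x => ?_)
    simp only [Interaction.codiff, Interaction.force, map_sub, map_mul, Complex.conj_ofReal,
      hc1.pderiv_star le_rfl]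
    ring
  rw [e1, h1, e2, neg_add_cancel]

theorem Interaction.MemH1On.norm_weakJet_none_sq (h : I.MemH1On μ Λ f) :
    ‖I.weakJet μ Λ f none‖ ^ 2 = mass μ f := norm_toL2_sq h.memLp

theorem Interaction.MemH1On.gsq_weakJet (h : I.MemH1On μ Λ f) :
    gsq (I.weakJet μ Λ f) = I.gradSq μ Λ f := by
  rw [Interaction.gradSq, ← Finset.sum_coe_sort, gsq]
  exact Finset.sum_congr rfl fun j _ =>
    norm_toL2_sq (Interaction.hasWeakDeriv_weakDeriv (h.exists_deriv j j.2)).memLp_deriv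

theorem Interaction.MemH1.memH1On (h : I.MemH1 μ f) (Λ : Finset (Site d)) : I.MemH1On μ Λ f :=
  ⟨h.memLp, fun j _ => h.exists_deriv j trivial, (hasSum_fintype _).summable⟩

/-- The weak derivative is chosen for every function separately, not for its class. Uniqueness makes
the choice irrelevant. -/
theorem Interaction.IsGibbs.weakJet_congr (hμ : I.IsGibbs μ) (hf : I.MemH1On μ Λ f)
    (hg : I.MemH1On μ Λ g) (h : f =ᵐ[μ] g) : I.weakJet μ Λ f = I.weakJet μ Λ g := by
  rw [← sub_eq_zero]
  refine (hμ.isSobolev Λ).unique _ ((sobolev I μ Λ).toSubmodule.sub_mem hf.weakJet_mem hg.weakJet_mem) ?_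
  change toL2 μ f - toL2 μ g = 0
  rw [toL2_congr hf.memLp h, sub_self]

theorem Cyl.cyl_one_pderiv (hg : Cyl ((⊤ : ℕ∞) : WithTop ℕ∞) Δ g) (j : Site d) :
    Cyl 1 Δ (LatticeLSE.pderiv j g) := by
  refine hg.pderiv ?_ j
  have h : (((1 + 1 : ℕ∞)) : WithTop ℕ∞) ≤ ((⊤ : ℕ∞) : WithTop ℕ∞) := WithTop.coe_le_coe.2 le_top
  exact h

/-- The weak equation pairs without conjugation, while the inner product conjugates its left
argument. The equation is therefore tested with the conjugate of `g`. -/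
theorem Cyl.L_star (hg : Cyl ((⊤ : ℕ∞) : WithTop ℕ∞) Δ g) (x : Config d) :
    I.L Λ (fun x => starRingEnd ℂ (g x)) x =
      ∑ j ∈ Λ, starRingEnd ℂ (I.codiff Λ j (LatticeLSE.pderiv j g) x) := by
  refine Finset.sum_congr rfl fun j _ => ?_
  have h1 : Cyl 1 Δ g := hg.of_le (by exact_mod_cast le_top)
  have h2 : Cyl 1 Δ (LatticeLSE.pderiv j g) := hg.cyl_one_pderiv j
  have e : LatticeLSE.pderiv j (fun x => starRingEnd ℂ (g x)) =
      fun x => starRingEnd ℂ (LatticeLSE.pderiv j g x) := funext (h1.pderiv_star le_rfl j)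
  rw [e, h2.pderiv_star le_rfl, Interaction.codiff, Interaction.force, map_sub, map_mul,
    Complex.conj_ofReal]

/-- The integration by parts is used with `∂_j g` as the test function. The right side involves no
derivative of `x`, as in the original weak equation. -/
theorem form_jetOf {x : Jet (Lp ℂ 2 μ) Λ} (hx : x ∈ sobolev I μ Λ) (hΔ : nbhd I.range Λ ⊆ Δ)
    (hg : Cyl ((⊤ : ℕ∞) : WithTop ℕ∞) Δ g) (hb : BddSupp Δ g) :
    form (jetOf μ Λ g) x =
      -∑ j : Λ, inner ℂ (toL2 μ (I.codiff Λ j (pderiv (j : Site d) g))) (x none) := by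
  have h1 : Cyl 1 Δ g := hg.of_le (by exact_mod_cast le_top)
  rw [form, ← Finset.sum_neg_distrib]
  refine Finset.sum_congr rfl fun j _ => eq_neg_of_add_eq_zero_left ?_
  exact inner_toL2_add_inner_codiff hx j hΔ (hg.cyl_one_pderiv _)
    (hb.pderiv h1 le_rfl _)

theorem integrable_conj_mul_logNL (lam : ℝ) (u : Lp ℂ 2 μ) (hg : Cyl 1 Δ g) (hb : BddSupp Δ g) :
    Integrable (fun x => starRingEnd ℂ (g x) * logNL lam (‖u‖ ^ 2) (u x)) μ := by
  obtain ⟨C, -, hC⟩ := hg.exists_norm_le hb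
  exact (integrable_logNL lam u).bdd_mul hg.star.measurable.aestronglyMeasurable
    (Eventually.of_forall fun x => by rw [RCLike.norm_conj]; exact hC x)

/-- The right-hand side of the weak equation, in terms of the gradient. -/
theorem integral_weak_rhs (lam : ℝ) (h : I.MemH1On μ Λ f) (hΔ : nbhd I.range Λ ⊆ Δ)
    (hg : Cyl ((⊤ : ℕ∞) : WithTop ℕ∞) Δ g) (hb : BddSupp Δ g) :
    ∫ x, (-(I.L Λ (fun x => starRingEnd ℂ (g x)) x * f x) + starRingEnd ℂ (g x) *
        ((lam : ℂ) * f x * ((Real.log (‖f x‖ ^ 2 / mass μ f) : ℝ) : ℂ))) ∂μ =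
      form (jetOf μ Λ g) (I.weakJet μ Λ f) + pairNL lam (toL2 μ f) (toL2 μ g) := by
  have h1 : Cyl 1 Δ g := hg.of_le (by exact_mod_cast le_top)
  have hd : ∀ j, MemLp (I.codiff Λ j (pderiv j g)) 2 μ := fun j =>
    (I.cyl_codiff hΔ j (hg.cyl_one_pderiv j)).memLp
      ((hb.pderiv h1 le_rfl j).codiff (hg.cyl_one_pderiv j) j)
  have hi : ∀ j, Integrable (fun x => starRingEnd ℂ (I.codiff Λ j (pderiv j g) x) * f x) μ :=
    fun j => by
      refine (integrable_conj_mul (toL2 μ (I.codiff Λ j (pderiv j g))) (toL2 μ f)).congr ?_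
      filter_upwards [coeFn_toL2 (hd j), coeFn_toL2 h.memLp] with x e1 e2
      rw [e1, e2]
  have hn := integrable_conj_mul_logNL lam (toL2 μ f) h1 hb
  have e1 : ∫ x, (-(I.L Λ (fun x => starRingEnd ℂ (g x)) x * f x) + starRingEnd ℂ (g x) *
        ((lam : ℂ) * f x * ((Real.log (‖f x‖ ^ 2 / mass μ f) : ℝ) : ℂ))) ∂μ =
      ∫ x, (-(∑ j ∈ Λ, starRingEnd ℂ (I.codiff Λ j (pderiv j g) x) * f x) +
        starRingEnd ℂ (g x) * logNL lam (‖toL2 μ f‖ ^ 2) (toL2 μ f x)) ∂μ := by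
    refine integral_congr_ae ?_
    filter_upwards [coeFn_toL2 h.memLp] with x e
    rw [e, norm_toL2_sq h.memLp, hg.L_star, Finset.sum_mul, logNL, Complex.real_smul, mass]
    push_cast
    ring
  have hs : Integrable (fun x => -∑ j ∈ Λ,
      starRingEnd ℂ (I.codiff Λ j (pderiv j g) x) * f x) μ :=
    (integrable_finsetSum _ fun j _ => hi j).neg
  rw [e1, integral_add hs hn, integral_neg,
    integral_finsetSum _ fun j _ => hi j, form_jetOf h.weakJet_mem hΔ hg hb,
    ← Finset.sum_coe_sort]
  congr 1
  · congr 1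
    refine Finset.sum_congr rfl fun j _ => ?_
    exact (inner_toL2_toL2 (hd j) h.memLp).symm
  · refine integral_congr_ae ?_
    filter_upwards [coeFn_toL2 (h1.memLp hb)] with x e
    rw [e]

end WeakJet

/-! ### Smooth radial truncation and uniformly bounded approximation. -/

section Truncation

theorem IsRadial.one_sub {h h' : ℝ → ℝ} {C : ℝ} (hr : IsRadial h h' C) :
    IsRadial (fun s => 1 - h s) (fun s => -h' s) (1 + C) where
  hasDeriv s hs := (hr.hasDeriv s hs).const_sub 1
  cont := hr.cont.neg
  bound s hs := (abs_sub _ _).trans (by rw [abs_one]; linarith [hr.bound s hs])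
  bound_deriv s hs := by
    rw [mul_neg, abs_neg]
    linarith [hr.bound_deriv s hs]

theorem contDiff_radial_one_sub_tailCut (k : ℝ) (n : ℕ∞) :
    ContDiff ℝ n (radial fun s => 1 - tailCut k s) := by
  have h1 : ContDiff ℝ n fun z : ℂ => ‖z‖ ^ 2 / k - 1 :=
    ((contDiff_norm_sq ℝ).div_const k).sub contDiff_const
  exact (contDiff_const.sub (Real.smoothTransition.contDiff.comp h1)).smul contDiff_id

theorem norm_radial_one_sub_tailCut_le {k : ℝ} (hk : 0 < k) (z : ℂ) :
    ‖radial (fun s => 1 - tailCut k s) z‖ ≤ Real.sqrt (2 * k) := by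
  by_cases h : 2 * k ≤ ‖z‖ ^ 2
  · rw [radial, tailCut_eq_one hk h, sub_self, zero_smul, norm_zero]
    exact Real.sqrt_nonneg _
  · have h1 : ‖1 - tailCut k (‖z‖ ^ 2)‖ ≤ 1 := by
      rw [Real.norm_eq_abs, abs_le]
      constructor <;> linarith [tailCut_nonneg k (‖z‖ ^ 2),
        Real.smoothTransition.le_one (‖z‖ ^ 2 / k - 1), tailCut.eq_1 k (‖z‖ ^ 2)]
    rw [radial, norm_smul]
    refine (mul_le_of_le_one_left (norm_nonneg _) h1).trans ?_
    exact Real.le_sqrt_of_sq_le (not_le.1 h).le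

end Truncation

variable {d : ℕ} {I : Interaction d} {μ : Measure (Config d)} [IsProbabilityMeasure μ]
  {Λ : Finset (Site d)}

/-- Bounded functions are limits of uniformly bounded test functions. -/
theorem Interaction.IsGibbs.exists_bounded_approx (hμ : I.IsGibbs μ) {x : Jet (Lp ℂ 2 μ) Λ}
    (hx : x ∈ sobolev I μ Λ) {M : ℝ} (hM : ∀ᵐ ω ∂μ, ‖x none ω‖ ≤ M) :
    ∃ N : ℝ, 0 < N ∧ M ≤ N ∧ ∃ g : ℕ → Config d → ℂ, (∀ n, IsTest (nbhd I.range Λ) (g n)) ∧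
      (∀ n ω, ‖g n ω‖ ≤ N) ∧ Tendsto (fun n => jetOf μ Λ (g n)) atTop (𝓝 x) := by
  have hk : 0 < M ^ 2 + 1 := by positivity
  obtain ⟨B, hB⟩ := exists_isRadial_tailCut
  have hr := (hB _ hk).one_sub
  -- The truncation is the identity for `|z|² ≤ M² + 1`, so it does not change `x`; its derivatives
  -- are unchanged too, by uniqueness. By continuity the truncated approximations still converge to
  -- `x`, and they are bounded by `√(2 (M² + 1))`.
  have hfix : radialJet (fun s => 1 - tailCut (M ^ 2 + 1) s)
      (fun s => -tailCutDeriv (M ^ 2 + 1) s) x = x := by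
    rw [← sub_eq_zero]
    refine (hμ.isSobolev Λ).unique _ ((sobolev I μ Λ).toSubmodule.sub_mem
      ((hμ.isSobolev Λ).chain hr x hx) hx) ?_
    rw [PiLp.sub_apply, sub_eq_zero]
    refine Lp.ext ((hr.coeFn_radialJet_none x).trans ?_)
    filter_upwards [hM] with ω h
    rw [radial, tailCut_eq_zero hk, sub_zero, one_smul]
    nlinarith [norm_nonneg (x none ω)]
  obtain ⟨z, hz, hzx⟩ := mem_closure_iff_seq_limit.1 (hμ.mem_closure_jetOf hx)
  choose g hg hzg using hz
  have hlim := (hr.continuous_radialJet.tendsto x).comp hzx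
  rw [hfix] at hlim
  refine ⟨Real.sqrt (2 * (M ^ 2 + 1)), Real.sqrt_pos.2 (by positivity),
    Real.le_sqrt_of_sq_le (by nlinarith), fun n ω => radial (fun s => 1 - tailCut (M ^ 2 + 1) s)
      (g n ω), fun n => ?_, fun n ω => norm_radial_one_sub_tailCut_le hk _, hlim.congr fun n => ?_⟩
  · obtain ⟨Δ, hΔ, hc, hb⟩ := isTest_iff.1 (hg n)
    exact isTest_iff.2 ⟨Δ, hΔ, hc.comp (contDiff_radial_one_sub_tailCut _ _),
      hb.of_imp fun x hx => by simp [radial, hx]⟩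
  · obtain ⟨Δ, hΔ, hc, hb⟩ := isTest_iff.1 (hg n)
    rw [Function.comp_apply, hzg n]
    exact hr.radialJet_jetOf (hc.of_le (by exact_mod_cast le_top)) hb

/-! ### Weak solutions solve the abstract equation. -/

namespace Interaction.IsSolution

variable {lam : ℝ} {f : Config d → ℂ} {φ : ℝ → Config d → ℂ}

theorem continuousOn_toL2 (hφ : I.IsSolution μ Λ lam f φ) :
    ContinuousOn (fun t => toL2 μ (φ t)) (Set.Ici 0) := fun t ht => by
  have hm := fun s hs => (hφ.memH1On s hs).memLp
  rw [ContinuousWithinAt, tendsto_iff_edist_tendsto_0]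
  refine (hφ.continuous t ht).congr' ?_
  filter_upwards [self_mem_nhdsWithin] with s hs
  rw [toL2, toL2, dif_pos (hm s hs), dif_pos (hm t ht), Lp.edist_toLp_toLp]

/-- Against a smooth function the form involves `φ` but not its gradient (`form_jetOf`), so the
integrand is continuous in time and the differential equation can be integrated. -/
theorem testedBy_jetOf (hφ : I.IsSolution μ Λ lam f φ) {g : Config d → ℂ}
    (hg : IsTest (nbhd I.range Λ) g) {s t : ℝ} (hs : 0 ≤ s) (ht : 0 ≤ t) :
    TestedBy lam (fun t => toL2 μ (φ t)) (fun t => I.weakJet μ Λ (φ t)) (jetOf μ Λ g) s t := by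
  obtain ⟨Δ, hΔ, hc, hb⟩ := isTest_iff.1 hg
  obtain ⟨C, hC0, hC⟩ := hc.exists_norm_le hb
  have hcont := hφ.continuousOn_toL2
  have hint : Set.uIcc s t ⊆ Set.Ici 0 := fun r hr => (le_min hs ht).trans hr.1
  have hgC : ∀ᵐ ω ∂μ, ‖toL2 μ g ω‖ ≤ C + 1 := by
    filter_upwards [coeFn_toL2 hg.memLp] with ω h
    rw [h]
    linarith [hC ω]
  have hform : ∀ r ∈ Set.Ici (0 : ℝ), form (jetOf μ Λ g) (I.weakJet μ Λ (φ r)) =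
      -∑ j : Λ, inner ℂ (toL2 μ (I.codiff Λ j (pderiv (j : Site d) g))) (toL2 μ (φ r)) :=
    fun r hr => form_jetOf (hφ.memH1On r hr).weakJet_mem hΔ hc hb
  have hF : ContinuousOn (fun r => form (jetOf μ Λ g) (I.weakJet μ Λ (φ r)) +
      pairNL lam (toL2 μ (φ r)) (toL2 μ g)) (Set.Ici 0) := by
    refine ContinuousOn.add (ContinuousOn.congr ?_ hform) fun r hr => ?_
    · exact (continuousOn_finsetSum _ fun j _ => continuousOn_const.inner hcont).neg
    · exact tendsto_pairNL (by linarith : 0 < C + 1) (hcont r hr) tendsto_const_nhds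
        (Eventually.of_forall fun _ => hgC) hgC
  have hFi : IntervalIntegrable (fun r => form (jetOf μ Λ g) (I.weakJet μ Λ (φ r)) +
      pairNL lam (toL2 μ (φ r)) (toL2 μ g)) volume s t := (hF.mono hint).intervalIntegrable
  refine ⟨hFi, ?_⟩
  have hG : ContinuousOn (fun r => inner ℂ (toL2 μ g) (toL2 μ (φ r))) (Set.Ici 0) :=
    continuousOn_const.inner hcont
  have hder : ∀ r ∈ Set.Ici (0 : ℝ), HasDerivWithinAt
      (fun r => inner ℂ (toL2 μ g) (toL2 μ (φ r)))
      (-Complex.I * (form (jetOf μ Λ g) (I.weakJet μ Λ (φ r)) +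
        pairNL lam (toL2 μ (φ r)) (toL2 μ g))) (Set.Ici 0) r := fun r hr => by
    obtain ⟨D, hD, he⟩ := hφ.equation _ hg.star r hr
    rw [integral_weak_rhs lam (hφ.memH1On r hr) hΔ hc hb] at he
    rw [← he, ← mul_assoc, neg_mul, Complex.I_mul_I, neg_neg, one_mul]
    exact hD.congr (fun q hq => inner_toL2_toL2 hg.memLp (hφ.memH1On q hq).memLp)
      (inner_toL2_toL2 hg.memLp (hφ.memH1On r hr).memLp)
  have h := intervalIntegral.integral_eq_sub_of_hasDeriv_right (hG.mono hint)
    (fun r hr => (hder r ((le_min hs ht).trans hr.1.le)).mono fun q hq =>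
      ((le_min hs ht).trans hr.1.le).trans (Set.mem_Ioi.1 hq).le) (hFi.const_mul _)
  rw [intervalIntegral.integral_const_mul] at h
  change inner ℂ (toL2 μ g) (toL2 μ (φ t) - toL2 μ (φ s)) = _
  rw [inner_sub_right]
  exact h.symm

theorem exists_norm_weakJet_le (hφ : I.IsSolution μ Λ lam f φ) {T : ℝ} (hT : 0 ≤ T) :
    ∃ C, ∀ t, 0 ≤ t → t ≤ T → ‖I.weakJet μ Λ (φ t)‖ ≤ C := by
  obtain ⟨C, hC⟩ := hφ.gradSq_bounded T hT
  obtain ⟨D, hD⟩ := isCompact_Icc.exists_bound_of_continuousOn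
    (hφ.continuousOn_toL2.mono (Set.Icc_subset_Ici_self : Set.Icc (0 : ℝ) T ⊆ _))
  refine ⟨Real.sqrt (D ^ 2 + C), fun t h0 h1 => Real.le_sqrt_of_sq_le ?_⟩
  have h := hφ.memH1On t h0
  rw [norm_sq_jet, h.gsq_weakJet]
  exact add_le_add (pow_le_pow_left₀ (norm_nonneg _) (hD t ⟨h0, h1⟩) 2) (hC t h0 h1)

/-- Weak solutions solve the abstract equation in the space of jets. -/
theorem isSol (hφ : I.IsSolution μ Λ lam f φ) (hμ : I.IsGibbs μ) :
    IsSol (sobolev I μ Λ) lam (fun t => toL2 μ (φ t)) fun t => I.weakJet μ Λ (φ t) where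
  mem t ht := (hφ.memH1On t ht).weakJet_mem
  none_eq t ht := rfl
  bounded T hT := hφ.exists_norm_weakJet_le hT
  cont := hφ.continuousOn_toL2
  eqn x hx M hM s t hs ht := by
    obtain ⟨N, hN, hMN, g, hg, hgN, hlim⟩ := hμ.exists_bounded_approx hx hM
    obtain ⟨C, hC⟩ := hφ.exists_norm_weakJet_le (hs.trans (le_max_left s t))
    have hC' : ∀ r ∈ Set.uIcc s t, ‖I.weakJet μ Λ (φ r)‖ ≤ C := fun r hr =>
      hC r ((le_min hs ht).trans hr.1) hr.2
    refine TestedBy.of_tendsto hN hlim (fun n => ?_) (hM.mono fun ω h => h.trans hMN) hC'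
      (fun r hr => (norm_none_le _).trans (hC' r hr)) fun n => hφ.testedBy_jetOf (hg n) hs ht
    change ∀ᵐ ω ∂μ, ‖toL2 μ (g n) ω‖ ≤ N
    filter_upwards [coeFn_toL2 (hg n).memLp] with ω h
    rw [h]
    exact hgN n ω

end Interaction.IsSolution

/-! ### The entropy in terms of `L² log L`. -/

section Entropy

theorem mul_log_le_mul_log_one_add {s : ℝ} (hs : 0 ≤ s) :
    s * Real.log s ≤ s * Real.log (1 + s) := by
  rcases hs.eq_or_lt with rfl | h
  · simp
  · exact mul_le_mul_of_nonneg_left (Real.log_le_log h (by linarith)) hs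

theorem mul_log_one_add_le {s : ℝ} (hs : 0 ≤ s) :
    s * Real.log (1 + s) ≤ s * Real.log s + 1 := by
  rcases hs.eq_or_lt with rfl | h
  · simp
  · have h1 : Real.log (1 + s) - Real.log s ≤ (1 + s) / s - 1 := by
      rw [← Real.log_div (by positivity) h.ne']
      exact Real.log_le_sub_one_of_pos (by positivity)
    have h2 := mul_le_mul_of_nonneg_left h1 hs
    have h3 : s * ((1 + s) / s - 1) = 1 := by field_simp; ring
    linarith

variable {Ω : Type*} [MeasurableSpace Ω] {μ : Measure Ω} [IsProbabilityMeasure μ]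

theorem aestronglyMeasurable_sq_mul_log (u : Lp ℂ 2 μ) :
    AEStronglyMeasurable (fun ω => ‖u ω‖ ^ 2 * Real.log (‖u ω‖ ^ 2)) μ :=
  (Real.continuous_mul_log.comp_aestronglyMeasurable
    ((continuous_norm.pow 2).comp_aestronglyMeasurable (Lp.aestronglyMeasurable u)) :)

/-- On `[0, ∞)` the functions `s log s` and `s log (1 + s)` differ by at most `1`, and the measure
is finite. -/
theorem tame_iff_integrable_sq_mul_log (u : Lp ℂ 2 μ) :
    Tame u ↔ Integrable (fun ω => ‖u ω‖ ^ 2 * Real.log (‖u ω‖ ^ 2)) μ := by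
  constructor <;> intro h
  · refine Integrable.mono' (Integrable.add h (integrable_const 1))
      (aestronglyMeasurable_sq_mul_log u) (Eventually.of_forall fun ω => ?_)
    have h1 := mul_log_le_mul_log_one_add (sq_nonneg ‖u ω‖)
    have h2 := mul_log_one_add_le (sq_nonneg ‖u ω‖)
    have h3 : 0 ≤ ‖u ω‖ ^ 2 * Real.log (1 + ‖u ω‖ ^ 2) :=
      mul_nonneg (sq_nonneg _) (Real.log_nonneg (by linarith [sq_nonneg ‖u ω‖]))
    rw [Real.norm_eq_abs, Pi.add_apply, young, abs_le]
    constructor <;> nlinarith [sq_nonneg ‖u ω‖]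
  · refine Integrable.mono' (((integrable_norm_sq u).add h).add (integrable_const 1))
      (aestronglyMeasurable_young u) (Eventually.of_forall fun ω => ?_)
    have h2 := mul_log_one_add_le (sq_nonneg ‖u ω‖)
    rw [Real.norm_eq_abs, abs_of_nonneg (young_nonneg _), Pi.add_apply, Pi.add_apply, young]
    linarith

end Entropy

variable {d : ℕ} {I : Interaction d} {μ : Measure (Config d)} [IsProbabilityMeasure μ]
  {Λ : Finset (Site d)}

/-- The logarithm of the quotient splits where `f ≠ 0`. If the mass is zero, `f` vanishes almost
everywhere, and both sides are zero. -/
theorem entropy_integrand_ae_eq {f : Config d → ℂ} (hf : MemLp f 2 μ) :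
    (fun x => ‖f x‖ ^ 2 * Real.log (‖f x‖ ^ 2 / ∫ y, ‖f y‖ ^ 2 ∂μ)) =ᵐ[μ] fun x =>
      ‖toL2 μ f x‖ ^ 2 * Real.log (‖toL2 μ f x‖ ^ 2) -
        ‖toL2 μ f x‖ ^ 2 * Real.log (‖toL2 μ f‖ ^ 2) := by
  have h0 : ∀ᵐ x ∂μ, toL2 μ f = 0 → toL2 μ f x = 0 := by
    by_cases h : toL2 μ f = 0
    · filter_upwards [Lp.coeFn_zero ℂ 2 μ] with x hx _
      rw [h, hx, Pi.zero_apply]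
    · exact Eventually.of_forall fun x h' => absurd h' h
  filter_upwards [h0, coeFn_toL2 hf] with x hx he
  rw [← norm_toL2_sq hf, ← he]
  by_cases h1 : toL2 μ f x = 0
  · simp [h1]
  · have h2 : toL2 μ f ≠ 0 := fun h => h1 (hx h)
    rw [Real.log_div (by positivity) (by positivity)]
    ring

theorem entropy_of_tame {f : Config d → ℂ} (hf : MemLp f 2 μ) (h : Tame (toL2 μ f)) :
    entropy μ (fun x => ‖f x‖ ^ 2) =
      ((logMoment (toL2 μ f) - ‖toL2 μ f‖ ^ 2 * Real.log (‖toL2 μ f‖ ^ 2) : ℝ) : EReal) := by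
  have e := entropy_integrand_ae_eq hf
  have h1 := (tame_iff_integrable_sq_mul_log _).1 h
  have h2 := (integrable_norm_sq (toL2 μ f)).mul_const (Real.log (‖toL2 μ f‖ ^ 2))
  rw [entropy, if_pos ((integrable_congr e).2 (h1.sub h2)), integral_congr_ae e,
    integral_sub h1 h2, integral_mul_const, integral_norm_sq, logMoment]

theorem entropy_of_not_tame {f : Config d → ℂ} (hf : MemLp f 2 μ) (h : ¬ Tame (toL2 μ f)) :
    entropy μ (fun x => ‖f x‖ ^ 2) = ⊤ := by
  rw [entropy, if_neg]
  rw [integrable_congr (entropy_integrand_ae_eq hf)]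
  refine fun h1 => h ((tame_iff_integrable_sq_mul_log _).2 ?_)
  refine (h1.add ((integrable_norm_sq (toL2 μ f)).mul_const
    (Real.log (‖toL2 μ f‖ ^ 2)))).congr (Eventually.of_forall fun x => ?_)
  exact sub_add_cancel _ _

/-! ### The conservation laws for weak solutions. -/

namespace Interaction.IsSolution

variable {lam : ℝ} {f : Config d → ℂ} {φ : ℝ → Config d → ℂ}

theorem weakJet_zero (hφ : I.IsSolution μ Λ lam f φ) (hμ : I.IsGibbs μ) (hf : I.MemH1 μ f) :
    I.weakJet μ Λ (φ 0) = I.weakJet μ Λ f :=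
  hμ.weakJet_congr (hφ.memH1On 0 le_rfl) (hf.memH1On Λ) hφ.initial

theorem mass_eq (hφ : I.IsSolution μ Λ lam f φ) (hμ : I.IsGibbs μ) (hf : I.MemH1 μ f) {t : ℝ}
    (ht : 0 ≤ t) : mass μ (φ t) = mass μ f := by
  rw [← (hφ.memH1On t ht).norm_weakJet_none_sq, ← (hf.memH1On Λ).norm_weakJet_none_sq,
    ← hφ.weakJet_zero hμ hf]
  exact congrArg (· ^ 2) ((hφ.isSol hμ).norm_eq (hμ.isSobolev Λ) ht)

theorem energy_eq (hφ : I.IsSolution μ Λ lam f φ) (hμ : I.IsGibbs μ) (hf : I.MemH1 μ f) {t : ℝ}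
    (ht : 0 ≤ t) : I.energy μ Λ lam (φ t) = I.energy μ Λ lam f := by
  have hs := hφ.isSol hμ
  have hV := hμ.isSobolev Λ
  have hft := hφ.memH1On t ht
  have hf0 := hf.memH1On Λ
  have e0 : toL2 μ (φ 0) = toL2 μ f := toL2_congr (hφ.memH1On 0 le_rfl).memLp hφ.initial
  have hnorm := hs.norm_eq hV ht
  have htame := hs.tame_of_tame_zero hV ht
  have hen := fun h => hs.energy_eq hV h ht
  simp only [hφ.weakJet_zero hμ hf, e0, hft.gsq_weakJet, hf0.gsq_weakJet] at hnorm htame hen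
  rw [Interaction.energy, Interaction.energy]
  by_cases hl : lam = 0
  · subst hl
    simpa using hen fun h => absurd rfl h
  by_cases h : Tame (toL2 μ f)
  · rw [entropy_of_tame hft.memLp (htame.2 h), entropy_of_tame hf.memLp h, ← EReal.coe_mul,
      ← EReal.coe_mul, ← EReal.coe_add, ← EReal.coe_add, hnorm]
    exact congrArg _ (by linear_combination hen fun _ => h)
  -- The entropy is infinite at both times and the gradient terms are finite; the sign of `lam`
  -- decides which infinity both energies are.
  · rw [entropy_of_not_tame hft.memLp (fun h' => h (htame.1 h')), entropy_of_not_tame hf.memLp h]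
    rcases lt_or_gt_of_ne hl with hl | hl
    · rw [EReal.coe_mul_top_of_neg hl, EReal.add_bot, EReal.add_bot]
    · rw [EReal.coe_mul_top_of_pos hl, EReal.coe_add_top, EReal.coe_add_top]

end Interaction.IsSolution

end LatticeLSE

end

theorem theorem5p1 (d : ℕ) (I : LatticeLSE.Interaction d) (hI : I.Normalizable)
    (μ : MeasureTheory.Measure (LatticeLSE.Config d)) (hμ : I.IsGibbs μ)
    (Λ : Finset (LatticeLSE.Site d)) (lam : ℝ)
    (f : LatticeLSE.Config d → ℂ) (hf : I.MemH1 μ f)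
    (φ : ℝ → LatticeLSE.Config d → ℂ) (hφ : I.IsSolution μ Λ lam f φ) :
    (∀ t, 0 ≤ t → LatticeLSE.mass μ (φ t) = LatticeLSE.mass μ f) ∧
    ((∀ ω, Differentiable ℝ (I.Ubd Λ ω) ∧ Differentiable ℝ (fderiv ℝ (I.Ubd Λ ω))) →
      ∀ t, 0 ≤ t → I.energy μ Λ lam (φ t) = I.energy μ Λ lam f) := by
  have := hμ.isProbabilityMeasure
  exact ⟨fun t ht => hφ.mass_eq hμ hf ht, fun _ t ht => hφ.energy_eq hμ hf ht⟩
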